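/- **Setting.** A *reductive pair* $(\mathfrak g,K)$ consists of a finite-dimensional real Lie algebra $\mathfrak g_0$ with complexification $\mathfrak g$, an involution $\theta$ of $\mathfrak g_0$, a compact Lie group $K$ acting on $\mathfrak g_0$ by $\mathrm{Ad}$, with an embedding of $\mathrm{Lie}(K)$ onto the fixed space $\mathfrak g_0^{\theta}$ such that $\mathrm{Ad}$ extends the adjoint action of $K$ on $\mathrm{Lie}(K)$ and its differential is the adjoint action of $\mathrm{Lie}(K)$ on $\mathfrak g_0$, and a symmetric form $B$ on $\mathfrak g_0$, invariant under $\mathfrak g_0$, $K$ and $\theta$, negative definite on $\mathfrak g_0^{\theta}$ and positive definite on $\mathfrak g_0^{-\theta}$; $\mathrm{Ad}$ commutes with $\theta$. A *germane* parabolic subalgebra $\mathfrak q\subseteq\mathfrak g$ is a subalgebra containing a Borel subalgebra (maximal solvable subalgebra), together with a Levi decomposition $\mathfrak q=\mathfrak l\oplus\mathfrak u$, where $\mathfrak u=\mathfrak q\cap\mathfrak q^{\perp}$ is the nilpotent radical and $\mathfrak l$ is the complexification of a $\theta$-stable real subalgebra $\mathfrak l_0\subseteq\mathfrak g_0$; $L\cap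 K$ is the subgroup of $K$ stabilizing both $\mathfrak q$ and $\theta(\mathfrak q)$. All modules are $(\mathfrak g,K)$- resp. $(\mathfrak l,L\cap K)$-modules (locally finite for the compact group, with compatible actions; no finiteness otherwise). A *full abelian subcategory* is a full subcategory, closed under isomorphism, that contains the zero modules and is closed under kernels, cokernels and finite direct sums; $K(\cdot)$ is its Grothendieck group. A pair $(\mathcal G,\mathcal L)$ of full abelian subcategories of the $(\mathfrak g,K)$- resp. $(\mathfrak l,L\cap K)$-modules is *$\mathfrak u$-admissible* if $\mathbf C\in\mathcal G$, $\mathcal L$ contains all $\bigwedge^q\mathfrak u^*$ and is closed under tensoring with them, and $H^q(\mathfrak u;V)\in\mathcal L$ for all $V\in\mathcal G$ and all $q$. Then $H:K(\mathcal G)\to K(\mathcal L)$, $[V]\mapsto\sum_q(-1)^q[H^q(\mathfrak u;V)]$, is a homomorphism, and elements of $K(\mathcal L)$ may be multiplied by $W_{\mathfrak q}=\sum_q(-1)^q[\bigwedge^q\mathfrak u^*]$. A *$\mathfrak u$-admissible quadruple* $\mathcal Q=(\mathcal G,\mathcal L,K_{\mathcal G},K_{\mathcal L})$ consists of such a pair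 and of subgroups $K_{\mathcal G}\subseteq K(\mathcal G)$, $K_{\mathcal L}\subseteq K(\mathcal L)$ with $H(K_{\mathcal G})\subseteq K_{\mathcal L}$ and $K_{\mathcal L}\cdot W_{\mathfrak q}\subseteq K_{\mathcal L}$. Put $C_{\mathfrak q}(\mathcal Q)=K_{\mathcal L}[W_{\mathfrak q}^{-1}]$ and, for $X\in K_{\mathcal G}$, $c_{\mathfrak q}(X)=H(X)/W_{\mathfrak q}\in C_{\mathfrak q}(\mathcal Q)$. *Partial operations.* In $K(\mathcal L)$ the product of $[X]$ and $[Y]$ is $[X\otimes Y]$ if $X$, $Y$, $X\otimes Y\in\mathcal L$, and the dual of $[X]$ is $[X^*]$ if $X,X^*\in\mathcal L$, where $X^*$ is the module of $L\cap K$-finite functionals; these relations are extended biadditively, resp. additively. They extend to localizations by $\frac{a}{W_{\mathfrak q}^{m}}\cdot\frac{b}{W_{\mathfrak q}^{n}}=\frac{ab}{W_{\mathfrak q}^{m+n}}$ and $\left(\frac{a}{W_{\mathfrak q}^n}\right)^*=\frac{t^na^*}{W_{\mathfrak q}^n}$, where $t=(-1)^{\dim\mathfrak u}[\bigwedge^{\dim\mathfrak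 u}\mathfrak u^*]$ (so that $W_{\mathfrak q}^*=W_{\mathfrak q}/t$), whenever the numerators on the right are defined and lie in $K_{\mathcal L}$. **Hypotheses.** Let $\iota:(\mathfrak g',K')\to(\mathfrak g,K)$ be an inclusion of reductive pairs: an injective homomorphism $\mathfrak g_0'\to\mathfrak g_0$ and an injective smooth homomorphism $K'\to K$, compatible with each other on $\mathrm{Lie}(K')$ and with $\theta$, $B$ and $\mathrm{Ad}$. Let $\mathfrak q'\subseteq\mathfrak g'$ and $\mathfrak q\subseteq\mathfrak g$ be germane parabolic subalgebras with $\mathfrak q'\subseteq\mathfrak q$, $\mathfrak l_0'\subseteq\mathfrak l_0$, $L'\cap K'\subseteq L\cap K$ and $\mathfrak u'\subseteq\mathfrak u$. Let $\mathcal Q=(\mathcal G,\mathcal L,K_{\mathcal G},K_{\mathcal L})$ be a $\mathfrak u$-admissible and $\mathcal Q'=(\mathcal G',\mathcal L',K_{\mathcal G'},K_{\mathcal L'})$ a $\mathfrak u'$-admissible quadruple. Assume that restriction along $\iota$ maps $\mathcal G$ to $\mathcal G'$, $\mathcal L$ to $\mathcal L'$, $K_{\mathcal G}$ to $K_{\mathcal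 G'}$ and $K_{\mathcal L}$ to $K_{\mathcal L'}$; that $\mathcal L'$ contains the modules $\bigwedge^p(\mathfrak u/\mathfrak u')^*$ and is closed under tensoring with them; and that $$W_{\mathfrak q/\mathfrak q'}:=\sum_p(-1)^p\left[\bigwedge\nolimits^p(\mathfrak u/\mathfrak u')^*\right]$$ lies in $K_{\mathcal L'}$ and $K_{\mathcal L'}\cdot W_{\mathfrak q/\mathfrak q'}\subseteq K_{\mathcal L'}$. **Proposition 1.7.** In $K(\mathcal L')$ one has $W_{\mathfrak q}|_{\mathfrak l',L'\cap K'}=W_{\mathfrak q'}\cdot W_{\mathfrak q/\mathfrak q'}$, and there is an additive map $$\iota:C_{\mathfrak q}(\mathcal Q)\to C_{\mathfrak q'}(\mathcal Q')[W_{\mathfrak q/\mathfrak q'}^{-1}],\qquad \frac{a}{W_{\mathfrak q}^n}\mapsto\frac{a|_{\mathfrak l',L'\cap K'}}{W_{\mathfrak q'}^n\,W_{\mathfrak q/\mathfrak q'}^n}\qquad(a\in K_{\mathcal L},\ n\ge 0),$$ with the following properties. 1. It is multiplicative: if $z$ is a product of $x$ and $y$ in $C_{\mathfrak q}(\mathcal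 Q)$, then $\iota(z)$ is a product of $\iota(x)$ and $\iota(y)$. 2. It respects duals: if $z$ is a dual of $x$ in $C_{\mathfrak q}(\mathcal Q)$, formed by means of modules in $\mathcal L$ whose restrictions to $(\mathfrak l',L'\cap K')$ are admissible (every finite-dimensional representation of $L'\cap K'$ occurs in them with finite multiplicity), then $\iota(z)$ is a dual of $\iota(x)$, formed by means of admissible modules in $\mathcal L'$. Here the dual of $a/(W_{\mathfrak q'}^mW_{\mathfrak q/\mathfrak q'}^n)$ is $t'^m s^n a^*/(W_{\mathfrak q'}^mW_{\mathfrak q/\mathfrak q'}^n)$ (the numerator lying in $K_{\mathcal L'}$), where $t'$ and $s$ are formed from $\mathfrak u'$ and $\mathfrak u/\mathfrak u'$ as $t$ is from $\mathfrak u$. 3. For every $X\in K_{\mathcal G}$ one has $\iota(c_{\mathfrak q}(X))=c_{\mathfrak q'}(X|_{\mathfrak g',K'})$, i.e. $\iota\circ c_{\mathfrak q}=c_{\mathfrak q'}\circ\iota$. -/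

import Mathlib

open scoped TensorProduct Manifold ContDiff Polynomial

noncomputable section

namespace AlgChar

/-! ## Pairs and their modules -/

/-- A pair `(𝔥, M)`: a finite-dimensional complex Lie algebra, a topological group acting on it by
automorphisms `Ad`, and the relation saying that `γ` is a smooth one-parameter subgroup of `M`
whose velocity at `0` is the element `x` of `𝔥`, which encodes the embedding of `Lie M` into `𝔥`.
The pairs occurring below come from reductive pairs and their germane parabolic subalgebras, where
this relation is a concrete one. -/
structure HCPair where
  h : Type
  [lieRing : LieRing h]
  [lieAlgebra : LieAlgebra ℂ h]
  [finite : Module.Finite ℂ h]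
  M : Type
  [group : Group M]
  [top : TopologicalSpace M]
  [topGroup : IsTopologicalGroup M]
  Ad : M →* Module.End ℂ h
  Ad_lie : ∀ m x y, Ad m ⁅x, y⁆ = ⁅Ad m x, Ad m y⁆
  IsVelocity : (Multiplicative ℝ →* M) → h → Prop
  Ad_continuous : ∀ (y : h) (l : Module.Dual ℂ h), Continuous fun m => l (Ad m y)
  Ad_hasDerivAt : ∀ γ x, IsVelocity γ x → ∀ (y : h) (l : Module.Dual ℂ h),
    HasDerivAt (fun t : ℝ => l (Ad (γ (.ofAdd t)) y)) (l ⁅x, y⁆) 0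

attribute [instance] HCPair.lieRing HCPair.lieAlgebra HCPair.finite HCPair.group HCPair.top
  HCPair.topGroup

/-- A morphism of pairs. -/
structure HCPair.Hom (P' P : HCPair) where
  φ : P'.h →ₗ⁅ℂ⁆ P.h
  ψ : P'.M →* P.M
  continuous_ψ : Continuous ψ
  φ_Ad : ∀ m x, φ (P'.Ad m x) = P.Ad (ψ m) (φ x)
  velocity : ∀ γ x, P'.IsVelocity γ x → P.IsVelocity (ψ.comp γ) (φ x)

/-- An `(𝔥, M)`-module: a complex vector space `V` with compatible actions `ρ` of `𝔥` and `σ` of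
`M`, such that `M` acts locally finitely and continuously (on finite-dimensional invariant
subspaces), and the differential of the action of `M` is the action of `Lie M` through `𝔥`.
Continuity and differentiability in finite-dimensional spaces are tested on linear functionals. -/
structure GKMod (P : HCPair) where
  V : Type
  [addCommGroup : AddCommGroup V]
  [module : Module ℂ V]
  ρ : P.h →ₗ[ℂ] Module.End ℂ V
  σ : P.M →* Module.End ℂ V
  ρ_lie : ∀ x y v, ρ ⁅x, y⁆ v = ρ x (ρ y v) - ρ y (ρ x v)
  σ_ρ : ∀ m x v, σ m (ρ x v) = ρ (P.Ad m x) (σ m v)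
  locallyFinite : ∀ v, ∃ S : Submodule ℂ V, FiniteDimensional ℂ S ∧ ∀ m, σ m v ∈ S
  σ_continuous : ∀ (v : V) (l : Module.Dual ℂ V), Continuous fun m => l (σ m v)
  σ_hasDerivAt : ∀ γ x, P.IsVelocity γ x → ∀ (v : V) (l : Module.Dual ℂ V),
    HasDerivAt (fun t : ℝ => l (σ (γ (.ofAdd t)) v)) (l (ρ x v)) 0

attribute [instance] GKMod.addCommGroup GKMod.module

namespace GKMod

variable {P P' : HCPair}

/-- Morphisms of `(𝔥, M)`-modules. -/
structure Hom (X Y : GKMod P) where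
  f : X.V →ₗ[ℂ] Y.V
  map_ρ : ∀ x v, f (X.ρ x v) = Y.ρ x (f v)
  map_σ : ∀ m v, f (X.σ m v) = Y.σ m (f v)

/-- `0 → X → Y → Z → 0` is exact. -/
def ShortExact {X Y Z : GKMod P} (i : Hom X Y) (p : Hom Y Z) : Prop :=
  Function.Injective i.f ∧ LinearMap.range i.f = LinearMap.ker p.f ∧ Function.Surjective p.f

/-- Restriction along a morphism of pairs. -/
def res (φ : HCPair.Hom P' P) (X : GKMod P) : GKMod P' where
  V := X.V
  ρ := X.ρ ∘ₗ (φ.φ : P'.h →ₗ[ℂ] P.h)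
  σ := X.σ.comp φ.ψ
  ρ_lie x y v := by simp [X.ρ_lie]
  σ_ρ m x v := by simp [X.σ_ρ, φ.φ_Ad]
  locallyFinite v := by
    obtain ⟨S, h1, h2⟩ := X.locallyFinite v
    exact ⟨S, h1, fun m => h2 _⟩
  σ_continuous v l := (X.σ_continuous v l).comp φ.continuous_ψ
  σ_hasDerivAt γ x h v l := X.σ_hasDerivAt _ _ (φ.velocity γ x h) v l

/-- Restriction of morphisms. -/
def Hom.res (φ : HCPair.Hom P' P) {X Y : GKMod P} (f : Hom X Y) : Hom (X.res φ) (Y.res φ) where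
  f := f.f
  map_ρ x v := f.map_ρ (φ.φ x) v
  map_σ m v := f.map_σ (φ.ψ m) v

/-- The adjoint module. -/
def adjoint (P : HCPair) : GKMod P where
  V := P.h
  ρ := (LieAlgebra.ad ℂ P.h : P.h →ₗ[ℂ] Module.End ℂ P.h)
  σ := P.Ad
  ρ_lie x y v := by simp
  σ_ρ m x v := by simp [P.Ad_lie]
  locallyFinite v := ⟨⊤, inferInstance, fun _ => trivial⟩
  σ_continuous := P.Ad_continuous
  σ_hasDerivAt := P.Ad_hasDerivAt

/-- The trivial one-dimensional module. -/
def triv (P : HCPair) : GKMod P where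
  V := ℂ
  ρ := 0
  σ := 1
  ρ_lie x y v := by simp
  σ_ρ m x v := by simp
  locallyFinite v := ⟨⊤, inferInstance, fun _ => trivial⟩
  σ_continuous v l := by simpa using continuous_const
  σ_hasDerivAt γ x h v l := by simpa using hasDerivAt_const (0 : ℝ) (l v)

/-- The module structure on a vector space `W` with actions of `𝔥` and `M` that has an
equivariant embedding into an `(𝔥, M)`-module. -/
def ofInj (X : GKMod P) (W : Type) [AddCommGroup W] [Module ℂ W] (j : W →ₗ[ℂ] X.V)
    (hj : Function.Injective j) (ρ : P.h → Module.End ℂ W) (σ : P.M → Module.End ℂ W)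
    (hρ : ∀ x w, j (ρ x w) = X.ρ x (j w)) (hσ : ∀ m w, j (σ m w) = X.σ m (j w)) : GKMod P where
  V := W
  ρ :=
    { toFun := ρ
      map_add' := fun x y => LinearMap.ext fun w => hj (by simp [hρ])
      map_smul' := fun c x => LinearMap.ext fun w => hj (by simp [hρ]) }
  σ :=
    { toFun := σ
      map_one' := LinearMap.ext fun w => hj (by simp [hσ])
      map_mul' := fun x y => LinearMap.ext fun w => hj (by simp [hσ]) }
  ρ_lie x y w := hj (by simp [hρ, X.ρ_lie])
  σ_ρ m x w := hj (by simp [hρ, hσ, X.σ_ρ])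
  locallyFinite w := by
    obtain ⟨S, h1, h2⟩ := X.locallyFinite (j w)
    refine ⟨S.comap j, ?_, fun m => ?_⟩
    · exact FiniteDimensional.of_injective ((j.restrict (fun _ h => h) : S.comap j →ₗ[ℂ] S))
        fun a b h => Subtype.ext (hj (congrArg Subtype.val h))
    · simpa [hσ] using h2 m
  σ_continuous w l := by
    obtain ⟨r, hr⟩ := LinearMap.exists_leftInverse_of_injective j (LinearMap.ker_eq_bot.2 hj)
    have := X.σ_continuous (j w) (l ∘ₗ r)
    refine this.congr fun m => ?_
    have h : r (j (σ m w)) = σ m w := LinearMap.congr_fun hr _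
    simp [← hσ, h]
  σ_hasDerivAt γ x h w l := by
    obtain ⟨r, hr⟩ := LinearMap.exists_leftInverse_of_injective j (LinearMap.ker_eq_bot.2 hj)
    have h0 : ∀ u, r (j u) = u := fun u => LinearMap.congr_fun hr u
    simpa [← hσ, ← hρ, h0] using X.σ_hasDerivAt γ x h (j w) (l ∘ₗ r)

/-- The submodule of `X` carried by a stable subspace. -/
def sub (X : GKMod P) (S : Submodule ℂ X.V) (hρ : ∀ x, ∀ v ∈ S, X.ρ x v ∈ S)
    (hσ : ∀ m, ∀ v ∈ S, X.σ m v ∈ S) : GKMod P :=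
  X.ofInj S S.subtype S.injective_subtype (fun x => (X.ρ x).restrict (hρ x))
    (fun m => (X.σ m).restrict (hσ m)) (fun _ _ => rfl) (fun _ _ => rfl)

/-- The quotient of `X` by a stable subspace. -/
def quot (X : GKMod P) (S : Submodule ℂ X.V) (hρ : ∀ x, ∀ v ∈ S, X.ρ x v ∈ S)
    (hσ : ∀ m, ∀ v ∈ S, X.σ m v ∈ S) : GKMod P where
  V := X.V ⧸ S
  ρ :=
    { toFun := fun x => S.mapQ S (X.ρ x) (hρ x)
      map_add' := fun x y => by ext v; simp
      map_smul' := fun c x => by ext v; simp }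
  σ :=
    { toFun := fun m => S.mapQ S (X.σ m) (hσ m)
      map_one' := by ext v; simp
      map_mul' := fun x y => by ext v; simp }
  ρ_lie x y v := by
    obtain ⟨v, rfl⟩ := S.mkQ_surjective v
    simp [X.ρ_lie]
  σ_ρ m x v := by
    obtain ⟨v, rfl⟩ := S.mkQ_surjective v
    simp [X.σ_ρ]
  locallyFinite v := by
    obtain ⟨v, rfl⟩ := S.mkQ_surjective v
    obtain ⟨T, h1, h2⟩ := X.locallyFinite v
    exact ⟨T.map S.mkQ, inferInstance, fun m => ⟨_, h2 m, rfl⟩⟩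
  σ_continuous v l := by
    obtain ⟨v, rfl⟩ := S.mkQ_surjective v
    exact X.σ_continuous v (l ∘ₗ S.mkQ)
  σ_hasDerivAt γ x h v l := by
    obtain ⟨v, rfl⟩ := S.mkQ_surjective v
    exact X.σ_hasDerivAt γ x h v (l ∘ₗ S.mkQ)

theorem exists_expansion {V : Type} [AddCommGroup V] [Module ℂ V] (S : Submodule ℂ V)
    [FiniteDimensional ℂ S] : ∃ (n : ℕ) (w : Fin n → V) (μ : Fin n → Module.Dual ℂ V),
    ∀ s ∈ S, s = ∑ i, μ i s • w i := by
  let b := Module.finBasis ℂ S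
  choose μ hμ using fun i => LinearMap.exists_extend (b.coord i)
  refine ⟨_, fun i => (b i : V), μ, fun s hs => ?_⟩
  have h1 : ∀ i, μ i s = b.repr ⟨s, hs⟩ i := fun i => LinearMap.congr_fun (hμ i) ⟨s, hs⟩
  have h2 := congrArg S.subtype (b.sum_repr ⟨s, hs⟩)
  rw [map_sum] at h2
  simpa only [h1, map_smul, Submodule.subtype_apply] using h2.symm

/-- For finitely many vectors, there is a finite-dimensional subspace containing their orbits. -/
theorem exists_orbit (X : GKMod P) {ι : Type} [Finite ι] (v : ι → X.V) :
    ∃ S : Submodule ℂ X.V, FiniteDimensional ℂ S ∧ ∀ i m, X.σ m (v i) ∈ S := by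
  choose S h1 h2 using fun i => X.locallyFinite (v i)
  refine ⟨⨆ i, S i, inferInstance, fun i m => le_iSup S i (h2 i m)⟩

/-- The tensor product. -/
def tensor (X Y : GKMod P) : GKMod P where
  V := X.V ⊗[ℂ] Y.V
  ρ :=
    { toFun := fun x => (X.ρ x).rTensor Y.V + (Y.ρ x).lTensor X.V
      map_add' := fun x y => by ext a b; simp; abel
      map_smul' := fun c x => by ext a b; simp [TensorProduct.smul_tmul'] }
  σ :=
    { toFun := fun m => TensorProduct.map (X.σ m) (Y.σ m)
      map_one' := by ext a b; simp
      map_mul' := fun x y => by ext a b; simp }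
  ρ_lie x y v := by
    induction v with
    | zero => simp
    | add a b ha hb => simp only [map_add, ha, hb]; abel
    | tmul a b =>
      simp [X.ρ_lie, Y.ρ_lie, TensorProduct.sub_tmul, TensorProduct.tmul_sub]
      abel
  σ_ρ m x v := by
    induction v with
    | zero => simp
    | add a b ha hb => simp only [map_add, ha, hb]
    | tmul a b => simp [X.σ_ρ, Y.σ_ρ]
  locallyFinite v := by
    induction v with
    | zero => exact ⟨⊥, inferInstance, fun m => by simp⟩
    | add a b ha hb =>
      obtain ⟨S, h1, h2⟩ := ha
      obtain ⟨T, h3, h4⟩ := hb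
      refine ⟨S ⊔ T, inferInstance, fun m => ?_⟩
      rw [map_add]
      exact Submodule.add_mem_sup (h2 m) (h4 m)
    | tmul a b =>
      obtain ⟨S, h1, h2⟩ := X.locallyFinite a
      obtain ⟨T, h3, h4⟩ := Y.locallyFinite b
      refine ⟨LinearMap.range (TensorProduct.map S.subtype T.subtype), inferInstance,
        fun m => ⟨(⟨_, h2 m⟩ : S) ⊗ₜ (⟨_, h4 m⟩ : T), by simp⟩⟩
  σ_continuous v l := by
    induction v with
    | zero => simpa using continuous_const
    | add a b ha hb => simp only [map_add]; exact ha.add hb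
    | tmul a b =>
      obtain ⟨S, h1, h2⟩ := X.locallyFinite a
      obtain ⟨n, w, μ, hw⟩ := exists_expansion S
      have : ∀ m, l ((X.σ m a) ⊗ₜ (Y.σ m b)) =
          ∑ i, μ i (X.σ m a) * (l ∘ₗ TensorProduct.mk ℂ _ _ (w i)) (Y.σ m b) := fun m => by
        conv_lhs => rw [hw _ (h2 m)]
        simp [TensorProduct.sum_tmul, ← TensorProduct.smul_tmul']
      simp only [MonoidHom.coe_mk, OneHom.coe_mk, TensorProduct.map_tmul, this]
      exact continuous_finsetSum _ fun i _ => (X.σ_continuous a _).mul (Y.σ_continuous b _)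
  σ_hasDerivAt γ x h v l := by
    induction v with
    | zero => simpa using hasDerivAt_const (0 : ℝ) (0 : ℂ)
    | add a b ha hb => simp only [map_add]; exact ha.add hb
    | tmul a b =>
      obtain ⟨S, h1, h2⟩ := X.locallyFinite a
      obtain ⟨n, w, μ, hw⟩ := exists_expansion (S ⊔ Submodule.span ℂ {X.ρ x a})
      have h3 : ∀ m, X.σ m a ∈ S ⊔ Submodule.span ℂ {X.ρ x a} := fun m =>
        Submodule.mem_sup_left (h2 m)
      have h4 : X.ρ x a ∈ S ⊔ Submodule.span ℂ {X.ρ x a} :=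
        Submodule.mem_sup_right (Submodule.mem_span_singleton_self _)
      have h5 : ∀ c ∈ S ⊔ Submodule.span ℂ {X.ρ x a}, ∀ d : Y.V, l (c ⊗ₜ d) =
          ∑ i, μ i c * (l ∘ₗ TensorProduct.mk ℂ _ _ (w i)) d := fun c hc d => by
        conv_lhs => rw [hw _ hc]
        simp [TensorProduct.sum_tmul, ← TensorProduct.smul_tmul']
      have h6 : a ∈ S ⊔ Submodule.span ℂ {X.ρ x a} := by simpa using h3 1
      have := HasDerivAt.fun_sum (u := Finset.univ) fun i _ =>
        (X.σ_hasDerivAt γ x h a (μ i)).fun_mul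
          (Y.σ_hasDerivAt γ x h b (l ∘ₗ TensorProduct.mk ℂ _ _ (w i)))
      simp only [MonoidHom.coe_mk, OneHom.coe_mk, TensorProduct.map_tmul, h5 _ (h3 _)]
      convert! this using 1
      simp [h5 _ h4, h5 _ h6, Finset.sum_add_distrib]

/-- Functoriality of `X ⊗ F` in `X`. -/
def Hom.tensor {X Y : GKMod P} (f : Hom X Y) (F : GKMod P) : Hom (X.tensor F) (Y.tensor F) where
  f := f.f.rTensor F.V
  map_ρ x v := by
    change (f.f.rTensor F.V) (((X.ρ x).rTensor F.V + (F.ρ x).lTensor X.V) v) =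
      ((Y.ρ x).rTensor F.V + (F.ρ x).lTensor Y.V) ((f.f.rTensor F.V) v)
    induction v using TensorProduct.induction_on with
    | zero => simp
    | add a b ha hb => rw [map_add, map_add, ha, hb, ← map_add, ← map_add]
    | tmul a b => simp [f.map_ρ]
  map_σ m v := by
    change (f.f.rTensor F.V) (TensorProduct.map (X.σ m) (F.σ m) v) =
      TensorProduct.map (Y.σ m) (F.σ m) ((f.f.rTensor F.V) v)
    induction v using TensorProduct.induction_on with
    | zero => simp
    | add a b ha hb => rw [map_add, map_add, ha, hb, ← map_add, ← map_add]
    | tmul a b => simp [f.map_σ]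

theorem tensor_exact {X Y Z : GKMod P} (F : GKMod P) (i : Hom X Y) (p : Hom Y Z)
    (h : ShortExact i p) : ShortExact (i.tensor F) (p.tensor F) :=
  ⟨Module.Flat.rTensor_preserves_injective_linearMap _ h.1,
    (LinearMap.exact_iff.1 (rTensor_exact F.V (LinearMap.exact_iff.2 h.2.1.symm) h.2.2)).symm,
    LinearMap.rTensor_surjective _ h.2.2⟩

/-- The interchange of the last two factors of `(X ⊗ E) ⊗ F`. -/
def rightComm (X E F : GKMod P) : Hom ((X.tensor E).tensor F) ((X.tensor F).tensor E) where
  f := (TensorProduct.rightComm ℂ X.V E.V F.V).toLinearMap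
  map_ρ x := LinearMap.congr_fun (show (TensorProduct.rightComm ℂ X.V E.V F.V).toLinearMap ∘ₗ
      (((X.ρ x).rTensor E.V + (E.ρ x).lTensor X.V).rTensor F.V +
        (F.ρ x).lTensor (X.V ⊗[ℂ] E.V)) =
      (((X.ρ x).rTensor F.V + (F.ρ x).lTensor X.V).rTensor E.V +
        (E.ρ x).lTensor (X.V ⊗[ℂ] F.V)) ∘ₗ (TensorProduct.rightComm ℂ X.V E.V F.V).toLinearMap
    from TensorProduct.ext_threefold fun a b c => by simp; abel)
  map_σ m := LinearMap.congr_fun (show (TensorProduct.rightComm ℂ X.V E.V F.V).toLinearMap ∘ₗ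
      TensorProduct.map (TensorProduct.map (X.σ m) (E.σ m)) (F.σ m) =
      TensorProduct.map (TensorProduct.map (X.σ m) (F.σ m)) (E.σ m) ∘ₗ
        (TensorProduct.rightComm ℂ X.V E.V F.V).toLinearMap
    from TensorProduct.ext_threefold fun a b c => by simp)

end GKMod

/-! ## Alternating forms and the Chevalley-Eilenberg complex -/

section Alternating

variable {E X : Type} [AddCommGroup E] [Module ℂ E] [AddCommGroup X] [Module ℂ X] {q : ℕ}

/-- The derivation of alternating forms induced by an endomorphism `a`:
`(altDer a f)(v₁, …, v_q) = ∑ₖ f(v₁, …, a vₖ, …, v_q)`. -/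
def altDer (a : Module.End ℂ E) (f : E [⋀^Fin q]→ₗ[ℂ] X) : E [⋀^Fin q]→ₗ[ℂ] X where
  toFun v := ∑ k, f (Function.update v k (a (v k)))
  map_update_add' v i x y := by
    rename_i inst
    obtain rfl : inst = instDecidableEqFin q := Subsingleton.elim _ _
    rw [← Finset.sum_add_distrib]
    refine Finset.sum_congr rfl fun k _ => ?_
    by_cases h : k = i
    · subst h; simp
    · simp [Function.update_of_ne h, Function.update_comm (Ne.symm h)]
  map_update_smul' v i c x := by
    rename_i inst
    obtain rfl : inst = instDecidableEqFin q := Subsingleton.elim _ _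
    rw [Finset.smul_sum]
    refine Finset.sum_congr rfl fun k _ => ?_
    by_cases h : k = i
    · subst h; simp
    · simp [Function.update_of_ne h, Function.update_comm (Ne.symm h)]
  map_eq_zero_of_eq' v i j hv hij := by
    rw [Fintype.sum_eq_add i j hij]
    · have : Function.update v j (a (v j)) =
          Function.update v i (a (v i)) ∘ Equiv.swap i j := by
        ext k
        rcases eq_or_ne k i with rfl | hi
        · simp [Function.update_of_ne hij, Function.update_of_ne hij.symm, hv]
        rcases eq_or_ne k j with rfl | hj
        · simp [hv]
        · simp [Equiv.swap_apply_of_ne_of_ne hi hj, Function.update_of_ne hi,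
            Function.update_of_ne hj]
      rw [this, f.map_swap _ hij, add_neg_cancel]
    · rintro k ⟨hi, hj⟩
      refine f.map_eq_zero_of_eq _ ?_ hij
      rw [Function.update_of_ne hi.symm, Function.update_of_ne hj.symm, hv]

theorem altDer_apply (a : Module.End ℂ E) (f : E [⋀^Fin q]→ₗ[ℂ] X) (v : Fin q → E) :
    altDer a f v = ∑ k, f (Function.update v k (a (v k))) := rfl

/-- `altDer` as a bilinear map. -/
def altDerL : Module.End ℂ E →ₗ[ℂ] Module.End ℂ (E [⋀^Fin q]→ₗ[ℂ] X) :=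
  LinearMap.mk₂ ℂ altDer
    (fun a b f => by ext v; simp [altDer_apply, Finset.sum_add_distrib])
    (fun c a f => by ext v; simp [altDer_apply, Finset.smul_sum])
    (fun a f g => by ext v; simp [altDer_apply, Finset.sum_add_distrib])
    (fun c a f => by ext v; simp [altDer_apply, Finset.smul_sum])

theorem altDerL_apply (a : Module.End ℂ E) (f : E [⋀^Fin q]→ₗ[ℂ] X) :
    altDerL a f = altDer a f := rfl

theorem altDer_comm (a b : Module.End ℂ E) (f : E [⋀^Fin q]→ₗ[ℂ] X) :
    altDer a (altDer b f) - altDer b (altDer a f) = altDer (b * a - a * b) f := by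
  have key : ∀ (a b : Module.End ℂ E) (v : Fin q → E), altDer a (altDer b f) v =
      altDer (b * a) f v + ∑ k, ∑ j ∈ Finset.univ.erase k,
        f (Function.update (Function.update v k (a (v k))) j (b (v j))) := by
    intro a b v
    simp only [altDer_apply]
    rw [← Finset.sum_add_distrib]
    refine Finset.sum_congr rfl fun k _ => ?_
    rw [← Finset.add_sum_erase _ _ (Finset.mem_univ k)]
    congr 1
    · simp
    · refine Finset.sum_congr rfl fun j hj => ?_
      rw [Function.update_of_ne (Finset.ne_of_mem_erase hj)]
  ext v
  have h0 : altDer (b * a - a * b) f = altDer (b * a) f - altDer (a * b) f := by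
    simp only [← altDerL_apply, map_sub, LinearMap.sub_apply]
  rw [AlternatingMap.sub_apply, key, key, h0, AlternatingMap.sub_apply]
  have : (∑ k, ∑ j ∈ Finset.univ.erase k,
        f (Function.update (Function.update v k (a (v k))) j (b (v j)))) =
      ∑ k, ∑ j ∈ Finset.univ.erase k,
        f (Function.update (Function.update v k (b (v k))) j (a (v j))) := by
    rw [Finset.sum_comm' (t' := Finset.univ) (s' := fun k => Finset.univ.erase k)
      (by simp [eq_comm])]
    refine Finset.sum_congr rfl fun k _ => Finset.sum_congr rfl fun j hj => ?_
    rw [Function.update_comm (Finset.ne_of_mem_erase hj)]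
  rw [this]
  abel

/-- Postcomposition of alternating forms with an endomorphism of the coefficients. -/
def altPost : Module.End ℂ X →ₗ[ℂ] Module.End ℂ (E [⋀^Fin q]→ₗ[ℂ] X) :=
  LinearMap.mk₂ ℂ (fun A f => A.compAlternatingMap f)
    (fun _ _ _ => rfl) (fun _ _ _ => rfl) (fun A f g => by ext; simp) (fun c A f => by ext; simp)

theorem altPost_apply (A : Module.End ℂ X) (f : E [⋀^Fin q]→ₗ[ℂ] X) (v : Fin q → E) :
    altPost A f v = A (f v) := rfl

theorem altPost_altDer (A : Module.End ℂ X) (a : Module.End ℂ E) (f : E [⋀^Fin q]→ₗ[ℂ] X) :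
    altPost A (altDer a f) = altDer a (altPost A f) := by
  ext v; simp [altPost_apply, altDer_apply]

theorem altDer_alternatize (a : Module.End ℂ E) (g : E →ₗ[ℂ] E [⋀^Fin q]→ₗ[ℂ] X) :
    altDer a (AlternatingMap.alternatizeUncurryFin g) =
      AlternatingMap.alternatizeUncurryFin (altDerL a ∘ₗ g + g ∘ₗ a) := by
  ext v
  simp only [altDer_apply, AlternatingMap.alternatizeUncurryFin_apply, LinearMap.add_apply,
    LinearMap.comp_apply, AlternatingMap.add_apply, smul_add, altDerL_apply, Finset.smul_sum]
  rw [Finset.sum_comm]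
  refine Finset.sum_congr rfl fun i _ => ?_
  rw [Fin.sum_univ_succAbove _ i, add_comm]
  congr 1
  · refine Finset.sum_congr rfl fun j _ => ?_
    rw [Fin.removeNth_update_succAbove, Function.update_of_ne (Fin.succAbove_ne i j).symm]
    rfl
  · simp

theorem altPost_alternatize (A : Module.End ℂ X) (g : E →ₗ[ℂ] E [⋀^Fin q]→ₗ[ℂ] X) :
    altPost A (AlternatingMap.alternatizeUncurryFin g) =
      AlternatingMap.alternatizeUncurryFin (altPost A ∘ₗ g) := by
  ext v
  simp [altPost_apply, AlternatingMap.alternatizeUncurryFin_apply]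

/-- The Chevalley-Eilenberg differential of a Lie algebra `𝔲` with coefficients in a
representation `r` on `X`:
`(d f)(x₀, …, x_q) = ∑ᵢ (-1)ⁱ xᵢ f(…, x̂ᵢ, …) + ∑_{i<j} (-1)^{i+j} f([xᵢ, xⱼ], …, x̂ᵢ, …, x̂ⱼ, …)`.
The second sum is written as `-½ ∑ᵢ (-1)ⁱ (altDer (ad xᵢ) f)(…, x̂ᵢ, …)`, in which every pair
`{i, j}` occurs twice. -/
def ceDiff {𝔲 : Type} [LieRing 𝔲] [LieAlgebra ℂ 𝔲] (r : 𝔲 →ₗ[ℂ] Module.End ℂ X) (q : ℕ) :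
    (𝔲 [⋀^Fin q]→ₗ[ℂ] X) →ₗ[ℂ] (𝔲 [⋀^Fin (q + 1)]→ₗ[ℂ] X) :=
  AlternatingMap.alternatizeUncurryFinLM ∘ₗ
    (altPost ∘ₗ r - (1 / 2 : ℂ) • altDerL ∘ₗ (LieAlgebra.ad ℂ 𝔲 : 𝔲 →ₗ[ℂ] Module.End ℂ 𝔲)).flip

theorem ceDiff_eq {𝔲 : Type} [LieRing 𝔲] [LieAlgebra ℂ 𝔲] (r : 𝔲 →ₗ[ℂ] Module.End ℂ X)
    (f : 𝔲 [⋀^Fin q]→ₗ[ℂ] X) :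
    ceDiff r q f = AlternatingMap.alternatizeUncurryFin ((altPost ∘ₗ r -
      (1 / 2 : ℂ) • altDerL ∘ₗ (LieAlgebra.ad ℂ 𝔲 : 𝔲 →ₗ[ℂ] Module.End ℂ 𝔲)).flip f) := rfl

/-- Compatibility of the differential with a derivation `a` of `𝔲` acting on the coefficients
through `A`. -/
theorem ceDiff_der {𝔲 : Type} [LieRing 𝔲] [LieAlgebra ℂ 𝔲] (r : 𝔲 →ₗ[ℂ] Module.End ℂ X)
    (a : Module.End ℂ 𝔲) (ha : ∀ x y, a ⁅x, y⁆ = ⁅a x, y⁆ + ⁅x, a y⁆) (A : Module.End ℂ X)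
    (hA : ∀ x w, r (a x) w = A (r x w) - r x (A w)) (f : 𝔲 [⋀^Fin q]→ₗ[ℂ] X) :
    ceDiff r q (altPost A f - altDer a f) =
      altPost A (ceDiff r q f) - altDer a (ceDiff r q f) := by
  rw [ceDiff_eq, ceDiff_eq, altDer_alternatize, altPost_alternatize,
    ← AlternatingMap.alternatizeUncurryFinLM_apply, ← AlternatingMap.alternatizeUncurryFinLM_apply,
    ← AlternatingMap.alternatizeUncurryFinLM_apply, ← map_sub]
  congr 1
  apply LinearMap.ext
  intro y
  have h1 : LieAlgebra.ad ℂ 𝔲 (a y) = a * LieAlgebra.ad ℂ 𝔲 y - LieAlgebra.ad ℂ 𝔲 y * a := by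
    ext z; simp [ha]
  have h2 := altDer_comm a (LieAlgebra.ad ℂ 𝔲 y) f
  have h3 : altDer (LieAlgebra.ad ℂ 𝔲 (a y)) f =
      altDer (LieAlgebra.ad ℂ 𝔲 y) (altDer a f) - altDer a (altDer (LieAlgebra.ad ℂ 𝔲 y) f) := by
    rw [altDer_comm, h1]
  have h4 : altPost (r (a y)) f = altPost A (altPost (r y) f) - altPost (r y) (altPost A f) := by
    ext v; simp [altPost_apply, hA]
  simp only [LinearMap.flip_apply, LinearMap.sub_apply, LinearMap.comp_apply, LinearMap.add_apply,
    LinearMap.smul_apply, map_sub, altDerL_apply, altPost_altDer, map_smul,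
    LieHom.coe_toLinearMap, h3, h4, smul_sub]
  abel

/-- Compatibility of the differential with an automorphism `b` of `𝔲` (with inverse `b'`) acting
on the coefficients through `B`. -/
theorem ceDiff_aut {𝔲 : Type} [LieRing 𝔲] [LieAlgebra ℂ 𝔲] (r : 𝔲 →ₗ[ℂ] Module.End ℂ X)
    (b b' : Module.End ℂ 𝔲) (hb : b * b' = 1) (hb' : b' * b = 1)
    (hlie : ∀ x y, b ⁅x, y⁆ = ⁅b x, b y⁆) (B : Module.End ℂ X)
    (hB : ∀ x w, B (r x w) = r (b x) (B w)) (f : 𝔲 [⋀^Fin q]→ₗ[ℂ] X) :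
    ceDiff r q (altPost B (f.compLinearMap b')) = altPost B ((ceDiff r q f).compLinearMap b') := by
  have hbb : ∀ x, b (b' x) = x := fun x => LinearMap.congr_fun hb x
  have hbb' : ∀ x, b' (b x) = x := fun x => LinearMap.congr_fun hb' x
  have hlie' : ∀ x y, b' ⁅x, y⁆ = ⁅b' x, b' y⁆ := fun x y => by
    conv_lhs => rw [← hbb x, ← hbb y, ← hlie, hbb']
  ext v
  simp only [ceDiff_eq, AlternatingMap.alternatizeUncurryFin_apply, altPost_apply,
    AlternatingMap.compLinearMap_apply, map_sum, LinearMap.flip_apply,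
    LinearMap.sub_apply, LinearMap.comp_apply, LinearMap.smul_apply, AlternatingMap.sub_apply,
    AlternatingMap.smul_apply, altDerL_apply, altDer_apply]
  refine Finset.sum_congr rfl fun i _ => ?_
  have h1 : ∀ k, (b' ∘ Function.update (Fin.removeNth i v) k
      ((LieAlgebra.ad ℂ 𝔲 (v i)) (Fin.removeNth i v k))) =
      Function.update (Fin.removeNth i fun j => b' (v j)) k
      ((LieAlgebra.ad ℂ 𝔲 (b' (v i))) (Fin.removeNth i (fun j => b' (v j)) k)) := fun k => by
    rw [Function.comp_update]
    simp [hlie', Fin.removeNth]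
    rfl
  have h2 : ∀ x w, r x (B w) = B (r (b' x) w) := fun x w => by rw [hB, hbb]
  have h3 : ∀ k, (fun j => b' (Function.update (Fin.removeNth i v) k
      ((LieAlgebra.ad ℂ 𝔲 : 𝔲 →ₗ[ℂ] Module.End ℂ 𝔲) (v i) (Fin.removeNth i v k)) j)) = _ := h1
  rw [map_zsmul, map_sub, map_smul, map_sum, ← h2]
  simp only [h3]
  rfl

/-- Postcomposition of alternating forms with a linear map. -/
def altComp {Y : Type} [AddCommGroup Y] [Module ℂ Y] (f : X →ₗ[ℂ] Y) :
    (E [⋀^Fin q]→ₗ[ℂ] X) →ₗ[ℂ] (E [⋀^Fin q]→ₗ[ℂ] Y) where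
  toFun c := f.compAlternatingMap c
  map_add' a b := by ext v; simp
  map_smul' a b := by ext v; simp

theorem altComp_apply {Y : Type} [AddCommGroup Y] [Module ℂ Y] (f : X →ₗ[ℂ] Y)
    (c : E [⋀^Fin q]→ₗ[ℂ] X) (v : Fin q → E) : altComp f c v = f (c v) := rfl

theorem altComp_exact {Y Z : Type} [AddCommGroup Y] [Module ℂ Y] [AddCommGroup Z] [Module ℂ Z]
    (i : X →ₗ[ℂ] Y) (p : Y →ₗ[ℂ] Z) (h : Function.Injective i ∧
      LinearMap.range i = LinearMap.ker p ∧ Function.Surjective p) :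
    Function.Injective (altComp (E := E) (q := q) i) ∧
      LinearMap.range (altComp (E := E) (q := q) i) = LinearMap.ker (altComp p) ∧
      Function.Surjective (altComp (E := E) (q := q) p) := by
  obtain ⟨s, hs⟩ := LinearMap.exists_rightInverse_of_surjective p (LinearMap.range_eq_top.2 h.2.2)
  obtain ⟨r, hr⟩ := LinearMap.exists_leftInverse_of_injective i (LinearMap.ker_eq_bot.2 h.1)
  have hs' : ∀ c, p (s c) = c := fun c => LinearMap.congr_fun hs c
  have hr' : ∀ a, r (i a) = a := fun a => LinearMap.congr_fun hr a
  refine ⟨fun a b hab => AlternatingMap.ext fun v => h.1 (DFunLike.congr_fun hab v), ?_,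
    fun c => ⟨altComp s c, AlternatingMap.ext fun v => hs' (c v)⟩⟩
  refine Submodule.ext fun c => ⟨?_, fun hc => ⟨altComp r c, AlternatingMap.ext fun v => ?_⟩⟩
  · rintro ⟨a, rfl⟩
    refine AlternatingMap.ext fun v => ?_
    have : i (a v) ∈ LinearMap.ker p := by rw [← h.2.1]; exact ⟨_, rfl⟩
    exact this
  · have : c v ∈ LinearMap.range i := by rw [h.2.1]; exact DFunLike.congr_fun hc v
    obtain ⟨a, ha⟩ := this
    change i (r (c v)) = c v
    rw [← ha, hr']

theorem alt_eq_zero_of_finrank_lt [FiniteDimensional ℂ E] (h : Module.finrank ℂ E < q)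
    (c : E [⋀^Fin q]→ₗ[ℂ] X) : c = 0 := by
  ext v
  refine c.map_linearDependent v fun hv => ?_
  have := hv.fintype_card_le_finrank
  rw [Fintype.card_fin] at this
  omega

theorem ceDiff_altComp {𝔲 Y : Type} [LieRing 𝔲] [LieAlgebra ℂ 𝔲] [AddCommGroup Y] [Module ℂ Y]
    (r : 𝔲 →ₗ[ℂ] Module.End ℂ X) (s : 𝔲 →ₗ[ℂ] Module.End ℂ Y) (f : X →ₗ[ℂ] Y)
    (hf : ∀ x v, f (r x v) = s x (f v)) (c : 𝔲 [⋀^Fin q]→ₗ[ℂ] X) :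
    ceDiff s q (altComp f c) = altComp f (ceDiff r q c) := by
  ext v
  simp [ceDiff_eq, AlternatingMap.alternatizeUncurryFin_apply, altPost_apply, altComp_apply,
    altDerL_apply, altDer_apply, hf]

end Alternating

section Square

variable {𝔲 X : Type} [LieRing 𝔲] [LieAlgebra ℂ 𝔲] [AddCommGroup X] [Module ℂ X] {q : ℕ}

open AlternatingMap

theorem altDer_eq_alternatize (a : Module.End ℂ 𝔲) (f : 𝔲 [⋀^Fin (q + 1)]→ₗ[ℂ] X) :
    altDer a f = alternatizeUncurryFin (f.curryLeft ∘ₗ a) := by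
  ext v
  rw [altDer_apply, alternatizeUncurryFin_apply]
  refine Finset.sum_congr rfl fun k _ => ?_
  have h := f.map_insertNth k (a (v k)) (k.removeNth v)
  rw [Fin.insertNth_removeNth] at h
  rw [h]
  rfl

/-- Twice alternating a bilinear map that is antisymmetric up to sign change. -/
theorem alternatize_swap (b b' : 𝔲 →ₗ[ℂ] 𝔲 →ₗ[ℂ] 𝔲 [⋀^Fin q]→ₗ[ℂ] X)
    (h : ∀ x y, b' x y = b y x) :
    alternatizeUncurryFin (alternatizeUncurryFinLM ∘ₗ b') =
      -alternatizeUncurryFin (alternatizeUncurryFinLM ∘ₗ b) := by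
  have := alternatizeUncurryFin_alternatizeUncurryFinLM_comp_of_symmetric (f := b' + b)
    (fun x y => by simp [h, add_comm])
  rw [LinearMap.comp_add, alternatizeUncurryFin_add] at this
  exact eq_neg_of_add_eq_zero_left this

/-- The Jacobi identity, in terms of alternating forms. -/
theorem alternatize_jacobi (f : 𝔲 [⋀^Fin q]→ₗ[ℂ] X)
    (b : 𝔲 →ₗ[ℂ] 𝔲 →ₗ[ℂ] 𝔲 [⋀^Fin q]→ₗ[ℂ] X)
    (hb : ∀ x y, b x y = altDer (LieAlgebra.ad ℂ 𝔲 ⁅x, y⁆) f) :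
    alternatizeUncurryFin (alternatizeUncurryFinLM ∘ₗ b) = 0 := by
  cases q with
  | zero =>
    refine alternatizeUncurryFin_alternatizeUncurryFinLM_comp_of_symmetric fun x y => ?_
    rw [hb, hb]
    ext v
    simp [altDer_apply]
  | succ q =>
    let α : 𝔲 →ₗ[ℂ] 𝔲 →ₗ[ℂ] 𝔲 := (LieAlgebra.ad ℂ 𝔲 : 𝔲 →ₗ[ℂ] Module.End ℂ 𝔲)
    let T : 𝔲 →ₗ[ℂ] 𝔲 →ₗ[ℂ] 𝔲 →ₗ[ℂ] 𝔲 [⋀^Fin q]→ₗ[ℂ] X := α.compr₂ (α.compr₂ f.curryLeft)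
    let F (S : 𝔲 →ₗ[ℂ] 𝔲 →ₗ[ℂ] 𝔲 →ₗ[ℂ] 𝔲 [⋀^Fin q]→ₗ[ℂ] X) : 𝔲 [⋀^Fin (q + 3)]→ₗ[ℂ] X :=
      alternatizeUncurryFin (alternatizeUncurryFinLM ∘ₗ S.compr₂ alternatizeUncurryFinLM)
    have hF : ∀ S S', F (S + S') = F S + F S' := fun S S' => by
      change alternatizeUncurryFin _ = alternatizeUncurryFin _ + alternatizeUncurryFin _
      rw [← alternatizeUncurryFin_add, ← LinearMap.comp_add]
      congr 2
      refine LinearMap.ext₂ fun x y => ?_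
      simp
    have h12 : ∀ S, F S.flip = -F S := fun S =>
      alternatize_swap _ _ fun x y => rfl
    have h23 : ∀ S, F (LinearMap.lflip.toLinearMap ∘ₗ S) = -F S := fun S => by
      have h := fun x => alternatize_swap (S x) (S x).flip fun y z => rfl
      change alternatizeUncurryFin _ = -alternatizeUncurryFin _
      rw [← alternatizeUncurryFinLM_apply, ← alternatizeUncurryFinLM_apply,
        ← map_neg]
      congr 1
      exact LinearMap.ext h
    let C (S : 𝔲 →ₗ[ℂ] 𝔲 →ₗ[ℂ] 𝔲 →ₗ[ℂ] 𝔲 [⋀^Fin q]→ₗ[ℂ] X) :=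
      LinearMap.lflip.toLinearMap ∘ₗ S.flip
    have hC : ∀ S, F (C S) = F S := fun S => by rw [h23, h12, neg_neg]
    have h0 : T + C T + C (C T) = 0 := by
      refine LinearMap.ext₂ fun x y => LinearMap.ext fun z => ?_
      change f.curryLeft ⁅⁅x, y⁆, z⁆ + f.curryLeft ⁅⁅z, x⁆, y⁆ + f.curryLeft ⁅⁅y, z⁆, x⁆ = 0
      rw [← map_add, ← map_add, ← lie_skew ⁅x, y⁆ z, ← lie_skew ⁅z, x⁆ y, ← lie_skew ⁅y, z⁆ x]
      have := lie_jacobi x y z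
      rw [show -⁅z, ⁅x, y⁆⁆ + -⁅y, ⁅z, x⁆⁆ + -⁅x, ⁅y, z⁆⁆ = -(⁅x, ⁅y, z⁆⁆ + ⁅y, ⁅z, x⁆⁆ + ⁅z, ⁅x, y⁆⁆)
        by abel, this, neg_zero, _root_.map_zero]
    have h1 : F T + F T + F T = 0 := by
      have := congrArg F h0
      rw [hF, hF, hC, hC, hC] at this
      rw [this]
      have h2 := hF 0 0
      rw [add_zero] at h2
      simpa using h2
    have h2 : F T = 0 := by
      have : (3 : ℂ) • F T = 0 := by
        rw [← h1, show (3 : ℂ) = 1 + 1 + 1 by norm_num, add_smul, add_smul, one_smul]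
      exact (smul_eq_zero.1 this).resolve_left (by norm_num)
    rw [← h2]
    congr 2
    refine LinearMap.ext₂ fun x y => ?_
    rw [hb, altDer_eq_alternatize]
    rfl

/-- The square of the differential vanishes. -/
theorem ceDiff_ceDiff (r : 𝔲 →ₗ[ℂ] Module.End ℂ X)
    (hr : ∀ x y w, r ⁅x, y⁆ w = r x (r y w) - r y (r x w)) (f : 𝔲 [⋀^Fin q]→ₗ[ℂ] X) :
    ceDiff r (q + 1) (ceDiff r q f) = 0 := by
  let α : 𝔲 →ₗ[ℂ] Module.End ℂ 𝔲 := (LieAlgebra.ad ℂ 𝔲 : 𝔲 →ₗ[ℂ] Module.End ℂ 𝔲)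
  let D : 𝔲 →ₗ[ℂ] Module.End ℂ (𝔲 [⋀^Fin q]→ₗ[ℂ] X) := altPost ∘ₗ r - (1 / 2 : ℂ) • altDerL ∘ₗ α
  have hD : ∀ x g, D x g = altPost (r x) g - (1 / 2 : ℂ) • altDer (α x) g := fun x g => rfl
  let b : 𝔲 →ₗ[ℂ] 𝔲 →ₗ[ℂ] 𝔲 [⋀^Fin q]→ₗ[ℂ] X :=
    LinearMap.mk₂ ℂ (fun y x => D y (D x f) - (1 / 2 : ℂ) • D ⁅y, x⁆ f)
      (fun y y' x => by simp only [map_add, LinearMap.add_apply, add_lie, smul_add]; abel)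
      (fun c y x => by simp only [map_smul, LinearMap.smul_apply, smul_lie, smul_sub,
        smul_comm c (1 / 2 : ℂ)])
      (fun y x x' => by simp only [map_add, LinearMap.add_apply, lie_add, smul_add]; abel)
      (fun c y x => by simp only [map_smul, LinearMap.smul_apply, lie_smul, smul_sub,
        smul_comm c (1 / 2 : ℂ)])
  have hb : ∀ y x, b y x = D y (D x f) - (1 / 2 : ℂ) • D ⁅y, x⁆ f := fun _ _ => rfl
  have h1 : ceDiff r (q + 1) (ceDiff r q f) =
      alternatizeUncurryFin (alternatizeUncurryFinLM ∘ₗ b) := by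
    rw [ceDiff_eq, ceDiff_eq]
    congr 1
    refine LinearMap.ext fun y => ?_
    change altPost (r y) (alternatizeUncurryFin (D.flip f)) -
      (1 / 2 : ℂ) • altDer (α y) (alternatizeUncurryFin (D.flip f)) =
      alternatizeUncurryFin (b y)
    rw [altPost_alternatize, altDer_alternatize, ← alternatizeUncurryFin_smul,
      ← alternatizeUncurryFinLM_apply, ← alternatizeUncurryFinLM_apply,
      ← alternatizeUncurryFinLM_apply, ← map_sub]
    congr 1
    refine LinearMap.ext fun x => ?_
    rw [hb, hD y]
    change altPost (r y) (D x f) - (1 / 2 : ℂ) • (altDer (α y) (D x f) + D ⁅y, x⁆ f) = _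
    rw [smul_add]
    abel
  have h2 : ∀ y x, b y x - b x y = (1 / 4 : ℂ) • altDer (α ⁅y, x⁆) f := fun y x => by
    have e1 : D ⁅x, y⁆ f = -D ⁅y, x⁆ f := by rw [← lie_skew, map_neg, LinearMap.neg_apply]
    have e2 : altPost (r ⁅y, x⁆) f =
        altPost (r y) (altPost (r x) f) - altPost (r x) (altPost (r y) f) := by
      ext v; simp [altPost_apply, hr]
    have e3 : altDer (α ⁅y, x⁆) f = altDer (α x) (altDer (α y) f) - altDer (α y) (altDer (α x) f) := by
      rw [altDer_comm]
      congr 1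
      ext z
      simp [α]
    rw [hb, hb, e1]
    simp only [hD, e2, e3, map_sub, map_smul, altPost_altDer]
    simp only [← altDerL_apply, map_sub, map_smul]
    module
  have h3 := alternatize_jacobi f ((4 : ℂ) • (b - b.flip)) fun y x => by
    change (4 : ℂ) • (b y x - b x y) = _
    rw [h2, smul_smul, show (4 : ℂ) * (1 / 4) = 1 by norm_num, one_smul]
    rfl
  have h4 := alternatize_swap b b.flip fun x y => rfl
  have h5 : (8 : ℂ) • alternatizeUncurryFin (alternatizeUncurryFinLM ∘ₗ b) = 0 := by
    rw [LinearMap.comp_smul, alternatizeUncurryFin_smul, LinearMap.comp_sub,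
      ← alternatizeUncurryFinLM_apply, map_sub, alternatizeUncurryFinLM_apply,
      alternatizeUncurryFinLM_apply, h4, sub_neg_eq_add, smul_add, ← add_smul] at h3
    rw [← h3]
    norm_num
  rw [h1]
  exact (smul_eq_zero.1 h5).resolve_left (by norm_num)

end Square

namespace GKMod

variable {P P' : HCPair}

theorem σ_mul_inv (X : GKMod P) (m : P.M) : X.σ m * X.σ m⁻¹ = 1 := by
  rw [← map_mul, mul_inv_cancel, map_one]

theorem σ_inv_mul (X : GKMod P) (m : P.M) : X.σ m⁻¹ * X.σ m = 1 := by
  rw [← map_mul, inv_mul_cancel, map_one]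

section AltAux

variable (E X : GKMod P) {q : ℕ}

/-- The action of a group element on alternating forms. -/
def altσ (m : P.M) : Module.End ℂ (E.V [⋀^Fin q]→ₗ[ℂ] X.V) where
  toFun f := altPost (X.σ m) (f.compLinearMap (E.σ m⁻¹))
  map_add' f g := by ext v; simp [altPost_apply]
  map_smul' c f := by ext v; simp [altPost_apply]

theorem altσ_apply (m : P.M) (f : E.V [⋀^Fin q]→ₗ[ℂ] X.V) (v : Fin q → E.V) :
    altσ E X m f v = X.σ m (f fun i => E.σ m⁻¹ (v i)) := rfl

/-- Alternating forms with values in a subspace. -/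
def altVal (V : Type) [AddCommGroup V] [Module ℂ V] (T : Submodule ℂ X.V) :
    Submodule ℂ (V [⋀^Fin q]→ₗ[ℂ] X.V) where
  carrier := {f | ∀ v, f v ∈ T}
  add_mem' hf hg v := T.add_mem (hf v) (hg v)
  zero_mem' _ := T.zero_mem
  smul_mem' c _ hf v := T.smul_mem c (hf v)

variable [FiniteDimensional ℂ E.V]

theorem alt_expansion (f : E.V [⋀^Fin q]→ₗ[ℂ] X.V) (v : Fin q → E.V) :
    f v = ∑ J : Fin q → Fin (Module.finrank ℂ E.V),
      (∏ k, (Module.finBasis ℂ E.V).coord (J k) (v k)) •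
        f fun k => Module.finBasis ℂ E.V (J k) := by
  have h : v = fun k => ∑ j, (Module.finBasis ℂ E.V).coord j (v k) • Module.finBasis ℂ E.V j := by
    ext k; exact ((Module.finBasis ℂ E.V).sum_repr (v k)).symm
  conv_lhs => rw [h]
  rw [← AlternatingMap.coe_multilinearMap, MultilinearMap.map_sum]
  refine Finset.sum_congr rfl fun J _ => ?_
  rw [MultilinearMap.map_smul_univ]

theorem exists_altVal (f : E.V [⋀^Fin q]→ₗ[ℂ] X.V) :
    ∃ T : Submodule ℂ X.V, FiniteDimensional ℂ T ∧ ∀ m v, X.σ m (f v) ∈ T := by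
  obtain ⟨T, h1, h2⟩ := X.exists_orbit
    (fun J : Fin q → Fin (Module.finrank ℂ E.V) => f fun k => Module.finBasis ℂ E.V (J k))
  refine ⟨T, h1, fun m v => ?_⟩
  rw [alt_expansion E X f v, map_sum]
  exact Submodule.sum_mem _ fun J _ => by rw [map_smul]; exact T.smul_mem _ (h2 J m)

theorem finite_altVal (T : Submodule ℂ X.V) [FiniteDimensional ℂ T] :
    FiniteDimensional ℂ (altVal X E.V T : Submodule ℂ (E.V [⋀^Fin q]→ₗ[ℂ] X.V)) := by
  let F : (altVal X E.V T : Submodule ℂ (E.V [⋀^Fin q]→ₗ[ℂ] X.V)) →ₗ[ℂ]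
      ((Fin q → Fin (Module.finrank ℂ E.V)) → T) :=
    { toFun := fun f J => ⟨f.1 fun k => Module.finBasis ℂ E.V (J k), f.2 _⟩
      map_add' := fun f g => rfl
      map_smul' := fun c f => rfl }
  refine FiniteDimensional.of_injective F fun f g h => Subtype.ext (AlternatingMap.ext fun v => ?_)
  rw [alt_expansion, alt_expansion E X g.1]
  refine Finset.sum_congr rfl fun J _ => ?_
  congr 1
  exact congrArg Subtype.val (congrFun h J)

/-- Every linear functional on alternating forms is a linear combination of evaluations on vectors
followed by functionals. -/
theorem alt_functional (l : Module.Dual ℂ (E.V [⋀^Fin q]→ₗ[ℂ] X.V)) :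
    ∃ (ν : (Fin q → Fin (Module.finrank ℂ E.V)) → Module.Dual ℂ X.V),
 ∀ f,
      l f = ∑ J, ν J (f fun k => Module.finBasis ℂ E.V (J k)) := by
  let F : (E.V [⋀^Fin q]→ₗ[ℂ] X.V) →ₗ[ℂ] ((Fin q → Fin (Module.finrank ℂ E.V)) → X.V) :=
    { toFun := fun f J => f fun k => Module.finBasis ℂ E.V (J k)
      map_add' := fun f g => rfl
      map_smul' := fun c f => rfl }
  have hF : Function.Injective F := fun f g h => AlternatingMap.ext fun v => by
    rw [alt_expansion, alt_expansion E X g]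
    exact Finset.sum_congr rfl fun J _ => by rw [show f _ = g _ from congrFun h J]
  obtain ⟨r, hr⟩ := LinearMap.exists_leftInverse_of_injective F (LinearMap.ker_eq_bot.2 hF)
  refine ⟨fun J => l ∘ₗ r ∘ₗ LinearMap.single ℂ (fun _ => X.V) J, fun f => ?_⟩
  have h0 : r (F f) = f := LinearMap.congr_fun hr f
  conv_lhs => rw [← h0, ← Finset.univ_sum_single (F f), map_sum, map_sum]
  rfl

theorem altσ_expansion (m : P.M) (f : E.V [⋀^Fin q]→ₗ[ℂ] X.V) (v : Fin q → E.V) :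
    altσ E X m f v = ∑ J : Fin q → Fin (Module.finrank ℂ E.V),
      (∏ k, (Module.finBasis ℂ E.V).coord (J k) (E.σ m⁻¹ (v k))) •
        X.σ m (f fun k => Module.finBasis ℂ E.V (J k)) := by
  rw [altσ_apply, alt_expansion E X f, map_sum]
  simp

theorem altσ_continuous (f : E.V [⋀^Fin q]→ₗ[ℂ] X.V)
    (l : Module.Dual ℂ (E.V [⋀^Fin q]→ₗ[ℂ] X.V)) : Continuous fun m => l (altσ E X m f) := by
  obtain ⟨ν, hν⟩ := alt_functional E X l
  simp only [hν, altσ_expansion, map_sum, map_smul]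
  refine continuous_finsetSum _ fun J _ => continuous_finsetSum _ fun I _ => ?_
  exact Continuous.mul (continuous_finsetProd Finset.univ fun k _ =>
    (E.σ_continuous (Module.finBasis ℂ E.V (J k)) _).comp continuous_inv) (X.σ_continuous _ _)

theorem altσ_hasDerivAt (γ : Multiplicative ℝ →* P.M) (x : P.h) (h : P.IsVelocity γ x)
    (f : E.V [⋀^Fin q]→ₗ[ℂ] X.V) (l : Module.Dual ℂ (E.V [⋀^Fin q]→ₗ[ℂ] X.V)) :
    HasDerivAt (fun t : ℝ => l (altσ E X (γ (.ofAdd t)) f))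
      (l (altPost (X.ρ x) f - altDer (E.ρ x) f)) 0 := by
  obtain ⟨ν, hν⟩ := alt_functional E X l
  have hE : ∀ (v : E.V) (μ : Module.Dual ℂ E.V),
      HasDerivAt (fun t : ℝ => μ (E.σ (γ (.ofAdd t))⁻¹ v)) (-μ (E.ρ x v)) 0 := fun v μ => by
    have h1 := E.σ_hasDerivAt γ x h v μ
    rw [← neg_zero] at h1
    have h2 := h1.scomp (0 : ℝ) (hasDerivAt_neg (0 : ℝ))
    rw [neg_one_smul] at h2
    refine h2.congr_of_eventuallyEq (Filter.Eventually.of_forall fun t => ?_)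
    simp
  simp only [hν, altσ_expansion, map_sum, map_smul]
  refine HasDerivAt.fun_sum fun J _ => ?_
  have key := HasDerivAt.fun_sum (u := Finset.univ)
    fun (I : Fin q → Fin (Module.finrank ℂ E.V)) _ =>
    (HasDerivAt.fun_finsetProd (u := Finset.univ) fun k _ =>
      hE (Module.finBasis ℂ E.V (J k)) ((Module.finBasis ℂ E.V).coord (I k))).fun_smul
      (X.σ_hasDerivAt γ x h (f fun k => Module.finBasis ℂ E.V (I k)) (ν J))
  convert! key using 1
  simp only [ofAdd_zero, map_one, inv_one, Module.End.one_apply, Finset.sum_add_distrib,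
    AlternatingMap.sub_apply, map_sub, altPost_apply, altDer_apply]
  rw [sub_eq_add_neg]
  congr 1
  · conv_lhs => rw [alt_expansion E X f, map_sum, map_sum]
    simp
  · rw [map_sum, ← Finset.sum_neg_distrib]
    simp only [Finset.sum_smul]
    rw [Finset.sum_comm]
    refine Finset.sum_congr rfl fun k _ => ?_
    rw [alt_expansion E X f, map_sum, ← Finset.sum_neg_distrib]
    refine Finset.sum_congr rfl fun I _ => ?_
    rw [map_smul, ← Finset.mul_prod_erase _ _ (Finset.mem_univ k), Function.update_self]
    have : ∏ j ∈ Finset.univ.erase k, (Module.finBasis ℂ E.V).coord (I j)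
          (Function.update (fun k => Module.finBasis ℂ E.V (J k)) k
            (E.ρ x (Module.finBasis ℂ E.V (J k))) j) =
        ∏ j ∈ Finset.univ.erase k, (Module.finBasis ℂ E.V).coord (I j)
          (Module.finBasis ℂ E.V (J j)) :=
      Finset.prod_congr rfl fun j hj => by rw [Function.update_of_ne (Finset.ne_of_mem_erase hj)]
    rw [this]
    simp [mul_comm]

end AltAux

/-- The module of alternating `q`-linear forms on `E` with values in `X`, i.e.
`Hom(⋀^q E, X) = (⋀^q E*) ⊗ X`. -/
def alt (E X : GKMod P) [FiniteDimensional ℂ E.V] (q : ℕ) : GKMod P where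
  V := E.V [⋀^Fin q]→ₗ[ℂ] X.V
  ρ := altPost ∘ₗ X.ρ - altDerL ∘ₗ E.ρ
  σ :=
    { toFun := altσ E X
      map_one' := by ext f v; simp [altσ_apply]
      map_mul' := fun a b => by ext f v; simp [altσ_apply] }
  ρ_lie x y f := by
    have h1 : E.ρ ⁅x, y⁆ = E.ρ x * E.ρ y - E.ρ y * E.ρ x := by ext v; simp [E.ρ_lie]
    have h2 : altPost (X.ρ ⁅x, y⁆) f =
        altPost (X.ρ x) (altPost (X.ρ y) f) - altPost (X.ρ y) (altPost (X.ρ x) f) := by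
      ext v; simp [altPost_apply, X.ρ_lie]
    have h3 : altDer (E.ρ ⁅x, y⁆) f =
        altDer (E.ρ y) (altDer (E.ρ x) f) - altDer (E.ρ x) (altDer (E.ρ y) f) := by
      rw [h1, altDer_comm]
    simp only [LinearMap.sub_apply, LinearMap.comp_apply, h2, map_sub, altDerL_apply,
      altPost_altDer, h3]
    abel
  σ_ρ m x f := by
    have h : ∀ w, E.σ m⁻¹ (E.ρ (P.Ad m x) w) = E.ρ x (E.σ m⁻¹ w) := fun w => by
      rw [E.σ_ρ, ← Module.End.mul_apply (P.Ad m⁻¹), ← map_mul, inv_mul_cancel, map_one,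
        Module.End.one_apply]
    ext v
    simp only [MonoidHom.coe_mk, OneHom.coe_mk, altσ_apply, LinearMap.sub_apply,
      LinearMap.comp_apply, AlternatingMap.sub_apply, altPost_apply, altDerL_apply, altDer_apply,
      map_sub, X.σ_ρ, map_sum]
    congr 1
    refine Finset.sum_congr rfl fun k _ => ?_
    congr 2
    ext j
    rcases eq_or_ne j k with rfl | hj
    · simp [h]
    · simp [Function.update_of_ne hj]
  locallyFinite f := by
    obtain ⟨T, h1, h2⟩ := exists_altVal E X f
    exact ⟨altVal X E.V T, finite_altVal E X T, fun m v => h2 m _⟩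
  σ_continuous := altσ_continuous E X
  σ_hasDerivAt := altσ_hasDerivAt E X

theorem altσ_altComp (E : GKMod P) {X Y : GKMod P} (f : Hom X Y) {q : ℕ} (m : P.M)
    (c : E.V [⋀^Fin q]→ₗ[ℂ] X.V) : altComp f.f (altσ E X m c) = altσ E Y m (altComp f.f c) := by
  ext v
  simp [altComp_apply, altσ_apply, f.map_σ]

theorem altρ_altComp (E : GKMod P) {X Y : GKMod P} (f : Hom X Y) {q : ℕ} (x : P.h)
    (c : E.V [⋀^Fin q]→ₗ[ℂ] X.V) : altComp f.f (altPost (X.ρ x) c - altDer (E.ρ x) c) =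
      altPost (Y.ρ x) (altComp f.f c) - altDer (E.ρ x) (altComp f.f c) := by
  ext v
  simp [altPost_apply, altDer_apply, altComp_apply, f.map_ρ]

/-- Functoriality of `Hom(⋀^q E, X)` in `X`. -/
def altMap (E : GKMod P) [FiniteDimensional ℂ E.V] {X Y : GKMod P} (f : Hom X Y) (q : ℕ) :
    Hom (alt E X q) (alt E Y q) where
  f := altComp f.f
  map_ρ := altρ_altComp E f
  map_σ := altσ_altComp E f

theorem altMap_exact (E : GKMod P) [FiniteDimensional ℂ E.V] {X Y Z : GKMod P} (i : Hom X Y)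
    (p : Hom Y Z) (h : ShortExact i p) (q : ℕ) : ShortExact (altMap E i q) (altMap E p q) :=
  altComp_exact i.f p.f h

end GKMod

/-! ## Abelian subcategories and Grothendieck groups -/

/-- A full abelian subcategory of the category of `(𝔥, M)`-modules (closed under kernels,
cokernels and finite direct sums), containing with an object all objects isomorphic to it. -/
structure AbSubcat (P : HCPair) where
  mem : GKMod P → Prop
  zero : ∀ Z : GKMod P, Subsingleton Z.V → mem Z
  ker : ∀ {X Y Z : GKMod P} (f : GKMod.Hom X Y) (i : GKMod.Hom Z X), mem X → mem Y →
    Function.Injective i.f → LinearMap.range i.f = LinearMap.ker f.f → mem Z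
  coker : ∀ {X Y Z : GKMod P} (f : GKMod.Hom X Y) (p : GKMod.Hom Y Z), mem X → mem Y →
    Function.Surjective p.f → LinearMap.ker p.f = LinearMap.range f.f → mem Z
  sum : ∀ {X Y Z : GKMod P} (i : GKMod.Hom X Z) (j : GKMod.Hom Y Z), mem X → mem Y →
    Function.Bijective (fun v : X.V × Y.V => i.f v.1 + j.f v.2) → mem Z

variable {P : HCPair}

/-- The relations `[Y] = [X] + [Z]` for short exact sequences. -/
def K0.relations (𝒢 : AbSubcat P) : AddSubgroup (FreeAbelianGroup {X : GKMod P // 𝒢.mem X}) :=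
  AddSubgroup.closure {a | ∃ (X Y Z : {X : GKMod P // 𝒢.mem X}) (i : GKMod.Hom X.1 Y.1)
    (p : GKMod.Hom Y.1 Z.1), GKMod.ShortExact i p ∧ a = .of Y - .of X - .of Z}

/-- The Grothendieck group. -/
abbrev K0 (𝒢 : AbSubcat P) : Type 1 :=
  FreeAbelianGroup {X : GKMod P // 𝒢.mem X} ⧸ K0.relations 𝒢

namespace K0

/-- The class `[X]`. -/
def cls (𝒢 : AbSubcat P) (X : GKMod P) (hX : 𝒢.mem X) : K0 𝒢 :=
  QuotientAddGroup.mk (FreeAbelianGroup.of ⟨X, hX⟩)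

theorem cls_exact (𝒢 : AbSubcat P) {X Y Z : GKMod P} (hX : 𝒢.mem X) (hY : 𝒢.mem Y)
    (hZ : 𝒢.mem Z) (i : GKMod.Hom X Y) (p : GKMod.Hom Y Z) (h : GKMod.ShortExact i p) :
    cls 𝒢 Y hY = cls 𝒢 X hX + cls 𝒢 Z hZ := by
  rw [← sub_eq_zero, ← sub_sub]
  let o (W : GKMod P) (hW : 𝒢.mem W) : FreeAbelianGroup {X : GKMod P // 𝒢.mem X} := .of ⟨W, hW⟩
  refine (QuotientAddGroup.eq_zero_iff (o Y hY - o X hX - o Z hZ)).2 ?_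
  exact AddSubgroup.subset_closure ⟨⟨X, hX⟩, ⟨Y, hY⟩, ⟨Z, hZ⟩, i, p, h, rfl⟩

/-- Additive functions on objects extend to the Grothendieck group. -/
def lift {A : Type 1} [AddCommGroup A] (𝒢 : AbSubcat P) (φ : ∀ X : GKMod P, 𝒢.mem X → A)
    (hφ : ∀ (X Y Z : GKMod P) (hX : 𝒢.mem X) (hY : 𝒢.mem Y) (hZ : 𝒢.mem Z) (i : GKMod.Hom X Y)
      (p : GKMod.Hom Y Z), GKMod.ShortExact i p → φ Y hY = φ X hX + φ Z hZ) : K0 𝒢 →+ A :=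
  QuotientAddGroup.lift _ (FreeAbelianGroup.lift fun X => φ X.1 X.2) <| by
    rw [relations, AddSubgroup.closure_le]
    rintro _ ⟨X, Y, Z, i, p, h, rfl⟩
    simp [hφ X.1 Y.1 Z.1 X.2 Y.2 Z.2 i p h]

theorem lift_cls {A : Type 1} [AddCommGroup A] (𝒢 : AbSubcat P)
    (φ : ∀ X : GKMod P, 𝒢.mem X → A) (hφ) (X : GKMod P) (hX : 𝒢.mem X) :
    lift 𝒢 φ hφ (cls 𝒢 X hX) = φ X hX :=
  FreeAbelianGroup.lift_apply_of _ _

theorem hom_ext {A : Type 1} [AddCommGroup A] {𝒢 : AbSubcat P} {f g : K0 𝒢 →+ A}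
    (h : ∀ X hX, f (cls 𝒢 X hX) = g (cls 𝒢 X hX)) : f = g := by
  refine QuotientAddGroup.addMonoidHom_ext _ ?_
  ext X
  exact h X.1 X.2

theorem cls_zero (𝒢 : AbSubcat P) (X : GKMod P) (hX : 𝒢.mem X) [Subsingleton X.V] :
    cls 𝒢 X hX = 0 := by
  have h := cls_exact 𝒢 hX hX hX ⟨0, by simp, by simp⟩ ⟨0, by simp, by simp⟩
    ⟨fun a b _ => Subsingleton.elim a b, Submodule.ext fun a => by
      simp [Subsingleton.elim a 0], fun a => ⟨0, Subsingleton.elim _ _⟩⟩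
  simpa using h

end K0

namespace GKMod

/-- The image of a morphism. -/
def im {X Y : GKMod P} (f : Hom X Y) : GKMod P :=
  Y.sub (LinearMap.range f.f)
    (by rintro x _ ⟨v, rfl⟩; exact ⟨_, f.map_ρ x v⟩) (by rintro x _ ⟨v, rfl⟩; exact ⟨_, f.map_σ x v⟩)

theorem im_mem {𝒢 : AbSubcat P} {X Y : GKMod P} (f : Hom X Y) (hX : 𝒢.mem X) (hY : 𝒢.mem Y) :
    𝒢.mem (im f) := by
  let C : GKMod P := Y.quot (LinearMap.range f.f)
    (by rintro x _ ⟨v, rfl⟩; exact ⟨_, f.map_ρ x v⟩) (by rintro x _ ⟨v, rfl⟩; exact ⟨_, f.map_σ x v⟩)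
  let p : Hom Y C := ⟨(LinearMap.range f.f).mkQ, fun _ _ => rfl, fun _ _ => rfl⟩
  have hC : 𝒢.mem C := 𝒢.coker f p hX hY (Submodule.mkQ_surjective _) (Submodule.ker_mkQ _)
  let i : Hom (im f) Y := ⟨(LinearMap.range f.f).subtype, fun _ _ => rfl, fun _ _ => rfl⟩
  exact 𝒢.ker p i hY hC (Submodule.injective_subtype _)
    ((Submodule.range_subtype _).trans (Submodule.ker_mkQ _).symm)

theorem cls_eq_im {𝒢 : AbSubcat P} {X Y Z : GKMod P} (f : Hom X Y) (g : Hom Y Z) (hX : 𝒢.mem X)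
    (hY : 𝒢.mem Y) (hZ : 𝒢.mem Z) (h : LinearMap.range f.f = LinearMap.ker g.f) :
    K0.cls 𝒢 Y hY = K0.cls 𝒢 (im f) (im_mem f hX hY) + K0.cls 𝒢 (im g) (im_mem g hY hZ) := by
  refine K0.cls_exact 𝒢 _ _ _ ⟨(LinearMap.range f.f).subtype, fun _ _ => rfl, fun _ _ => rfl⟩
    ⟨g.f.rangeRestrict, fun x v => Subtype.ext (g.map_ρ x v), fun m v => Subtype.ext (g.map_σ m v)⟩
    ⟨Submodule.injective_subtype _, ?_, LinearMap.surjective_rangeRestrict _⟩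
  exact ((Submodule.range_subtype _).trans h).trans (LinearMap.ker_rangeRestrict _).symm

end GKMod

theorem K0.cls_iso (𝒢 : AbSubcat P) {X Y : GKMod P} (hX : 𝒢.mem X) (hY : 𝒢.mem Y)
    (f : GKMod.Hom X Y) (hf : Function.Bijective f.f) : K0.cls 𝒢 X hX = K0.cls 𝒢 Y hY := by
  let j : GKMod.Hom Y Y := ⟨0, by simp, by simp⟩
  have h1 : Subsingleton (GKMod.im j).V :=
    ⟨fun ⟨_, a, ha⟩ ⟨_, b, hb⟩ => Subtype.ext (ha.symm.trans hb)⟩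
  have h2 := K0.cls_exact 𝒢 hX hY (GKMod.im_mem j hY hY) f ⟨j.f.rangeRestrict,
    fun x v => Subtype.ext (j.map_ρ x v), fun m v => Subtype.ext (j.map_σ m v)⟩
    ⟨hf.1, (LinearMap.range_eq_top.2 hf.2).trans
      ((LinearMap.ker_rangeRestrict j.f).trans LinearMap.ker_zero).symm,
      LinearMap.surjective_rangeRestrict _⟩
  rw [K0.cls_zero 𝒢 (GKMod.im j), add_zero] at h2
  exact h2.symm

/-! ## Complexes of modules -/

/-- Cochain complexes of `(𝔥, M)`-modules, in non-negative degrees. -/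
structure Cpx (P : HCPair) where
  C : ℕ → GKMod P
  d : ∀ q, GKMod.Hom (C q) (C (q + 1))
  d_d : ∀ q v, (d (q + 1)).f ((d q).f v) = 0

namespace Cpx

/-- The subspace of `q`-coboundaries. -/
def B (A : Cpx P) : (q : ℕ) → Submodule ℂ (A.C q).V
  | 0 => ⊥
  | q + 1 => LinearMap.range (A.d q).f

theorem B_ρ (A : Cpx P) (q : ℕ) (x : P.h) (v : (A.C q).V) (hv : v ∈ A.B q) :
    (A.C q).ρ x v ∈ A.B q := by
  cases q with
  | zero => rw [(Submodule.mem_bot ℂ).1 hv, map_zero]; exact zero_mem _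
  | succ q => obtain ⟨w, rfl⟩ := hv; exact ⟨_, (A.d q).map_ρ x w⟩

theorem B_σ (A : Cpx P) (q : ℕ) (m : P.M) (v : (A.C q).V) (hv : v ∈ A.B q) :
    (A.C q).σ m v ∈ A.B q := by
  cases q with
  | zero => rw [(Submodule.mem_bot ℂ).1 hv, map_zero]; exact zero_mem _
  | succ q => obtain ⟨w, rfl⟩ := hv; exact ⟨_, (A.d q).map_σ m w⟩

/-- The module of `q`-cocycles. -/
def Z (A : Cpx P) (q : ℕ) : GKMod P :=
  (A.C q).sub (LinearMap.ker (A.d q).f)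
    (fun x v hv => by rw [LinearMap.mem_ker] at hv ⊢; rw [(A.d q).map_ρ, hv, map_zero])
    (fun m v hv => by rw [LinearMap.mem_ker] at hv ⊢; rw [(A.d q).map_σ, hv, map_zero])

/-- The `q`-th cohomology: cocycles modulo coboundaries. -/
def H (A : Cpx P) (q : ℕ) : GKMod P :=
  (A.Z q).quot ((A.B q).comap (LinearMap.ker (A.d q).f).subtype)
    (fun x v hv => A.B_ρ q x v.1 hv) (fun m v hv => A.B_σ q m v.1 hv)

/-- The class of a cocycle. -/
def hcls (A : Cpx P) (q : ℕ) : LinearMap.ker (A.d q).f →ₗ[ℂ] (A.H q).V :=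
  Submodule.mkQ _

theorem hcls_surjective (A : Cpx P) (q : ℕ) : Function.Surjective (A.hcls q) :=
  Submodule.mkQ_surjective _

theorem hcls_eq_zero (A : Cpx P) (q : ℕ) (v : LinearMap.ker (A.d q).f) :
    A.hcls q v = 0 ↔ v.1 ∈ A.B q :=
  Submodule.Quotient.mk_eq_zero _

theorem d_of_mem_B (A : Cpx P) (q : ℕ) (v : (A.C q).V) (hv : v ∈ A.B q) : (A.d q).f v = 0 := by
  cases q with
  | zero => rw [(Submodule.mem_bot ℂ).1 hv, map_zero]
  | succ q => obtain ⟨w, rfl⟩ := hv; exact A.d_d q w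

/-- Morphisms of complexes. -/
structure Hom (A B : Cpx P) where
  f : ∀ q, GKMod.Hom (A.C q) (B.C q)
  comm : ∀ q v, (B.d q).f ((f q).f v) = (f (q + 1)).f ((A.d q).f v)

theorem Hom.map_B {A B : Cpx P} (f : Hom A B) (q : ℕ) (v : (A.C q).V) (hv : v ∈ A.B q) :
    (f.f q).f v ∈ B.B q := by
  cases q with
  | zero => rw [(Submodule.mem_bot ℂ).1 hv, map_zero]; exact zero_mem _
  | succ q => obtain ⟨w, rfl⟩ := hv; exact ⟨_, f.comm q w⟩

/-- The map induced on cocycles. -/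
def Hom.onZ {A B : Cpx P} (f : Hom A B) (q : ℕ) :
    LinearMap.ker (A.d q).f →ₗ[ℂ] LinearMap.ker (B.d q).f :=
  (f.f q).f.restrict fun v hv => by
    rw [LinearMap.mem_ker] at hv ⊢; rw [f.comm, hv, map_zero]

/-- The map induced on cohomology. -/
def Hom.onH {A B : Cpx P} (f : Hom A B) (q : ℕ) : GKMod.Hom (A.H q) (B.H q) where
  f := Submodule.mapQ _ _ (f.onZ q) fun v hv => f.map_B q v.1 hv
  map_ρ x v := by
    obtain ⟨v, rfl⟩ := A.hcls_surjective q v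
    exact congrArg (B.hcls q) (Subtype.ext ((f.f q).map_ρ x v.1))
  map_σ m v := by
    obtain ⟨v, rfl⟩ := A.hcls_surjective q v
    exact congrArg (B.hcls q) (Subtype.ext ((f.f q).map_σ m v.1))

theorem Hom.onH_hcls {A B : Cpx P} (f : Hom A B) (q : ℕ) (v : LinearMap.ker (A.d q).f) :
    (f.onH q).f (A.hcls q v) = B.hcls q (f.onZ q v) := rfl

section LES

variable {A B C : Cpx P} (i : Hom A B) (p : Hom B C)

theorem exact_mid (h : ∀ q, GKMod.ShortExact (i.f q) (p.f q)) (q : ℕ) :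
    LinearMap.range (i.onH q).f = LinearMap.ker (p.onH q).f := by
  have hp : ∀ q a, (p.f q).f ((i.f q).f a) = 0 := fun q a => by
    rw [← LinearMap.mem_ker, ← (h q).2.1]; exact ⟨a, rfl⟩
  ext v
  obtain ⟨⟨v, hv⟩, rfl⟩ := B.hcls_surjective q v
  rw [LinearMap.mem_ker, Hom.onH_hcls, hcls_eq_zero]
  constructor
  · rintro ⟨a, ha⟩
    obtain ⟨⟨a, ha'⟩, rfl⟩ := A.hcls_surjective q a
    rw [Hom.onH_hcls, ← sub_eq_zero, ← map_sub, hcls_eq_zero] at ha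
    have := p.map_B q _ ha
    rw [← neg_mem_iff]
    simpa [Hom.onZ, hp] using this
  · intro hb
    obtain ⟨w, hw, hwv⟩ : ∃ w ∈ B.B q, (p.f q).f w = (p.f q).f v := by
      cases q with
      | zero => exact ⟨0, zero_mem _, by rw [map_zero]; exact ((Submodule.mem_bot ℂ).1 hb).symm⟩
      | succ q =>
        obtain ⟨c, hc⟩ := hb
        obtain ⟨b, rfl⟩ := (h q).2.2 c
        exact ⟨_, ⟨b, rfl⟩, (p.comm q b).symm.trans hc⟩
    have h1 : v - w ∈ LinearMap.range (i.f q).f := by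
      rw [(h q).2.1, LinearMap.mem_ker, map_sub, hwv, sub_self]
    obtain ⟨a, ha⟩ := h1
    have h2 : (A.d q).f a = 0 := (h (q + 1)).1 <| by
      rw [← i.comm, ha, map_sub, LinearMap.mem_ker.1 hv, B.d_of_mem_B q w hw, map_zero, sub_zero]
    refine ⟨A.hcls q ⟨a, h2⟩, ?_⟩
    rw [Hom.onH_hcls, ← sub_eq_zero, ← map_sub, hcls_eq_zero]
    have : (i.f q).f a - v ∈ B.B q := by
      rw [ha]; simpa using hw
    exact this

theorem exists_connecting (h : ∀ q, GKMod.ShortExact (i.f q) (p.f q)) (q : ℕ) :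
    ∃ δ : GKMod.Hom (C.H q) (A.H (q + 1)), ∀ (b : (B.C q).V) (a : (A.C (q + 1)).V)
      (hb : (p.f q).f b ∈ LinearMap.ker (C.d q).f) (ha : a ∈ LinearMap.ker (A.d (q + 1)).f),
      (i.f (q + 1)).f a = (B.d q).f b → δ.f (C.hcls q ⟨_, hb⟩) = A.hcls (q + 1) ⟨a, ha⟩ := by
  have hp : ∀ q a, (p.f q).f ((i.f q).f a) = 0 := fun q a => by
    rw [← LinearMap.mem_ker, ← (h q).2.1]; exact ⟨a, rfl⟩
  obtain ⟨s, hs⟩ := LinearMap.exists_rightInverse_of_surjective (p.f q).f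
    (LinearMap.range_eq_top.2 (h q).2.2)
  obtain ⟨r, hr⟩ := LinearMap.exists_leftInverse_of_injective (i.f (q + 1)).f
    (LinearMap.ker_eq_bot.2 (h (q + 1)).1)
  have hs' : ∀ c, (p.f q).f (s c) = c := fun c => LinearMap.congr_fun hs c
  have hr' : ∀ a, r ((i.f (q + 1)).f a) = a := fun a => LinearMap.congr_fun hr a
  have hi : ∀ b, (p.f q).f b ∈ LinearMap.ker (C.d q).f →
      (i.f (q + 1)).f (r ((B.d q).f b)) = (B.d q).f b := fun b hb => by
    have : (B.d q).f b ∈ LinearMap.range (i.f (q + 1)).f := by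
      rw [(h (q + 1)).2.1, LinearMap.mem_ker, ← p.comm]; exact hb
    obtain ⟨a, ha⟩ := this
    rw [← ha, hr']
  have hk : ∀ b, (p.f q).f b ∈ LinearMap.ker (C.d q).f →
      r ((B.d q).f b) ∈ LinearMap.ker (A.d (q + 1)).f := fun b hb => by
    refine LinearMap.mem_ker.2 ((h (q + 1 + 1)).1 ?_)
    rw [← i.comm, hi b hb, B.d_d, map_zero]
  let δ₀ : LinearMap.ker (C.d q).f →ₗ[ℂ] (A.H (q + 1)).V :=
    A.hcls (q + 1) ∘ₗ LinearMap.codRestrict _ (r ∘ₗ (B.d q).f ∘ₗ s ∘ₗ Submodule.subtype _)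
      fun z => hk (s z) (by rw [hs']; exact z.2)
  have key : ∀ (b : (B.C q).V) (a : (A.C (q + 1)).V)
      (hb : (p.f q).f b ∈ LinearMap.ker (C.d q).f) (ha : a ∈ LinearMap.ker (A.d (q + 1)).f),
      (i.f (q + 1)).f a = (B.d q).f b → δ₀ ⟨_, hb⟩ = A.hcls (q + 1) ⟨a, ha⟩ := by
    intro b a hb ha hab
    have h1 : s ((p.f q).f b) - b ∈ LinearMap.range (i.f q).f := by
      rw [(h q).2.1, LinearMap.mem_ker, map_sub, hs', sub_self]
    obtain ⟨w, hw⟩ := h1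
    rw [← sub_eq_zero]
    change A.hcls (q + 1) _ - _ = 0
    rw [← map_sub, hcls_eq_zero]
    refine ⟨w, (h (q + 1)).1 ?_⟩
    rw [← i.comm, hw, map_sub, ← hab]
    change _ = (i.f (q + 1)).f (r ((B.d q).f (s ((p.f q).f b))) - a)
    rw [map_sub, hi _ (by rw [hs']; exact hb)]
  have hδ : (C.B q).comap (LinearMap.ker (C.d q).f).subtype ≤ LinearMap.ker δ₀ := by
    rintro ⟨z, hz⟩ hzB
    obtain ⟨b, rfl, hb⟩ : ∃ b, (p.f q).f b = z ∧ (B.d q).f b = 0 := by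
      cases q with
      | zero => exact ⟨0, by rw [map_zero]; exact ((Submodule.mem_bot ℂ).1 hzB).symm, map_zero _⟩
      | succ q =>
        obtain ⟨c, hc⟩ := hzB
        obtain ⟨b, rfl⟩ := (h q).2.2 c
        exact ⟨(B.d q).f b, (p.comm q b).symm.trans hc, B.d_d q b⟩
    rw [LinearMap.mem_ker, key b 0 hz (zero_mem _) (by rw [map_zero, hb])]
    exact map_zero _
  refine ⟨⟨Submodule.liftQ _ δ₀ hδ, ?_, ?_⟩, key⟩
  · intro x v
    obtain ⟨⟨v, hv⟩, rfl⟩ := C.hcls_surjective q v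
    obtain ⟨b, rfl⟩ := (h q).2.2 v
    have h1 : (p.f q).f ((B.C q).ρ x b) ∈ LinearMap.ker (C.d q).f := by
      rw [(p.f q).map_ρ, LinearMap.mem_ker, (C.d q).map_ρ, LinearMap.mem_ker.1 hv, map_zero]
    have h2 := key _ _ hv (hk b hv) (hi b hv)
    have h3 := key _ ((A.C (q + 1)).ρ x (r ((B.d q).f b))) h1
      (by rw [LinearMap.mem_ker, (A.d _).map_ρ, LinearMap.mem_ker.1 (hk b hv), map_zero])
      (by rw [(i.f _).map_ρ, hi b hv, (B.d _).map_ρ])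
    have h4 : (⟨_, h1⟩ : LinearMap.ker (C.d q).f) = (C.Z q).ρ x ⟨_, hv⟩ :=
      Subtype.ext ((p.f q).map_ρ x b)
    rw [h4] at h3
    exact h3.trans (congrArg ((A.H (q + 1)).ρ x) h2.symm)
  · intro m v
    obtain ⟨⟨v, hv⟩, rfl⟩ := C.hcls_surjective q v
    obtain ⟨b, rfl⟩ := (h q).2.2 v
    have h1 : (p.f q).f ((B.C q).σ m b) ∈ LinearMap.ker (C.d q).f := by
      rw [(p.f q).map_σ, LinearMap.mem_ker, (C.d q).map_σ, LinearMap.mem_ker.1 hv, map_zero]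
    have h2 := key _ _ hv (hk b hv) (hi b hv)
    have h3 := key _ ((A.C (q + 1)).σ m (r ((B.d q).f b))) h1
      (by rw [LinearMap.mem_ker, (A.d _).map_σ, LinearMap.mem_ker.1 (hk b hv), map_zero])
      (by rw [(i.f _).map_σ, hi b hv, (B.d _).map_σ])
    have h4 : (⟨_, h1⟩ : LinearMap.ker (C.d q).f) = (C.Z q).σ m ⟨_, hv⟩ :=
      Subtype.ext ((p.f q).map_σ m b)
    rw [h4] at h3
    exact h3.trans (congrArg ((A.H (q + 1)).σ m) h2.symm)

theorem exact_right (h : ∀ q, GKMod.ShortExact (i.f q) (p.f q)) (q : ℕ)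
    (δ : GKMod.Hom (C.H q) (A.H (q + 1))) (hδ : ∀ (b : (B.C q).V) (a : (A.C (q + 1)).V)
      (hb : (p.f q).f b ∈ LinearMap.ker (C.d q).f) (ha : a ∈ LinearMap.ker (A.d (q + 1)).f),
      (i.f (q + 1)).f a = (B.d q).f b → δ.f (C.hcls q ⟨_, hb⟩) = A.hcls (q + 1) ⟨a, ha⟩) :
    LinearMap.range (p.onH q).f = LinearMap.ker δ.f ∧
      LinearMap.range δ.f = LinearMap.ker (i.onH (q + 1)).f := by
  have hp : ∀ q a, (p.f q).f ((i.f q).f a) = 0 := fun q a => by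
    rw [← LinearMap.mem_ker, ← (h q).2.1]; exact ⟨a, rfl⟩
  have hex : ∀ b, (p.f q).f b ∈ LinearMap.ker (C.d q).f →
      ∃ a ∈ LinearMap.ker (A.d (q + 1)).f, (i.f (q + 1)).f a = (B.d q).f b := fun b hb => by
    have : (B.d q).f b ∈ LinearMap.range (i.f (q + 1)).f := by
      rw [(h (q + 1)).2.1, LinearMap.mem_ker, ← p.comm]; exact hb
    obtain ⟨a, ha⟩ := this
    refine ⟨a, LinearMap.mem_ker.2 ((h (q + 1 + 1)).1 ?_), ha⟩
    rw [← i.comm, ha, B.d_d, map_zero]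
  constructor
  · ext v
    obtain ⟨⟨v, hv⟩, rfl⟩ := C.hcls_surjective q v
    constructor
    · rintro ⟨w, hw⟩
      obtain ⟨⟨w, hw'⟩, rfl⟩ := B.hcls_surjective q w
      rw [LinearMap.mem_ker, ← hw, Hom.onH_hcls]
      refine (hδ w 0 (p.onZ q ⟨w, hw'⟩).2 (zero_mem _) ?_).trans (map_zero _)
      rw [map_zero, LinearMap.mem_ker.1 hw']
    · intro h0
      obtain ⟨b, rfl⟩ := (h q).2.2 v
      obtain ⟨a, ha, hab⟩ := hex b hv
      rw [LinearMap.mem_ker, hδ b a hv ha hab, hcls_eq_zero] at h0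
      obtain ⟨w, rfl⟩ := h0
      have h1 : b - (i.f q).f w ∈ LinearMap.ker (B.d q).f := by
        rw [LinearMap.mem_ker, map_sub, i.comm, hab, sub_self]
      refine ⟨B.hcls q ⟨_, h1⟩, ?_⟩
      rw [Hom.onH_hcls]
      congr 1
      refine Subtype.ext ?_
      change (p.f q).f (b - (i.f q).f w) = _
      rw [map_sub, hp, sub_zero]
  · ext v
    obtain ⟨⟨v, hv⟩, rfl⟩ := A.hcls_surjective (q + 1) v
    constructor
    · rintro ⟨c, hc⟩
      obtain ⟨⟨c, hc'⟩, rfl⟩ := C.hcls_surjective q c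
      obtain ⟨b, rfl⟩ := (h q).2.2 c
      obtain ⟨a, ha, hab⟩ := hex b hc'
      rw [← hc, hδ b a hc' ha hab, LinearMap.mem_ker, Hom.onH_hcls, hcls_eq_zero]
      exact ⟨b, hab.symm⟩
    · intro h0
      rw [LinearMap.mem_ker, Hom.onH_hcls, hcls_eq_zero] at h0
      obtain ⟨b, hb⟩ := h0
      have hb' : (B.d q).f b = (i.f (q + 1)).f v := hb
      have h1 : (p.f q).f b ∈ LinearMap.ker (C.d q).f := by
        rw [LinearMap.mem_ker, p.comm, hb', hp]
      exact ⟨_, hδ b v h1 hv hb'.symm⟩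

/-- The Euler characteristic of cohomology is additive. -/
theorem euler_additive {𝓛 : AbSubcat P} (h : ∀ q, GKMod.ShortExact (i.f q) (p.f q))
    (hA : ∀ q, 𝓛.mem (A.H q)) (hB : ∀ q, 𝓛.mem (B.H q)) (hC : ∀ q, 𝓛.mem (C.H q)) (n : ℕ)
    (hn : Subsingleton (A.C n).V) :
    ∑ q ∈ Finset.range n, (-1 : ℤ) ^ q • K0.cls 𝓛 (B.H q) (hB q) =
      ∑ q ∈ Finset.range n, (-1 : ℤ) ^ q • K0.cls 𝓛 (A.H q) (hA q) +
      ∑ q ∈ Finset.range n, (-1 : ℤ) ^ q • K0.cls 𝓛 (C.H q) (hC q) := by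
  choose δ hδ using exists_connecting i p h
  let α q := K0.cls 𝓛 _ (GKMod.im_mem (i.onH q) (hA q) (hB q))
  let β q := K0.cls 𝓛 _ (GKMod.im_mem (p.onH q) (hB q) (hC q))
  let γ q := K0.cls 𝓛 _ (GKMod.im_mem (δ q) (hC q) (hA (q + 1)))
  have h1 : ∀ q, K0.cls 𝓛 (B.H q) (hB q) = α q + β q := fun q =>
    GKMod.cls_eq_im _ _ (hA q) (hB q) (hC q) (exact_mid i p h q)
  have h2 : ∀ q, K0.cls 𝓛 (C.H q) (hC q) = β q + γ q := fun q =>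
    GKMod.cls_eq_im _ _ (hB q) (hC q) (hA (q + 1)) (exact_right i p h q _ (hδ q)).1
  have h3 : ∀ q, K0.cls 𝓛 (A.H (q + 1)) (hA (q + 1)) = γ q + α (q + 1) := fun q =>
    GKMod.cls_eq_im _ _ (hC q) (hA (q + 1)) (hB (q + 1)) (exact_right i p h q _ (hδ q)).2
  have h4 : K0.cls 𝓛 (A.H 0) (hA 0) = α 0 := by
    let j : GKMod.Hom (A.H 0) (A.H 0) := ⟨0, by simp, by simp⟩
    have hj : LinearMap.range j.f = LinearMap.ker (i.onH 0).f := by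
      refine LinearMap.range_zero.trans (LinearMap.ker_eq_bot'.2 fun v hv => ?_).symm
      obtain ⟨v, rfl⟩ := A.hcls_surjective 0 v
      rw [Hom.onH_hcls, hcls_eq_zero] at hv
      have h5 : v.1 = 0 := (h 0).1 (((Submodule.mem_bot ℂ).1 hv).trans (map_zero _).symm)
      rw [show v = 0 from Subtype.ext h5, map_zero]
    have h6 : Subsingleton (GKMod.im j).V :=
      ⟨fun ⟨_, a, ha⟩ ⟨_, b, hb⟩ => Subtype.ext (ha.symm.trans hb)⟩
    have h7 := GKMod.cls_eq_im j (i.onH 0) (hA 0) (hA 0) (hB 0) hj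
    rwa [K0.cls_zero 𝓛 (GKMod.im j), zero_add] at h7
  have h8 : ∀ m, ∑ q ∈ Finset.range (m + 1), (-1 : ℤ) ^ q • (K0.cls 𝓛 (A.H q) (hA q) +
      K0.cls 𝓛 (C.H q) (hC q) - K0.cls 𝓛 (B.H q) (hB q)) = (-1 : ℤ) ^ m • γ m := fun m => by
    induction m with
    | zero => simp [h4, h1, h2]
    | succ m ih =>
      rw [Finset.sum_range_succ, ih, h3, h1, h2, pow_succ]
      simp only [mul_neg_one, neg_smul, smul_add, smul_sub]
      abel
  cases n with
  | zero => simp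
  | succ m =>
    have h9 : Subsingleton (A.H (m + 1)).V := (A.hcls_surjective (m + 1)).subsingleton
    have h10 : Subsingleton (GKMod.im (δ m)).V :=
      inferInstanceAs (Subsingleton (LinearMap.range (δ m).f))
    have h11 : γ m = 0 := K0.cls_zero _ _ _
    have h12 := h8 m
    simp only [h11, smul_zero, smul_add, smul_sub, Finset.sum_add_distrib,
      Finset.sum_sub_distrib] at h12
    exact (sub_eq_zero.1 h12).symm

end LES

end Cpx

/-! ## Reductive pairs -/

/-- A reductive pair `(𝔤, K)`, given by the data `(𝔤₀, K, θ, B)` of the associated reductive group: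
a compact Lie group `K` acting on a finite-dimensional real Lie algebra `𝔤₀`, an involution `θ`
whose fixed space is `Lie K`, and an invariant form `B`, negative definite on the `+1`-eigenspace
and positive definite on the `-1`-eigenspace of `θ`, the two being orthogonal.
(These conditions force `𝔤₀` to be reductive and `B` to be nondegenerate.) -/
structure ReductivePair where
  g₀ : Type
  [lieRing : LieRing g₀]
  [lieAlgebra : LieAlgebra ℝ g₀]
  [finite : Module.Finite ℝ g₀]
  K : Type
  [group : Group K]
  [top : TopologicalSpace K]
  dimK : ℕ
  [charted : ChartedSpace (EuclideanSpace ℝ (Fin dimK)) K]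
  [lieGroup : LieGroup (𝓡 dimK) ∞ K]
  [compact : CompactSpace K]
  [t2 : T2Space K]
  θ : g₀ →ₗ⁅ℝ⁆ g₀
  θ_θ : ∀ x, θ (θ x) = x
  B : LinearMap.BilinForm ℝ g₀
  B_symm : ∀ x y : g₀, B x y = B y x
  B_lie : ∀ x y z : g₀, B ⁅x, y⁆ z = -B y ⁅x, z⁆
  B_θ : ∀ x y, B (θ x) (θ y) = B x y
  B_neg : ∀ x, θ x = x → x ≠ 0 → B x x < 0
  B_pos : ∀ x, θ x = -x → x ≠ 0 → 0 < B x x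
  /-- The adjoint action of `K` on `𝔤₀`. -/
  Ad : K →* Module.End ℝ g₀
  Ad_lie : ∀ (k : K) (x y : g₀), Ad k ⁅x, y⁆ = ⁅Ad k x, Ad k y⁆
  θ_Ad : ∀ (k : K) (x : g₀), θ (Ad k x) = Ad k (θ x)
  B_Ad : ∀ k x y, B (Ad k x) (Ad k y) = B x y
  /-- The embedding of the Lie algebra of `K`. -/
  kIncl : GroupLieAlgebra (𝓡 dimK) K →ₗ[ℝ] g₀
  kIncl_injective : Function.Injective kIncl
  kIncl_lie : ∀ X Y : GroupLieAlgebra (𝓡 dimK) K, kIncl ⁅X, Y⁆ = ⁅kIncl X, kIncl Y⁆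
  kIncl_range : ∀ x, (∃ X, kIncl X = x) ↔ θ x = x
  /-- On `Lie K`, `Ad` is the adjoint action of `K`. -/
  Ad_kIncl : ∀ (k : K) (X : GroupLieAlgebra (𝓡 dimK) K), Ad k (kIncl X) =
    kIncl (mfderiv (𝓡 dimK) (𝓡 dimK) (fun m : K => k * m * k⁻¹) 1 X : EuclideanSpace ℝ (Fin dimK))
  Ad_smooth : ∀ (y : g₀) (l : Module.Dual ℝ g₀),
    ContMDiff (𝓡 dimK) 𝓘(ℝ, ℝ) ∞ fun k => l (Ad k y)
  /-- The differential of `Ad` is the adjoint action of `Lie K`. -/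
  Ad_deriv : ∀ (X : GroupLieAlgebra (𝓡 dimK) K) (y : g₀) (l : Module.Dual ℝ g₀),
    (mfderiv (𝓡 dimK) 𝓘(ℝ, ℝ) (fun k => l (Ad k y)) 1 X : ℝ) = l ⁅kIncl X, y⁆

attribute [instance] ReductivePair.lieRing ReductivePair.lieAlgebra ReductivePair.finite
  ReductivePair.group ReductivePair.top ReductivePair.charted ReductivePair.lieGroup
  ReductivePair.compact ReductivePair.t2

namespace ReductivePair

variable (R : ReductivePair)

/-- The complexified Lie algebra `𝔤`. -/
abbrev g : Type := ℂ ⊗[ℝ] R.g₀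

instance : IsTopologicalGroup R.K := topologicalGroup_of_lieGroup (𝓡 R.dimK) ∞

/-- The action of `K` on `𝔤`. -/
def AdC : R.K →* Module.End ℂ R.g where
  toFun k := (R.Ad k).baseChange ℂ
  map_one' := by ext; simp
  map_mul' a b := by ext; simp

theorem AdC_tmul (k : R.K) (c : ℂ) (x : R.g₀) : R.AdC k (c ⊗ₜ x) = c ⊗ₜ R.Ad k x := rfl

/-- The complex-linear extension of `θ`. -/
def θC : R.g →ₗ[ℂ] R.g := (R.θ : R.g₀ →ₗ[ℝ] R.g₀).baseChange ℂ

/-- The complex-bilinear extension of `B`. -/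
def BC : LinearMap.BilinForm ℂ R.g := R.B.baseChange ℂ

theorem BC_tmul (c d : ℂ) (x y : R.g₀) : R.BC (c ⊗ₜ x) (d ⊗ₜ y) = (d * c) * (R.B x y : ℂ) := by
  simp [BC, LinearMap.BilinForm.baseChange_tmul, mul_comm]

/-- `γ` is a smooth one-parameter subgroup of `K` with velocity `x ∈ Lie K ⊆ 𝔤` at `0`. -/
def IsVelocity (γ : Multiplicative ℝ →* R.K) (x : R.g) : Prop :=
  ∃ X : GroupLieAlgebra (𝓡 R.dimK) R.K, x = 1 ⊗ₜ R.kIncl X ∧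
    HasMFDerivAt 𝓘(ℝ, ℝ) (𝓡 R.dimK) (fun t : ℝ => γ (.ofAdd t)) 0
      (ContinuousLinearMap.toSpanSingleton ℝ (X : EuclideanSpace ℝ (Fin R.dimK)))

/-- Complex functionals of vectors `c ⊗ a` through real functionals of `a`. -/
theorem functional_tmul (l : Module.Dual ℂ R.g) (c : ℂ) : ∃ u v : Module.Dual ℝ R.g₀,
    ∀ a, l (c ⊗ₜ a) = (u a : ℂ) + (v a : ℂ) * Complex.I := by
  let F : R.g₀ →ₗ[ℝ] ℂ := (l.restrictScalars ℝ) ∘ₗ (TensorProduct.mk ℝ ℂ R.g₀ c)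
  exact ⟨Complex.reLm ∘ₗ F, Complex.imLm ∘ₗ F, fun a => (Complex.re_add_im _).symm⟩

theorem Ad_hasDerivAt (γ : Multiplicative ℝ →* R.K) (X : GroupLieAlgebra (𝓡 R.dimK) R.K)
    (h : HasMFDerivAt 𝓘(ℝ, ℝ) (𝓡 R.dimK) (fun t : ℝ => γ (.ofAdd t)) 0
      (ContinuousLinearMap.toSpanSingleton ℝ (X : EuclideanSpace ℝ (Fin R.dimK))))
    (y : R.g₀) (l : Module.Dual ℝ R.g₀) :
    HasDerivAt (fun t : ℝ => l (R.Ad (γ (.ofAdd t)) y)) (l ⁅R.kIncl X, y⁆) 0 := by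
  have h0 : γ (.ofAdd 0) = 1 := map_one γ
  let D : EuclideanSpace ℝ (Fin R.dimK) →L[ℝ] ℝ :=
    mfderiv (𝓡 R.dimK) 𝓘(ℝ, ℝ) (fun k : R.K => l (R.Ad k y)) 1
  have h1 : HasMFDerivAt (𝓡 R.dimK) 𝓘(ℝ, ℝ) (fun k => l (R.Ad k y)) (γ (.ofAdd (0 : ℝ))) D := by
    rw [h0]
    exact ((R.Ad_smooth y l).mdifferentiable (by simp) _).hasMFDerivAt
  have h2 : HasFDerivAt (fun t : ℝ => l (R.Ad (γ (.ofAdd t)) y))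
      (D ∘L ContinuousLinearMap.toSpanSingleton ℝ (X : EuclideanSpace ℝ (Fin R.dimK))) 0 :=
    (HasMFDerivAt.comp (0 : ℝ) h1 h).hasFDerivAt
  have h3 := h2.hasDerivAt
  have h4 : D X = l ⁅R.kIncl X, y⁆ := R.Ad_deriv X y l
  have h5 : D ((1 : ℝ) • (X : EuclideanSpace ℝ (Fin R.dimK))) = l ⁅R.kIncl X, y⁆ := by
    rw [one_smul]; exact h4
  exact h5 ▸ h3

/-- The pair `(𝔤, K)`. -/
abbrev pair : HCPair where
  h := R.g
  M := R.K
  Ad := R.AdC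
  Ad_lie m x y := by
    induction x using TensorProduct.induction_on with
    | zero => simp
    | add a b ha hb => simp only [add_lie, map_add, ha, hb]
    | tmul c a =>
      induction y using TensorProduct.induction_on with
      | zero => simp
      | add a b ha hb => simp only [lie_add, map_add, ha, hb]
      | tmul d b => simp [AdC_tmul, R.Ad_lie]
  IsVelocity := R.IsVelocity
  Ad_continuous y l := by
    induction y using TensorProduct.induction_on with
    | zero => simpa using continuous_const
    | add a b ha hb => simp only [map_add]; exact ha.add hb
    | tmul c a =>
      obtain ⟨u, v, h⟩ := R.functional_tmul l c
      simp only [AdC_tmul, h]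
      have h1 := fun l => (R.Ad_smooth a l).continuous
      exact (Complex.continuous_ofReal.comp (h1 u)).add
        ((Complex.continuous_ofReal.comp (h1 v)).mul continuous_const)
  Ad_hasDerivAt γ x hx y l := by
    obtain ⟨X, rfl, h⟩ := hx
    induction y using TensorProduct.induction_on with
    | zero => simpa using hasDerivAt_const (0 : ℝ) (0 : ℂ)
    | add a b ha hb => simp only [map_add, lie_add]; exact ha.add hb
    | tmul c a =>
      obtain ⟨u, v, huv⟩ := R.functional_tmul l c
      simp only [AdC_tmul, LieAlgebra.ExtendScalars.bracket_tmul, one_mul, huv]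
      exact (R.Ad_hasDerivAt γ X h a u).ofReal_comp.add
        ((R.Ad_hasDerivAt γ X h a v).ofReal_comp.mul_const _)

/-- The antilinear extension of `θ`. -/
def τ : R.g →ₗ[ℝ] R.g := TensorProduct.map Complex.conjAe.toLinearMap (R.θ : R.g₀ →ₗ[ℝ] R.g₀)

theorem exists_re_im (x : R.g) : ∃ a b : R.g₀, x = 1 ⊗ₜ a + Complex.I ⊗ₜ b := by
  induction x using TensorProduct.induction_on with
  | zero => exact ⟨0, 0, by simp⟩
  | add x y hx hy =>
    obtain ⟨a, b, rfl⟩ := hx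
    obtain ⟨c, d, rfl⟩ := hy
    exact ⟨a + c, b + d, by simp only [TensorProduct.tmul_add]; abel⟩
  | tmul c a =>
    refine ⟨c.re • a, c.im • a, ?_⟩
    rw [← TensorProduct.smul_tmul, ← TensorProduct.smul_tmul, ← TensorProduct.add_tmul]
    congr 1
    simp [Complex.re_add_im]

theorem B_self_θ (a : R.g₀) : R.B a (R.θ a) ≤ 0 ∧ (R.B a (R.θ a) = 0 → a = 0) := by
  have e1 : R.θ (a + R.θ a) = a + R.θ a := by rw [map_add, R.θ_θ, add_comm]
  have e2 : R.θ (a - R.θ a) = -(a - R.θ a) := by rw [map_sub, R.θ_θ, neg_sub]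
  have e3 : R.B (R.θ a) (R.θ a) = R.B a a := R.B_θ a a
  have e4 : R.B (R.θ a) a = R.B a (R.θ a) := R.B_symm _ _
  have e5 : R.B (a + R.θ a) (a + R.θ a) = 2 * R.B a a + 2 * R.B a (R.θ a) := by
    simp [e3, e4]; ring
  have e6 : R.B (a - R.θ a) (a - R.θ a) = 2 * R.B a a - 2 * R.B a (R.θ a) := by
    simp [e3, e4]; ring
  have p1 := R.B_neg _ e1
  have p2 := R.B_pos _ e2
  have e7 : (2 : ℝ) • a = (a + R.θ a) + (a - R.θ a) := by rw [two_smul]; abel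
  by_cases h1 : a + R.θ a = 0 <;> by_cases h2 : a - R.θ a = 0
  · have : a = 0 := by
      rw [h1, h2, add_zero] at e7
      exact (smul_eq_zero.1 e7).resolve_left two_ne_zero
    simp [this]
  · have := p2 h2
    rw [h1] at e5
    simp only [map_zero] at e5
    exact ⟨by linarith, fun h => by linarith⟩
  · have := p1 h1
    rw [h2] at e6
    simp only [map_zero] at e6
    exact ⟨by linarith, fun h => by linarith⟩
  · have := p1 h1
    have := p2 h2
    exact ⟨by linarith, fun h => by linarith⟩

theorem eq_zero_of_BC_τ (v : R.g) (h : R.BC v (R.τ v) = 0) : v = 0 := by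
  obtain ⟨a, b, rfl⟩ := R.exists_re_im v
  have e : R.B b (R.θ a) = R.B a (R.θ b) := by rw [R.B_symm, ← R.B_θ, R.θ_θ]
  have h1 : R.BC (1 ⊗ₜ a + Complex.I ⊗ₜ b) (R.τ (1 ⊗ₜ a + Complex.I ⊗ₜ b)) =
      ((R.B a (R.θ a) + R.B b (R.θ b) : ℝ) : ℂ) := by
    simp only [τ, map_add, TensorProduct.map_tmul, LinearMap.add_apply, BC_tmul]
    simp [e]
  rw [h1] at h
  have h2 : R.B a (R.θ a) + R.B b (R.θ b) = 0 := by exact_mod_cast h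
  have ha := R.B_self_θ a
  have hb := R.B_self_θ b
  rw [ha.2 (by linarith), hb.2 (by linarith)]
  simp

theorem τ_mem (S : Submodule ℝ R.g₀) (hS : ∀ x ∈ S, R.θ x ∈ S) (x : R.g)
    (hx : x ∈ S.baseChange ℂ) : R.τ x ∈ S.baseChange ℂ := by
  rw [Submodule.baseChange_eq_span] at hx
  induction hx using Submodule.span_induction with
  | zero => simp
  | add x y _ _ hx hy => rw [map_add]; exact add_mem hx hy
  | mem x hx =>
    obtain ⟨a, ha, rfl⟩ := hx
    exact Submodule.tmul_mem_baseChange_of_mem _ (hS a ha)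
  | smul c x _ hx =>
    have : ∀ y : R.g, R.τ (c • y) = (starRingEnd ℂ) c • R.τ y := fun y => by
      induction y using TensorProduct.induction_on with
      | zero => simp
      | add a b ha hb => simp only [smul_add, map_add, ha, hb]
      | tmul d a => simp [τ, TensorProduct.smul_tmul']
    rw [this]
    exact Submodule.smul_mem _ _ hx

theorem BC_lie (x y z : R.g) : R.BC ⁅x, y⁆ z = -R.BC y ⁅x, z⁆ := by
  have e0 : ∀ u : R.g, ⁅u, (0 : R.g)⁆ = 0 := fun u => lie_zero u
  have e1 : ∀ u v w : R.g, ⁅u, v + w⁆ = ⁅u, v⁆ + ⁅u, w⁆ := fun u v w => lie_add u v w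
  induction x using TensorProduct.induction_on with
  | zero => simp
  | add a b ha hb => simp only [add_lie, map_add, LinearMap.add_apply, ha, hb, neg_add]
  | tmul c a =>
    induction y using TensorProduct.induction_on with
    | zero => simp [e0]
    | add x y hx hy => simp only [e1, map_add, LinearMap.add_apply, hx, hy, neg_add]
    | tmul d b =>
      induction z using TensorProduct.induction_on with
      | zero => simp [e0]
      | add x y hx hy => simp only [e1, map_add, hx, hy, neg_add]
      | tmul e f =>
        simp only [LieAlgebra.ExtendScalars.bracket_tmul, BC_tmul, R.B_lie]
        push_cast
        ring

theorem BC_symm (x y : R.g) : R.BC x y = R.BC y x := by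
  induction x using TensorProduct.induction_on with
  | zero => simp
  | add a b ha hb => simp only [map_add, LinearMap.add_apply, ha, hb]
  | tmul c a =>
    induction y using TensorProduct.induction_on with
    | zero => simp
    | add x y hx hy => simp only [map_add, LinearMap.add_apply, hx, hy]
    | tmul d b => rw [BC_tmul, BC_tmul, R.B_symm, mul_comm c]

theorem BC_Ad (k : R.K) (x y : R.g) : R.BC (R.AdC k x) (R.AdC k y) = R.BC x y := by
  induction x using TensorProduct.induction_on with
  | zero => simp
  | add a b ha hb => simp only [map_add, LinearMap.add_apply, ha, hb]
  | tmul c a =>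
    induction y using TensorProduct.induction_on with
    | zero => simp
    | add x y hx hy => simp only [map_add, hx, hy]
    | tmul d b => simp only [AdC_tmul, BC_tmul, R.B_Ad]

/-- The complexification of a real subalgebra, as a subalgebra of `𝔤`. -/
def complexify (s : LieSubalgebra ℝ R.g₀) : LieSubalgebra ℂ R.g where
  toSubmodule := s.toSubmodule.baseChange ℂ
  lie_mem' {x y} hx hy := by
    simp only [AddSubsemigroup.mem_carrier, AddSubmonoid.mem_toSubsemigroup,
      Submodule.mem_toAddSubmonoid] at hx hy ⊢
    rw [Submodule.baseChange_eq_span] at hx hy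
    induction hx, hy using Submodule.span_induction₂ with
    | zero_left => simp
    | zero_right => simp
    | add_left x y z _ _ _ h1 h2 => rw [add_lie]; exact add_mem h1 h2
    | add_right x y z _ _ _ h1 h2 => rw [lie_add]; exact add_mem h1 h2
    | smul_left r x y _ _ h => rw [smul_lie]; exact Submodule.smul_mem _ _ h
    | smul_right r x y _ _ h => rw [lie_smul]; exact Submodule.smul_mem _ _ h
    | mem_mem x y hx hy =>
      obtain ⟨a, ha, rfl⟩ := hx
      obtain ⟨b, hb, rfl⟩ := hy
      simpa using Submodule.tmul_mem_baseChange_of_mem (1 : ℂ) (s.lie_mem ha hb)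

/-- The nilpotent radical of a parabolic subalgebra `𝔮`, described as the set of elements of `𝔮`
that are orthogonal to `𝔮` with respect to the invariant form. -/
def nilradical (q : LieSubalgebra ℂ R.g) : LieSubalgebra ℂ R.g where
  carrier := {x | x ∈ q ∧ ∀ y ∈ q, R.BC x y = 0}
  add_mem' := fun ⟨h1, h2⟩ ⟨h3, h4⟩ => ⟨add_mem h1 h3, fun y hy => by simp [h2 y hy, h4 y hy]⟩
  zero_mem' := ⟨zero_mem _, by simp⟩
  smul_mem' c x h := ⟨q.smul_mem c h.1, fun y hy => by simp [h.2 y hy]⟩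
  lie_mem' {x y} hx hy := ⟨q.lie_mem hx.1 hy.1, fun z hz => by
    rw [R.BC_lie, hy.2 _ (q.lie_mem hx.1 hz), neg_zero]⟩

end ReductivePair

/-- Borel subalgebras: maximal solvable subalgebras. -/
def IsBorel {L : Type} [LieRing L] [LieAlgebra ℂ L] (b : LieSubalgebra ℂ L) : Prop :=
  Maximal (fun c : LieSubalgebra ℂ L => LieAlgebra.IsSolvable c) b

/-- A germane parabolic subalgebra `𝔮` of `𝔤`: it contains a Borel subalgebra, and it is the
direct sum of the complexification of a `θ`-stable real subalgebra `𝔩₀` and of its nilpotent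
radical. -/
structure GermaneParabolic (R : ReductivePair) where
  q : LieSubalgebra ℂ R.g
  exists_borel : ∃ b, IsBorel b ∧ b ≤ q
  l₀ : LieSubalgebra ℝ R.g₀
  θ_mem : ∀ x ∈ l₀, R.θ x ∈ l₀
  levi_inf : (R.complexify l₀).toSubmodule ⊓ (R.nilradical q).toSubmodule = ⊥
  levi_sup : (R.complexify l₀).toSubmodule ⊔ (R.nilradical q).toSubmodule = q.toSubmodule

namespace GermaneParabolic

variable {R : ReductivePair} (𝔭 : GermaneParabolic R)

/-- The Levi factor. -/
def l : LieSubalgebra ℂ R.g := R.complexify 𝔭.l₀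

/-- The nilpotent radical. -/
def u : LieSubalgebra ℂ R.g := R.nilradical 𝔭.q

theorem l_le : ∀ x ∈ 𝔭.l, x ∈ 𝔭.q := fun x hx => by
  have : x ∈ 𝔭.q.toSubmodule := by rw [← 𝔭.levi_sup]; exact Submodule.mem_sup_left hx
  exact this

/-- The group `L ∩ K`, where `L` is the intersection of the normalizers of `𝔮` and `θ(𝔮)`. -/
def LK : Subgroup R.K where
  carrier := {k | 𝔭.q.toSubmodule.map (R.AdC k) = 𝔭.q.toSubmodule ∧
    (𝔭.q.toSubmodule.map R.θC).map (R.AdC k) = 𝔭.q.toSubmodule.map R.θC}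
  mul_mem' {a b} ha hb := by
    have h : R.AdC (a * b) = R.AdC a ∘ₗ R.AdC b := map_mul R.AdC a b
    simp only [Set.mem_ofPred_eq, h, Submodule.map_comp] at *
    rw [hb.1, hb.2]
    exact ha
  one_mem' := by simp [Module.End.one_eq_id]
  inv_mem' {a} ha := by
    have h : R.AdC a⁻¹ ∘ₗ R.AdC a = LinearMap.id := by
      rw [← Module.End.mul_eq_comp, ← map_mul, inv_mul_cancel, map_one, Module.End.one_eq_id]
    refine ⟨?_, ?_⟩
    · conv_lhs => rw [← ha.1]
      rw [← Submodule.map_comp, h, Submodule.map_id]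
    · conv_lhs => rw [← ha.2]
      rw [← Submodule.map_comp, h, Submodule.map_id]

theorem q_Ad (k : 𝔭.LK) (x : R.g) (hx : x ∈ 𝔭.q) : R.AdC k x ∈ 𝔭.q := by
  have : R.AdC k x ∈ 𝔭.q.toSubmodule := k.2.1 ▸ Submodule.mem_map_of_mem hx
  exact this

theorem u_Ad (k : 𝔭.LK) (x : R.g) (hx : x ∈ 𝔭.u) : R.AdC k x ∈ 𝔭.u := by
  refine ⟨𝔭.q_Ad k x hx.1, fun y hy => ?_⟩
  have h : R.AdC k (R.AdC (k : R.K)⁻¹ y) = y := by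
    rw [← Module.End.mul_apply, ← map_mul, mul_inv_cancel, map_one, Module.End.one_apply]
  rw [← h, R.BC_Ad]
  exact hx.2 _ (𝔭.q_Ad k⁻¹ y hy)

theorem l_Ad (k : 𝔭.LK) (x : R.g) (hx : x ∈ 𝔭.l) : R.AdC k x ∈ 𝔭.l := by
  let S := 𝔭.l₀.toSubmodule.map (R.Ad k)
  have h1 : ∀ y ∈ 𝔭.l, R.AdC k y ∈ S.baseChange ℂ := fun y hy => by
    change y ∈ 𝔭.l₀.toSubmodule.baseChange ℂ at hy
    rw [Submodule.baseChange_eq_span] at hy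
    induction hy using Submodule.span_induction with
    | zero => simp
    | add x y _ _ hx hy => rw [map_add]; exact add_mem hx hy
    | smul c x _ hx => rw [map_smul]; exact Submodule.smul_mem _ _ hx
    | mem x hx =>
      obtain ⟨a, ha, rfl⟩ := hx
      exact Submodule.tmul_mem_baseChange_of_mem _ (Submodule.mem_map_of_mem ha)
  have h2 : ∀ y ∈ S.baseChange ℂ, y ∈ 𝔭.q := fun y hy => by
    rw [Submodule.baseChange_eq_span] at hy
    induction hy using Submodule.span_induction with
    | zero => exact zero_mem _
    | add x y _ _ hx hy => exact add_mem hx hy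
    | smul c x _ hx => exact 𝔭.q.smul_mem c hx
    | mem x hx =>
      obtain ⟨_, ⟨a, ha, rfl⟩, rfl⟩ := hx
      exact 𝔭.q_Ad k _ (𝔭.l_le (1 ⊗ₜ a) (Submodule.tmul_mem_baseChange_of_mem _ ha))
  have h3 : R.AdC k x ∈ (R.complexify 𝔭.l₀).toSubmodule ⊔ (R.nilradical 𝔭.q).toSubmodule := by
    rw [𝔭.levi_sup]
    exact 𝔭.q_Ad k x (𝔭.l_le x hx)
  obtain ⟨y, hy, v, hv, hyv⟩ := Submodule.mem_sup.1 h3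
  have h4 : R.τ v = R.τ (R.AdC k x) - R.τ y := by rw [← hyv, map_add, add_sub_cancel_left]
  have h5 : R.τ (R.AdC k x) ∈ 𝔭.q := h2 _ (R.τ_mem S (by
    rintro _ ⟨a, ha, rfl⟩
    rw [R.θ_Ad]
    exact Submodule.mem_map_of_mem (𝔭.θ_mem a ha)) _ (h1 x hx))
  have h6 : R.τ y ∈ 𝔭.q := 𝔭.l_le _ (R.τ_mem 𝔭.l₀.toSubmodule 𝔭.θ_mem y hy)
  have h7 : v = 0 := R.eq_zero_of_BC_τ v (by rw [h4]; exact hv.2 _ (sub_mem h5 h6))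
  rw [← hyv, h7, add_zero]
  exact hy

/-- The Levi pair `(𝔩, L ∩ K)`. -/
abbrev leviPair : HCPair where
  h := 𝔭.l
  M := 𝔭.LK
  Ad :=
    { toFun := fun k => (R.AdC k).restrict (𝔭.l_Ad k)
      map_one' := LinearMap.ext fun x => Subtype.ext (by simp)
      map_mul' := fun a b => LinearMap.ext fun x => Subtype.ext (by simp) }
  Ad_lie k x y := Subtype.ext (R.pair.Ad_lie k x y)
  IsVelocity γ x := R.IsVelocity (𝔭.LK.subtype.comp γ) x
  Ad_continuous y l := by
    obtain ⟨lExt, rfl⟩ := LinearMap.exists_extend (p := 𝔭.l.toSubmodule) l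
    exact (R.pair.Ad_continuous (y : R.g) lExt).comp continuous_subtype_val
  Ad_hasDerivAt γ x h y l := by
    obtain ⟨lExt, rfl⟩ := LinearMap.exists_extend (p := 𝔭.l.toSubmodule) l
    exact R.pair.Ad_hasDerivAt _ _ h (y : R.g) lExt

/-- The inclusion `(𝔩, L ∩ K) → (𝔤, K)`. -/
def leviIncl : HCPair.Hom 𝔭.leviPair R.pair where
  φ := 𝔭.l.incl
  ψ := 𝔭.LK.subtype
  continuous_ψ := continuous_subtype_val
  φ_Ad _ _ := rfl
  velocity _ _ h := h

theorem u_lie (x : R.g) (hx : x ∈ 𝔭.l) (y : R.g) (hy : y ∈ 𝔭.u) : ⁅x, y⁆ ∈ 𝔭.u :=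
  ⟨𝔭.q.lie_mem (𝔭.l_le x hx) hy.1, fun z hz => by
    rw [R.BC_lie, hy.2 _ (𝔭.q.lie_mem (𝔭.l_le x hx) hz), neg_zero]⟩

/-- `𝔲` as an `(𝔩, L ∩ K)`-module under the adjoint action. -/
abbrev uMod : GKMod 𝔭.leviPair :=
  ((GKMod.adjoint R.pair).res 𝔭.leviIncl).ofInj 𝔭.u 𝔭.u.toSubmodule.subtype
    (Submodule.injective_subtype _)
    (fun x => LinearMap.restrict (p := 𝔭.u.toSubmodule) (q := 𝔭.u.toSubmodule)
      (LieAlgebra.ad ℂ R.g (x : R.g)) (𝔭.u_lie x x.2))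
    (fun k => LinearMap.restrict (p := 𝔭.u.toSubmodule) (q := 𝔭.u.toSubmodule)
      (R.AdC k) (𝔭.u_Ad k))
    (fun _ _ => rfl) (fun _ _ => rfl)

instance : FiniteDimensional ℂ 𝔭.u := inferInstanceAs (FiniteDimensional ℂ 𝔭.u.toSubmodule)

instance : FiniteDimensional ℂ 𝔭.uMod.V := inferInstanceAs (FiniteDimensional ℂ 𝔭.u)

/-- The `(𝔩, L ∩ K)`-module `Hom(⋀^q 𝔲, V)` of `q`-cochains. -/
abbrev cochains (V : GKMod R.pair) (q : ℕ) : GKMod 𝔭.leviPair :=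
  GKMod.alt 𝔭.uMod (V.res 𝔭.leviIncl) q

/-- The standard complex `Hom(⋀^• 𝔲, V)` computing `H^•(𝔲; V)`. -/
def complex (V : GKMod R.pair) : Cpx 𝔭.leviPair where
  C := 𝔭.cochains V
  d _ :=
    { f := ceDiff (𝔲 := 𝔭.u) (X := V.V) (V.ρ ∘ₗ 𝔭.u.toSubmodule.subtype) _
      map_ρ := fun x f =>
        ceDiff_der (𝔲 := 𝔭.u) (X := V.V) (V.ρ ∘ₗ 𝔭.u.toSubmodule.subtype) (𝔭.uMod.ρ x)
          (fun a b => Subtype.ext (leibniz_lie (x : R.g) (a : R.g) (b : R.g))) (V.ρ (x : R.g))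
          (fun a w => V.ρ_lie (x : R.g) (a : R.g) w) f
      map_σ := fun k f =>
        ceDiff_aut (𝔲 := 𝔭.u) (X := V.V) (V.ρ ∘ₗ 𝔭.u.toSubmodule.subtype)
          (𝔭.uMod.σ k) (𝔭.uMod.σ k⁻¹) (𝔭.uMod.σ_mul_inv k) (𝔭.uMod.σ_inv_mul k)
          (fun a b => Subtype.ext (R.pair.Ad_lie (k : 𝔭.LK) (a : R.g) (b : R.g)))
          (V.σ ((k : 𝔭.LK) : R.K)) (fun a w => V.σ_ρ ((k : 𝔭.LK) : R.K) (a : R.g) w) f }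
  d_d _ f := ceDiff_ceDiff (𝔲 := 𝔭.u) (X := V.V) (V.ρ ∘ₗ 𝔭.u.toSubmodule.subtype)
    (fun x y w => V.ρ_lie (x : R.g) (y : R.g) w) f

/-- The cohomology `H^q(𝔲; V)` as an `(𝔩, L ∩ K)`-module. -/
def coho (V : GKMod R.pair) (q : ℕ) : GKMod 𝔭.leviPair := (𝔭.complex V).H q

/-- The map of complexes induced by a morphism of modules. -/
def complexMap {V W : GKMod R.pair} (f : GKMod.Hom V W) :
    Cpx.Hom (𝔭.complex V) (𝔭.complex W) where
  f := GKMod.altMap 𝔭.uMod (f.res 𝔭.leviIncl)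
  comm _ c := ceDiff_altComp (𝔲 := 𝔭.u) (V.ρ ∘ₗ 𝔭.u.toSubmodule.subtype)
    (W.ρ ∘ₗ 𝔭.u.toSubmodule.subtype) f.f (fun x v => f.map_ρ (x : R.g) v) c

theorem complexMap_exact {X Y Z : GKMod R.pair} (i : GKMod.Hom X Y) (p : GKMod.Hom Y Z)
    (h : GKMod.ShortExact i p) (q : ℕ) :
    GKMod.ShortExact ((𝔭.complexMap i).f q) ((𝔭.complexMap p).f q) :=
  GKMod.altMap_exact 𝔭.uMod (i.res 𝔭.leviIncl) (p.res 𝔭.leviIncl) h q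

theorem cochains_subsingleton (V : GKMod R.pair) :
    Subsingleton ((𝔭.complex V).C (Module.finrank ℂ 𝔭.uMod.V + 1)).V :=
  ⟨fun a b => (alt_eq_zero_of_finrank_lt (Nat.lt_succ_self _) a).trans
    (alt_eq_zero_of_finrank_lt (Nat.lt_succ_self _) b).symm⟩

end GermaneParabolic

/-! ## Operations on Grothendieck groups -/

section Operations

variable {P P' : HCPair}

namespace K0

/-- Restriction of classes along a morphism of pairs. -/
def res (φ : HCPair.Hom P' P) (𝒢 : AbSubcat P) (𝒢' : AbSubcat P')
    (h : ∀ X, 𝒢.mem X → 𝒢'.mem (X.res φ)) : K0 𝒢 →+ K0 𝒢' :=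
  lift 𝒢 (fun X hX => cls 𝒢' (X.res φ) (h X hX)) fun _ _ _ _ _ _ i p e =>
    cls_exact 𝒢' _ _ _ (i.res φ) (p.res φ) e

/-- Multiplication by the class of a module `F`: `[X] ↦ [X ⊗ F]`. -/
def mulRight (𝓛 : AbSubcat P) (F : GKMod P) (h : ∀ X, 𝓛.mem X → 𝓛.mem (X.tensor F)) :
    K0 𝓛 →+ K0 𝓛 :=
  lift 𝓛 (fun X hX => cls 𝓛 (X.tensor F) (h X hX)) fun _ _ _ _ _ _ i p e =>
    cls_exact 𝓛 _ _ _ (i.tensor F) (p.tensor F) (GKMod.tensor_exact F i p e)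

end K0

/-- The module `⋀^q E*`, realized as the space of alternating `q`-linear forms on `E`. -/
abbrev GKMod.extDual (E : GKMod P) [FiniteDimensional ℂ E.V] (q : ℕ) : GKMod P :=
  GKMod.alt E (GKMod.triv P) q

/-- The category contains all `⋀^q E*` and is closed under tensoring with them. -/
structure AbSubcat.ClosedUnderExt (𝓛 : AbSubcat P) (E : GKMod P) [FiniteDimensional ℂ E.V] :
    Prop where
  mem : ∀ q, 𝓛.mem (E.extDual q)
  tensor : ∀ q X, 𝓛.mem X → 𝓛.mem (X.tensor (E.extDual q))

namespace K0

variable (𝓛 : AbSubcat P) (E : GKMod P) [FiniteDimensional ℂ E.V] (h : 𝓛.ClosedUnderExt E)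

/-- The class `∑_q (-1)^q [⋀^q E*]`. -/
def extCls : K0 𝓛 :=
  ∑ q ∈ Finset.range (Module.finrank ℂ E.V + 1), (-1 : ℤ) ^ q • cls 𝓛 (E.extDual q) (h.mem q)

/-- Multiplication by the class `∑_q (-1)^q [⋀^q E*]`. -/
def mulExt : K0 𝓛 →+ K0 𝓛 :=
  ∑ q ∈ Finset.range (Module.finrank ℂ E.V + 1),
    (-1 : ℤ) ^ q • mulRight 𝓛 (E.extDual q) (h.tensor q)

/-- Multiplication by the class `(-1)^d [⋀^d E*]`, where `d = dim E`. -/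
def mulTop : K0 𝓛 →+ K0 𝓛 :=
  (-1 : ℤ) ^ Module.finrank ℂ E.V • mulRight 𝓛 (E.extDual (Module.finrank ℂ E.V)) (h.tensor _)

theorem mulExt_comm (F : GKMod P) [FiniteDimensional ℂ F.V] (hF : 𝓛.ClosedUnderExt F) (x : K0 𝓛) :
    mulExt 𝓛 E h (mulExt 𝓛 F hF x) = mulExt 𝓛 F hF (mulExt 𝓛 E h x) := by
  have key : ∀ p q x, mulRight 𝓛 (E.extDual p) (h.tensor p) (mulRight 𝓛 (F.extDual q)
      (hF.tensor q) x) = mulRight 𝓛 (F.extDual q) (hF.tensor q)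
        (mulRight 𝓛 (E.extDual p) (h.tensor p) x) := fun p q x => by
    refine DFunLike.congr_fun (f := (mulRight 𝓛 (E.extDual p) (h.tensor p)).comp
      (mulRight 𝓛 (F.extDual q) (hF.tensor q))) (g := (mulRight 𝓛 (F.extDual q)
      (hF.tensor q)).comp (mulRight 𝓛 (E.extDual p) (h.tensor p))) (hom_ext fun X hX => ?_) x
    simp only [AddMonoidHom.comp_apply, mulRight, lift_cls]
    exact cls_iso 𝓛 _ _ (GKMod.rightComm X (F.extDual q) (E.extDual p))
      (TensorProduct.rightComm ℂ X.V _ _).bijective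
  simp only [mulExt, AddMonoidHom.finsetSum_apply, AddMonoidHom.smul_apply, map_sum, map_zsmul,
    key, Finset.smul_sum, smul_smul]
  rw [Finset.sum_comm]
  simp only [mul_comm]

/-- The partially defined multiplication: it is given by the tensor product on classes of modules
whose tensor product lies in the category, and extended by biadditivity. -/
inductive Mul : K0 𝓛 → K0 𝓛 → K0 𝓛 → Prop
  | cls (X Y : GKMod P) (hX : 𝓛.mem X) (hY : 𝓛.mem Y) (hXY : 𝓛.mem (X.tensor Y)) :
      Mul (cls 𝓛 X hX) (cls 𝓛 Y hY) (cls 𝓛 (X.tensor Y) hXY)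
  | zero_left (y : K0 𝓛) : Mul 0 y 0
  | zero_right (x : K0 𝓛) : Mul x 0 0
  | neg_left {x y z : K0 𝓛} : Mul x y z → Mul (-x) y (-z)
  | neg_right {x y z : K0 𝓛} : Mul x y z → Mul x (-y) (-z)
  | add_left {x x' y z z' : K0 𝓛} : Mul x y z → Mul x' y z' → Mul (x + x') y (z + z')
  | add_right {x y y' z z' : K0 𝓛} : Mul x y z → Mul x y' z' → Mul x (y + y') (z + z')

end K0

namespace GKMod

/-- `Y` is isomorphic to the dual of `X`, i.e. to the module of all `M`-finite linear functionals
on `X`. -/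
def IsDual (X Y : GKMod P) : Prop :=
  ∃ b : Y.V →ₗ[ℂ] Module.Dual ℂ X.V, Function.Injective b ∧
    (∀ x y v, b (Y.ρ x y) v = -b y (X.ρ x v)) ∧
    (∀ m y v, b (Y.σ m y) v = b y (X.σ m⁻¹ v)) ∧
    ∀ l : Module.Dual ℂ X.V, (∃ y, b y = l) ↔
      ∃ S : Submodule ℂ (Module.Dual ℂ X.V), FiniteDimensional ℂ S ∧ ∀ m, l ∘ₗ X.σ m ∈ S

/-- The space of `M`-equivariant linear maps from a representation `τ` of `M` to `X`. -/
def intertwiners (X : GKMod P) {W : Type} [AddCommGroup W] [Module ℂ W]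
    (τ : P.M →* Module.End ℂ W) : Submodule ℂ (W →ₗ[ℂ] X.V) where
  carrier := {f | ∀ m w, f (τ m w) = X.σ m (f w)}
  add_mem' hf hg m w := by simp [hf m w, hg m w]
  zero_mem' m w := by simp
  smul_mem' c f hf m w := by simp [hf m w]

/-- Admissible modules: every finite-dimensional representation of `M` occurs with finite
multiplicity. -/
def IsAdmissible (X : GKMod P) : Prop :=
  ∀ (W : Type) [AddCommGroup W] [Module ℂ W] [FiniteDimensional ℂ W] (τ : P.M →* Module.End ℂ W),
    FiniteDimensional ℂ (X.intertwiners τ)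

end GKMod

/-- The partially defined duality: it sends the class of a module `X` satisfying `D` to the class
of its dual, if this lies in the category, and is extended by additivity. -/
inductive K0.Dual (𝓛 : AbSubcat P) (D : GKMod P → Prop) : K0 𝓛 → K0 𝓛 → Prop
  | cls (X Y : GKMod P) (hX : 𝓛.mem X) (hY : 𝓛.mem Y) (hD : D X) (h : X.IsDual Y) :
      K0.Dual 𝓛 D (cls 𝓛 X hX) (cls 𝓛 Y hY)
  | zero : K0.Dual 𝓛 D 0 0
  | neg {x y : K0 𝓛} : K0.Dual 𝓛 D x y → K0.Dual 𝓛 D (-x) (-y)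
  | add {x x' y y' : K0 𝓛} : K0.Dual 𝓛 D x y → K0.Dual 𝓛 D x' y' → K0.Dual 𝓛 D (x + x') (y + y')

end Operations

/-! ## Localization -/

section Localization

/-- The localization `A[w⁻¹]` of an abelian group `A` with respect to an endomorphism `w`, i.e. of
the `ℤ[X]`-module on which `X` acts as `w` with respect to the powers of `X`. -/
abbrev Loc {A : Type 1} [AddCommGroup A] (w : A →+ A) : Type 1 :=
  LocalizedModule (Submonoid.powers (Polynomial.X : ℤ[X])) (Module.AEval' w.toIntLinearMap)

/-- The fraction `a / w^n`. -/
def Loc.frac {A : Type 1} [AddCommGroup A] (w : A →+ A) (a : A) (n : ℕ) : Loc w :=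
  LocalizedModule.mk (Module.AEval'.of w.toIntLinearMap a) ⟨Polynomial.X ^ n, n, rfl⟩

/-- A homomorphism commuting with `w`, as a homomorphism of `ℤ[X]`-modules. -/
def Loc.lin {A : Type 1} [AddCommGroup A] (w v : A →+ A) (h : ∀ a, v (w a) = w (v a)) :
    Module.AEval' w.toIntLinearMap →ₗ[ℤ[X]] Module.AEval' w.toIntLinearMap :=
  LinearMap.ofAEval w.toIntLinearMap
    ((Module.AEval'.of w.toIntLinearMap).toLinearMap ∘ₗ v.toIntLinearMap)
    fun m => (congrArg _ (h m)).trans (Module.AEval'.X_smul_of w.toIntLinearMap (v m)).symm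

/-- The endomorphism `a / w^n ↦ v a / w^n`, for `v` commuting with `w`. -/
def Loc.map {A : Type 1} [AddCommGroup A] (w v : A →+ A) (h : ∀ a, v (w a) = w (v a)) :
    Loc w →+ Loc w :=
  (LocalizedModule.map (Submonoid.powers (Polynomial.X : ℤ[X])) (Loc.lin w v h)).toAddMonoidHom

theorem Loc.map_frac {A : Type 1} [AddCommGroup A] (w v : A →+ A) (h : ∀ a, v (w a) = w (v a))
    (a : A) (n : ℕ) : Loc.map w v h (Loc.frac w a n) = Loc.frac w (v a) n :=
  LocalizedModule.map_mk _ _ _ _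

/-- The extension of a partially defined multiplication (for which `w` is the multiplication by an
element) to the localization: `(a / w^m) (b / w^n) = (a b) / w^(m + n)`. -/
def Loc.Mul {A : Type 1} [AddCommGroup A] (w : A →+ A) (μ : A → A → A → Prop) (x y z : Loc w) :
    Prop :=
  ∃ (a b c : A) (m n : ℕ), μ a b c ∧ x = Loc.frac w a m ∧ y = Loc.frac w b n ∧
    z = Loc.frac w c (m + n)

end Localization

/-! ## Admissible quadruples and algebraic characters -/

section Characters

variable {R : ReductivePair} (𝔭 : GermaneParabolic R)

/-- `𝔲`-admissible pairs `(𝒢, 𝓛)` of categories. -/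
structure Admissible (𝒢 : AbSubcat R.pair) (𝓛 : AbSubcat 𝔭.leviPair) : Prop where
  triv_mem : 𝒢.mem (GKMod.triv R.pair)
  ext : 𝓛.ClosedUnderExt 𝔭.uMod
  coho_mem : ∀ V, 𝒢.mem V → ∀ q, 𝓛.mem (𝔭.coho V q)

variable {𝔭}

/-- The homomorphism `H : K(𝒢) → K(𝓛)`, `[V] ↦ ∑_q (-1)^q [H^q(𝔲; V)]`. The cohomology vanishes in
degrees above `dim 𝔲`. -/
def Admissible.H {𝒢 : AbSubcat R.pair} {𝓛 : AbSubcat 𝔭.leviPair} (h : Admissible 𝔭 𝒢 𝓛) :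
    K0 𝒢 →+ K0 𝓛 :=
  K0.lift 𝒢 (fun V hV => ∑ q ∈ Finset.range (Module.finrank ℂ 𝔭.uMod.V + 1),
      (-1 : ℤ) ^ q • K0.cls 𝓛 (𝔭.coho V q) (h.coho_mem V hV q))
    fun X Y Z hX hY hZ i p e =>
      Cpx.euler_additive (𝔭.complexMap i) (𝔭.complexMap p) (𝔭.complexMap_exact i p e)
        (h.coho_mem X hX) (h.coho_mem Y hY) (h.coho_mem Z hZ) _ (𝔭.cochains_subsingleton X)

/-- Multiplication by the Weyl denominator `W_𝔮 = ∑_q (-1)^q [⋀^q 𝔲*]` on `K(𝓛)`. -/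
def Admissible.W {𝒢 : AbSubcat R.pair} {𝓛 : AbSubcat 𝔭.leviPair} (h : Admissible 𝔭 𝒢 𝓛) :
    K0 𝓛 →+ K0 𝓛 :=
  K0.mulExt 𝓛 𝔭.uMod h.ext

/-- `𝔲`-admissible quadruples `(𝒢, 𝓛, K_𝒢, K_𝓛)`. -/
structure Quadruple (𝔭 : GermaneParabolic R) where
  𝒢 : AbSubcat R.pair
  𝓛 : AbSubcat 𝔭.leviPair
  adm : Admissible 𝔭 𝒢 𝓛
  KG : AddSubgroup (K0 𝒢)
  KL : AddSubgroup (K0 𝓛)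
  H_mem : ∀ x ∈ KG, adm.H x ∈ KL
  W_mem : ∀ x ∈ KL, adm.W x ∈ KL

namespace Quadruple

variable (Q : Quadruple 𝔭)

/-- `H : K_𝒢 → K_𝓛`. -/
def H : Q.KG →+ Q.KL where
  toFun x := ⟨Q.adm.H x, Q.H_mem x x.2⟩
  map_zero' := Subtype.ext (map_zero _)
  map_add' x y := Subtype.ext (map_add Q.adm.H (x : K0 Q.𝒢) y)

/-- Multiplication by `W_𝔮` on `K_𝓛`. -/
def W : Q.KL →+ Q.KL where
  toFun x := ⟨Q.adm.W x, Q.W_mem x x.2⟩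
  map_zero' := Subtype.ext (map_zero _)
  map_add' x y := Subtype.ext (map_add Q.adm.W (x : K0 Q.𝓛) y)

/-- The group `C_𝔮(𝒬) = K_𝓛[W_𝔮⁻¹]`. -/
abbrev C : Type 1 := Loc Q.W

/-- The fraction `a / W_𝔮^n`. -/
def frac (a : Q.KL) (n : ℕ) : Q.C := Loc.frac Q.W a n

/-- The algebraic character `c_𝔮(X) = H(X) / W_𝔮`. -/
def c (x : Q.KG) : Q.C := Q.frac (Q.H x) 1

/-- The partially defined multiplication of `K_𝓛`. -/
def MulL (x y z : Q.KL) : Prop := K0.Mul Q.𝓛 x y z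

/-- The partially defined multiplication of `C_𝔮(𝒬)`. -/
def Mul : Q.C → Q.C → Q.C → Prop := Loc.Mul Q.W Q.MulL

/-- The partially defined duality of `C_𝔮(𝒬)`, on modules satisfying `D`:
as `W_𝔮* = W_𝔮 / t` with `t = (-1)^d [⋀^d 𝔲*]` and `d = dim 𝔲`, the dual of `a / W_𝔮^n` is
`t^n a* / W_𝔮^n`. -/
def Dual (D : GKMod 𝔭.leviPair → Prop) (x z : Q.C) : Prop :=
  ∃ (a c : Q.KL) (b : K0 Q.𝓛) (n : ℕ), K0.Dual Q.𝓛 D a b ∧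
    (c : K0 Q.𝓛) = (K0.mulTop Q.𝓛 𝔭.uMod Q.adm.ext)^[n] b ∧ x = Q.frac a n ∧ z = Q.frac c n

end Quadruple

end Characters

/-! ## Restriction -/

/-- An inclusion `ι : (𝔤', K') → (𝔤, K)` of reductive pairs, compatible with all data. -/
structure ReductivePair.Inclusion (R' R : ReductivePair) where
  φ : R'.g₀ →ₗ⁅ℝ⁆ R.g₀
  φ_injective : Function.Injective φ
  ψ : R'.K →* R.K
  ψ_injective : Function.Injective ψ
  ψ_smooth : ContMDiff (𝓡 R'.dimK) (𝓡 R.dimK) ∞ ψ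
  φ_θ : ∀ x, φ (R'.θ x) = R.θ (φ x)
  φ_B : ∀ x y, R.B (φ x) (φ y) = R'.B x y
  φ_Ad : ∀ k x, φ (R'.Ad k x) = R.Ad (ψ k) (φ x)
  /-- The differential of `ψ` is the restriction of `φ`. -/
  φ_kIncl : ∀ X : GroupLieAlgebra (𝓡 R'.dimK) R'.K, φ (R'.kIncl X) =
    R.kIncl (mfderiv (𝓡 R'.dimK) (𝓡 R.dimK) ψ 1 X : EuclideanSpace ℝ (Fin R.dimK))

namespace ReductivePair.Inclusion

variable {R' R : ReductivePair} (ι : R'.Inclusion R)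

/-- The inclusion `𝔤' → 𝔤`. -/
def φC : R'.g →ₗ⁅ℂ⁆ R.g where
  toLinearMap := (ι.φ : R'.g₀ →ₗ[ℝ] R.g₀).baseChange ℂ
  map_lie' {x y} := by
    have e0 : ∀ u : R'.g, ⁅u, (0 : R'.g)⁆ = 0 := fun u => lie_zero u
    have e1 : ∀ u v w : R'.g, ⁅u, v + w⁆ = ⁅u, v⁆ + ⁅u, w⁆ := fun u v w => lie_add u v w
    have e2 : ∀ u v w : R.g, ⁅u, v + w⁆ = ⁅u, v⁆ + ⁅u, w⁆ := fun u v w => lie_add u v w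
    induction x using TensorProduct.induction_on with
    | zero => simp
    | add a b ha hb =>
      simp only [AddHom.toFun_eq_coe, LinearMap.coe_toAddHom] at ha hb ⊢
      simp only [add_lie, map_add, ha, hb]
    | tmul c a =>
      induction y using TensorProduct.induction_on with
      | zero => simp [e0]
      | add x y hx hy =>
        simp only [AddHom.toFun_eq_coe, LinearMap.coe_toAddHom] at hx hy ⊢
        simp only [e1, e2, map_add, hx, hy]
      | tmul d b => simp

theorem velocity (γ : Multiplicative ℝ →* R'.K) (x : R'.g) (h : R'.IsVelocity γ x) :
    R.IsVelocity (ι.ψ.comp γ) (ι.φC x) := by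
  obtain ⟨X, rfl, hX⟩ := h
  let D : EuclideanSpace ℝ (Fin R'.dimK) →L[ℝ] EuclideanSpace ℝ (Fin R.dimK) :=
    mfderiv (𝓡 R'.dimK) (𝓡 R.dimK) ι.ψ 1
  have h1 : HasMFDerivAt (𝓡 R'.dimK) (𝓡 R.dimK) ι.ψ (γ (.ofAdd (0 : ℝ))) D := by
    rw [show γ (.ofAdd 0) = 1 from map_one γ]
    exact (ι.ψ_smooth.mdifferentiable (by simp) _).hasMFDerivAt
  refine ⟨D X, ?_, ?_⟩
  · change (1 : ℂ) ⊗ₜ ι.φ (R'.kIncl X) = _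
    rw [ι.φ_kIncl]
    rfl
  · have h2 := HasMFDerivAt.comp (0 : ℝ) h1 hX
    have h3 : D ∘L ContinuousLinearMap.toSpanSingleton ℝ (X : EuclideanSpace ℝ (Fin R'.dimK)) =
        ContinuousLinearMap.toSpanSingleton ℝ (D X) := by
      refine ContinuousLinearMap.ext fun t => ?_
      change D (t • (X : EuclideanSpace ℝ (Fin R'.dimK))) = t • D X
      exact map_smul D t _
    exact h3 ▸ h2

/-- `ι` as a morphism of pairs. -/
def hom : HCPair.Hom R'.pair R.pair where
  φ := ι.φC
  ψ := ι.ψ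
  continuous_ψ := ι.ψ_smooth.continuous
  φ_Ad m x := by
    change ι.φC (R'.AdC m x) = R.AdC (ι.ψ m) (ι.φC x)
    induction x using TensorProduct.induction_on with
    | zero => simp
    | add a b ha hb => rw [map_add, map_add, map_add, ha, hb, map_add]
    | tmul c a => exact congrArg (c ⊗ₜ[ℝ] ·) (ι.φ_Ad m a)
  velocity := ι.velocity

end ReductivePair.Inclusion

/-- Germane parabolic subalgebras `𝔮' ⊆ 𝔮` with Levi factors `L' ⊆ L` and nilpotent radicals
`𝔲' ⊆ 𝔲`. -/
structure ParabolicInclusion {R' R : ReductivePair} (ι : R'.Inclusion R) (𝔭' : GermaneParabolic R')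
    (𝔭 : GermaneParabolic R) : Prop where
  q_le : ∀ x ∈ 𝔭'.q, ι.φC x ∈ 𝔭.q
  l_le : ∀ x ∈ 𝔭'.l₀, ι.φ x ∈ 𝔭.l₀
  LK_le : ∀ k ∈ 𝔭'.LK, ι.ψ k ∈ 𝔭.LK
  u_le : ∀ x ∈ 𝔭'.u, ι.φC x ∈ 𝔭.u

namespace ParabolicInclusion

variable {R' R : ReductivePair} {ι : R'.Inclusion R} {𝔭' : GermaneParabolic R'}
  {𝔭 : GermaneParabolic R} (j : ParabolicInclusion ι 𝔭' 𝔭)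

theorem lC_le (j : ParabolicInclusion ι 𝔭' 𝔭) (x : R'.g) (hx : x ∈ 𝔭'.l) : ι.φC x ∈ 𝔭.l := by
  change x ∈ 𝔭'.l₀.toSubmodule.baseChange ℂ at hx
  rw [Submodule.baseChange_eq_span] at hx
  induction hx using Submodule.span_induction with
  | zero => rw [map_zero]; exact zero_mem _
  | add x y _ _ hx hy => rw [map_add]; exact add_mem hx hy
  | smul c x _ hx => rw [map_smul]; exact 𝔭.l.smul_mem c hx
  | mem x hx =>
    obtain ⟨a, ha, rfl⟩ := hx
    exact Submodule.tmul_mem_baseChange_of_mem _ (j.l_le a ha)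

/-- The inclusion `(𝔩', L' ∩ K') → (𝔩, L ∩ K)`. -/
def hom : HCPair.Hom 𝔭'.leviPair 𝔭.leviPair where
  φ :=
    { toFun := fun x => ⟨ι.φC x, j.lC_le x x.2⟩
      map_add' := fun x y => Subtype.ext (map_add ι.φC (x : R'.g) y)
      map_smul' := fun c x => Subtype.ext (map_smul ι.φC c (x : R'.g))
      map_lie' := Subtype.ext (LieHom.map_lie ι.φC _ _) }
  ψ := (ι.ψ.comp 𝔭'.LK.subtype).codRestrict 𝔭.LK fun k => j.LK_le k k.2
  continuous_ψ := (ι.ψ_smooth.continuous.comp continuous_subtype_val).subtype_mk _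
  φ_Ad m x := Subtype.ext (ι.hom.φ_Ad (m : 𝔭'.LK) (x : R'.g))
  velocity _ _ h := ι.velocity _ _ h

/-- The inclusion `𝔲' → 𝔲`. -/
def uMap : 𝔭'.uMod.V →ₗ[ℂ] (𝔭.uMod.res j.hom).V :=
  (ι.φC : R'.g →ₗ[ℂ] R.g).restrict (p := 𝔭'.u.toSubmodule) (q := 𝔭.u.toSubmodule) j.u_le

/-- The `(𝔩', L' ∩ K')`-module `𝔲 / 𝔲'`. -/
abbrev relMod : GKMod 𝔭'.leviPair :=
  (𝔭.uMod.res j.hom).quot (LinearMap.range j.uMap)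
    (by
      rintro x _ ⟨v, rfl⟩
      exact ⟨𝔭'.uMod.ρ x v, Subtype.ext (LieHom.map_lie ι.φC (x : R'.g) (show 𝔭'.u from v).1)⟩)
    (by
      rintro m _ ⟨v, rfl⟩
      exact ⟨𝔭'.uMod.σ m v, Subtype.ext (ι.hom.φ_Ad (m : 𝔭'.LK) (show 𝔭'.u from v).1)⟩)

instance : FiniteDimensional ℂ (𝔭.uMod.res j.hom).V :=
  inferInstanceAs (FiniteDimensional ℂ 𝔭.uMod.V)

instance : FiniteDimensional ℂ j.relMod.V :=
  inferInstanceAs (FiniteDimensional ℂ ((𝔭.uMod.res j.hom).V ⧸ LinearMap.range j.uMap))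

end ParabolicInclusion

/-- Compatibility of restriction along `ι` with the quadruples `𝒬'` and `𝒬`: restriction maps `𝒢`
to `𝒢'`, `𝓛` to `𝓛'`, `K_𝒢` to `K_𝒢'` and `K_𝓛` to `K_𝓛'`; the relative Weyl denominator
`W_{𝔮/𝔮'} = ∑_p (-1)^p [⋀^p (𝔲/𝔲')*]` is an element of `K_𝓛'` (in particular the summands are
objects of `𝓛'`, with which objects of `𝓛'` may be tensored), and `K_𝓛'` is closed under
multiplication by it. -/
structure Compatible {R' R : ReductivePair} {ι : R'.Inclusion R} {𝔭' : GermaneParabolic R'}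
    {𝔭 : GermaneParabolic R} (j : ParabolicInclusion ι 𝔭' 𝔭) (Q' : Quadruple 𝔭')
    (Q : Quadruple 𝔭) : Prop where
  resG : ∀ X, Q.𝒢.mem X → Q'.𝒢.mem (X.res ι.hom)
  resL : ∀ X, Q.𝓛.mem X → Q'.𝓛.mem (X.res j.hom)
  resKG : ∀ x ∈ Q.KG, K0.res ι.hom Q.𝒢 Q'.𝒢 resG x ∈ Q'.KG
  resKL : ∀ x ∈ Q.KL, K0.res j.hom Q.𝓛 Q'.𝓛 resL x ∈ Q'.KL
  ext : Q'.𝓛.ClosedUnderExt j.relMod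
  W_mem : K0.extCls Q'.𝓛 j.relMod ext ∈ Q'.KL
  W_mul : ∀ x ∈ Q'.KL, K0.mulExt Q'.𝓛 j.relMod ext x ∈ Q'.KL

namespace Compatible

variable {R' R : ReductivePair} {ι : R'.Inclusion R} {𝔭' : GermaneParabolic R'}
  {𝔭 : GermaneParabolic R} {j : ParabolicInclusion ι 𝔭' 𝔭} {Q' : Quadruple 𝔭'} {Q : Quadruple 𝔭}
  (h : Compatible j Q' Q)

/-- Restriction `K_𝒢 → K_𝒢'`. -/
def onG : Q.KG →+ Q'.KG where
  toFun x := ⟨K0.res ι.hom Q.𝒢 Q'.𝒢 h.resG x, h.resKG x x.2⟩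
  map_zero' := Subtype.ext (map_zero _)
  map_add' x y := Subtype.ext (map_add (K0.res ι.hom Q.𝒢 Q'.𝒢 h.resG) (x : K0 Q.𝒢) y)

/-- Restriction `K_𝓛 → K_𝓛'`. -/
def onL : Q.KL →+ Q'.KL where
  toFun x := ⟨K0.res j.hom Q.𝓛 Q'.𝓛 h.resL x, h.resKL x x.2⟩
  map_zero' := Subtype.ext (map_zero _)
  map_add' x y := Subtype.ext (map_add (K0.res j.hom Q.𝓛 Q'.𝓛 h.resL) (x : K0 Q.𝓛) y)

/-- Multiplication by `W_{𝔮/𝔮'}` on `K_𝓛'`. -/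
def relW : Q'.KL →+ Q'.KL where
  toFun x := ⟨K0.mulExt Q'.𝓛 j.relMod h.ext x, h.W_mul x x.2⟩
  map_zero' := Subtype.ext (map_zero _)
  map_add' x y := Subtype.ext (map_add (K0.mulExt Q'.𝓛 j.relMod h.ext) (x : K0 Q'.𝓛) y)

/-- Multiplication by `W_{𝔮/𝔮'}` on `C_𝔮'(𝒬')`. -/
def relWC : Q'.C →+ Q'.C :=
  Loc.map Q'.W h.relW fun x =>
    Subtype.ext (K0.mulExt_comm Q'.𝓛 j.relMod h.ext 𝔭'.uMod Q'.adm.ext x)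

/-- The group `C_𝔮'(𝒬')[W_{𝔮/𝔮'}⁻¹]`. -/
abbrev C : Type 1 := Loc h.relWC

/-- The fraction `x / W_{𝔮/𝔮'}^n`. -/
def frac (x : Q'.C) (n : ℕ) : h.C := Loc.frac h.relWC x n

/-- The partially defined multiplication of `C_𝔮'(𝒬')[W_{𝔮/𝔮'}⁻¹]`. -/
def Mul : h.C → h.C → h.C → Prop := Loc.Mul h.relWC Q'.Mul

/-- The partially defined duality of `C_𝔮'(𝒬')[W_{𝔮/𝔮'}⁻¹]`, on modules satisfying `D`: the dual of
`a / (W_𝔮'^m W_{𝔮/𝔮'}^n)` is `t'^m t^n a* / (W_𝔮'^m W_{𝔮/𝔮'}^n)`, with the top exterior powers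
`t' = (-1)^e [⋀^e 𝔲'*]` and `t = (-1)^d [⋀^d (𝔲/𝔲')*]`. -/
def Dual (D : GKMod 𝔭'.leviPair → Prop) (x z : h.C) : Prop :=
  ∃ (a c : Q'.KL) (b : K0 Q'.𝓛) (m n : ℕ), K0.Dual Q'.𝓛 D a b ∧
    (c : K0 Q'.𝓛) = (K0.mulTop Q'.𝓛 𝔭'.uMod Q'.adm.ext)^[m]
      ((K0.mulTop Q'.𝓛 j.relMod h.ext)^[n] b) ∧
    x = h.frac (Q'.frac a m) n ∧ z = h.frac (Q'.frac c m) n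

end Compatible

end AlgChar

end

/-! Both identities behind the proposition compare alternating forms on 𝔲 with alternating forms on
𝔲'. Let τ be the antilinear extension of θ. The form `-B(τ x, y)` is a Hermitian inner product on 𝔤
for which the adjoint of `ad x` is `-ad (τ x)` and K acts unitarily. Since 𝔩' is τ-stable,
orthogonal projections onto subspaces stable under 𝔩' and L' ∩ K' are equivariant, so 𝔲 splits over
(𝔩', L' ∩ K') as 𝔲' ⊕ 𝔲/𝔲'. Forms on 𝔲 of bidegree (p, q) are then forms on 𝔲/𝔲' of degree p with
values in forms on 𝔲' of degree q. Taking alternating sums gives the restriction of W_𝔮, and the top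
degree gives that of t (`ParabolicInclusion.res_mulExt`, `ParabolicInclusion.res_mulTop`).

The compatibility with characters needs H(V)|_{𝔩'} = W_{𝔮/𝔮'} · H'(V|_{𝔤'}), which is an Euler
characteristic version of the Hochschild-Serre spectral sequence (`ParabolicInclusion.euler_coho`).
As 𝔲' need not be an ideal of 𝔲, the filtration has to be chosen with care. Let F₀ = 𝔲' and let
F_{i+1} consist of the x in 𝔲 with [𝔲', x] ⊆ F_i. By Engel's theorem F_k = 𝔲 for some k, because
elements of the nilpotent radical are ad-nilpotent in 𝔤
(`ReductivePair.isNilpotent_of_mem_nilradical`, by an argument in the style of Cartan's criterion).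
Give 𝔲' the weight 0 and the orthogonal complement of F_{i-1} in F_i the weight k + i. A bracket of
vectors of weights a and b, not both 0, then has only components of weight below a + b: bracketing
with 𝔲' descends one step, and two positive weights add up to more than the largest weight 2k. Hence
the differential of Hom(⋀𝔲, V) does not lower weights, and its weight-preserving part involves only
the bracket and the action of 𝔲'. The cohomology of that part is Hom(⋀^p(𝔲/𝔲'), H^q(𝔲'; V)).

The cochains themselves need not belong to 𝓛', so Euler characteristics cannot be compared on the
level of complexes. Only the two cohomologies are known to lie in 𝓛'. They are put into an exact
couple built from a truncated Rees complex, with first page H^n(gr) ⊕ H^{n+1}(A) and a nilpotent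
endomorphism. Passing to derived couples does not change the Euler characteristic of the page and
ends with zero (`ExactCouple.euler_eq_zero`, `Cpx.Grading.euler_eq`).

For duals one has to see that a functional on X which is finite for L' ∩ K' is already finite for L
∩ K when the restriction of X is admissible. Averaging over these compact groups shows that such a
functional factors through the projection onto a finite-dimensional L ∩ K-stable subspace
(`GKMod.exists_finite_of_res`). Products are compatible with restriction on classes of modules and
hence in general. The remaining point is the well-definedness of the map of localizations, which is
the formula for the restriction of W_𝔮. -/

noncomputable section

namespace AlgChar

/-! ### Factorizations, direct sums and images of modules. -/

namespace GKMod

variable {P : HCPair}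

/-- The zero morphism. -/
def Hom.zero (X Y : GKMod P) : Hom X Y := ⟨0, by simp, by simp⟩

/-- The identity morphism. -/
def Hom.id (X : GKMod P) : Hom X X := ⟨LinearMap.id, fun _ _ => rfl, fun _ _ => rfl⟩

/-- Composition of morphisms. -/
def Hom.comp {X Y Z : GKMod P} (g : Hom Y Z) (f : Hom X Y) : Hom X Z :=
  ⟨g.f ∘ₗ f.f, fun x v => by simp [f.map_ρ, g.map_ρ], fun m v => by simp [f.map_σ, g.map_σ]⟩

/-- A morphism that vanishes on the kernel of a surjective one factors through it. -/
theorem Hom.exists_factor {X Y Z : GKMod P} (p : Hom X Y) (g : Hom X Z)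
    (hp : Function.Surjective p.f) (h : ∀ v, p.f v = 0 → g.f v = 0) :
    ∃ r : Hom Y Z, ∀ v, r.f (p.f v) = g.f v := by
  obtain ⟨s, hs⟩ := LinearMap.exists_rightInverse_of_surjective p.f (LinearMap.range_eq_top.2 hp)
  have hs' : ∀ y, p.f (s y) = y := fun y => LinearMap.congr_fun hs y
  have key : ∀ v, g.f (s (p.f v)) = g.f v := fun v => by
    rw [← sub_eq_zero, ← map_sub]
    exact h _ (by rw [map_sub, hs', sub_self])
  refine ⟨⟨g.f ∘ₗ s, fun x y => ?_, fun m y => ?_⟩, key⟩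
  · obtain ⟨v, rfl⟩ := hp y
    rw [← p.map_ρ]
    change g.f (s (p.f _)) = Z.ρ x (g.f (s (p.f v)))
    rw [key, key, g.map_ρ]
  · obtain ⟨v, rfl⟩ := hp y
    rw [← p.map_σ]
    change g.f (s (p.f _)) = Z.σ m (g.f (s (p.f v)))
    rw [key, key, g.map_σ]

/-- Two quotients of a module by the same submodule are isomorphic. -/
theorem Hom.exists_iso {X Y Z : GKMod P} (p : Hom X Y) (g : Hom X Z)
    (hp : Function.Surjective p.f) (hg : Function.Surjective g.f)
    (h : ∀ v, p.f v = 0 ↔ g.f v = 0) : ∃ r : Hom Y Z, Function.Bijective r.f := by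
  obtain ⟨r, hr⟩ := p.exists_factor g hp fun v => (h v).1
  refine ⟨r, (injective_iff_map_eq_zero r.f).2 fun y hy => ?_, fun z => ?_⟩
  · obtain ⟨v, rfl⟩ := hp y
    rw [hr] at hy
    exact (h v).2 hy
  · obtain ⟨v, rfl⟩ := hg z
    exact ⟨p.f v, hr v⟩

/-- The direct sum of two modules. -/
def prod (X Y : GKMod P) : GKMod P where
  V := X.V × Y.V
  ρ :=
    { toFun := fun x => (X.ρ x).prodMap (Y.ρ x)
      map_add' := fun x y => by ext <;> simp
      map_smul' := fun c x => by ext <;> simp }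
  σ :=
    { toFun := fun m => (X.σ m).prodMap (Y.σ m)
      map_one' := by ext <;> simp
      map_mul' := fun x y => by ext <;> simp }
  ρ_lie x y v := by ext <;> simp [X.ρ_lie, Y.ρ_lie]
  σ_ρ m x v := by ext <;> simp [X.σ_ρ, Y.σ_ρ]
  locallyFinite v := by
    obtain ⟨S, h1, h2⟩ := X.locallyFinite v.1
    obtain ⟨T, h3, h4⟩ := Y.locallyFinite v.2
    exact ⟨S.map (LinearMap.inl ℂ _ _) ⊔ T.map (LinearMap.inr ℂ _ _), inferInstance, fun m =>
      Submodule.mem_sup.2 ⟨_, ⟨_, h2 m, rfl⟩, _, ⟨_, h4 m, rfl⟩, by simp⟩⟩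
  σ_continuous v l := by
    have := (X.σ_continuous v.1 (l ∘ₗ LinearMap.inl ℂ _ _)).add
      (Y.σ_continuous v.2 (l ∘ₗ LinearMap.inr ℂ _ _))
    refine this.congr fun m => ?_
    simp [← map_add]
  σ_hasDerivAt γ x h v l := by
    have := (X.σ_hasDerivAt γ x h v.1 (l ∘ₗ LinearMap.inl ℂ _ _)).add
      (Y.σ_hasDerivAt γ x h v.2 (l ∘ₗ LinearMap.inr ℂ _ _))
    simpa [Pi.add_def, ← map_add] using! this

/-- The inclusion of the first summand. -/
def inl (X Y : GKMod P) : Hom X (X.prod Y) :=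
  ⟨LinearMap.inl ℂ _ _, fun x _ => Prod.ext rfl (map_zero (Y.ρ x)).symm,
    fun m _ => Prod.ext rfl (map_zero (Y.σ m)).symm⟩

/-- The inclusion of the second summand. -/
def inr (X Y : GKMod P) : Hom Y (X.prod Y) :=
  ⟨LinearMap.inr ℂ _ _, fun x _ => Prod.ext (map_zero (X.ρ x)).symm rfl,
    fun m _ => Prod.ext (map_zero (X.σ m)).symm rfl⟩

/-- The projection to the second summand. -/
def snd (X Y : GKMod P) : Hom (X.prod Y) Y :=
  ⟨LinearMap.snd ℂ _ _, fun _ _ => rfl, fun _ _ => rfl⟩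

theorem inl_snd_exact (X Y : GKMod P) : ShortExact (inl X Y) (snd X Y) :=
  ⟨LinearMap.inl_injective, LinearMap.range_inl ℂ X.V Y.V, Prod.snd_surjective⟩

theorem prod_mem {𝓛 : AbSubcat P} {X Y : GKMod P} (hX : 𝓛.mem X) (hY : 𝓛.mem Y) :
    𝓛.mem (X.prod Y) :=
  𝓛.sum (inl X Y) (inr X Y) hX hY <| by
    have : (fun v : X.V × Y.V => (inl X Y).f v.1 + (inr X Y).f v.2) = fun v : X.V × Y.V => v :=
      funext fun v => Prod.ext (add_zero v.1) (zero_add v.2)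
    rw [this]
    exact Function.bijective_id

theorem cls_prod {𝓛 : AbSubcat P} {X Y : GKMod P} (hX : 𝓛.mem X) (hY : 𝓛.mem Y) :
    K0.cls 𝓛 (X.prod Y) (prod_mem hX hY) = K0.cls 𝓛 X hX + K0.cls 𝓛 Y hY :=
  K0.cls_exact 𝓛 _ _ _ _ _ (inl_snd_exact X Y)

/-- The module `Y` is a cokernel of the zero endomorphism of `X`; dually, `mem_of_iso'` uses a
kernel. -/
theorem mem_of_iso {𝓛 : AbSubcat P} {X Y : GKMod P} (hX : 𝓛.mem X) (f : Hom X Y)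
    (hf : Function.Bijective f.f) : 𝓛.mem Y :=
  𝓛.coker (Hom.zero X X) f hX hX hf.2 <| by
    rw [LinearMap.ker_eq_bot.2 hf.1]; exact LinearMap.range_zero.symm

theorem mem_of_iso' {𝓛 : AbSubcat P} {X Y : GKMod P} (hX : 𝓛.mem X) (f : Hom Y X)
    (hf : Function.Bijective f.f) : 𝓛.mem Y :=
  𝓛.ker (Hom.zero X X) f hX hX hf.1 <| by
    rw [LinearMap.range_eq_top.2 hf.2]; exact LinearMap.ker_zero.symm

/-- The projection to a quotient. -/
def quotProj (X : GKMod P) (S : Submodule ℂ X.V) (hρ : ∀ x, ∀ v ∈ S, X.ρ x v ∈ S)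
    (hσ : ∀ m, ∀ v ∈ S, X.σ m v ∈ S) : Hom X (X.quot S hρ hσ) :=
  ⟨S.mkQ, fun _ _ => rfl, fun _ _ => rfl⟩

/-- The corestriction of a morphism to its image. -/
def toIm {X Y : GKMod P} (f : Hom X Y) : Hom X (im f) :=
  ⟨f.f.rangeRestrict, fun x v => Subtype.ext (f.map_ρ x v), fun m v => Subtype.ext (f.map_σ m v)⟩

/-- The inclusion of the image of a morphism. -/
def imIncl {X Y : GKMod P} (f : Hom X Y) : Hom (im f) Y :=
  ⟨(LinearMap.range f.f).subtype, fun _ _ => rfl, fun _ _ => rfl⟩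

end GKMod

/-! ### Euler characteristics of complexes with terms in the category. -/

namespace Cpx

variable {P : HCPair}

/-- The inclusion of the cocycles. -/
def zIncl (A : Cpx P) (q : ℕ) : GKMod.Hom (A.Z q) (A.C q) :=
  ⟨(LinearMap.ker (A.d q).f).subtype, fun _ _ => rfl, fun _ _ => rfl⟩

/-- The class of a cocycle, as a morphism. -/
def hclsHom (A : Cpx P) (q : ℕ) : GKMod.Hom (A.Z q) (A.H q) :=
  ⟨A.hcls q, fun _ _ => rfl, fun _ _ => rfl⟩

/-- The corestriction of a morphism to the cocycles. -/
def toZ (A : Cpx P) {q : ℕ} {X : GKMod P} (f : GKMod.Hom X (A.C q))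
    (h : ∀ v, (A.d q).f (f.f v) = 0) : GKMod.Hom X (A.Z q) :=
  ⟨f.f.codRestrict _ h, fun x v => Subtype.ext (f.map_ρ x v), fun m v => Subtype.ext (f.map_σ m v)⟩

section Euler

variable {𝓛 : AbSubcat P} (A : Cpx P) (hA : ∀ q, 𝓛.mem (A.C q))

include hA in
theorem Z_mem (q : ℕ) : 𝓛.mem (A.Z q) :=
  𝓛.ker (A.d q) (A.zIncl q) (hA q) (hA (q + 1)) Subtype.val_injective (Submodule.range_subtype _)

include hA in
theorem H_mem (q : ℕ) : 𝓛.mem (A.H q) := by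
  cases q with
  | zero =>
    refine 𝓛.coker (GKMod.Hom.zero (A.Z 0) (A.Z 0)) (A.hclsHom 0) (A.Z_mem hA 0) (A.Z_mem hA 0)
      (A.hcls_surjective 0) ?_
    rw [show (GKMod.Hom.zero (A.Z 0) (A.Z 0)).f = 0 from rfl, LinearMap.range_zero]
    refine LinearMap.ker_eq_bot'.2 fun v hv => Subtype.ext ?_
    exact (Submodule.mem_bot ℂ).1 ((A.hcls_eq_zero 0 v).1 hv)
  | succ q =>
    refine 𝓛.coker (A.toZ (A.d q) (A.d_d q)) (A.hclsHom (q + 1)) (hA q) (A.Z_mem hA _)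
      (A.hcls_surjective _) (Submodule.ext fun v => ?_)
    refine (A.hcls_eq_zero (q + 1) v).trans ⟨?_, ?_⟩
    · rintro ⟨w, hw⟩; exact ⟨w, Subtype.ext hw⟩
    · rintro ⟨w, hw⟩; exact ⟨w, congrArg Subtype.val hw⟩

/-- The Euler characteristic of a complex is that of its cohomology. -/
theorem euler_eq (n : ℕ) (hn : Subsingleton (A.C n).V) :
    ∑ q ∈ Finset.range n, (-1 : ℤ) ^ q • K0.cls 𝓛 (A.C q) (hA q) =
      ∑ q ∈ Finset.range n, (-1 : ℤ) ^ q • K0.cls 𝓛 (A.H q) (A.H_mem hA q) := by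
  let β q := K0.cls 𝓛 _ (GKMod.im_mem (A.d q) (hA q) (hA (q + 1)))
  let ζ q := K0.cls 𝓛 _ (A.Z_mem hA q)
  have h1 : ∀ q, K0.cls 𝓛 (A.C q) (hA q) = ζ q + β q := fun q =>
    K0.cls_exact 𝓛 _ _ _ (A.zIncl q) (GKMod.toIm (A.d q)) ⟨Subtype.val_injective,
      (Submodule.range_subtype _).trans (LinearMap.ker_rangeRestrict _).symm,
      LinearMap.surjective_rangeRestrict _⟩
  have h2 : ∀ q, ζ (q + 1) = β q + K0.cls 𝓛 (A.H (q + 1)) (A.H_mem hA _) := fun q => by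
    refine K0.cls_exact 𝓛 _ _ _ (A.toZ (GKMod.imIncl (A.d q))
      (by rintro ⟨_, w, rfl⟩; exact A.d_d q w)) (A.hclsHom (q + 1))
      ⟨fun a b h => Subtype.ext (congrArg (fun v : (A.Z (q + 1)).V => v.1) h), Submodule.ext fun v => ?_,
        A.hcls_surjective _⟩
    refine Iff.trans ⟨?_, ?_⟩ (A.hcls_eq_zero (q + 1) v).symm
    · rintro ⟨w, rfl⟩; exact w.2
    · intro h; exact ⟨⟨v.1, h⟩, rfl⟩
  have h3 : ζ 0 = K0.cls 𝓛 (A.H 0) (A.H_mem hA 0) := by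
    refine K0.cls_iso 𝓛 _ _ (A.hclsHom 0) ⟨?_, A.hcls_surjective 0⟩
    refine (injective_iff_map_eq_zero _).2 fun v hv => Subtype.ext ?_
    exact (Submodule.mem_bot ℂ).1 ((A.hcls_eq_zero 0 v).1 hv)
  -- In the truncated sums everything telescopes except the image of the last differential, which is
  -- zero once the target vanishes.
  have h4 : ∀ m, ∑ q ∈ Finset.range (m + 1), (-1 : ℤ) ^ q • (K0.cls 𝓛 (A.C q) (hA q) -
      K0.cls 𝓛 (A.H q) (A.H_mem hA q)) = (-1 : ℤ) ^ m • β m := fun m => by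
    induction m with
    | zero => simp [h1, h3]
    | succ m ih =>
      rw [Finset.sum_range_succ, ih, h1, h2, pow_succ]
      simp only [mul_neg_one, neg_smul, smul_add, smul_sub]
      abel
  cases n with
  | zero => simp
  | succ m =>
    have h5 : Subsingleton (GKMod.im (A.d m)).V :=
      inferInstanceAs (Subsingleton (LinearMap.range (A.d m).f))
    have h6 : β m = 0 := K0.cls_zero _ _ _
    have h7 := h4 m
    simp only [h6, smul_zero, smul_sub, Finset.sum_sub_distrib] at h7
    exact sub_eq_zero.1 h7

end Euler

end Cpx

/-- An exact couple of graded modules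
`⋯ → D n → D n → E (n + 1) → D (n + 1) → D (n + 1) → ⋯` starting with `0 → E 0 → D 0`. -/
structure ExactCouple (P : HCPair) where
  D : ℕ → GKMod P
  E : ℕ → GKMod P
  i : ∀ n, GKMod.Hom (D n) (D n)
  j : ∀ n, GKMod.Hom (D n) (E (n + 1))
  k : ∀ n, GKMod.Hom (E n) (D n)
  exact_D : ∀ n v, (j n).f v = 0 ↔ ∃ w, (i n).f w = v
  exact_E : ∀ n v, (k (n + 1)).f v = 0 ↔ ∃ w, (j n).f w = v
  exact_k : ∀ n v, (i n).f v = 0 ↔ ∃ w, (k n).f w = v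
  injective : ∀ v, (k 0).f v = 0 → v = 0

/-! ### Derived couples and Euler characteristics. -/

namespace ExactCouple

variable {P : HCPair}

/-- The complex formed by the modules `E n`. -/
abbrev cpx (c : ExactCouple P) : Cpx P where
  C := c.E
  d n := (c.j n).comp (c.k n)
  d_d n v := by
    change (c.j (n + 1)).f ((c.k (n + 1)).f ((c.j n).f ((c.k n).f v))) = 0
    rw [(c.exact_E n _).2 ⟨_, rfl⟩, map_zero]

/-- The derived couple. -/
theorem exists_derived (c : ExactCouple P) : ∃ c' : ExactCouple P, c'.E = c.cpx.H ∧
    ∀ R, (∀ n (v : (c.D n).V), ((c.i n).f ^ (R + 1)) v = 0) →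
      ∀ n (v : (c'.D n).V), ((c'.i n).f ^ R) v = 0 := by
  have hd : ∀ n v, (c.cpx.d n).f v = (c.j n).f ((c.k n).f v) := fun _ _ => rfl
  have hj : ∀ n (v : (c.D n).V), (c.cpx.d (n + 1)).f ((c.j n).f v) = 0 := fun n v => by
    exact (congrArg (c.j (n + 1)).f ((c.exact_E n _).2 ⟨_, rfl⟩)).trans (map_zero _)
  -- The rule `i v ↦ [j v]` is well defined: if `i v = 0`, then `v = k w` and `j v = d w` is a
  -- coboundary.
  have h1 : ∀ n, ∃ j' : GKMod.Hom (GKMod.im (c.i n)) (c.cpx.H (n + 1)), ∀ v,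
      j'.f ((GKMod.toIm (c.i n)).f v) = c.cpx.hcls (n + 1) ⟨(c.j n).f v, hj n v⟩ := fun n => by
    refine (GKMod.toIm (c.i n)).exists_factor ((c.cpx.hclsHom (n + 1)).comp
      (c.cpx.toZ (c.j n) (hj n))) (LinearMap.surjective_rangeRestrict _) fun v hv => ?_
    obtain ⟨w, rfl⟩ := (c.exact_k n v).1 (congrArg Subtype.val hv)
    exact (c.cpx.hcls_eq_zero (n + 1) _).2 ⟨w, rfl⟩
  -- A cocycle satisfies `j (k v) = 0`, so `k v` lies in the image of `i`, the new module `D`.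
  have hz : ∀ n (v : (c.cpx.Z n).V), ∃ w, (c.i n).f w = (c.k n).f v.1 := fun n v =>
    (c.exact_D n _).1 v.2
  have h2 : ∀ n, ∃ k' : GKMod.Hom (c.cpx.H n) (GKMod.im (c.i n)), ∀ v : (c.cpx.Z n).V,
      (k'.f (c.cpx.hcls n v)).1 = (c.k n).f v.1 := fun n => by
    have hB : ∀ v : (c.cpx.Z n).V, c.cpx.hcls n v = 0 → (c.k n).f v.1 = 0 := fun v hv => by
      have hv' := (c.cpx.hcls_eq_zero n v).1 hv
      cases n with
      | zero => rw [(Submodule.mem_bot ℂ).1 hv', map_zero]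
      | succ n =>
        obtain ⟨w, hw⟩ := hv'
        exact (c.exact_E n _).2 ⟨_, hw⟩
    obtain ⟨k', hk'⟩ := (c.cpx.hclsHom n).exists_factor (Z := GKMod.im (c.i n))
      ⟨((c.k n).f ∘ₗ (c.cpx.zIncl n).f).codRestrict _ (hz n),
        fun x v => Subtype.ext ((c.k n).map_ρ x v.1), fun m v => Subtype.ext ((c.k n).map_σ m v.1)⟩
      (c.cpx.hcls_surjective n) fun v hv => Subtype.ext (hB v hv)
    exact ⟨k', fun v => congrArg Subtype.val (hk' v)⟩
  choose j' hj' using h1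
  choose k' hk' using h2
  refine ⟨⟨fun n => GKMod.im (c.i n), c.cpx.H, fun n => (GKMod.toIm (c.i n)).comp
    (GKMod.imIncl (c.i n)), j', k', ?_, ?_, ?_, ?_⟩, rfl, ?_⟩
  · rintro n ⟨_, v, rfl⟩
    change (j' n).f ((GKMod.toIm (c.i n)).f v) = 0 ↔ _
    rw [hj', Cpx.hcls_eq_zero]
    constructor
    -- A relation `j v = d e = j (k e)` puts `v - k e` into the image of `i`, and `i` does not see
    -- `k e`.
    · rintro ⟨e, he⟩
      have : (c.j n).f (v - (c.k n).f e) = 0 := by rw [map_sub]; exact sub_eq_zero.2 he.symm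
      obtain ⟨w, hw⟩ := (c.exact_D n _).1 this
      refine ⟨⟨_, w, rfl⟩, Subtype.ext ?_⟩
      change (c.i n).f ((c.i n).f w) = (c.i n).f v
      rw [hw, map_sub, (c.exact_k n _).2 ⟨e, rfl⟩, sub_zero]
    · rintro ⟨⟨_, w, rfl⟩, hw⟩
      have hw' : (c.i n).f ((c.i n).f w) = (c.i n).f v := congrArg Subtype.val hw
      obtain ⟨e, he⟩ := (c.exact_k n (v - (c.i n).f w)).1 (by rw [map_sub, hw', sub_self])
      refine ⟨e, ?_⟩
      change (c.j n).f ((c.k n).f e) = (c.j n).f v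
      rw [he, map_sub, (c.exact_D n _).2 ⟨w, rfl⟩, sub_zero]
  · intro n v
    obtain ⟨v, rfl⟩ := c.cpx.hcls_surjective _ v
    constructor
    · intro h
      obtain ⟨w, hw⟩ := (c.exact_E n v.1).1 ((hk' (n + 1) v).symm.trans (congrArg Subtype.val h))
      refine ⟨(GKMod.toIm (c.i n)).f w, ?_⟩
      rw [hj']
      exact congrArg _ (Subtype.ext hw)
    · rintro ⟨⟨_, w, rfl⟩, hw⟩
      rw [← hw]
      refine Subtype.ext ?_
      change ((k' (n + 1)).f ((j' n).f ((GKMod.toIm (c.i n)).f w))).1 = 0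
      rw [hj']
      exact (hk' (n + 1) _).trans ((c.exact_E n _).2 ⟨w, rfl⟩)
  · rintro n ⟨_, v, rfl⟩
    constructor
    · intro h
      have h' : (c.i n).f ((c.i n).f v) = 0 := congrArg Subtype.val h
      obtain ⟨e, he⟩ := (c.exact_k n _).1 h'
      have h3 : (c.cpx.d n).f e = 0 := by
        refine (congrArg (c.j n).f he).trans ((c.exact_D n _).2 ⟨v, rfl⟩)
      exact ⟨c.cpx.hcls n ⟨e, h3⟩, Subtype.ext ((hk' n _).trans he)⟩
    · rintro ⟨w, hw⟩
      obtain ⟨w, rfl⟩ := c.cpx.hcls_surjective _ w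
      refine Subtype.ext ?_
      change (c.i n).f ((c.i n).f v) = 0
      refine (c.exact_k n _).2 ⟨w.1, ?_⟩
      exact (hk' n w).symm.trans (congrArg Subtype.val hw)
  · intro v h
    obtain ⟨v, rfl⟩ := c.cpx.hcls_surjective _ v
    have := c.injective v.1 ((hk' 0 v).symm.trans (congrArg Subtype.val h))
    rw [show v = 0 from Subtype.ext this, map_zero]
  -- The new endomorphism is the restriction of `i` to its own image, so one power fewer is needed
  -- to annihilate it.
  · intro R hR n
    have key : ∀ (r : ℕ) (v : (GKMod.im (c.i n)).V), ((((GKMod.toIm (c.i n)).comp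
        (GKMod.imIncl (c.i n))).f ^ r) v).1 = ((c.i n).f ^ r) v.1 := fun r => by
      induction r with
      | zero => intro v; rfl
      | succ r ih =>
        intro v
        rw [pow_succ, pow_succ, Module.End.mul_apply, ih]
        rfl
    rintro ⟨_, v, rfl⟩
    refine Subtype.ext ((key R _).trans ?_)
    have := hR n v
    rwa [pow_succ, Module.End.mul_apply] at this

/-- The Euler characteristic of an exact couple with nilpotent `i` vanishes. -/
theorem euler_eq_zero {𝓛 : AbSubcat P} (R : ℕ) (c : ExactCouple P) (hE : ∀ n, 𝓛.mem (c.E n))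
    (hi : ∀ n (v : (c.D n).V), ((c.i n).f ^ R) v = 0) (n : ℕ)
    (hn : ∀ m, n ≤ m → Subsingleton (c.E m).V) :
    ∑ q ∈ Finset.range n, (-1 : ℤ) ^ q • K0.cls 𝓛 (c.E q) (hE q) = 0 := by
  -- Classes are formed of the modules `E` only; the modules `D` need not lie in the category. For
  -- `R = 0` all `D n` vanish, and exactness forces all `E n` to vanish.
  induction R generalizing c with
  | zero =>
    have h0 : ∀ n (v : (c.D n).V), v = 0 := hi
    refine Finset.sum_eq_zero fun q _ => ?_
    have : Subsingleton (c.E q).V := by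
      refine subsingleton_of_forall_eq 0 fun v => ?_
      cases q with
      | zero => exact c.injective v (h0 _ _)
      | succ q =>
        obtain ⟨w, rfl⟩ := (c.exact_E q v).1 (h0 _ _)
        rw [h0 _ w, map_zero]
    rw [K0.cls_zero, smul_zero]
  | succ R ih =>
    obtain ⟨c', hc', h'⟩ := c.exists_derived
    have h1 := c.cpx.euler_eq hE n (hn n le_rfl)
    refine h1.trans ?_
    have h2 := ih c' (fun q => by rw [hc']; exact c.cpx.H_mem hE q) (h' R hi) fun m hm => by
      rw [hc']
      have := hn m hm
      have h3 : Subsingleton (c.cpx.C m).V := this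
      exact (c.cpx.hcls_surjective m).subsingleton
    rw [← h2]
    refine Finset.sum_congr rfl fun q _ => ?_
    congr 1
    congr 1
    rw [hc']

end ExactCouple

/-! ### Complexes filtered by weights and their Rees complexes. -/

namespace GKMod

variable {P : HCPair}

/-- The direct sum of `N` copies of a module. -/
def pow (X : GKMod P) (N : ℕ) : GKMod P where
  V := Fin N → X.V
  ρ :=
    { toFun := fun x => LinearMap.pi fun i => X.ρ x ∘ₗ LinearMap.proj i
      map_add' := fun x y => LinearMap.ext fun v => funext fun i => by simp
      map_smul' := fun c x => LinearMap.ext fun v => funext fun i => by simp }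
  σ :=
    { toFun := fun m => LinearMap.pi fun i => X.σ m ∘ₗ LinearMap.proj i
      map_one' := LinearMap.ext fun v => funext fun i => by simp
      map_mul' := fun x y => LinearMap.ext fun v => funext fun i => by simp }
  ρ_lie x y v := funext fun i => by simp [X.ρ_lie]
  σ_ρ m x v := funext fun i => by simp [X.σ_ρ]
  locallyFinite v := by
    obtain ⟨S, h1, h2⟩ := X.exists_orbit v
    refine ⟨LinearMap.range (LinearMap.pi fun i => S.subtype ∘ₗ LinearMap.proj i :
      (Fin N → S) →ₗ[ℂ] (Fin N → X.V)), inferInstance, fun m => ⟨fun i => ⟨_, h2 i m⟩, rfl⟩⟩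
  σ_continuous v l := by
    have : ∀ w, l w = ∑ i, (l ∘ₗ LinearMap.single ℂ (fun _ => X.V) i) (w i) := fun w => by
      conv_lhs => rw [← Finset.univ_sum_single w, map_sum]
      rfl
    simp only [this]
    exact continuous_finsetSum _ fun i _ => X.σ_continuous (v i) _
  σ_hasDerivAt γ x h v l := by
    have : ∀ w, l w = ∑ i, (l ∘ₗ LinearMap.single ℂ (fun _ => X.V) i) (w i) := fun w => by
      conv_lhs => rw [← Finset.univ_sum_single w, map_sum]
      rfl
    simp only [this]
    exact HasDerivAt.fun_sum fun i _ => X.σ_hasDerivAt γ x h (v i) _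

end GKMod

namespace Cpx

variable {P : HCPair}

theorem Hom.onH_onH {A B C D : Cpx P} (f : Hom A B) (g : Hom B D) (f' : Hom A C) (g' : Hom C D)
    (h : ∀ q v, (g.f q).f ((f.f q).f v) = (g'.f q).f ((f'.f q).f v)) (q : ℕ) (v : (A.H q).V) :
    (g.onH q).f ((f.onH q).f v) = (g'.onH q).f ((f'.onH q).f v) := by
  obtain ⟨v, rfl⟩ := A.hcls_surjective q v
  exact congrArg (D.hcls q) (Subtype.ext (h q v.1))

/-- The identity of a complex. -/
def Hom.id (A : Cpx P) : Hom A A := ⟨fun q => GKMod.Hom.id _, fun _ _ => rfl⟩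

theorem Hom.id_onH (A : Cpx P) (q : ℕ) (v : (A.H q).V) : ((Hom.id A).onH q).f v = v := by
  obtain ⟨v, rfl⟩ := A.hcls_surjective q v
  rfl

theorem Hom.onH_leftInverse {A B : Cpx P} (f : Hom A B) (g : Hom B A)
    (h : ∀ q v, (g.f q).f ((f.f q).f v) = v) (q : ℕ) (v : (A.H q).V) :
    (g.onH q).f ((f.onH q).f v) = v := by
  rw [Hom.onH_onH f g (Hom.id A) (Hom.id A) h, Hom.id_onH, Hom.id_onH]

theorem Hom.onH_comp_zero {A B C : Cpx P} (f : Hom A B) (g : Hom B C)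
    (h : ∀ q v, (g.f q).f ((f.f q).f v) = 0) (q : ℕ) (v : (A.H q).V) :
    (g.onH q).f ((f.onH q).f v) = 0 := by
  obtain ⟨v, rfl⟩ := A.hcls_surjective q v
  exact (congrArg (C.hcls q) (Subtype.ext (h q v.1))).trans (map_zero _)

/-- There are no coboundaries in degree 0, so injectivity on cochains passes to cohomology. -/
theorem Hom.onH_zero_injective {A B : Cpx P} (f : Hom A B) (h : Function.Injective (f.f 0).f)
    (v : (A.H 0).V) (hv : (f.onH 0).f v = 0) : v = 0 := by
  obtain ⟨v, rfl⟩ := A.hcls_surjective 0 v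
  rw [Hom.onH_hcls, hcls_eq_zero] at hv
  have h5 : v.1 = 0 := h (((Submodule.mem_bot ℂ).1 hv).trans (map_zero _).symm)
  rw [show v = 0 from Subtype.ext h5, map_zero]

/-- A grading of the modules of a complex by weights `w < N` such that the differential does not
lower the weight. -/
structure Grading (A : Cpx P) where
  N : ℕ
  wt : ∀ (w n : ℕ), GKMod.Hom (A.C n) (A.C n)
  wt_self : ∀ w n v, (wt w n).f ((wt w n).f v) = (wt w n).f v
  wt_ne : ∀ w w' n v, w ≠ w' → (wt w n).f ((wt w' n).f v) = 0
  sum_wt : ∀ n v, ∑ w ∈ Finset.range N, (wt w n).f v = v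
  wt_d : ∀ w w' n v, w' < w → (wt w' (n + 1)).f ((A.d n).f ((wt w n).f v)) = 0

namespace Grading

variable {A : Cpx P} (g : A.Grading)

theorem wt_eq_zero (w n : ℕ) (hw : g.N ≤ w) (v : (A.C n).V) : (g.wt w n).f v = 0 := by
  rw [← g.sum_wt n v, map_sum]
  refine Finset.sum_eq_zero fun w' hw' => g.wt_ne _ _ _ _ ?_
  have := Finset.mem_range.1 hw'
  omega

/-- The vectors whose components of weights below `p` vanish. -/
def F (p n : ℕ) : Submodule ℂ (A.C n).V where
  carrier := {v | ∀ w < p, (g.wt w n).f v = 0}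
  add_mem' ha hb w hw := by rw [map_add, ha w hw, hb w hw, add_zero]
  zero_mem' w hw := map_zero _
  smul_mem' c v hv w hw := by rw [map_smul, hv w hw, smul_zero]

theorem F_anti {p p' : ℕ} (h : p ≤ p') (n : ℕ) (v : (A.C n).V) (hv : v ∈ g.F p' n) :
    v ∈ g.F p n := fun w hw => hv w (hw.trans_le h)

theorem F_succ {p n : ℕ} {v : (A.C n).V} (hv : v ∈ g.F p n) (h : (g.wt p n).f v = 0) :
    v ∈ g.F (p + 1) n := fun w hw => by
  rcases Nat.lt_succ_iff_lt_or_eq.1 hw with h' | rfl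
  exacts [hv w h', h]

theorem F_top {p n : ℕ} (hp : g.N ≤ p) {v : (A.C n).V} (hv : v ∈ g.F p n) : v = 0 := by
  rw [← g.sum_wt n v]
  exact Finset.sum_eq_zero fun w hw => hv w ((Finset.mem_range.1 hw).trans_le hp)

theorem F_ρ {p n : ℕ} (x : P.h) {v : (A.C n).V} (hv : v ∈ g.F p n) : (A.C n).ρ x v ∈ g.F p n :=
  fun w hw => by rw [(g.wt w n).map_ρ, hv w hw, map_zero]

theorem F_σ {p n : ℕ} (m : P.M) {v : (A.C n).V} (hv : v ∈ g.F p n) : (A.C n).σ m v ∈ g.F p n :=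
  fun w hw => by rw [(g.wt w n).map_σ, hv w hw, map_zero]

theorem wt_mem_F (p n : ℕ) (v : (A.C n).V) : (g.wt p n).f v ∈ g.F p n :=
  fun w hw => g.wt_ne _ _ _ _ hw.ne

/-- On vectors of weights at least `p`, the components of `d v` of weight at most `p` depend only
on the component of `v` of weight `p`. -/
theorem wt_d_eq {p n : ℕ} {v : (A.C n).V} (hv : v ∈ g.F p n) :
    (g.wt p (n + 1)).f ((A.d n).f v) = (g.wt p (n + 1)).f ((A.d n).f ((g.wt p n).f v)) := by
  conv_lhs => rw [← g.sum_wt n v, map_sum, map_sum]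
  refine (Finset.sum_eq_single p (fun w _ hw => ?_) fun hp => ?_)
  · rcases lt_or_gt_of_ne hw with h | h
    · rw [hv w h, map_zero, map_zero]
    · exact g.wt_d _ _ _ _ h
  · rw [Finset.mem_range, not_lt] at hp
    rw [g.wt_eq_zero p (n + 1) hp]

theorem F_d {p n : ℕ} {v : (A.C n).V} (hv : v ∈ g.F p n) : (A.d n).f v ∈ g.F p (n + 1) :=
  fun w hw => by
    rw [g.wt_d_eq (g.F_anti hw.le n v hv), hv w hw, map_zero, map_zero]

/-- The part of the differential that preserves weights. -/
def d₀ (n : ℕ) : GKMod.Hom (A.C n) (A.C (n + 1)) where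
  f := ∑ w ∈ Finset.range g.N, (g.wt w (n + 1)).f ∘ₗ (A.d n).f ∘ₗ (g.wt w n).f
  map_ρ x v := by
    simp [LinearMap.sum_apply, (g.wt _ _).map_ρ, (A.d _).map_ρ]
  map_σ m v := by
    simp [LinearMap.sum_apply, (g.wt _ _).map_σ, (A.d _).map_σ]

theorem d₀_apply (n : ℕ) (v : (A.C n).V) : (g.d₀ n).f v =
    ∑ w ∈ Finset.range g.N, (g.wt w (n + 1)).f ((A.d n).f ((g.wt w n).f v)) := by
  simp [d₀, LinearMap.sum_apply]

theorem d₀_wt (w n : ℕ) (v : (A.C n).V) : (g.d₀ n).f ((g.wt w n).f v) =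
    (g.wt w (n + 1)).f ((A.d n).f ((g.wt w n).f v)) := by
  rw [d₀_apply]
  refine (Finset.sum_eq_single w (fun w' _ hw => ?_) fun hp => ?_).trans ?_
  · rw [g.wt_ne _ _ _ _ hw, map_zero, map_zero]
  · rw [Finset.mem_range, not_lt] at hp
    rw [g.wt_eq_zero w (n + 1) hp]
  · rw [g.wt_self]

/-- The associated graded complex. -/
abbrev gr : Cpx P where
  C := A.C
  d := g.d₀
  d_d n v := by
    rw [g.d₀_apply n, map_sum]
    refine Finset.sum_eq_zero fun w _ => ?_
    rw [d₀_wt, ← g.wt_d_eq (g.F_d (g.wt_mem_F w n v)), A.d_d, map_zero]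

/-- The sequences of vectors of weights at least `e, e + 1, …`. -/
def reesSub (e n : ℕ) : Submodule ℂ (ℕ → (A.C n).V) where
  carrier := {f | ∀ p, f p ∈ g.F (p + e) n}
  add_mem' ha hb p := add_mem (ha p) (hb p)
  zero_mem' p := zero_mem _
  smul_mem' c f hf p := Submodule.smul_mem _ c (hf p)

/-- The sequences of vectors of weights at least `e, e + 1, …`, as a module. -/
def reesMod (e n : ℕ) : GKMod P :=
  ((A.C n).pow g.N).ofInj (g.reesSub e n)
    (LinearMap.pi fun i : Fin g.N => LinearMap.proj (i : ℕ) ∘ₗ Submodule.subtype _)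
    -- Entries of index at least `N` vanish, so a sequence is determined by finitely many entries.
    -- This makes local finiteness available, which fails for infinite products in general.
    (fun a b h => Subtype.ext <| funext fun p => by
      rcases lt_or_ge p g.N with hp | hp
      · exact congrFun h ⟨p, hp⟩
      · rw [g.F_top (hp.trans (Nat.le_add_right p e)) (a.2 p),
          g.F_top (hp.trans (Nat.le_add_right p e)) (b.2 p)])
    (fun x => (LinearMap.pi fun p => (A.C n).ρ x ∘ₗ LinearMap.proj p).restrict
      fun _ hf p => g.F_ρ x (hf p))
    (fun m => (LinearMap.pi fun p => (A.C n).σ m ∘ₗ LinearMap.proj p).restrict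
      fun _ hf p => g.F_σ m (hf p))
    (fun _ _ => rfl) (fun _ _ => rfl)

/-- A truncated version of the Rees complex of the filtration by weights. -/
def rees (e : ℕ) : Cpx P where
  C := g.reesMod e
  d n :=
    { f := (LinearMap.pi fun p => (A.d n).f ∘ₗ LinearMap.proj p).restrict
        fun _ hf p => g.F_d (hf p)
      map_ρ := fun x f => Subtype.ext <| funext fun p => (A.d n).map_ρ x (f.1 p)
      map_σ := fun m f => Subtype.ext <| funext fun p => (A.d n).map_σ m (f.1 p) }
  d_d n f := Subtype.ext <| funext fun p => A.d_d n (f.1 p)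

/-- The inclusion of the sequences with larger weights. -/
def incl : Hom (g.rees 1) (g.rees 0) where
  f n := ⟨(LinearMap.id).restrict fun _ hf p => g.F_anti (Nat.le_succ p) n _ (hf p),
    fun _ _ => rfl, fun _ _ => rfl⟩
  comm _ _ := rfl

/-- The removal of the first term of a sequence. -/
def drop : Hom (g.rees 0) (g.rees 1) where
  f n := ⟨(LinearMap.pi fun p => LinearMap.proj (p + 1)).restrict fun _ hf p => hf (p + 1),
    fun _ _ => rfl, fun _ _ => rfl⟩
  comm _ _ := rfl

/-- The insertion of zero in front of a sequence. -/
def shift : Hom (g.rees 1) (g.rees 0) where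
  f n := ⟨(LinearMap.pi fun p => Nat.casesOn p 0 fun p => LinearMap.proj p).restrict fun f hf p => by
      cases p with
      | zero => exact zero_mem _
      | succ p => exact hf p,
    fun x f => Subtype.ext <| funext fun p => by
      cases p with
      | zero => exact (map_zero ((A.C n).ρ x)).symm
      | succ p => rfl,
    fun m f => Subtype.ext <| funext fun p => by
      cases p with
      | zero => exact (map_zero ((A.C n).σ m)).symm
      | succ p => rfl⟩
  comm n f := Subtype.ext <| funext fun p => by
    cases p with
    | zero => exact map_zero (A.d n).f
    | succ p => rfl

/-- The sequences concentrated in the first term. -/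
def single : Hom A (g.rees 0) where
  f n := ⟨(LinearMap.pi fun p => Nat.casesOn p LinearMap.id fun _ => 0).codRestrict _ fun v p => by
      cases p with
      -- In index 0 there is no condition, since all weights are nonnegative.
      | zero => exact fun w hw => absurd hw (Nat.not_lt_zero w)
      | succ p => exact zero_mem _,
    fun x f => Subtype.ext <| funext fun p => by
      cases p with
      | zero => rfl
      | succ p => exact (map_zero ((A.C n).ρ x)).symm,
    fun m f => Subtype.ext <| funext fun p => by
      cases p with
      | zero => rfl
      | succ p => exact (map_zero ((A.C n).σ m)).symm⟩
  comm n f := Subtype.ext <| funext fun p => by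
    cases p with
    | zero => rfl
    | succ p => exact map_zero (A.d n).f

/-- The first term of a sequence. -/
def first : Hom (g.rees 0) A where
  f _ := ⟨LinearMap.proj 0 ∘ₗ Submodule.subtype _, fun _ _ => rfl, fun _ _ => rfl⟩
  comm _ _ := rfl

/-- The sum of the components of lowest weight of a sequence. -/
def symbLin (n : ℕ) : g.reesSub 0 n →ₗ[ℂ] (A.C n).V where
  toFun f := ∑ p ∈ Finset.range g.N, (g.wt p n).f (f.1 p)
  map_add' f f' := by
    rw [← Finset.sum_add_distrib]
    exact Finset.sum_congr rfl fun p _ => map_add (g.wt p n).f (f.1 p) (f'.1 p)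
  map_smul' c f := by
    rw [Finset.smul_sum]
    exact Finset.sum_congr rfl fun p _ => map_smul (g.wt p n).f c (f.1 p)

/-- The components of lowest weight. -/
def symb : Hom (g.rees 0) g.gr where
  f n :=
    { f := g.symbLin n
      map_ρ := fun x f => (Finset.sum_congr rfl fun p _ => (g.wt p n).map_ρ x (f.1 p)).trans
        (map_sum ((A.C n).ρ x) (fun p => (g.wt p n).f (f.1 p)) (Finset.range g.N)).symm
      map_σ := fun m f => (Finset.sum_congr rfl fun p _ => (g.wt p n).map_σ m (f.1 p)).trans
        (map_sum ((A.C n).σ m) (fun p => (g.wt p n).f (f.1 p)) (Finset.range g.N)).symm }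
  comm n f := (map_sum (g.d₀ n).f (fun p => (g.wt p n).f (f.1 p)) (Finset.range g.N)).trans <|
    Finset.sum_congr rfl fun p _ => (g.d₀_wt p n (f.1 p)).trans (g.wt_d_eq (f.2 p)).symm

theorem symb_apply (n : ℕ) (f : (g.reesMod 0 n).V) :
    (g.symb.f n).f f = ∑ p ∈ Finset.range g.N, (g.wt p n).f (f.1 p) := rfl

/-- The quotient of the sequences in `F p` by those in `F (p + 1)` is the product of the graded
pieces, and these are the components of a single vector. The sequence of all components of `v` is a
preimage of `v`. -/
theorem incl_symb_exact (n : ℕ) : GKMod.ShortExact (g.incl.f n) (g.symb.f n) := by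
  refine ⟨fun a b h => Subtype.ext (congrArg (fun f : (g.reesMod 0 n).V => f.1) h),
    Submodule.ext fun f => ⟨?_, fun h => ?_⟩, fun v => ?_⟩
  · rintro ⟨f, rfl⟩
    refine LinearMap.mem_ker.2 ((g.symb_apply n _).trans (Finset.sum_eq_zero fun p _ => ?_))
    exact f.2 p p (Nat.lt_succ_self p)
  · have h' := (g.symb_apply n f).symm.trans (LinearMap.mem_ker.1 h)
    have h0 : ∀ p, (g.wt p n).f (f.1 p) = 0 := fun p => by
      rcases lt_or_ge p g.N with hp | hp
      · have := congrArg (g.wt p n).f h'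
        rwa [map_zero, map_sum, Finset.sum_eq_single p (fun w _ hw => g.wt_ne _ _ _ _ hw.symm)
          (fun hp' => absurd (Finset.mem_range.2 hp) hp'), g.wt_self] at this
      · exact g.wt_eq_zero p n hp _
    exact ⟨⟨f.1, fun p => g.F_succ (f.2 p) (h0 p)⟩, rfl⟩
  · refine ⟨⟨fun p => (g.wt p n).f v, fun p => g.wt_mem_F p n v⟩, (g.symb_apply n _).trans ?_⟩
    simp only [g.wt_self, g.sum_wt]

/-- Splitting off the first entry identifies the Rees complex `rees 0` with the direct sum of `A`
and `rees 1`, and cohomology respects this decomposition. -/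
theorem single_add_shift (n : ℕ) (v : ((g.rees 0).H n).V) :
    (g.single.onH n).f ((g.first.onH n).f v) + (g.shift.onH n).f ((g.drop.onH n).f v) = v := by
  obtain ⟨v, rfl⟩ := (g.rees 0).hcls_surjective n v
  simp only [Hom.onH_hcls]
  rw [← map_add]
  refine congrArg _ (Subtype.ext (Subtype.ext (funext fun p => ?_)))
  cases p with
  | zero => exact add_zero _
  | succ p => exact zero_add _

/-- Shifting sequences to the left. -/
def left : Hom (g.rees 0) (g.rees 0) where
  f n := (g.incl.f n).comp (g.drop.f n)
  comm _ _ := rfl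

theorem left_pow (n R : ℕ) (v : LinearMap.ker ((g.rees 0).d n).f) :
    ∃ v' : LinearMap.ker ((g.rees 0).d n).f, (∀ p, v'.1.1 p = v.1.1 (p + R)) ∧
      ((g.left.onH n).f ^ R) ((g.rees 0).hcls n v) = (g.rees 0).hcls n v' := by
  induction R generalizing v with
  | zero => exact ⟨v, fun _ => rfl, rfl⟩
  | succ R ih =>
    obtain ⟨v', h1, h2⟩ := ih (g.left.onZ n v)
    refine ⟨v', fun p => (h1 p).trans rfl, ?_⟩
    rw [pow_succ, Module.End.mul_apply, Hom.onH_hcls, h2]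

/-- After `N` shifts all entries have weights at least `N`, and hence are zero. -/
theorem left_nilpotent (n : ℕ) (v : ((g.rees 0).H n).V) : ((g.left.onH n).f ^ g.N) v = 0 := by
  obtain ⟨v, rfl⟩ := (g.rees 0).hcls_surjective n v
  obtain ⟨v', e1, e2⟩ := g.left_pow n g.N v
  have : v' = 0 := Subtype.ext <| Subtype.ext <| funext fun p =>
    (e1 p).trans (g.F_top (Nat.le_add_left _ _) (v.1.2 (p + g.N)))
  exact e2.trans ((congrArg _ this).trans (map_zero _))

/-- The modules of the first page of the exact couple below. -/
def coupleE : ℕ → GKMod P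
  | 0 => A.H 0
  | n + 1 => (g.gr.H n).prod (A.H (n + 1))

/-- The morphism on a direct sum given by two morphisms. -/
def coprodHom {X Y Z : GKMod P} (f : GKMod.Hom X Z) (f' : GKMod.Hom Y Z) :
    GKMod.Hom (X.prod Y) Z where
  f := LinearMap.coprod f.f f'.f
  map_ρ x v := by
    change f.f (X.ρ x v.1) + f'.f (Y.ρ x v.2) = Z.ρ x (f.f v.1 + f'.f v.2)
    rw [f.map_ρ, f'.map_ρ, map_add]
  map_σ m v := by
    change f.f (X.σ m v.1) + f'.f (Y.σ m v.2) = Z.σ m (f.f v.1 + f'.f v.2)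
    rw [f.map_σ, f'.map_σ, map_add]

/-- The third map of the exact couple below. -/
def coupleK (δ : ∀ n, GKMod.Hom (g.gr.H n) ((g.rees 1).H (n + 1))) :
    ∀ n, GKMod.Hom (g.coupleE n) ((g.rees 0).H n)
  | 0 => g.single.onH 0
  | n + 1 => coprodHom ((g.shift.onH (n + 1)).comp (δ n)) (g.single.onH (n + 1))

/-- The exact couple of the filtration of a complex by weights. -/
theorem exists_couple : ∃ c : ExactCouple P,
    c.E = g.coupleE ∧
    ∀ n (v : (c.D n).V), ((c.i n).f ^ g.N) v = 0 := by
  -- The starting point is the long exact sequence of `0 → rees 1 → rees 0 → gr → 0`. It relates two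
  -- different modules, which is why `rees 1` gets replaced by `rees 0 = A ⊕ rees 1`.
  choose δ hδ using exists_connecting g.incl g.symb g.incl_symb_exact
  have hr := fun n => exact_right g.incl g.symb g.incl_symb_exact n (δ n) (hδ n)
  have hm := exact_mid g.incl g.symb g.incl_symb_exact
  have h1 := Hom.onH_leftInverse g.shift g.drop fun _ _ => rfl
  have h2 := Hom.onH_leftInverse g.single g.first fun _ _ => rfl
  have h3 := Hom.onH_comp_zero g.single g.drop fun _ _ => rfl
  have h4 := Hom.onH_comp_zero g.shift g.first fun _ _ => rfl
  have hl : ∀ n v, (g.left.onH n).f v = (g.incl.onH n).f ((g.drop.onH n).f v) := fun n v => by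
    obtain ⟨v, rfl⟩ := (g.rees 0).hcls_surjective n v
    rfl
  -- The endomorphism `left` first drops the entry in `A` and then includes `rees 1` into `rees 0`.
  -- Its cokernel is that of the inclusion, while its kernel acquires the extra summand `H(A)`. This
  -- explains the second summand of `coupleE`.
  refine ⟨⟨(g.rees 0).H, g.coupleE, g.left.onH,
    fun n => (GKMod.inl _ _).comp (g.symb.onH n), g.coupleK δ, ?_, ?_, ?_, ?_⟩, rfl, ?_⟩
  · intro n v
    have e1 : ((GKMod.inl (g.gr.H n) (A.H (n + 1))).comp (g.symb.onH n)).f v = 0 ↔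
        v ∈ LinearMap.range (g.incl.onH n).f := by
      rw [hm]
      exact ⟨fun h => congrArg Prod.fst h, fun h => Prod.ext h rfl⟩
    refine e1.trans ?_
    constructor
    · rintro ⟨w, rfl⟩
      exact ⟨(g.shift.onH n).f w, by rw [hl, h1]⟩
    · rintro ⟨w, rfl⟩
      exact ⟨_, (hl n w).symm⟩
  · rintro n ⟨e, a⟩
    constructor
    · intro h
      have h' : (g.shift.onH (n + 1)).f ((δ n).f e) + (g.single.onH (n + 1)).f a = 0 := h
      have e1 := congrArg (g.drop.onH (n + 1)).f h'
      rw [map_add, h1, h3, add_zero, map_zero] at e1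
      have e2 := congrArg (g.first.onH (n + 1)).f h'
      rw [map_add, h2, h4, zero_add, map_zero] at e2
      obtain ⟨w, hw⟩ : e ∈ LinearMap.range (g.symb.onH n).f := by
        rw [(hr n).1]; exact e1
      exact ⟨w, Prod.ext hw e2.symm⟩
    · rintro ⟨w, hw⟩
      have e1 : (g.symb.onH n).f w = e := congrArg Prod.fst hw
      have e2 : (0 : (A.H (n + 1)).V) = a := congrArg Prod.snd hw
      change (g.shift.onH (n + 1)).f ((δ n).f e) + (g.single.onH (n + 1)).f a = 0
      have e3 : e ∈ LinearMap.ker (δ n).f := by rw [← (hr n).1]; exact ⟨w, e1⟩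
      rw [LinearMap.mem_ker.1 e3, ← e2, map_zero, map_zero, add_zero]
  · intro n v
    rw [hl]
    cases n with
    | zero =>
      constructor
      · intro h
        -- In degree 0 no connecting morphism enters, and the kernel of `left` is just `H^0(A)`.
        have e1 := Hom.onH_zero_injective g.incl (g.incl_symb_exact 0).1 _ h
        have e2 := g.single_add_shift 0 v
        rw [e1, map_zero, add_zero] at e2
        exact ⟨_, e2⟩
      · rintro ⟨w, rfl⟩
        exact (congrArg (g.incl.onH 0).f (h3 0 w)).trans (map_zero _)
    | succ n =>
      constructor
      · intro h
        obtain ⟨e, he⟩ : (g.drop.onH (n + 1)).f v ∈ LinearMap.range (δ n).f := by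
          rw [(hr n).2]; exact h
        refine ⟨(e, (g.first.onH (n + 1)).f v), ?_⟩
        change (g.shift.onH (n + 1)).f ((δ n).f e) +
          (g.single.onH (n + 1)).f ((g.first.onH (n + 1)).f v) = v
        rw [he]
        exact (add_comm _ _).trans (g.single_add_shift (n + 1) v)
      · rintro ⟨⟨e, a⟩, rfl⟩
        change (g.incl.onH (n + 1)).f ((g.drop.onH (n + 1)).f
          ((g.shift.onH (n + 1)).f ((δ n).f e) + (g.single.onH (n + 1)).f a)) = 0
        have e3 : (δ n).f e ∈ LinearMap.ker (g.incl.onH (n + 1)).f := by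
          rw [← (hr n).2]; exact ⟨e, rfl⟩
        rw [map_add, h1, h3, add_zero]
        exact e3
  · intro v h
    have h' : (g.single.onH 0).f v = 0 := h
    have e1 := congrArg (g.first.onH 0).f h'
    exact (h2 0 v).symm.trans (e1.trans (map_zero _))
  · exact g.left_nilpotent

/-- The cohomology of a filtered complex and that of the associated graded complex have the same
Euler characteristic. -/
theorem euler_eq {𝓛 : AbSubcat P} (hA : ∀ q, 𝓛.mem (A.H q)) (hG : ∀ q, 𝓛.mem (g.gr.H q)) (n : ℕ)
    (hn : ∀ m, n ≤ m → Subsingleton (A.C m).V) :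
    ∑ q ∈ Finset.range n, (-1 : ℤ) ^ q • K0.cls 𝓛 (A.H q) (hA q) =
      ∑ q ∈ Finset.range n, (-1 : ℤ) ^ q • K0.cls 𝓛 (g.gr.H q) (hG q) := by
  obtain ⟨⟨D, E, i, j, k, x1, x2, x3, x4⟩, hE, hi⟩ := g.exists_couple
  dsimp only at hE hi
  subst hE
  have hAn : ∀ m, n ≤ m → Subsingleton (A.H m).V := fun m hm => by
    have := hn m hm
    exact (A.hcls_surjective m).subsingleton
  have hGn : ∀ m, n ≤ m → Subsingleton (g.gr.H m).V := fun m hm => by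
    have : Subsingleton (g.gr.C m).V := hn m hm
    exact (g.gr.hcls_surjective m).subsingleton
  have h := ExactCouple.euler_eq_zero (𝓛 := 𝓛) g.N ⟨D, _, i, j, k, x1, x2, x3, x4⟩ (fun q => by
    cases q with
    | zero => exact hA 0
    | succ q => exact GKMod.prod_mem (hG q) (hA (q + 1))) hi (n + 1) (fun m hm => by
    cases m with
    | zero => omega
    | succ m =>
      have := hGn m (by omega)
      have := hAn (m + 1) (by omega)
      exact inferInstanceAs (Subsingleton ((g.gr.H m).V × (A.H (m + 1)).V)))
  -- Degree `n + 1` of the couple holds `H^n(gr)` beside `H^{n+1}(A)`. Because of this shift the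
  -- vanishing sum is the difference of the two Euler characteristics.
  rw [Finset.sum_range_succ'] at h
  have h5 : ∀ q, K0.cls 𝓛 ((g.gr.H q).prod (A.H (q + 1))) (GKMod.prod_mem (hG q) (hA (q + 1))) =
      K0.cls 𝓛 (g.gr.H q) (hG q) + K0.cls 𝓛 (A.H (q + 1)) (hA (q + 1)) := fun q =>
    GKMod.cls_prod (hG q) (hA (q + 1))
  have h6 : ∑ q ∈ Finset.range n, (-1 : ℤ) ^ (q + 1) • (K0.cls 𝓛 (g.gr.H q) (hG q) +
      K0.cls 𝓛 (A.H (q + 1)) (hA (q + 1))) + (-1 : ℤ) ^ 0 • K0.cls 𝓛 (A.H 0) (hA 0) = 0 := by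
    rw [← h]
    congr 1
    refine Finset.sum_congr rfl fun q _ => ?_
    rw [← h5]
    rfl
  have := hAn n le_rfl
  have h7 := Finset.sum_range_succ' (fun q => (-1 : ℤ) ^ q • K0.cls 𝓛 (A.H q) (hA q)) n
  rw [Finset.sum_range_succ, K0.cls_zero 𝓛 (A.H n), smul_zero, add_zero] at h7
  rw [h7, ← sub_eq_zero, ← h6]
  simp only [smul_add, Finset.sum_add_distrib, pow_succ, mul_neg_one, neg_smul,
    Finset.sum_neg_distrib]
  abel

end Grading

end Cpx

/-! ## Solvability and nilpotency -/

section Solvable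

variable {L : Type} [LieRing L] [LieAlgebra ℂ L]

/-- Subspaces of a Lie algebra whose iterated brackets eventually vanish. -/
inductive BracketSolvable : Submodule ℂ L → Prop
  | bot : BracketSolvable ⊥
  | step (W W' : Submodule ℂ L) (h : ∀ x ∈ W, ∀ y ∈ W, ⁅x, y⁆ ∈ W') : BracketSolvable W' →
      BracketSolvable W

/-- The derived series of `b`, viewed inside `L`, is a chain of the required kind; the induction
climbs it from its last, zero term. -/
theorem BracketSolvable.of_isSolvable (b : LieSubalgebra ℂ L) (h : LieAlgebra.IsSolvable b) :
    BracketSolvable b.toSubmodule := by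
  obtain ⟨k, hk⟩ := (LieAlgebra.isSolvable_iff ℂ b).1 h
  have key : ∀ j ≤ k, BracketSolvable
      ((LieAlgebra.derivedSeries ℂ b (k - j)).toSubmodule.map b.toSubmodule.subtype) := by
    intro j hj
    induction j with
    | zero => rw [Nat.sub_zero, hk]; simpa using BracketSolvable.bot
    | succ j ih =>
      refine .step _ _ ?_ (ih (by omega))
      rintro _ ⟨x, hx, rfl⟩ _ ⟨y, hy, rfl⟩
      refine ⟨(⁅(show b from x), (show b from y)⁆ : b), ?_, rfl⟩
      rw [show k - j = k - (j + 1) + 1 by omega, LieAlgebra.derivedSeries_def,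
        LieAlgebra.derivedSeriesOfIdeal_succ]
      exact LieSubmodule.lie_mem_lie hx hy
  have h0 := key k le_rfl
  rw [Nat.sub_self, LieAlgebra.derivedSeries_def, LieAlgebra.derivedSeriesOfIdeal_zero] at h0
  simpa using h0

theorem BracketSolvable.isSolvable {W : Submodule ℂ L} (h : BracketSolvable W)
    (c : LieSubalgebra ℂ L) (hc : c.toSubmodule = W) : LieAlgebra.IsSolvable c := by
  -- The number `k` depends on `W` only: as soon as some derived term lies in `W`, it takes `k` more
  -- steps to reach zero. This uniformity in `j` is what the induction needs.
  have key : ∃ k, ∀ j, (∀ x ∈ LieAlgebra.derivedSeries ℂ c j, (x : L) ∈ W) →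
      LieAlgebra.derivedSeries ℂ c (j + k) = ⊥ := by
    clear hc
    induction h with
    | bot =>
      refine ⟨0, fun j hj => (LieSubmodule.eq_bot_iff _).2 fun x hx => Subtype.ext ?_⟩
      exact (Submodule.mem_bot ℂ).1 (hj x hx)
    | step W W' h _ ih =>
      obtain ⟨k, hk⟩ := ih
      refine ⟨k + 1, fun j hj => ?_⟩
      rw [show j + (k + 1) = j + 1 + k by omega]
      refine hk (j + 1) fun x hx => ?_
      rw [LieAlgebra.derivedSeries_def, LieAlgebra.derivedSeriesOfIdeal_succ,
        ← LieSubmodule.mem_toSubmodule, LieSubmodule.lieIdeal_oper_eq_linear_span'] at hx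
      induction hx using Submodule.span_induction with
      | zero => exact zero_mem _
      | add x y _ _ hx hy => exact add_mem hx hy
      | smul r x _ hx => exact W'.smul_mem r hx
      | mem x hx =>
        obtain ⟨a, ha, b, hb, rfl⟩ := hx
        exact h _ (hj a ha) _ (hj b hb)
  obtain ⟨k, hk⟩ := key
  refine LieAlgebra.IsSolvable.mk (R := ℂ) (k := 0 + k) (hk 0 fun x _ => ?_)
  rw [← hc]; exact x.2

/-- The elements of `L` whose bracket with `I` is contained in `I`. -/
def bracketNormalizer (I : Submodule ℂ L) : Submodule ℂ L where
  carrier := {x | ∀ y ∈ I, ⁅x, y⁆ ∈ I}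
  add_mem' ha hb y hy := by rw [add_lie]; exact add_mem (ha y hy) (hb y hy)
  zero_mem' y _ := by rw [zero_lie]; exact zero_mem _
  smul_mem' c x hx y hy := by rw [smul_lie]; exact I.smul_mem c (hx y hy)

theorem lie_mem_bracketNormalizer {I : Submodule ℂ L} {x y : L} (hx : x ∈ bracketNormalizer I)
    (hy : y ∈ bracketNormalizer I) : ⁅x, y⁆ ∈ bracketNormalizer I := fun z hz => by
  rw [lie_lie]
  exact sub_mem (hx _ (hy z hz)) (hy _ (hx z hz))

theorem lie_mem_sup {W W' I : Submodule ℂ L} (h : ∀ x ∈ W, ∀ y ∈ W, ⁅x, y⁆ ∈ W')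
    (hW : W ≤ bracketNormalizer I) (hI : I ≤ bracketNormalizer I) {x y : L} (hx : x ∈ W ⊔ I)
    (hy : y ∈ W ⊔ I) : ⁅x, y⁆ ∈ W' ⊔ I := by
  obtain ⟨a, ha, i, hi, rfl⟩ := Submodule.mem_sup.1 hx
  obtain ⟨c, hc, k, hk, rfl⟩ := Submodule.mem_sup.1 hy
  have h1 : ⁅a + i, c + k⁆ = ⁅a, c⁆ + (⁅a, k⁆ - ⁅c, i⁆ + ⁅i, k⁆) := by
    rw [add_lie, lie_add, lie_add, ← lie_skew c i]; abel
  rw [h1]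
  exact Submodule.add_mem_sup (h a ha c hc)
    (add_mem (sub_mem (hW ha k hk) (hW hc i hi)) (hI hi k hk))

/-- Modulo `I` the chain of `W` can be reused. Its members need not normalize `I`, so each of them
is cut down to the normalizer, which is closed under brackets. -/
theorem BracketSolvable.sup {W I : Submodule ℂ L} (hW : BracketSolvable W)
    (hI : BracketSolvable I) (hI' : I ≤ bracketNormalizer I) :
    BracketSolvable (W ⊓ bracketNormalizer I ⊔ I) := by
  induction hW with
  | bot => simpa using hI
  | step W W' h _ ih =>
    refine .step _ _ (fun x hx y hy => ?_) ih
    refine lie_mem_sup (W := W ⊓ bracketNormalizer I) (fun x hx y hy => ?_) inf_le_right hI' hx hy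
    exact ⟨h x hx.1 y hy.1, lie_mem_bracketNormalizer hx.2 hy.2⟩

/-- The sum of a subspace closed under brackets and of a subspace stable under it. -/
def supSubalgebra (W I : Submodule ℂ L) (h : ∀ x ∈ W, ∀ y ∈ W, ⁅x, y⁆ ∈ W)
    (hW : W ≤ bracketNormalizer I) (hI : I ≤ bracketNormalizer I) : LieSubalgebra ℂ L where
  toSubmodule := W ⊔ I
  lie_mem' hx hy := lie_mem_sup h hW hI hx hy

theorem isSolvable_supSubalgebra {W I : Submodule ℂ L} (h : ∀ x ∈ W, ∀ y ∈ W, ⁅x, y⁆ ∈ W)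
    (hW : W ≤ bracketNormalizer I) (hI : I ≤ bracketNormalizer I) (sW : BracketSolvable W)
    (sI : BracketSolvable I) : LieAlgebra.IsSolvable (supSubalgebra W I h hW hI) :=
  (sW.sup sI hI).isSolvable _ (by rw [inf_eq_left.2 hW]; rfl)

/-- A Borel subalgebra contains the solvable subalgebras normalizing it. -/
theorem IsBorel.mem_of_normalizes {b : LieSubalgebra ℂ L} (hb : IsBorel b) {s : L}
    (hs : ∀ y ∈ b, ⁅s, y⁆ ∈ b) : s ∈ b := by
  have h1 : ∀ x ∈ Submodule.span ℂ {s}, ∀ y ∈ Submodule.span ℂ {s}, ⁅x, y⁆ = 0 := by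
    intro x hx y hy
    obtain ⟨c, rfl⟩ := Submodule.mem_span_singleton.1 hx
    obtain ⟨d, rfl⟩ := Submodule.mem_span_singleton.1 hy
    simp
  have h2 : Submodule.span ℂ {s} ≤ bracketNormalizer b.toSubmodule := by
    rw [Submodule.span_singleton_le_iff_mem]; exact hs
  -- The line through `s` is abelian, so `b` together with `s` spans a solvable subalgebra, and
  -- maximality of `b` applies.
  have h3 := isSolvable_supSubalgebra (W := Submodule.span ℂ {s}) (I := b.toSubmodule)
    (fun x hx y hy => by rw [h1 x hx y hy]; exact zero_mem _) h2 (fun x hx y hy => b.lie_mem hx hy)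
    (.step _ ⊥ (fun x hx y hy => by rw [h1 x hx y hy]; exact zero_mem _) .bot)
    (.of_isSolvable b hb.1)
  exact hb.2 h3 (fun x hx => Submodule.mem_sup_right hx)
    (Submodule.mem_sup_left (Submodule.mem_span_singleton_self s))

/-- A Borel subalgebra contains the solvable subalgebras that it normalizes. -/
theorem IsBorel.le_of_normalizes {b : LieSubalgebra ℂ L} (hb : IsBorel b) {I : Submodule ℂ L}
    (hI : I ≤ bracketNormalizer I) (hs : BracketSolvable I)
    (h : b.toSubmodule ≤ bracketNormalizer I) : I ≤ b.toSubmodule := by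
  have h3 := isSolvable_supSubalgebra (fun x hx y hy => b.lie_mem hx hy) h hI
    (.of_isSolvable b hb.1) hs
  exact fun x hx => hb.2 h3 (fun x hx => Submodule.mem_sup_left hx) (Submodule.mem_sup_right hx)

/-- By Engel's theorem, a subspace closed under brackets consisting of nilpotent elements is
solvable. -/
theorem BracketSolvable.of_isNilpotent [FiniteDimensional ℂ L] (c : LieSubalgebra ℂ L)
    (h : ∀ x ∈ c, IsNilpotent (LieAlgebra.ad ℂ L x)) : BracketSolvable c.toSubmodule := by
  have : LieRing.IsNilpotent c := (LieAlgebra.isNilpotent_iff_forall (R := ℂ)).2 fun x =>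
    LieSubalgebra.isNilpotent_ad_of_isNilpotent_ad c (h x x.2)
  exact .of_isSolvable c inferInstance

end Solvable

/-! ### Generalized eigenspaces and a trace criterion for nilpotency. -/

section LinearAlgebra

open Module.End

variable {V : Type} [AddCommGroup V] [Module ℂ V] [FiniteDimensional ℂ V]

/-- The endomorphism acting by `φ μ` on the generalized eigenspace of `a` with eigenvalue `μ`. -/
theorem exists_end_on_eigenspaces (a : Module.End ℂ V) (φ : ℂ → ℂ) : ∃ D : Module.End ℂ V,
    (∀ μ, ∀ v ∈ a.maxGenEigenspace μ, D v = φ μ • v) ∧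
    ∀ W : Submodule ℂ V, (∀ w ∈ W, a w ∈ W) → ∀ w ∈ W, D w ∈ W := by
  classical
  have hI := DirectSum.isInternal_submodule_of_iSupIndep_of_iSup_eq_top
    a.independent_maxGenEigenspace (iSup_maxGenEigenspace_eq_top a)
  let e := LinearEquiv.ofBijective (DirectSum.coeLinearMap fun μ => a.maxGenEigenspace μ) hI
  let D : Module.End ℂ V := DirectSum.toModule ℂ ℂ V
    (fun μ => φ μ • (a.maxGenEigenspace μ).subtype) ∘ₗ e.symm.toLinearMap
  have hD : ∀ μ, ∀ v ∈ a.maxGenEigenspace μ, D v = φ μ • v := fun μ v hv => by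
    have : e.symm v = DirectSum.lof ℂ ℂ (fun μ => a.maxGenEigenspace μ) μ ⟨v, hv⟩ := by
      rw [LinearEquiv.symm_apply_eq]
      exact (DirectSum.coeLinearMap_lof (fun μ => a.maxGenEigenspace μ) μ ⟨v, hv⟩).symm
    change DirectSum.toModule ℂ ℂ V _ (e.symm v) = _
    rw [this, DirectSum.toModule_lof]
    rfl
  refine ⟨D, hD, fun W hW w hw => ?_⟩
  -- A stable subspace is the sum of its intersections with the generalized eigenspaces, on each of
  -- which `D` is a scalar.
  rw [Submodule.eq_iSup_inf_genEigenspace ⊤ hW (iSup_maxGenEigenspace_eq_top a)] at hw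
  induction hw using Submodule.iSup_induction' with
  | zero => rw [map_zero]; exact zero_mem _
  | add x y _ _ hx hy => rw [map_add]; exact add_mem hx hy
  | mem μ x hx => rw [hD μ x hx.2]; exact W.smul_mem _ hx.1

/-- The trace of `D T a`, where `D` acts by conjugate eigenvalues and `T` commutes with `a`. -/
theorem trace_conj (a D T : Module.End ℂ V)
    (hD : ∀ μ, ∀ v ∈ a.maxGenEigenspace μ, D v = starRingEnd ℂ μ • v) (hT : Commute a T)
    (hpos : ∀ W : Submodule ℂ V, W ≠ ⊥ → ∀ h : ∀ w ∈ W, T w ∈ W,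
      0 < (LinearMap.trace ℂ W (T.restrict h)).re)
    (h0 : LinearMap.trace ℂ V (D ∘ₗ T ∘ₗ a) = 0) : IsNilpotent a := by
  classical
  have hI := DirectSum.isInternal_submodule_of_iSupIndep_of_iSup_eq_top
    a.independent_maxGenEigenspace (iSup_maxGenEigenspace_eq_top a)
  have hfin : {μ | a.maxGenEigenspace μ ≠ ⊥}.Finite :=
    WellFoundedGT.finite_ne_bot_of_iSupIndep a.independent_maxGenEigenspace
  have ha := fun μ => a.mapsTo_maxGenEigenspace_of_comm (Commute.refl _) μ
  have hT' := fun μ => a.mapsTo_maxGenEigenspace_of_comm hT μ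
  have hDm : ∀ μ, ∀ v ∈ a.maxGenEigenspace μ, D v ∈ a.maxGenEigenspace μ := fun μ v hv => by
    rw [hD μ v hv]; exact Submodule.smul_mem _ _ hv
  have hm : ∀ μ, Set.MapsTo (D ∘ₗ T ∘ₗ a) (a.maxGenEigenspace μ) (a.maxGenEigenspace μ) :=
    fun μ v hv => hDm μ _ (hT' μ (ha μ hv))
  rw [LinearMap.trace_eq_sum_trace_restrict' hI hfin hm] at h0
  -- On the generalized eigenspace of `μ` the operator `a - μ` is nilpotent and commutes with `T`,
  -- so `T a` has trace `μ` times that of `T`. The factor `D` contributes the conjugate of `μ`.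
  have key : ∀ μ, LinearMap.trace ℂ _ ((D ∘ₗ T ∘ₗ a).restrict (hm μ)) =
      (Complex.normSq μ : ℂ) * LinearMap.trace ℂ _ (T.restrict (hT' μ)) := fun μ => by
    have e1 : (D ∘ₗ T ∘ₗ a).restrict (hm μ) =
        starRingEnd ℂ μ • (T.restrict (hT' μ) ∘ₗ a.restrict (ha μ)) :=
      LinearMap.ext fun v => Subtype.ext (hD μ _ (hT' μ (ha μ v.2)))
    have hc : Commute (T.restrict (hT' μ)) (a.restrict (ha μ)) :=
      LinearMap.restrict_commute hT.symm _ _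
    rw [e1, map_smul, LinearMap.trace_comp_eq_mul_of_commute_of_isNilpotent μ hc
      (a.isNilpotent_restrict_maxGenEigenspace_sub_algebraMap μ), Complex.normSq_eq_conj_mul_self,
      smul_eq_mul, mul_assoc]
  simp only [key] at h0
  have h1 : ∀ μ ∈ hfin.toFinset, Complex.normSq μ *
      (LinearMap.trace ℂ _ (T.restrict (hT' μ))).re = 0 := by
    refine (Finset.sum_eq_zero_iff_of_nonneg fun μ hμ => ?_).1 ?_
    · exact mul_nonneg (Complex.normSq_nonneg μ)
        (hpos _ (hfin.mem_toFinset.1 hμ) (hT' μ)).le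
    · have := congrArg Complex.re h0
      rw [Complex.re_sum] at this
      simpa using this
  -- All terms of the vanishing sum are nonnegative, hence zero. As `T` has positive trace on
  -- nonzero stable subspaces, no nonzero eigenvalue remains.
  have h2 : ∀ μ, μ ≠ 0 → a.maxGenEigenspace μ = ⊥ := fun μ hμ => by
    by_contra hne
    have := h1 μ (hfin.mem_toFinset.2 hne)
    rcases mul_eq_zero.1 this with h | h
    · exact hμ (Complex.normSq_eq_zero.1 h)
    · exact (hpos _ hne (hT' μ)).ne' h
  have h3 : a.maxGenEigenspace 0 = ⊤ := by
    rw [← iSup_maxGenEigenspace_eq_top a]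
    refine le_antisymm (le_iSup _ 0) (iSup_le fun μ => ?_)
    rcases eq_or_ne μ 0 with rfl | hμ
    · exact le_rfl
    · rw [h2 μ hμ]; exact bot_le
  refine ⟨Module.finrank ℂ V, LinearMap.ext fun v => ?_⟩
  have hv : v ∈ a.maxGenEigenspace 0 := by rw [h3]; trivial
  rw [maxGenEigenspace_eq_genEigenspace_finrank, genEigenspace_nat, zero_smul, sub_zero] at hv
  exact hv
end LinearAlgebra

/-! ### Traces in Hermitian spaces. -/

section InnerProduct

variable {E : Type} [NormedAddCommGroup E] [InnerProductSpace ℂ E] [FiniteDimensional ℂ E]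

theorem exists_orthogonal_projection (W : Submodule ℂ E) : ∃ P : Module.End ℂ E,
    (∀ x, P x ∈ W) ∧ (∀ x ∈ W, P x = x) ∧ ∀ x, ∀ w ∈ W, inner ℂ w (x - P x) = 0 :=
  ⟨W.starProjection.toLinearMap, fun x => W.starProjection_apply_mem x,
    fun _ hx => Submodule.starProjection_eq_self_iff.2 hx,
    fun x w hw => (Submodule.mem_orthogonal _ _).1 (Submodule.sub_starProjection_mem_orthogonal x)
      w hw⟩

/-- In an orthonormal basis of `W` the trace is the sum of the diagonal entries `⟨e, T e⟩`, each
with positive real part. -/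
theorem re_trace_restrict_pos (T : Module.End ℂ E) (hT : ∀ f, f ≠ 0 → 0 < (inner ℂ f (T f)).re)
    (W : Submodule ℂ E) (hW : W ≠ ⊥) (h : ∀ w ∈ W, T w ∈ W) :
    0 < (LinearMap.trace ℂ W (T.restrict h)).re := by
  rw [LinearMap.trace_eq_sum_inner _ (stdOrthonormalBasis ℂ W), Complex.re_sum]
  have hd : 0 < Module.finrank ℂ W := by
    have := Submodule.nontrivial_iff_ne_bot.2 hW
    exact Module.finrank_pos
  refine Finset.sum_pos (fun i _ => ?_) ⟨⟨0, hd⟩, Finset.mem_univ _⟩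
  refine hT (stdOrthonormalBasis ℂ W i : W) fun h0 => ?_
  have h1 := (stdOrthonormalBasis ℂ W).orthonormal.ne_zero i
  exact h1 (Subtype.ext h0)

/-- The trace of `a* a` is the square of the Hilbert-Schmidt norm of `a`. -/
theorem re_trace_adjoint (a a' : Module.End ℂ E)
    (h : ∀ u v, inner ℂ (a u) v = inner ℂ u (a' v)) :
    0 ≤ (LinearMap.trace ℂ E (a' ∘ₗ a)).re ∧
      ((LinearMap.trace ℂ E (a' ∘ₗ a)).re = 0 → a = 0) := by
  have key : (LinearMap.trace ℂ E (a' ∘ₗ a)).re = ∑ i, ‖a (stdOrthonormalBasis ℂ E i)‖ ^ 2 := by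
    rw [LinearMap.trace_eq_sum_inner _ (stdOrthonormalBasis ℂ E), Complex.re_sum]
    refine Finset.sum_congr rfl fun i _ => ?_
    rw [LinearMap.comp_apply, ← h, inner_self_eq_norm_sq_to_K]
    norm_cast
  rw [key]
  refine ⟨Finset.sum_nonneg fun i _ => sq_nonneg _, fun h0 => ?_⟩
  rw [Finset.sum_eq_zero_iff_of_nonneg fun i _ => sq_nonneg _] at h0
  refine (stdOrthonormalBasis ℂ E).toBasis.ext fun i => ?_
  simpa using h0 i (Finset.mem_univ i)

end InnerProduct

/-! ### The Hermitian form on `𝔤`, and the Killing form. -/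

namespace ReductivePair

variable (R : ReductivePair)

theorem τ_tmul (c : ℂ) (x : R.g₀) : R.τ (c ⊗ₜ x) = (starRingEnd ℂ c) ⊗ₜ R.θ x := rfl

theorem τ_smul (c : ℂ) (y : R.g) : R.τ (c • y) = (starRingEnd ℂ) c • R.τ y := by
  induction y using TensorProduct.induction_on with
  | zero => simp
  | add a b ha hb => simp only [smul_add, map_add, ha, hb]
  | tmul d a => simp [τ, TensorProduct.smul_tmul']

theorem τ_τ (y : R.g) : R.τ (R.τ y) = y := by
  induction y using TensorProduct.induction_on with
  | zero => simp
  | add a b ha hb => simp only [map_add, ha, hb]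
  | tmul d a => simp [τ_tmul, R.θ_θ]

theorem BC_τ (x y : R.g) : R.BC (R.τ x) (R.τ y) = starRingEnd ℂ (R.BC x y) := by
  induction x using TensorProduct.induction_on with
  | zero => simp
  | add a b ha hb => simp only [map_add, LinearMap.add_apply, ha, hb]
  | tmul c a =>
    induction y using TensorProduct.induction_on with
    | zero => simp
    | add x y hx hy => simp only [map_add, hx, hy]
    | tmul d b => simp [τ_tmul, BC_tmul, R.B_θ]

theorem τ_lie (x y : R.g) : R.τ ⁅x, y⁆ = ⁅R.τ x, R.τ y⁆ := by
  have e0 : ∀ u : R.g, ⁅u, (0 : R.g)⁆ = 0 := fun u => lie_zero u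
  have e1 : ∀ u v w : R.g, ⁅u, v + w⁆ = ⁅u, v⁆ + ⁅u, w⁆ := fun u v w => lie_add u v w
  induction x using TensorProduct.induction_on with
  | zero => simp
  | add a b ha hb => simp only [add_lie, map_add, ha, hb]
  | tmul c a =>
    induction y using TensorProduct.induction_on with
    | zero => simp [e0]
    | add x y hx hy => simp only [e1, map_add, hx, hy]
    | tmul d b => simp [τ_tmul]

theorem τ_AdC (k : R.K) (x : R.g) : R.τ (R.AdC k x) = R.AdC k (R.τ x) := by
  induction x using TensorProduct.induction_on with
  | zero => simp
  | add a b ha hb => simp only [map_add, ha, hb]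
  | tmul c a => simp [τ_tmul, AdC_tmul, R.θ_Ad]

/-- The Hermitian form `-B(τ x, y)`. -/
def innerCore : InnerProductSpace.Core ℂ R.g where
  inner x y := -R.BC (R.τ x) y
  conj_inner_symm x y := by
    rw [map_neg, ← R.BC_τ, R.τ_τ, R.BC_symm]
  re_inner_nonneg x := by
    obtain ⟨a, b, rfl⟩ := R.exists_re_im x
    have e : R.B (R.θ b) a = R.B (R.θ a) b := by rw [R.B_symm, ← R.B_θ, R.θ_θ]
    have h1 : R.BC (R.τ (1 ⊗ₜ a + Complex.I ⊗ₜ b)) (1 ⊗ₜ a + Complex.I ⊗ₜ b) =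
        ((R.B a (R.θ a) + R.B b (R.θ b) : ℝ) : ℂ) := by
      simp only [τ, map_add, TensorProduct.map_tmul, LinearMap.add_apply, BC_tmul]
      simp [e, R.B_symm (R.θ a) a, R.B_symm (R.θ b) b]
    have h2 : (-R.BC (R.τ (1 ⊗ₜ a + Complex.I ⊗ₜ b)) (1 ⊗ₜ a + Complex.I ⊗ₜ b)).re =
        -(R.B a (R.θ a) + R.B b (R.θ b)) := by
      rw [h1, ← Complex.ofReal_neg, Complex.ofReal_re]
    refine le_of_le_of_eq ?_ h2.symm
    have := (R.B_self_θ a).1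
    have := (R.B_self_θ b).1
    linarith
  add_left x y z := by simp only [map_add, LinearMap.add_apply, neg_add]
  smul_left x y r := by simp only [R.τ_smul, map_smul, LinearMap.smul_apply, smul_eq_mul, mul_neg]
  definite x h := R.eq_zero_of_BC_τ x (by rw [R.BC_symm]; exact neg_eq_zero.1 h)

/-- Orthogonal projections. -/
theorem exists_projection (W : Submodule ℂ R.g) : ∃ P : Module.End ℂ R.g,
    (∀ x, P x ∈ W) ∧ (∀ x ∈ W, P x = x) ∧ ∀ x, ∀ w ∈ W, R.BC (R.τ w) (x - P x) = 0 := by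
  letI := R.innerCore.toNormedAddCommGroup
  letI := InnerProductSpace.ofCore R.innerCore.toCore
  obtain ⟨P, h1, h2, h3⟩ := exists_orthogonal_projection W
  exact ⟨P, h1, h2, fun x w hw => neg_eq_zero.1 (h3 x w hw)⟩

theorem re_trace_restrict_pos (T : Module.End ℂ R.g)
    (hT : ∀ f, f ≠ 0 → (R.BC (R.τ f) (T f)).re < 0)
    (W : Submodule ℂ R.g) (hW : W ≠ ⊥) (h : ∀ w ∈ W, T w ∈ W) :
    0 < (LinearMap.trace ℂ W (T.restrict h)).re := by
  letI := R.innerCore.toNormedAddCommGroup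
  letI := InnerProductSpace.ofCore R.innerCore.toCore
  refine AlgChar.re_trace_restrict_pos T (fun f hf => ?_) W hW h
  change 0 < (-R.BC (R.τ f) (T f)).re
  rw [Complex.neg_re, neg_pos]
  exact hT f hf

/-- For the Hermitian form, this says that the adjoint of `ad x` is `-ad (τ x)`. -/
theorem BC_τ_lie (x u v : R.g) : R.BC (R.τ ⁅x, u⁆) v = -R.BC (R.τ u) ⁅R.τ x, v⁆ := by
  rw [R.τ_lie, R.BC_lie]

/-- Since `-ad (τ x)` is the adjoint of `ad x`, the trace is minus the square of the Hilbert-Schmidt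
norm of `ad x`. -/
theorem re_trace_ad (x : R.g) :
    (LinearMap.trace ℂ R.g (LieAlgebra.ad ℂ R.g (R.τ x) ∘ₗ LieAlgebra.ad ℂ R.g x)).re ≤ 0 ∧
    ((LinearMap.trace ℂ R.g (LieAlgebra.ad ℂ R.g (R.τ x) ∘ₗ LieAlgebra.ad ℂ R.g x)).re = 0 →
      LieAlgebra.ad ℂ R.g x = 0) := by
  letI := R.innerCore.toNormedAddCommGroup
  letI := InnerProductSpace.ofCore R.innerCore.toCore
  have h := re_trace_adjoint (E := R.g) (LieAlgebra.ad ℂ R.g x) (-LieAlgebra.ad ℂ R.g (R.τ x))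
    fun u v => by
      change -R.BC (R.τ ⁅x, u⁆) v = -R.BC (R.τ u) (-⁅R.τ x, v⁆)
      rw [R.BC_τ_lie, map_neg]
  rw [LinearMap.neg_comp, map_neg, Complex.neg_re] at h
  exact ⟨neg_nonneg.1 h.1, fun h0 => h.2 (by rw [h0, neg_zero])⟩

theorem BC_nondegenerate : R.BC.Nondegenerate := by
  refine ⟨fun x h => R.eq_zero_of_BC_τ x (h _), fun x h => R.eq_zero_of_BC_τ x ?_⟩
  rw [R.BC_symm]; exact h _

/-- Two operators adjoint to each other and preserving a subspace commute with the orthogonal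
projection. -/
theorem projection_comm {W : Submodule ℂ R.g} {P : Module.End ℂ R.g} (h1 : ∀ x, P x ∈ W)
    (h2 : ∀ x ∈ W, P x = x) (h3 : ∀ x, ∀ w ∈ W, R.BC (R.τ w) (x - P x) = 0)
    (a a' : Module.End ℂ R.g) (haa : ∀ u v, R.BC (R.τ (a' u)) v = R.BC (R.τ u) (a v))
    (ha : ∀ w ∈ W, a w ∈ W) (ha' : ∀ w ∈ W, a' w ∈ W) (x : R.g) : P (a x) = a (P x) := by
  -- The difference lies in `W`. It is also orthogonal to `W`, because `a` preserves the orthogonal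
  -- complement when its adjoint `a'` preserves `W`. Hence it is zero.
  have h4 : ∀ w ∈ W, R.BC (R.τ w) (a (P x) - P (a x)) = 0 := fun w hw => by
    have e : a (P x) - P (a x) = (a x - P (a x)) - a (x - P x) := by rw [map_sub]; abel
    rw [e, map_sub, h3 _ w hw, ← haa, h3 _ _ (ha' w hw), sub_zero]
  have h5 : a (P x) - P (a x) = 0 := by
    refine R.eq_zero_of_BC_τ _ ?_
    rw [R.BC_symm]
    exact h4 _ (sub_mem (ha _ (h1 x)) (h1 _))
  exact (sub_eq_zero.1 h5).symm

theorem re_BC_τ_self (f : R.g) : (R.BC (R.τ f) f).re ≤ 0 ∧ ((R.BC (R.τ f) f).re = 0 → f = 0) := by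
  letI := R.innerCore.toNormedAddCommGroup
  letI := InnerProductSpace.ofCore R.innerCore.toCore
  have h1 := inner_self_nonneg (𝕜 := ℂ) (x := f)
  have h2 := re_inner_self_nonpos (𝕜 := ℂ) (x := f)
  change 0 ≤ (-R.BC (R.τ f) f).re at h1
  change (-R.BC (R.τ f) f).re ≤ 0 ↔ _ at h2
  rw [Complex.neg_re] at h1 h2
  exact ⟨by linarith, fun h => h2.1 (by rw [h, neg_zero])⟩

theorem BC_τ_comm (x y : R.g) : R.BC (R.τ x) y = starRingEnd ℂ (R.BC (R.τ y) x) := by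
  rw [← R.BC_τ, R.τ_τ, R.BC_symm]

/-- The center of `𝔤`. -/
def center : Submodule ℂ R.g := LinearMap.ker (LieAlgebra.ad ℂ R.g : R.g →ₗ[ℂ] Module.End ℂ R.g)

theorem mem_center {z : R.g} : z ∈ R.center ↔ ∀ x : R.g, ⁅z, x⁆ = 0 :=
  ⟨fun h x => LinearMap.congr_fun (LinearMap.mem_ker.1 h) x,
    fun h => LinearMap.mem_ker.2 (LinearMap.ext h)⟩

theorem lie_center {z : R.g} (hz : z ∈ R.center) (x : R.g) : ⁅x, z⁆ = 0 := by
  rw [← lie_skew, R.mem_center.1 hz, neg_zero]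

theorem τ_mem_center {z : R.g} (hz : z ∈ R.center) : R.τ z ∈ R.center :=
  R.mem_center.2 fun x => by rw [← R.τ_τ x, ← R.τ_lie, R.mem_center.1 hz, map_zero]

/-- On the orthogonal complement of the center, the invariant form is the trace form weighted by
an operator that commutes with the adjoint representation and is positive for the Hermitian
form. -/
theorem exists_inverse_killing : ∃ T : Module.End ℂ R.g, (∀ x y : R.g, T ⁅x, y⁆ = ⁅x, T y⁆) ∧
    (∀ x y, R.BC (T x) y = R.BC x (T y)) ∧ (∀ f, f ≠ 0 → (R.BC (R.τ f) (T f)).re < 0) ∧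
    ∀ f, (∀ z ∈ R.center, R.BC f z = 0) → ∀ y, killingForm ℂ R.g (T f) y = R.BC f y := by
  -- The operator `S` represents the Killing form through `B`. It is positive semidefinite for the
  -- Hermitian form, and only on the center does this degenerate; adding the orthogonal projection
  -- `P` onto the center makes it definite.
  let S : Module.End ℂ R.g :=
    (LinearMap.BilinForm.toDual R.BC R.BC_nondegenerate).symm.toLinearMap ∘ₗ killingForm ℂ R.g
  have hS : ∀ x y, R.BC (S x) y = killingForm ℂ R.g x y := fun x y =>
    LinearMap.BilinForm.apply_toDual_symm_apply (hB := R.BC_nondegenerate) _ _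
  have hK : ∀ x y, killingForm ℂ R.g x y = killingForm ℂ R.g y x := LieModule.traceForm_comm ℂ R.g R.g
  have nd : ∀ x x' : R.g, (∀ y, R.BC x y = R.BC x' y) → x = x' := fun x x' h =>
    sub_eq_zero.1 (R.BC_nondegenerate.1 _ fun y => by
      rw [map_sub, LinearMap.sub_apply, h, sub_self])
  obtain ⟨P, h1, h2, h3⟩ := R.exists_projection R.center
  have hP0 : ∀ v, (∀ w ∈ R.center, R.BC (R.τ w) v = 0) → P v = 0 := fun v hv => by
    refine R.eq_zero_of_BC_τ _ ?_
    have := h3 v _ (h1 v)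
    rw [map_sub, hv _ (h1 v), zero_sub, neg_eq_zero] at this
    rw [R.BC_symm, this]
  have hPl : ∀ x y : R.g, P ⁅x, y⁆ = 0 := fun x y => hP0 _ fun w hw => by
    rw [← neg_eq_zero, ← R.BC_lie, R.lie_center (R.τ_mem_center hw), map_zero, LinearMap.zero_apply]
  have hlP : ∀ x y : R.g, ⁅x, P y⁆ = 0 := fun x y => R.lie_center (h1 y) x
  have hPs : ∀ x y, R.BC (P x) y = R.BC (P x) (P y) := fun x y => by
    have := h3 y (R.τ (P x)) (R.τ_mem_center (h1 x))
    rwa [R.τ_τ, map_sub, sub_eq_zero] at this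
  have hSl : ∀ x y : R.g, S ⁅x, y⁆ = ⁅x, S y⁆ := fun x y => nd _ _ fun z => by
    rw [hS, R.BC_lie, hS, ← lie_skew, map_neg, LinearMap.neg_apply]
    exact congrArg _ (LieModule.traceForm_apply_lie_apply ℂ R.g R.g y x z)
  have neg : ∀ v, v ≠ 0 → (R.BC (R.τ v) ((S + P) v)).re < 0 := fun v hv => by
    have e1 : R.BC (R.τ v) (S v) = LinearMap.trace ℂ R.g
        (LieAlgebra.ad ℂ R.g (R.τ v) ∘ₗ LieAlgebra.ad ℂ R.g v) := by
      rw [R.BC_symm, hS, hK]; rfl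
    have e2 : (R.BC (R.τ v) (P v)).re = (R.BC (R.τ (P v)) (P v)).re := by
      have := h3 v _ (h1 v)
      rw [map_sub, sub_eq_zero] at this
      rw [R.BC_τ_comm, this, Complex.conj_re]
    have e3 := R.re_trace_ad v
    have e4 := R.re_BC_τ_self (P v)
    rw [LinearMap.add_apply, map_add, Complex.add_re, e1, e2]
    refine lt_of_le_of_ne (by linarith [e3.1, e4.1]) fun h0 => hv ?_
    have h5 := e3.2 (by linarith [e3.1, e4.1])
    rw [← h2 v (LinearMap.mem_ker.2 h5)]
    exact e4.2 (by linarith [e3.1, e4.1])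
  have inj : Function.Injective (S + P) := (injective_iff_map_eq_zero (S + P)).2 fun v hv => by
    by_contra hne
    have := neg v hne
    rw [hv, map_zero, Complex.zero_re] at this
    exact lt_irrefl _ this
  -- The operator sought is the inverse of `S + P`. It inherits symmetry, positivity and
  -- compatibility with brackets.
  let e := LinearEquiv.ofInjectiveEndo (S + P) inj
  have he : ∀ x, (S + P) (e.symm x) = x := fun x => e.apply_symm_apply x
  have he' : ∀ x, S (e.symm x) + P (e.symm x) = x := he
  refine ⟨e.symm.toLinearMap, fun x y => inj ?_, fun x y => ?_, fun f hf => ?_, fun f hf y => ?_⟩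
  · change (S + P) (e.symm ⁅x, y⁆) = (S + P) ⁅x, e.symm y⁆
    have h7 : ⁅x, y⁆ = ⁅x, S (e.symm y)⁆ + ⁅x, P (e.symm y)⁆ :=
      (congrArg (fun v : R.g => ⁅x, v⁆) (he' y).symm).trans (lie_add x _ _)
    rw [hlP, add_zero] at h7
    rw [he, LinearMap.add_apply, hSl, hPl, add_zero, h7]
  · change R.BC (e.symm x) y = R.BC x (e.symm y)
    conv_lhs => rw [← he' y]
    conv_rhs => rw [← he' x]
    rw [map_add, map_add, LinearMap.add_apply, R.BC_symm _ (S (e.symm y)), hS, hS, hK,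
      R.BC_symm _ (P (e.symm y)), hPs (e.symm y) (e.symm x), hPs (e.symm x) (e.symm y),
      R.BC_symm (P (e.symm x))]
  · change (R.BC (R.τ f) (e.symm f)).re < 0
    have hg : e.symm f ≠ 0 := fun h => hf (by rw [← he f, h, map_zero])
    have := neg _ hg
    rwa [he, R.BC_τ_comm, Complex.conj_re] at this
  · change killingForm ℂ R.g (e.symm f) y = _
    -- Write `g` for `e.symm f`. Then `P g = f - S g` is central and orthogonal to the center: `f`
    -- by assumption, and `S g` because central elements lie in the radical of the Killing form.
    have h5 : P (e.symm f) = 0 := by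
      refine R.eq_zero_of_BC_τ _ ?_
      rw [R.BC_symm]
      have hw := R.τ_mem_center (h1 (e.symm f))
      have h6 : P (e.symm f) = f - S (e.symm f) := by rw [eq_sub_iff_add_eq, add_comm, he']
      have h7 : R.BC (R.τ (P (e.symm f))) (f - S (e.symm f)) = 0 := by
        rw [map_sub, R.BC_symm _ f, hf _ hw, R.BC_symm, hS, hK, zero_sub, neg_eq_zero]
        change LinearMap.trace ℂ R.g (LieAlgebra.ad ℂ R.g _ ∘ₗ LieAlgebra.ad ℂ R.g _) = 0
        rw [show LieAlgebra.ad ℂ R.g (R.τ (P (e.symm f))) = 0 from LinearMap.mem_ker.1 hw,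
          LinearMap.zero_comp, map_zero]
      rwa [← h6] at h7
    have h6 := he' f
    rw [h5, add_zero] at h6
    rw [← hS, h6]

end ReductivePair

/-! ### Nilpotency of the elements of the nilpotent radical. -/

namespace ReductivePair

variable (R : ReductivePair)

/-- Eigenvalues add up under brackets of generalized eigenspaces, and complex conjugation is
additive. -/
theorem eigenspace_derivation (x : R.g) (D : Module.End ℂ R.g)
    (hD : ∀ μ, ∀ v ∈ (LieAlgebra.ad ℂ R.g x).maxGenEigenspace μ, D v = starRingEnd ℂ μ • v)
    (u v : R.g) : D ⁅u, v⁆ = ⁅D u, v⁆ + ⁅u, D v⁆ := by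
  have ht : ∀ w : R.g, w ∈ ⨆ μ, (LieAlgebra.ad ℂ R.g x).maxGenEigenspace μ := fun w => by
    rw [Module.End.iSup_maxGenEigenspace_eq_top]; trivial
  have e0 : ∀ u : R.g, ⁅u, (0 : R.g)⁆ = 0 := fun u => lie_zero u
  have e1 : ∀ u v w : R.g, ⁅u, v + w⁆ = ⁅u, v⁆ + ⁅u, w⁆ := fun u v w => lie_add u v w
  induction ht u using Submodule.iSup_induction' with
  | zero => simp
  | add a b _ _ ha hb => simp only [add_lie, map_add, ha, hb]; abel
  | mem μ u hu =>
    induction ht v using Submodule.iSup_induction' with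
    | zero => simp [e0]
    | add a b _ _ ha hb => simp only [e1, map_add, ha, hb]; abel
    | mem ν v hv =>
      have h1 : ⁅u, v⁆ ∈ (LieAlgebra.ad ℂ R.g x).maxGenEigenspace (μ + ν) :=
        LieModule.lie_mem_maxGenEigenspace_toEnd hu hv
      have e2 : ⁅u, starRingEnd ℂ ν • v⁆ = starRingEnd ℂ ν • ⁅u, v⁆ := lie_smul _ u v
      have e3 : ⁅starRingEnd ℂ μ • u, v⁆ = starRingEnd ℂ μ • ⁅u, v⁆ := smul_lie _ u v
      rw [hD _ _ h1, hD _ _ hu, hD _ _ hv, e3, e2, ← add_smul, map_add]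

/-- Pairing `y` with `τ y` gives minus the square of the Hilbert-Schmidt norm of `ad y`. -/
theorem mem_center_of_killingForm {y : R.g} (h : ∀ z, killingForm ℂ R.g y z = 0) :
    y ∈ R.center := by
  refine LinearMap.mem_ker.2 ((R.re_trace_ad y).2 ?_)
  have h1 : LinearMap.trace ℂ R.g (LieAlgebra.ad ℂ R.g (R.τ y) ∘ₗ LieAlgebra.ad ℂ R.g y) =
      killingForm ℂ R.g y (R.τ y) :=
    LieModule.traceForm_comm ℂ R.g R.g (R.τ y) y
  rw [h1, h, Complex.zero_re]

/-- For every `x` there is `s` acting, up to the center, by the conjugates of the eigenvalues of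
`ad x` on its generalized eigenspaces. -/
theorem exists_conjugate_element (x : R.g) : ∃ s : R.g,
    (∀ W : Submodule ℂ R.g, (∀ w ∈ W, ⁅x, w⁆ ∈ W) → ∀ w ∈ W, ∃ z ∈ R.center, ⁅s, w⁆ + z ∈ W) ∧
    (R.BC x s = 0 → IsNilpotent (LieAlgebra.ad ℂ R.g x)) := by
  obtain ⟨T, hTl, hTs, hTn, hTk⟩ := R.exists_inverse_killing
  obtain ⟨D, hD, hDW⟩ := exists_end_on_eigenspaces (LieAlgebra.ad ℂ R.g x) (starRingEnd ℂ)
  -- The element `s = T f` is chosen such that its Killing pairing with every `y` is the trace of `D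
  -- ad y`. The functional vanishes on the center, so `f` is orthogonal to it and `T` inverts the
  -- Killing form at `f`.
  let F : Module.Dual ℂ R.g := LinearMap.trace ℂ R.g ∘ₗ LinearMap.mulLeft ℂ D ∘ₗ
    (LieAlgebra.ad ℂ R.g : R.g →ₗ[ℂ] Module.End ℂ R.g)
  let f := (LinearMap.BilinForm.toDual R.BC R.BC_nondegenerate).symm F
  have hf : ∀ y, R.BC f y = LinearMap.trace ℂ R.g (D * LieAlgebra.ad ℂ R.g y) := fun y =>
    LinearMap.BilinForm.apply_toDual_symm_apply (hB := R.BC_nondegenerate) F y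
  have hfz : ∀ z ∈ R.center, R.BC f z = 0 := fun z hz => by
    rw [hf, show LieAlgebra.ad ℂ R.g z = 0 from LinearMap.mem_ker.1 hz, mul_zero, map_zero]
  have hs : ∀ y, killingForm ℂ R.g (T f) y = LinearMap.trace ℂ R.g (D * LieAlgebra.ad ℂ R.g y) :=
    fun y => (hTk f hfz y).trans (hf y)
  have hd := R.eigenspace_derivation x D hD
  -- The derivation `E` is what separates `D` from being inner; it is orthogonal to all `ad y` for
  -- the trace form.
  let E : Module.End ℂ R.g := D - LieAlgebra.ad ℂ R.g (T f)
  have hE : ∀ y, LieAlgebra.ad ℂ R.g (E y) =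
      E * LieAlgebra.ad ℂ R.g y - LieAlgebra.ad ℂ R.g y * E := fun y => LinearMap.ext fun z => by
    have e2 : ∀ a b c : R.g, ⁅a, b - c⁆ = ⁅a, b⁆ - ⁅a, c⁆ := fun a b c => lie_sub a b c
    change ⁅D y - ⁅T f, y⁆, z⁆ = D ⁅y, z⁆ - ⁅T f, ⁅y, z⁆⁆ - ⁅y, D z - ⁅T f, z⁆⁆
    rw [sub_lie, hd, e2, leibniz_lie (T f) y z]
    abel
  have hEt : ∀ y, LinearMap.trace ℂ R.g (E * LieAlgebra.ad ℂ R.g y) = 0 := fun y => by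
    rw [sub_mul, map_sub, sub_eq_zero, ← hs]; rfl
  -- As `E` is a derivation, `ad (E y)` is the commutator of `E` and `ad y`, so the Killing pairing
  -- of `E y` with `z` is the trace of `E ad [y, z]`, which is zero.
  have hEz : ∀ y, E y ∈ R.center := fun y => R.mem_center_of_killingForm fun z => by
    change LinearMap.trace ℂ R.g (LieAlgebra.ad ℂ R.g (E y) * LieAlgebra.ad ℂ R.g z) = 0
    have hyz : LieAlgebra.ad ℂ R.g ⁅y, z⁆ = LieAlgebra.ad ℂ R.g y * LieAlgebra.ad ℂ R.g z -
        LieAlgebra.ad ℂ R.g z * LieAlgebra.ad ℂ R.g y := LinearMap.ext fun w => lie_lie y z w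
    rw [hE, sub_mul, map_sub, mul_assoc, mul_assoc, LinearMap.trace_mul_comm ℂ (LieAlgebra.ad ℂ R.g y),
      mul_assoc, ← map_sub, ← mul_sub, ← hEt ⁅y, z⁆, hyz]
  refine ⟨T f, fun W hW w hw => ⟨E w, hEz w, ?_⟩, fun h0 => ?_⟩
  · have : ⁅T f, w⁆ + E w = D w := add_sub_cancel _ _
    rw [this]
    exact hDW W hW w hw
  · have hc : ∀ y : R.g, T ⁅x, y⁆ = ⁅x, T y⁆ := hTl x
    have h1 : LieAlgebra.ad ℂ R.g (T x) = T * LieAlgebra.ad ℂ R.g x := LinearMap.ext fun y => by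
      change ⁅T x, y⁆ = T ⁅x, y⁆
      rw [← lie_skew, ← hTl, ← map_neg, lie_skew]
    refine trace_conj (LieAlgebra.ad ℂ R.g x) D T hD (LinearMap.ext fun y => (hc y).symm)
      (R.re_trace_restrict_pos T hTn) ?_
    -- Moving `T` to the other side turns `B(x, s)` into the trace of `D T ad x`, to which the trace
    -- criterion applies.
    rw [← hTs, R.BC_symm, hf, h1] at h0
    exact h0

variable {R}

theorem IsBorel.center_le {b : LieSubalgebra ℂ R.g} (hb : IsBorel b) {z : R.g}
    (hz : z ∈ R.center) : z ∈ b :=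
  hb.mem_of_normalizes fun y _ => by rw [R.mem_center.1 hz]; exact zero_mem _

/-- The elements of the nilpotent radical of a parabolic subalgebra are nilpotent. -/
theorem isNilpotent_of_mem_nilradical {q b : LieSubalgebra ℂ R.g} (hb : IsBorel b) (hbq : b ≤ q)
    {x : R.g} (hx : x ∈ R.nilradical q) : IsNilpotent (LieAlgebra.ad ℂ R.g x) := by
  let u := R.nilradical q
  have hqu : ∀ y ∈ q, ∀ x ∈ u, ⁅y, x⁆ ∈ u := fun y hy x hx => ⟨q.lie_mem hy hx.1, fun z hz => by
    rw [R.BC_lie, hx.2 _ (q.lie_mem hy hz), neg_zero]⟩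
  -- the derived algebra
  let N : Submodule ℂ R.g := Submodule.span ℂ {y | ∃ a ∈ u, ∃ c ∈ u, ⁅a, c⁆ = y}
  have hNu : N ≤ u.toSubmodule := Submodule.span_le.2 <| by
    rintro _ ⟨a, ha, c, hc, rfl⟩; exact u.lie_mem ha hc
  -- The element `s` attached to `x` maps `𝔲` into `𝔲` up to the center, which lies in `𝔮`. By
  -- invariance `B([a, c], s)` is, up to sign, the pairing of `c` in `𝔲` with an element of `𝔮`, so
  -- it vanishes.
  have hN : ∀ x ∈ N, IsNilpotent (LieAlgebra.ad ℂ R.g x) := fun x hx => by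
    obtain ⟨s, h1, h2⟩ := R.exists_conjugate_element x
    refine h2 ?_
    have h3 : N ≤ LinearMap.ker (R.BC.flip s) := Submodule.span_le.2 <| by
      rintro _ ⟨a, ha, c, hc, rfl⟩
      obtain ⟨z, hz, hw⟩ := h1 u.toSubmodule (fun w hw => u.lie_mem (hNu hx) hw) a ha
      change R.BC ⁅a, c⁆ s = 0
      have h4 : ⁅a, s⁆ = z - (⁅s, a⁆ + z) := by rw [← lie_skew]; abel
      rw [R.BC_lie, h4, map_sub, hc.2 z (hbq (IsBorel.center_le hb hz)), hc.2 _ hw.1, sub_zero,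
        neg_zero]
    exact h3 hx
  have hNN : ∀ x ∈ N, ∀ y ∈ N, ⁅x, y⁆ ∈ N := fun x hx y hy =>
    Submodule.subset_span ⟨x, hNu hx, y, hNu hy, rfl⟩
  have hsu : BracketSolvable u.toSubmodule := by
    refine .step _ N (fun x hx y hy => Submodule.subset_span ⟨x, hx, y, hy, rfl⟩) ?_
    exact .of_isNilpotent { N with lie_mem' := fun {x y} hx hy => hNN x hx y hy } hN
  -- By Engel's theorem the derived algebra of `𝔲` is solvable, hence so is `𝔲`. The Borel
  -- subalgebra normalizes it and therefore contains it.
  have hub : u.toSubmodule ≤ b.toSubmodule :=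
    hb.le_of_normalizes (fun x hx y hy => u.lie_mem hx hy) hsu fun y hy x hx => hqu y (hbq hy) x hx
  -- Now `x` lies in `b`, so `s` normalizes `b` and belongs to `b`, hence to `𝔮`, and is thus
  -- orthogonal to `x`.
  obtain ⟨s, h1, h2⟩ := R.exists_conjugate_element x
  refine h2 (hx.2 s (hbq ?_))
  refine hb.mem_of_normalizes fun y hy => ?_
  obtain ⟨z, hz, hw⟩ := h1 b.toSubmodule (fun w hw => b.lie_mem (hub hx) hw) y hy
  have := b.sub_mem hw (IsBorel.center_le hb hz)
  rwa [add_sub_cancel_right] at this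

end ReductivePair

/-! ## Alternating forms on graded spaces -/

section Forms

variable {E E' X : Type} [AddCommGroup E] [Module ℂ E] [AddCommGroup E'] [Module ℂ E']
  [AddCommGroup X] [Module ℂ X] {n : ℕ}

/-- The pullback of alternating forms. -/
def altPre (a : E →ₗ[ℂ] E') : (E' [⋀^Fin n]→ₗ[ℂ] X) →ₗ[ℂ] (E [⋀^Fin n]→ₗ[ℂ] X) where
  toFun f := f.compLinearMap a
  map_add' f g := by ext v; simp
  map_smul' c f := by ext v; simp

theorem altPre_apply (a : E →ₗ[ℂ] E') (f : E' [⋀^Fin n]→ₗ[ℂ] X) (v : Fin n → E) :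
    altPre a f v = f fun i => a (v i) := rfl

theorem altPre_altPost (a : E →ₗ[ℂ] E') (A : Module.End ℂ X) (f : E' [⋀^Fin n]→ₗ[ℂ] X) :
    altPre a (altPost A f) = altPost A (altPre a f) := rfl

theorem altPre_altDer (a : E →ₗ[ℂ] E') (b : Module.End ℂ E) (b' : Module.End ℂ E')
    (h : ∀ v, a (b v) = b' (a v)) (f : E' [⋀^Fin n]→ₗ[ℂ] X) :
    altPre a (altDer b' f) = altDer b (altPre a f) := by
  ext v
  rw [altPre_apply, altDer_apply, altDer_apply]
  refine Finset.sum_congr rfl fun k _ => ?_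
  rw [altPre_apply]
  congr 1
  ext i
  rcases eq_or_ne i k with rfl | hi
  · simp [h]
  · simp [Function.update_of_ne hi]

theorem alternatingMap_sum_apply {ι : Type} (s : Finset ι) (f : ι → E [⋀^Fin n]→ₗ[ℂ] X)
    (v : Fin n → E) : (∑ i ∈ s, f i) v = ∑ i ∈ s, f i v := by
  classical
  induction s using Finset.induction_on with
  | empty => simp
  | insert a s ha ih => rw [Finset.sum_insert ha, Finset.sum_insert ha, AlternatingMap.add_apply, ih]

/-- A coefficient of a Lagrange basis polynomial with nodes `0, …, M`. -/
def nodeCoeff (M w k : ℕ) : ℂ :=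
  (Lagrange.basis (Finset.range (M + 1)) (fun j : ℕ => (j : ℂ)) k).coeff w

/-- Interpolation at `M + 1` nodes reproduces `X ^ j` for `j ≤ M`; the identity compares the
coefficients of `X ^ w`. It serves to extract the component of weight `w` from the operators acting
by `k ^ j` in weight `j`. -/
theorem sum_nodeCoeff (M w j : ℕ) (hj : j ≤ M) :
    ∑ k ∈ Finset.range (M + 1), nodeCoeff M w k * (k : ℂ) ^ j = if j = w then 1 else 0 := by
  have h := Lagrange.eq_interpolate (s := Finset.range (M + 1)) (v := fun j : ℕ => (j : ℂ))
    (f := (Polynomial.X : ℂ[X]) ^ j) (fun a _ b _ h => Nat.cast_injective h) (by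
      rw [Polynomial.degree_X_pow, Finset.card_range]
      exact_mod_cast Nat.lt_succ_of_le hj)
  have h2 := congrArg (fun f => Polynomial.coeff f w) h
  simp only [Lagrange.interpolate_apply, Polynomial.finsetSum_coeff, Polynomial.coeff_C_mul,
    Polynomial.eval_pow, Polynomial.eval_X, Polynomial.coeff_X_pow] at h2
  rw [show (if j = w then (1 : ℂ) else 0) = if w = j then 1 else 0 by simp only [eq_comm], h2]
  exact Finset.sum_congr rfl fun k _ => mul_comm _ _

/-- A grading of a vector space by the weights `0, …, m`, given by projections. -/
structure LinGrading (E : Type) [AddCommGroup E] [Module ℂ E] where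
  m : ℕ
  π : ℕ → Module.End ℂ E
  idem : ∀ a v, π a (π a v) = π a v
  orth : ∀ a b, a ≠ b → ∀ v, π a (π b v) = 0
  sum : ∀ v, ∑ a ∈ Finset.range (m + 1), π a v = v

namespace LinGrading

variable (γ : LinGrading E)

/-- The operator acting by `k ^ a` in weight `a`. -/
def scale (k : ℕ) : Module.End ℂ E := ∑ a ∈ Finset.range (γ.m + 1), (k : ℂ) ^ a • γ.π a

theorem scale_apply {a : ℕ} (ha : a ≤ γ.m) {v : E} (hv : γ.π a v = v) (k : ℕ) :
    γ.scale k v = (k : ℂ) ^ a • v := by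
  rw [scale, LinearMap.sum_apply, Finset.sum_eq_single a]
  · rw [LinearMap.smul_apply, hv]
  · intro b _ hb
    rw [LinearMap.smul_apply, ← hv, γ.orth b a hb, smul_zero]
  · intro h
    exact absurd (Finset.mem_range.2 (Nat.lt_succ_of_le ha)) h

theorem scale_comm (A : E →ₗ[ℂ] E) (h : ∀ a v, A (γ.π a v) = γ.π a (A v)) (k : ℕ) (v : E) :
    A (γ.scale k v) = γ.scale k (A v) := by
  simp only [scale, LinearMap.sum_apply, LinearMap.smul_apply, map_sum, map_smul, h]

/-- Families of homogeneous vectors of the given weights. -/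
def Homog (a : Fin n → ℕ) (v : Fin n → E) : Prop := ∀ i, a i ≤ γ.m ∧ γ.π (a i) (v i) = v i

theorem alt_ext {f g : E [⋀^Fin n]→ₗ[ℂ] X} (h : ∀ a v, γ.Homog a v → f v = g v) : f = g := by
  ext v
  have e : v = fun i => ∑ a ∈ Finset.range (γ.m + 1), γ.π a (v i) :=
    funext fun i => (γ.sum (v i)).symm
  rw [e, ← AlternatingMap.coe_multilinearMap, ← AlternatingMap.coe_multilinearMap,
    MultilinearMap.map_sum_finset, MultilinearMap.map_sum_finset]
  refine Finset.sum_congr rfl fun a ha => h a _ fun i => ⟨?_, γ.idem _ _⟩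
  have := Fintype.mem_piFinset.1 ha i
  have := Finset.mem_range.1 this
  omega

variable [FiniteDimensional ℂ E]

/-- A bound for the weights of nonzero alternating forms. -/
def bound : ℕ := γ.m * Module.finrank ℂ E

/-- The component of weight `w` of an alternating form. -/
def altWt (w : ℕ) : Module.End ℂ (E [⋀^Fin n]→ₗ[ℂ] X) :=
  ∑ k ∈ Finset.range (γ.bound + 1), nodeCoeff γ.bound w k • altPre (γ.scale k)

theorem altWt_apply (w : ℕ) (f : E [⋀^Fin n]→ₗ[ℂ] X) : γ.altWt w f =
    ∑ k ∈ Finset.range (γ.bound + 1), nodeCoeff γ.bound w k • altPre (γ.scale k) f := by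
  simp [altWt, LinearMap.sum_apply]

theorem Homog.sum_le {γ : LinGrading E} {a : Fin n → ℕ} {v : Fin n → E} (h : γ.Homog a v)
    (hn : n ≤ Module.finrank ℂ E) : ∑ i, a i ≤ γ.bound := by
  calc ∑ i, a i ≤ ∑ _i : Fin n, γ.m := Finset.sum_le_sum fun i _ => (h i).1
    _ = n * γ.m := by simp
    _ ≤ γ.bound := by rw [bound, mul_comm]; exact Nat.mul_le_mul_left _ hn

/-- Pulling back along `scale k` multiplies the value by `k` to the total weight, and the node
coefficients single out the weight `w`. Total weights stay within the interpolation range because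
forms of degree above the dimension vanish. As `altWt` is a combination of pullbacks, its
equivariance is immediate. -/
theorem altWt_homog (w : ℕ) (f : E [⋀^Fin n]→ₗ[ℂ] X) {a : Fin n → ℕ} {v : Fin n → E}
    (h : γ.Homog a v) : γ.altWt w f v = if ∑ i, a i = w then f v else 0 := by
  rcases lt_or_ge (Module.finrank ℂ E) n with hn | hn
  · rw [alt_eq_zero_of_finrank_lt hn f, map_zero]; simp
  have hk : ∀ k, altPre (γ.scale k) f v = (k : ℂ) ^ (∑ i, a i) • f v := fun k => by
    have e : (fun i => γ.scale k (v i)) = fun i => (k : ℂ) ^ a i • v i :=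
      funext fun i => γ.scale_apply (h i).1 (h i).2 k
    rw [altPre_apply, e, AlternatingMap.map_smul_univ, Finset.prod_pow_eq_pow_sum]
  rw [altWt_apply, alternatingMap_sum_apply]
  simp only [AlternatingMap.smul_apply, hk, smul_smul]
  rw [← Finset.sum_smul, sum_nodeCoeff _ _ _ (h.sum_le hn)]
  split <;> simp

theorem altWt_self (w : ℕ) (f : E [⋀^Fin n]→ₗ[ℂ] X) : γ.altWt w (γ.altWt w f) = γ.altWt w f :=
  γ.alt_ext fun a v h => by
    rw [γ.altWt_homog _ _ h, γ.altWt_homog _ _ h]; split <;> rfl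

theorem altWt_ne {w w' : ℕ} (hw : w ≠ w') (f : E [⋀^Fin n]→ₗ[ℂ] X) :
    γ.altWt w (γ.altWt w' f) = 0 :=
  γ.alt_ext fun a v h => by
    rw [γ.altWt_homog _ _ h, γ.altWt_homog _ _ h]
    split_ifs with h1 h2
    · exact absurd (h1.symm.trans h2) hw
    · rfl
    · rfl

theorem sum_altWt (f : E [⋀^Fin n]→ₗ[ℂ] X) :
    ∑ w ∈ Finset.range (γ.bound + 1), γ.altWt w f = f := by
  rcases lt_or_ge (Module.finrank ℂ E) n with hn | hn
  · rw [alt_eq_zero_of_finrank_lt hn f]; simp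
  refine γ.alt_ext fun a v h => ?_
  rw [alternatingMap_sum_apply]
  simp only [γ.altWt_homog _ _ h]
  rw [Finset.sum_ite_eq, if_pos (Finset.mem_range.2 (Nat.lt_succ_of_le (h.sum_le hn)))]

theorem altWt_altPost (w : ℕ) (A : Module.End ℂ X) (f : E [⋀^Fin n]→ₗ[ℂ] X) :
    γ.altWt w (altPost A f) = altPost A (γ.altWt w f) := by
  simp only [altWt_apply, map_sum, map_smul, altPre_altPost]

theorem altWt_altDer (w : ℕ) (b : Module.End ℂ E) (hb : ∀ a v, b (γ.π a v) = γ.π a (b v))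
    (f : E [⋀^Fin n]→ₗ[ℂ] X) : γ.altWt w (altDer b f) = altDer b (γ.altWt w f) := by
  simp only [altWt_apply, ← altDerL_apply, map_sum, map_smul]
  refine Finset.sum_congr rfl fun k _ => ?_
  rw [altDerL_apply, altDerL_apply, altPre_altDer _ b b fun v => (γ.scale_comm b hb k v).symm]

theorem altWt_compLinearMap (w : ℕ) (b : Module.End ℂ E)
    (hb : ∀ a v, b (γ.π a v) = γ.π a (b v)) (f : E [⋀^Fin n]→ₗ[ℂ] X) :
    γ.altWt w (f.compLinearMap b) = (γ.altWt w f).compLinearMap b := by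
  ext v
  simp only [altWt_apply, alternatingMap_sum_apply, AlternatingMap.smul_apply, altPre_apply,
    AlternatingMap.compLinearMap_apply, γ.scale_comm b hb]

/-- Multilinear expressions in alternating forms vanish on families of homogeneous vectors whose
weight is not that of the form. -/
theorem altWt_apply_eq_zero (w : ℕ) (f : E [⋀^Fin n]→ₗ[ℂ] X) {a : Fin n → ℕ} {v : Fin n → E}
    (h : γ.Homog a v) (hw : ∑ i, a i ≠ w) : γ.altWt w f v = 0 := by
  rw [γ.altWt_homog _ _ h, if_neg hw]

/-- An alternating form vanishes on a family of homogeneous vectors one of which is replaced by a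
vector with components of smaller weights only, if it vanishes on all homogeneous families of
smaller weight. -/
theorem apply_update_eq_zero (f : E [⋀^Fin n]→ₗ[ℂ] X) {a : Fin n → ℕ} {v : Fin n → E}
    (h : γ.Homog a v) (k : Fin n) (x : E) (c : ℕ) (hx : ∀ b, c < b → γ.π b x = 0) (w : ℕ)
    (hc : ∑ i, a i + c < w + a k) (hf : γ.altWt w f = f) : f (Function.update v k x) = 0 := by
  rw [← γ.sum x, AlternatingMap.map_update_sum]
  refine Finset.sum_eq_zero fun b hb => ?_
  rcases lt_or_ge c b with hb' | hb'
  · rw [hx b hb']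
    exact f.map_coord_zero k (Function.update_self _ _ _)
  have h2 : γ.Homog (Function.update a k b) (Function.update v k (γ.π b x)) := fun i => by
    rcases eq_or_ne i k with rfl | hi
    · rw [Function.update_self, Function.update_self]
      exact ⟨Nat.le_of_lt_succ (Finset.mem_range.1 hb), γ.idem _ _⟩
    · rw [Function.update_of_ne hi, Function.update_of_ne hi]; exact h i
  rw [← hf]
  refine γ.altWt_apply_eq_zero w f h2 ?_
  have h3 : ∑ i, Function.update a k b i + a k = ∑ i, a i + b := by
    rw [Finset.sum_update_of_mem (Finset.mem_univ k), ← Finset.add_sum_erase _ a (Finset.mem_univ k),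
      Finset.sdiff_singleton_eq_erase]
    omega
  omega

end LinGrading

end Forms

/-! ## The filtration of the nilpotent radical -/

/-- Differences of an increasing chain of commuting projections. -/
def chainDiff {V : Type} [AddCommGroup V] [Module ℂ V] (P : ℕ → Module.End ℂ V) (k a : ℕ) :
    Module.End ℂ V :=
  if a = 0 then P 0 else if a ≤ k then 0 else P (a - k) - P (a - k - 1)

section Chain

variable {V : Type} [AddCommGroup V] [Module ℂ V] {P : ℕ → Module.End ℂ V}

theorem chainDiff_zero (k : ℕ) : chainDiff P k 0 = P 0 := if_pos rfl

theorem chainDiff_of_le {k a : ℕ} (h0 : a ≠ 0) (h : a ≤ k) : chainDiff P k a = 0 := by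
  rw [chainDiff, if_neg h0, if_pos h]

theorem chainDiff_of_lt {k a : ℕ} (h : k < a) :
    chainDiff P k a = P (a - k) - P (a - k - 1) := by
  rw [chainDiff, if_neg (by omega), if_neg (by omega)]

theorem chainDiff_idem (hP : ∀ a b v, P a (P b v) = P (min a b) v) (k a : ℕ) (v : V) :
    chainDiff P k a (chainDiff P k a v) = chainDiff P k a v := by
  rcases Nat.eq_zero_or_pos a with rfl | h0
  · rw [chainDiff_zero, hP, min_self]
  rcases le_or_gt a k with h | h
  · rw [chainDiff_of_le h0.ne' h, LinearMap.zero_apply, LinearMap.zero_apply]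
  · rw [chainDiff_of_lt h]
    simp only [LinearMap.sub_apply, map_sub, hP]
    rw [min_eq_right (by omega : a - k - 1 ≤ a - k), min_eq_left (by omega : a - k - 1 ≤ a - k),
      min_self, min_self]
    abel

theorem chainDiff_orth (hP : ∀ a b v, P a (P b v) = P (min a b) v) (k a b : ℕ) (hab : a ≠ b)
    (v : V) : chainDiff P k a (chainDiff P k b v) = 0 := by
  rcases Nat.eq_zero_or_pos a with rfl | h0
  · rcases le_or_gt b k with h | h
    · rw [chainDiff_of_le hab.symm h, LinearMap.zero_apply, map_zero]
    · rw [chainDiff_of_lt h, chainDiff_zero, LinearMap.sub_apply, map_sub, hP, hP, Nat.zero_min,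
        Nat.zero_min, sub_self]
  rcases le_or_gt a k with h | h
  · rw [chainDiff_of_le h0.ne' h, LinearMap.zero_apply]
  rcases Nat.eq_zero_or_pos b with rfl | h1
  · rw [chainDiff_of_lt h, chainDiff_zero, LinearMap.sub_apply, hP, hP, Nat.min_zero,
        Nat.min_zero, sub_self]
  rcases le_or_gt b k with h' | h'
  · rw [chainDiff_of_le h1.ne' h', LinearMap.zero_apply, map_zero]
  rw [chainDiff_of_lt h, chainDiff_of_lt h']
  simp only [LinearMap.sub_apply, map_sub, hP]
  rcases lt_or_gt_of_ne hab with hab | hab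
  · rw [min_eq_left (by omega : a - k ≤ b - k), min_eq_left (by omega : a - k ≤ b - k - 1),
      min_eq_left (by omega : a - k - 1 ≤ b - k), min_eq_left (by omega : a - k - 1 ≤ b - k - 1)]
    abel
  · rw [min_eq_right (by omega : b - k ≤ a - k), min_eq_right (by omega : b - k ≤ a - k - 1),
      min_eq_right (by omega : b - k - 1 ≤ a - k), min_eq_right (by omega : b - k - 1 ≤ a - k - 1)]
    abel

/-- The sum telescopes; the weights `1, …, k` contribute nothing and the last weight is `2 k`. -/
theorem sum_chainDiff (k : ℕ) (v : V) :
    ∑ a ∈ Finset.range (2 * k + 1), chainDiff P k a v = P k v := by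
  have h1 : ∀ t, chainDiff P k (k + 1 + t) v = P (t + 1) v - P t v := fun t => by
    rw [chainDiff_of_lt (by omega), LinearMap.sub_apply]
    congr 3 <;> omega
  rw [show 2 * k + 1 = (k + 1) + k by omega, Finset.sum_range_add]
  simp only [h1]
  rw [Finset.sum_range_sub (fun t => P t v), Finset.sum_range_succ', chainDiff_zero,
    Finset.sum_eq_zero fun a ha => ?_]
  · abel
  · have := Finset.mem_range.1 ha
    rw [chainDiff_of_le (by omega) (by omega), LinearMap.zero_apply]

end Chain

namespace ParabolicInclusion

variable {R' R : ReductivePair} {ι : R'.Inclusion R} {𝔭' : GermaneParabolic R'}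
  {𝔭 : GermaneParabolic R} (j : ParabolicInclusion ι 𝔭' 𝔭)

theorem φC_τ (ι : R'.Inclusion R) (x : R'.g) : ι.φC (R'.τ x) = R.τ (ι.φC x) := by
  induction x using TensorProduct.induction_on with
  | zero => simp
  | add a b ha hb => simp only [map_add, ha, hb]
  | tmul c a => exact congrArg (_ ⊗ₜ[ℝ] ·) (ι.φ_θ a)

/-- The ascending filtration of `𝔲` with zeroth step `𝔲'`, each step being the subspace of all
vectors that `𝔲'` maps to the preceding one. -/
def filt (ι : R'.Inclusion R) (𝔭' : GermaneParabolic R') (𝔭 : GermaneParabolic R) :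
    ℕ → Submodule ℂ R.g
  | 0 => 𝔭'.u.toSubmodule.map (ι.φC : R'.g →ₗ[ℂ] R.g)
  | i + 1 =>
    { carrier := {x | x ∈ 𝔭.u ∧ ∀ y ∈ 𝔭'.u, ⁅ι.φC y, x⁆ ∈ filt ι 𝔭' 𝔭 i}
      add_mem' := fun ha hb => ⟨add_mem ha.1 hb.1, fun y hy => by
        have e1 : ∀ u v w : R.g, ⁅u, v + w⁆ = ⁅u, v⁆ + ⁅u, w⁆ := fun u v w => lie_add u v w
        rw [e1]; exact add_mem (ha.2 y hy) (hb.2 y hy)⟩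
      zero_mem' := ⟨zero_mem _, fun y hy => by
        have e1 : ∀ u : R.g, ⁅u, (0 : R.g)⁆ = 0 := fun u => lie_zero u
        rw [e1]; exact zero_mem _⟩
      smul_mem' := fun c x h => ⟨𝔭.u.smul_mem c h.1, fun y hy => by
        have e1 : ∀ u v : R.g, ⁅u, c • v⁆ = c • ⁅u, v⁆ := fun u v => lie_smul c u v
        rw [e1]; exact Submodule.smul_mem _ _ (h.2 y hy)⟩ }

theorem mem_filt_zero {x : R.g} : x ∈ filt ι 𝔭' 𝔭 0 ↔ ∃ y ∈ 𝔭'.u, ι.φC y = x := Iff.rfl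

include j in
theorem filt_le (i : ℕ) {x : R.g} (hx : x ∈ filt ι 𝔭' 𝔭 i) : x ∈ 𝔭.u := by
  cases i with
  | zero => obtain ⟨y, hy, rfl⟩ := mem_filt_zero.1 hx; exact j.u_le y hy
  | succ i => exact hx.1

include j in
theorem lie_filt_zero {x y : R.g} (hx : x ∈ filt ι 𝔭' 𝔭 0) (hy : y ∈ filt ι 𝔭' 𝔭 0) :
    ⁅x, y⁆ ∈ filt ι 𝔭' 𝔭 0 := by
  obtain ⟨x, hx', rfl⟩ := mem_filt_zero.1 hx
  obtain ⟨y, hy', rfl⟩ := mem_filt_zero.1 hy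
  exact mem_filt_zero.2 ⟨⁅x, y⁆, 𝔭'.u.lie_mem hx' hy', LieHom.map_lie _ _ _⟩

include j in
theorem filt_le_succ (i : ℕ) {x : R.g} (hx : x ∈ filt ι 𝔭' 𝔭 i) : x ∈ filt ι 𝔭' 𝔭 (i + 1) := by
  induction i generalizing x with
  | zero => exact ⟨j.filt_le 0 hx, fun y hy => j.lie_filt_zero (mem_filt_zero.2 ⟨y, hy, rfl⟩) hx⟩
  | succ i ih => exact ⟨hx.1, fun y hy => ih (hx.2 y hy)⟩

include j in
theorem filt_mono {a b : ℕ} (h : a ≤ b) {x : R.g} (hx : x ∈ filt ι 𝔭' 𝔭 a) :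
    x ∈ filt ι 𝔭' 𝔭 b := by
  induction h with
  | refl => exact hx
  | step _ ih => exact j.filt_le_succ _ ih

-- By the Jacobi identity, since `𝔩'` normalizes `𝔲'`, each step of the filtration inherits
-- stability from the preceding one. The next lemma is the analogue for `L' ∩ K'`.
include j in
theorem filt_lie (i : ℕ) {x : R'.g} (hx : x ∈ 𝔭'.l) {v : R.g} (hv : v ∈ filt ι 𝔭' 𝔭 i) :
    ⁅ι.φC x, v⁆ ∈ filt ι 𝔭' 𝔭 i := by
  induction i generalizing v with
  | zero =>
    obtain ⟨y, hy, rfl⟩ := mem_filt_zero.1 hv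
    exact mem_filt_zero.2 ⟨⁅x, y⁆, 𝔭'.u_lie x hx y hy, LieHom.map_lie _ _ _⟩
  | succ i ih =>
    refine ⟨𝔭.u_lie _ (j.lC_le x hx) _ hv.1, fun y hy => ?_⟩
    have e : ⁅ι.φC y, ⁅ι.φC x, v⁆⁆ = ⁅ι.φC x, ⁅ι.φC y, v⁆⁆ - ⁅ι.φC ⁅x, y⁆, v⁆ := by
      have e1 : ∀ u v w : R.g, ⁅u, ⁅v, w⁆⁆ = ⁅⁅u, v⁆, w⁆ + ⁅v, ⁅u, w⁆⁆ := fun u v w => leibniz_lie u v w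
      rw [LieHom.map_lie, e1 (ι.φC x)]
      abel
    rw [e]
    exact sub_mem (ih (hv.2 y hy)) (hv.2 _ (𝔭'.u_lie x hx y hy))

include j in
theorem filt_Ad (i : ℕ) (k : 𝔭'.LK) {v : R.g} (hv : v ∈ filt ι 𝔭' 𝔭 i) :
    R.AdC (ι.ψ k) v ∈ filt ι 𝔭' 𝔭 i := by
  induction i generalizing v with
  | zero =>
    obtain ⟨y, hy, rfl⟩ := mem_filt_zero.1 hv
    exact mem_filt_zero.2 ⟨R'.AdC k y, 𝔭'.u_Ad k y hy, ι.hom.φ_Ad (k : R'.K) y⟩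
  | succ i ih =>
    refine ⟨𝔭.u_Ad ⟨ι.ψ k, j.LK_le k k.2⟩ _ hv.1, fun y hy => ?_⟩
    have h : R'.AdC k (R'.AdC (k : R'.K)⁻¹ y) = y := by
      rw [← Module.End.mul_apply, ← map_mul, mul_inv_cancel, map_one, Module.End.one_apply]
    have e1 : ι.φC y = R.AdC (ι.ψ k) (ι.φC (R'.AdC (k : R'.K)⁻¹ y)) := by
      conv_lhs => rw [← h]
      exact ι.hom.φ_Ad (k : R'.K) _
    have e2 := R.pair.Ad_lie (ι.ψ k) (ι.φC (R'.AdC (k : R'.K)⁻¹ y)) v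
    have e3 : ⁅ι.φC y, R.AdC (ι.ψ k) v⁆ =
        R.AdC (ι.ψ k) ⁅ι.φC (R'.AdC (k : R'.K)⁻¹ y), v⁆ := by
      rw [e1]; exact e2.symm
    rw [e3]
    exact ih (hv.2 _ (𝔭'.u_Ad k⁻¹ y hy))

-- The elements of `𝔲'` are nilpotent on `𝔤`, because they lie in `𝔲`. Engel's theorem makes the
-- action of `𝔲'` on `𝔤` nilpotent, so sufficiently many brackets with `𝔲'` vanish.
include j in
theorem exists_filt_eq_top : ∃ k, ∀ x ∈ 𝔭.u, x ∈ filt ι 𝔭' 𝔭 k := by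
  let _ : LieRingModule 𝔭'.u R.g := LieRingModule.compLieHom R.g (ι.φC.comp 𝔭'.u.incl)
  have _ : LieModule ℂ 𝔭'.u R.g := LieModule.compLieHom R.g (ι.φC.comp 𝔭'.u.incl)
  have hbr : ∀ (y : 𝔭'.u) (v : R.g), ⁅y, v⁆ = ⁅ι.φC y, v⁆ := fun _ _ => rfl
  obtain ⟨b, hb, hbq⟩ := 𝔭.exists_borel
  have hnil : LieModule.IsNilpotent 𝔭'.u R.g := by
    refine LieAlgebra.isEngelian_of_isNoetherian (R := ℂ) (L := 𝔭'.u) R.g fun y => ?_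
    exact R.isNilpotent_of_mem_nilradical hb hbq (j.u_le y y.2)
  obtain ⟨k, hk⟩ := (LieModule.isNilpotent_iff ℂ 𝔭'.u R.g).1 hnil
  refine ⟨k, ?_⟩
  -- Going up the lower central series from its zero term, each term meets `𝔲` within the next step
  -- of the filtration.
  have key : ∀ i ≤ k, ∀ x ∈ 𝔭.u, x ∈ LieModule.lowerCentralSeries ℂ 𝔭'.u R.g (k - i) →
      x ∈ filt ι 𝔭' 𝔭 i := by
    intro i
    induction i with
    | zero =>
      intro _ x _ hx
      rw [Nat.sub_zero, hk] at hx
      rw [(LieSubmodule.mem_bot x).1 hx]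
      exact zero_mem _
    | succ i ih =>
      intro hi x hxu hx
      refine ⟨hxu, fun y hy => ih (by omega) _ (𝔭.u.lie_mem (j.u_le y hy) hxu) ?_⟩
      rw [show k - i = (k - (i + 1)) + 1 by omega, LieModule.lowerCentralSeries_succ]
      exact LieSubmodule.lie_mem_lie (x := (⟨y, hy⟩ : 𝔭'.u)) (LieSubmodule.mem_top _) hx
  intro x hx
  refine key k le_rfl x hx ?_
  rw [Nat.sub_self, LieModule.lowerCentralSeries_zero]
  exact LieSubmodule.mem_top _

/-- There is an equivariant grading of `𝔲` with weight zero component `𝔲'`, for which the bracket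
lowers the weights except on `𝔲'`. -/
theorem exists_grading : ∃ (γ : LinGrading (𝔭.uMod.res j.hom).V)
    (r : GKMod.Hom (𝔭.uMod.res j.hom) 𝔭'.uMod),
    (∀ a x v, γ.π a ((𝔭.uMod.res j.hom).ρ x v) = (𝔭.uMod.res j.hom).ρ x (γ.π a v)) ∧
    (∀ a m v, γ.π a ((𝔭.uMod.res j.hom).σ m v) = (𝔭.uMod.res j.hom).σ m (γ.π a v)) ∧
    (∀ v, γ.π 0 v = j.uMap (r.f v)) ∧ (∀ v, r.f (j.uMap v) = v) ∧
    ∀ (a b c : ℕ) (x y : 𝔭.u), 1 ≤ a + b → a + b ≤ c → γ.π a x = x → γ.π b y = y →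
      γ.π c (⁅x, y⁆ : 𝔭.u) = 0 := by
  obtain ⟨k, hk⟩ := j.exists_filt_eq_top
  -- Orthogonal projections onto an increasing chain commute with each other, and the product of two
  -- of them is the one of smaller index.
  choose P hP1 hP2 hP3 using fun i => R.exists_projection (filt ι 𝔭' 𝔭 i)
  have hPlow : ∀ i x, (∀ w ∈ filt ι 𝔭' 𝔭 i, R.BC (R.τ w) x = 0) → P i x = 0 := fun i x hx => by
    refine R.eq_zero_of_BC_τ _ ?_
    rw [R.BC_symm]
    have := hP3 i x (P i x) (hP1 i x)
    rwa [map_sub, hx _ (hP1 i x), zero_sub, neg_eq_zero] at this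
  have hPmin : ∀ a b x, P a (P b x) = P (min a b) x := fun a b x => by
    rcases le_total a b with h | h
    · rw [min_eq_left h, ← sub_eq_zero, ← neg_eq_zero, neg_sub, ← map_sub]
      exact hPlow a _ fun w hw => hP3 b x w (j.filt_mono h hw)
    · rw [min_eq_right h, hP2 a _ (j.filt_mono h (hP1 b x))]
  have hPu : ∀ i x, P i x ∈ 𝔭.u := fun i x => j.filt_le i (hP1 i x)
  -- The adjoint of `ad x` is `-ad (τ x)`, and τ preserves `𝔩'` because `𝔩₀'` is θ-stable. Both
  -- operators preserve the filtration.
  have hPl : ∀ i, ∀ x ∈ 𝔭'.l, ∀ v : R.g, P i ⁅ι.φC x, v⁆ = ⁅ι.φC x, P i v⁆ := fun i x hx v => by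
    refine R.projection_comm (hP1 i) (hP2 i) (hP3 i) (LieAlgebra.ad ℂ R.g (ι.φC x))
      (-LieAlgebra.ad ℂ R.g (ι.φC (R'.τ x))) ?_ (fun w hw => j.filt_lie i hx hw)
      (fun w hw => ?_) v
    · intro u v
      have := R.BC_τ_lie (ι.φC (R'.τ x)) u v
      rw [LinearMap.neg_apply, map_neg, map_neg, LinearMap.neg_apply]
      change -(R.BC (R.τ ⁅ι.φC (R'.τ x), u⁆) v) = R.BC (R.τ u) ⁅ι.φC x, v⁆
      rw [this, neg_neg, φC_τ, R.τ_τ]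
    · exact neg_mem (j.filt_lie i (R'.τ_mem _ 𝔭'.θ_mem x hx) hw)
  -- The group acts unitarily, so the adjoint of an element is its inverse.
  have hPm : ∀ i (m : 𝔭'.LK) v, P i (R.AdC (ι.ψ m) v) = R.AdC (ι.ψ m) (P i v) := fun i m v => by
    refine R.projection_comm (hP1 i) (hP2 i) (hP3 i) (R.AdC (ι.ψ m)) (R.AdC (ι.ψ (m⁻¹ : 𝔭'.LK)))
      ?_ (fun w hw => j.filt_Ad i m hw) (fun w hw => j.filt_Ad i m⁻¹ hw) v
    intro u v
    rw [R.τ_AdC, ← R.BC_Ad (ι.ψ m), ← Module.End.mul_apply, ← map_mul, ← map_mul]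
    simp
  -- Weight 0 is `𝔲'`, the weights `1, …, k` are empty, and weight `k + i` is the complement of step
  -- `i - 1` in step `i`. The gap makes the sum of two positive weights exceed the largest weight `2
  -- k`.
  let Q := chainDiff P k
  have hQu : ∀ a x, Q a x ∈ 𝔭.u := fun a x => by
    change chainDiff P k a x ∈ 𝔭.u
    unfold chainDiff
    split_ifs
    · exact hPu _ _
    · exact zero_mem _
    · exact sub_mem (hPu _ _) (hPu _ _)
  have hQl : ∀ a, ∀ x ∈ 𝔭'.l, ∀ v : R.g, Q a ⁅ι.φC x, v⁆ = ⁅ι.φC x, Q a v⁆ := fun a x hx v => by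
    have e1 : ∀ u v w : R.g, ⁅u, v - w⁆ = ⁅u, v⁆ - ⁅u, w⁆ := fun u v w => lie_sub u v w
    have e2 : ∀ u : R.g, ⁅u, (0 : R.g)⁆ = 0 := fun u => lie_zero u
    change chainDiff P k a _ = ⁅ι.φC x, chainDiff P k a v⁆
    unfold chainDiff
    split_ifs
    · exact hPl _ _ hx _
    · rw [LinearMap.zero_apply, LinearMap.zero_apply, e2]
    · rw [LinearMap.sub_apply, LinearMap.sub_apply, hPl _ _ hx, hPl _ _ hx, e1]
  have hQm : ∀ a (m : 𝔭'.LK) v, Q a (R.AdC (ι.ψ m) v) = R.AdC (ι.ψ m) (Q a v) := fun a m v => by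
    change chainDiff P k a _ = R.AdC (ι.ψ m) (chainDiff P k a v)
    unfold chainDiff
    split_ifs
    · exact hPm _ _ _
    · rw [LinearMap.zero_apply, LinearMap.zero_apply, map_zero]
    · rw [LinearMap.sub_apply, LinearMap.sub_apply, hPm, hPm, map_sub]
  let Qu (a : ℕ) : 𝔭.u.toSubmodule →ₗ[ℂ] 𝔭.u.toSubmodule :=
    LinearMap.restrict (p := 𝔭.u.toSubmodule) (q := 𝔭.u.toSubmodule) (Q a) fun x _ => hQu a x
  let γ : LinGrading 𝔭.u.toSubmodule :=
    { m := 2 * k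
      π := Qu
      idem := fun a v => Subtype.ext (chainDiff_idem hPmin k a v.1)
      orth := fun a b hab v => Subtype.ext (chainDiff_orth hPmin k a b hab v.1)
      sum := fun v => Subtype.ext (by
        rw [AddSubmonoidClass.coe_finsetSum]
        exact (sum_chainDiff k v.1).trans (hP2 k _ (hk _ v.2))) }
  -- The complexification of an injective real map is injective by flatness. A linear retraction on
  -- the image then suffices: composed with the equivariant projection `Qu 0` it becomes
  -- equivariant.
  have hφinj : Function.Injective j.uMap := fun a b hab => by
    refine Subtype.ext (Module.Flat.lTensor_preserves_injective_linearMap (M := ℂ)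
      (ι.φ : R'.g₀ →ₗ[ℝ] R.g₀) ι.φ_injective ?_)
    exact congrArg Subtype.val hab
  obtain ⟨r₀, hr₀⟩ := LinearMap.exists_leftInverse_of_injective j.uMap (LinearMap.ker_eq_bot.2 hφinj)
  have hr0 : ∀ v, r₀ (j.uMap v) = v := fun v => LinearMap.congr_fun hr₀ v
  have hr1 : ∀ v : 𝔭.u.toSubmodule, j.uMap (r₀ (Qu 0 v)) = Qu 0 v := fun v => by
    obtain ⟨y, hy, hyv⟩ := mem_filt_zero.1 (hP1 0 v.1)
    have e : Qu 0 v = j.uMap (show 𝔭'.u from ⟨y, hy⟩) := Subtype.ext hyv.symm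
    exact (congrArg (fun w => j.uMap (r₀ w)) e).trans ((congrArg j.uMap (hr0 _)).trans e.symm)
  have hr2 : ∀ v, Qu 0 (j.uMap v) = j.uMap v := fun v =>
    Subtype.ext (hP2 0 _ (mem_filt_zero.2 ⟨v.1, v.2, rfl⟩))
  let r : GKMod.Hom (𝔭.uMod.res j.hom) 𝔭'.uMod :=
    { f := r₀ ∘ₗ Qu 0
      map_ρ := fun x v => hφinj (by
        have h1 : j.uMap (𝔭'.uMod.ρ x (r₀ (Qu 0 v))) =
            (𝔭.uMod.res j.hom).ρ x (j.uMap (r₀ (Qu 0 v))) :=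
          Subtype.ext (LieHom.map_lie ι.φC (x : R'.g) (r₀ (Qu 0 v)).1)
        refine (hr1 _).trans (Eq.trans ?_ h1.symm)
        refine Eq.trans ?_ (congrArg ((𝔭.uMod.res j.hom).ρ x) (hr1 v).symm)
        exact Subtype.ext (hQl 0 x x.2 (show 𝔭.u from v).1))
      map_σ := fun m v => hφinj (by
        have h1 : j.uMap (𝔭'.uMod.σ m (r₀ (Qu 0 v))) =
            (𝔭.uMod.res j.hom).σ m (j.uMap (r₀ (Qu 0 v))) :=
          Subtype.ext (ι.hom.φ_Ad (m : 𝔭'.LK) (r₀ (Qu 0 v)).1)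
        refine (hr1 _).trans (Eq.trans ?_ h1.symm)
        refine Eq.trans ?_ (congrArg ((𝔭.uMod.res j.hom).σ m) (hr1 v).symm)
        exact Subtype.ext (hQm 0 m (show 𝔭.u from v).1)) }
  -- The subtraction is truncated: for `a ≤ k` the assertion is membership in `𝔲'`, which is trivial
  -- for the empty weights.
  have hmem : ∀ a (x : R.g), Q a x = x → x ∈ filt ι 𝔭' 𝔭 (a - k) := fun a x hx => by
    rw [← hx]
    change chainDiff P k a x ∈ _
    unfold chainDiff
    split_ifs with h1 h2
    · rw [h1, Nat.zero_sub]; exact hP1 _ _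
    · exact zero_mem _
    · exact sub_mem (hP1 _ _) (j.filt_mono (by omega) (hP1 _ _))
  refine ⟨γ, r, fun a x v => Subtype.ext (hQl a x x.2 (show 𝔭.u from v).1),
    fun a m v => Subtype.ext (hQm a m (show 𝔭.u from v).1), fun v => (hr1 v).symm, fun v => ?_, ?_⟩
  · exact (congrArg r₀ (hr2 v)).trans (hr0 v)
  · intro a b c x y hab hc hx hy
    have hx' : Q a x.1 = x.1 := congrArg Subtype.val hx
    have hy' : Q b y.1 = y.1 := congrArg Subtype.val hy
    have hxm := hmem a _ hx'
    have hym := hmem b _ hy'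
    refine Subtype.ext ?_
    change chainDiff P k c ⁅x.1, y.1⁆ = 0
    rcases le_or_gt c k with h | h
    · rw [chainDiff_of_le (by omega) h, LinearMap.zero_apply]
    -- For `d = 0` the truncated `d - 1` is 0, in accordance with `𝔲'` being a subalgebra.
    have hlow : ∀ (d : ℕ) (u v : R.g), u ∈ filt ι 𝔭' 𝔭 0 → v ∈ filt ι 𝔭' 𝔭 d →
        ⁅u, v⁆ ∈ filt ι 𝔭' 𝔭 (d - 1) := fun d u v hu hv => by
      cases d with
      | zero => exact j.lie_filt_zero hu hv
      | succ d =>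
        obtain ⟨z, hz, rfl⟩ := mem_filt_zero.1 hu
        exact hv.2 z hz
    -- If one factor has weight 0, the bracket descends one step below the other factor, whose
    -- weight is at most `c`. If both weights exceed `k`, then `c ≥ 2 k + 2`, and the step in
    -- question is all of `𝔲`.
    have hz : ⁅x.1, y.1⁆ ∈ filt ι 𝔭' 𝔭 (c - k - 1) := by
      rcases le_or_gt a k with ha | ha
      · rw [Nat.sub_eq_zero_of_le ha] at hxm
        exact j.filt_mono (by omega) (hlow _ _ _ hxm hym)
      rcases le_or_gt b k with hb | hb
      · rw [Nat.sub_eq_zero_of_le hb] at hym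
        have e : ∀ u v : R.g, -⁅u, v⁆ = ⁅v, u⁆ := fun u v => lie_skew v u
        rw [← e]
        exact neg_mem (j.filt_mono (by omega) (hlow _ _ _ hym hxm))
      · exact j.filt_mono (by omega) (hk _ (𝔭.u.lie_mem x.2 y.2))
    -- Both projections in the difference fix the bracket.
    rw [chainDiff_of_lt h, LinearMap.sub_apply, hP2 _ _ hz, hP2 _ _ (j.filt_mono (by omega) hz),
      sub_self]

end ParabolicInclusion

/-! ## Alternating forms on split extensions -/

section Append

variable {α β : Type} {p q : ℕ}

theorem append_update_left (y : Fin p → α) (x : Fin q → α) (k : Fin p) (c : α) :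
    Fin.append (Function.update y k c) x =
      Function.update (Fin.append y x) (Fin.castAdd q k) c := by
  funext l
  induction l using Fin.addCases with
  | left l =>
    rcases eq_or_ne l k with rfl | h
    · simp
    · rw [Fin.append_left, Function.update_of_ne h, Function.update_of_ne, Fin.append_left]
      exact fun e => h (Fin.castAdd_injective _ _ e)
  | right l =>
    rw [Fin.append_right, Function.update_of_ne, Fin.append_right]
    intro e
    have := congrArg Fin.val e
    simp only [Fin.val_natAdd, Fin.val_castAdd] at this
    omega

theorem append_update_right (y : Fin p → α) (x : Fin q → α) (k : Fin q) (c : α) :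
    Fin.append y (Function.update x k c) =
      Function.update (Fin.append y x) (Fin.natAdd p k) c := by
  funext l
  induction l using Fin.addCases with
  | right l =>
    rcases eq_or_ne l k with rfl | h
    · simp
    · rw [Fin.append_right, Function.update_of_ne h, Function.update_of_ne, Fin.append_right]
      exact fun e => h (Fin.natAdd_injective _ _ e)
  | left l =>
    rw [Fin.append_left, Function.update_of_ne, Fin.append_left]
    intro e
    have := congrArg Fin.val e
    simp only [Fin.val_natAdd, Fin.val_castAdd] at this
    omega

theorem map_append (g : α → β) (y : Fin p → α) (x : Fin q → α) :
    (fun k => g (Fin.append y x k)) = Fin.append (fun k => g (y k)) (fun k => g (x k)) := by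
  funext l
  induction l using Fin.addCases with
  | left l => rw [Fin.append_left, Fin.append_left]
  | right l => rw [Fin.append_right, Fin.append_right]

/-- The explicit arguments identify `p + (q + 1)` with `(p + q) + 1`, so that an entry can be
removed from the second block. -/
theorem removeNth_append (y : Fin p → α) (x : Fin (q + 1) → α) (k : Fin (q + 1)) :
    @Fin.removeNth (p + q) (fun _ => α) (@Fin.natAdd (q + 1) p k) (@Fin.append p (q + 1) α y x) =
      Fin.append y (Fin.removeNth k x) := by
  funext l
  induction l using Fin.addCases with
  | left l =>
    have e : (Fin.natAdd p k : Fin (p + q + 1)).succAbove (Fin.castAdd q l) =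
        Fin.castAdd (q + 1) l := by
      apply Fin.ext
      have := l.2
      simp only [Fin.succAbove, Fin.lt_def, Fin.val_castSucc, Fin.val_castAdd, Fin.val_natAdd]
      split_ifs <;> simp <;> omega
    rw [Fin.append_left]
    exact (congrArg (Fin.append y x) e).trans (Fin.append_left _ _ _)
  | right l =>
    have e : (Fin.natAdd p k : Fin (p + q + 1)).succAbove (Fin.natAdd p l) =
        Fin.natAdd p (k.succAbove l) := by
      apply Fin.ext
      simp only [Fin.succAbove, Fin.lt_def, Fin.val_castSucc, Fin.val_natAdd]
      split_ifs <;> simp <;> omega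
    rw [Fin.append_right]
    exact (congrArg (Fin.append y x) e).trans (Fin.append_right _ _ _)

end Append

section Twisted

variable {E X : Type} [AddCommGroup E] [Module ℂ E] [AddCommGroup X] [Module ℂ X]

/-- The expression for the Chevalley-Eilenberg differential, for an arbitrary bilinear bracket `a`
and an arbitrary action `c`. -/
def twDiff (a : E →ₗ[ℂ] Module.End ℂ E) (c : E →ₗ[ℂ] Module.End ℂ X) (q : ℕ) :
    (E [⋀^Fin q]→ₗ[ℂ] X) →ₗ[ℂ] (E [⋀^Fin (q + 1)]→ₗ[ℂ] X) :=
  AlternatingMap.alternatizeUncurryFinLM ∘ₗ (altPost ∘ₗ c - (1 / 2 : ℂ) • altDerL ∘ₗ a).flip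

theorem twDiff_apply (a : E →ₗ[ℂ] Module.End ℂ E) (c : E →ₗ[ℂ] Module.End ℂ X) (q : ℕ)
    (f : E [⋀^Fin q]→ₗ[ℂ] X) (v : Fin (q + 1) → E) : twDiff a c q f v =
      ∑ i : Fin (q + 1), (-1 : ℤ) ^ (i : ℕ) • (c (v i) (f (Fin.removeNth i v)) - (1 / 2 : ℂ) • ∑ k,
        f (Function.update (Fin.removeNth i v) k (a (v i) (Fin.removeNth i v k)))) :=
  AlternatingMap.alternatizeUncurryFin_apply _ _

end Twisted

namespace GKMod

variable {P : HCPair}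

/-- A split exact sequence `0 → U → E → D → 0`. -/
structure Splitting (U E D : GKMod P) where
  i : Hom U E
  r : Hom E U
  p : Hom E D
  s : Hom D E
  r_i : ∀ u, r.f (i.f u) = u
  p_s : ∀ d, p.f (s.f d) = d
  sum : ∀ v, i.f (r.f v) + s.f (p.f v) = v

namespace Splitting

variable {U E D : GKMod P} (S : Splitting U E D)

theorem p_i (u : U.V) : S.p.f (S.i.f u) = 0 := by
  have h := S.sum (S.i.f u)
  rw [S.r_i, add_eq_left] at h
  rw [← S.p_s (S.p.f (S.i.f u)), h, map_zero]

theorem r_s (d : D.V) : S.r.f (S.s.f d) = 0 := by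
  have h := S.sum (S.s.f d)
  rw [S.p_s, add_eq_right] at h
  rw [← S.r_i (S.r.f (S.s.f d)), h, map_zero]

/-- The grading with `U` in weight `0` and `D` in weight `1`. -/
def grading : LinGrading E.V where
  m := 1
  π
    | 0 => S.i.f ∘ₗ S.r.f
    | 1 => S.s.f ∘ₗ S.p.f
    | _ + 2 => 0
  idem a v := by
    match a with
    | 0 => simp [S.r_i]
    | 1 => simp [S.p_s]
    | _ + 2 => simp
  orth a b h v := by
    match a, b with
    | 0, 0 => exact absurd rfl h
    | 1, 1 => exact absurd rfl h
    | 0, 1 => simp [S.r_s]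
    | 1, 0 => simp [S.p_i]
    | _ + 2, _ => simp
    | _, _ + 2 => simp
  sum v := by
    rw [Finset.sum_range_succ, Finset.sum_range_one]
    exact S.sum v

theorem grading_zero (v : E.V) : S.grading.π 0 v = S.i.f (S.r.f v) := rfl

theorem grading_one (v : E.V) : S.grading.π 1 v = S.s.f (S.p.f v) := rfl

theorem grading_ρ (a : ℕ) (x : P.h) (v : E.V) :
    S.grading.π a (E.ρ x v) = E.ρ x (S.grading.π a v) := by
  match a with
  | 0 => rw [grading_zero, grading_zero, S.r.map_ρ, S.i.map_ρ]
  | 1 => rw [grading_one, grading_one, S.p.map_ρ, S.s.map_ρ]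
  | _ + 2 => exact (map_zero (E.ρ x)).symm

theorem grading_σ (a : ℕ) (m : P.M) (v : E.V) :
    S.grading.π a (E.σ m v) = E.σ m (S.grading.π a v) := by
  match a with
  | 0 => rw [grading_zero, grading_zero, S.r.map_σ, S.i.map_σ]
  | 1 => rw [grading_one, grading_one, S.p.map_σ, S.s.map_σ]
  | _ + 2 => exact (map_zero (E.σ m)).symm

section Theta

variable {X : Type} [AddCommGroup X] [Module ℂ X] {p q : ℕ}

/-- The evaluation of forms on `E` on families of `p` vectors of `D` and `q` vectors of `U`. -/
def theta (X : Type) [AddCommGroup X] [Module ℂ X] (p q : ℕ) : (E.V [⋀^Fin (p + q)]→ₗ[ℂ] X) →ₗ[ℂ]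
    (D.V [⋀^Fin p]→ₗ[ℂ] (U.V [⋀^Fin q]→ₗ[ℂ] X)) where
  toFun f :=
    { toFun := fun y =>
        { toFun := fun x => f (Fin.append (fun k => S.s.f (y k)) (fun k => S.i.f (x k)))
          map_update_add' := fun x k a b => by
            rename_i inst
            obtain rfl : inst = instDecidableEqFin q := Subsingleton.elim _ _
            have e : ∀ c, (fun l => S.i.f (Function.update x k c l)) =
              Function.update (fun l => S.i.f (x l)) k (S.i.f c) := fun c =>
                Function.comp_update _ _ _ _
            rw [e, e, e, append_update_right, append_update_right, append_update_right, map_add,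
              AlternatingMap.map_update_add]
          map_update_smul' := fun x k t a => by
            rename_i inst
            obtain rfl : inst = instDecidableEqFin q := Subsingleton.elim _ _
            have e : ∀ c, (fun l => S.i.f (Function.update x k c l)) =
              Function.update (fun l => S.i.f (x l)) k (S.i.f c) := fun c =>
                Function.comp_update _ _ _ _
            rw [e, e, append_update_right, append_update_right, map_smul,
              AlternatingMap.map_update_smul]
          map_eq_zero_of_eq' := fun x k l h hkl => by
            refine f.map_eq_zero_of_eq _ (i := Fin.natAdd p k) (j := Fin.natAdd p l) ?_
              fun e => hkl (Fin.natAdd_injective _ _ e)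
            rw [Fin.append_right, Fin.append_right, h] }
      map_update_add' := fun y k a b => by
        rename_i inst
        obtain rfl : inst = instDecidableEqFin p := Subsingleton.elim _ _
        have e : ∀ c, (fun l => S.s.f (Function.update y k c l)) =
          Function.update (fun l => S.s.f (y l)) k (S.s.f c) := fun c =>
            Function.comp_update _ _ _ _
        ext x
        change f _ = f _ + f _
        rw [e, e, e, append_update_left, append_update_left, append_update_left, map_add,
          AlternatingMap.map_update_add]
      map_update_smul' := fun y k t a => by
        rename_i inst
        obtain rfl : inst = instDecidableEqFin p := Subsingleton.elim _ _
        have e : ∀ c, (fun l => S.s.f (Function.update y k c l)) =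
          Function.update (fun l => S.s.f (y l)) k (S.s.f c) := fun c =>
            Function.comp_update _ _ _ _
        ext x
        change f _ = t • f _
        rw [e, e, append_update_left, append_update_left, map_smul,
          AlternatingMap.map_update_smul]
      map_eq_zero_of_eq' := fun y k l h hkl => by
        ext x
        refine f.map_eq_zero_of_eq _ (i := Fin.castAdd q k) (j := Fin.castAdd q l) ?_
          fun e => hkl (Fin.castAdd_injective _ _ e)
        rw [Fin.append_left, Fin.append_left, h] }
  map_add' f g := rfl
  map_smul' c f := rfl

theorem theta_apply (f : E.V [⋀^Fin (p + q)]→ₗ[ℂ] X) (y : Fin p → D.V) (x : Fin q → U.V) :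
    S.theta X p q f y x = f (Fin.append (fun k => S.s.f (y k)) (fun k => S.i.f (x k))) := rfl

variable [FiniteDimensional ℂ E.V]

theorem altWt_eq_zero {n w : ℕ} (h : n < w) (f : E.V [⋀^Fin n]→ₗ[ℂ] X) :
    S.grading.altWt w f = 0 :=
  S.grading.alt_ext fun a v hv => by
    refine S.grading.altWt_apply_eq_zero w f hv ?_
    have : ∑ i, a i ≤ ∑ _i : Fin n, 1 := Finset.sum_le_sum fun i _ => (hv i).1
    rw [Finset.sum_const, Finset.card_univ, Fintype.card_fin, smul_eq_mul, mul_one] at this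
    omega

/-- The family consists of `p` vectors of weight 1 and `q` of weight 0, so only the component of
weight `p` is seen. -/
theorem theta_altWt (f : E.V [⋀^Fin (p + q)]→ₗ[ℂ] X) :
    S.theta X p q (S.grading.altWt p f) = S.theta X p q f := by
  ext y x
  rw [theta_apply, theta_apply, S.grading.altWt_homog p f (a := Fin.append (fun _ => 1) fun _ => 0),
    if_pos]
  · simp [Fin.sum_univ_add]
  · intro k
    induction k using Fin.addCases with
    | left k =>
      rw [Fin.append_left, Fin.append_left]
      exact ⟨le_rfl, by rw [grading_one, S.p_s]⟩
    | right k =>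
      rw [Fin.append_right, Fin.append_right]
      exact ⟨Nat.zero_le _, by rw [grading_zero, S.r_i]⟩

/-- On a homogeneous family of total weight `p` exactly `p` vectors come from `D`. A permutation
moves them to the front, where the form is given by its evaluation `theta`; on the other homogeneous
families the form vanishes by weight. -/
theorem eq_zero_of_theta (f : E.V [⋀^Fin (p + q)]→ₗ[ℂ] X) (hf : S.grading.altWt p f = f)
    (h0 : S.theta X p q f = 0) : f = 0 := by
  refine S.grading.alt_ext fun a v hv => ?_
  rw [AlternatingMap.zero_apply]
  by_cases hp : ∑ i, a i = p
  swap
  · rw [← hf]; exact S.grading.altWt_apply_eq_zero p f hv hp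
  have ha : ∀ i, a i = 0 ∨ a i = 1 := fun i => by
    have : a i ≤ 1 := (hv i).1
    omega
  let A : Finset (Fin (p + q)) := Finset.univ.filter fun i => a i = 1
  have hA : A.card = p := by
    refine (Finset.card_filter _ _).trans (Eq.trans ?_ hp)
    exact Finset.sum_congr rfl fun i _ => by rcases ha i with h | h <;> simp [h]
  have hA' : Aᶜ.card = q := by rw [Finset.card_compl, hA, Fintype.card_fin]; omega
  let σ : Equiv.Perm (Fin (p + q)) := finSumFinEquiv.symm.trans (finSumEquivOfFinset hA hA')
  have h1 : v ∘ σ = Fin.append (fun k => S.s.f (S.p.f (v (σ (Fin.castAdd q k)))))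
      (fun k => S.i.f (S.r.f (v (σ (Fin.natAdd p k))))) := by
    funext k
    induction k using Fin.addCases with
    | left k =>
      rw [Fin.append_left]
      have h : σ (Fin.castAdd q k) ∈ A := by
        simp only [σ, Equiv.trans_apply, finSumFinEquiv_symm_apply_castAdd, finSumEquivOfFinset_inl]
        exact Finset.orderEmbOfFin_mem _ _ _
      have h2 := (hv (σ (Fin.castAdd q k))).2
      rw [(Finset.mem_filter.1 h).2] at h2
      exact h2.symm
    | right k =>
      rw [Fin.append_right]
      have h : σ (Fin.natAdd p k) ∈ Aᶜ := by
        simp only [σ, Equiv.trans_apply, finSumFinEquiv_symm_apply_natAdd, finSumEquivOfFinset_inr]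
        exact Finset.orderEmbOfFin_mem _ _ _
      have h2 := (hv (σ (Fin.natAdd p k))).2
      rw [(ha _).resolve_right fun h3 =>
        Finset.mem_compl.1 h (Finset.mem_filter.2 ⟨Finset.mem_univ _, h3⟩)] at h2
      exact h2.symm
  rw [f.map_congr_perm v σ, h1]
  have h2 := DFunLike.congr_fun (DFunLike.congr_fun h0 fun k => S.p.f (v (σ (Fin.castAdd q k))))
    fun k => S.r.f (v (σ (Fin.natAdd p k)))
  rw [theta_apply] at h2
  rw [h2]
  exact smul_zero _

/-- The multilinear extension of `F` along the two projections is alternatized. On split families a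
permutation mixing the two blocks gives zero, and every other one reproduces `F`, its signs
cancelling. Dividing by the number of the latter gives a preimage. -/
theorem theta_surjective : Function.Surjective (S.theta X p q) := by
  classical
  intro F
  -- the multilinear extension of `F`
  let m₁ : MultilinearMap ℂ (fun _ : Fin p => E.V)
      (MultilinearMap ℂ (fun _ : Fin q => E.V) X) :=
    { toFun := fun y => ((F fun k => S.p.f (y k)).compLinearMap S.r.f).toMultilinearMap
      map_update_add' := fun y k a b => by
        rename_i inst
        obtain rfl : inst = instDecidableEqFin p := Subsingleton.elim _ _
        have e : ∀ c, (fun l => S.p.f (Function.update y k c l)) =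
          Function.update (fun l => S.p.f (y l)) k (S.p.f c) := fun c =>
            Function.comp_update _ _ _ _
        ext x
        rw [e, e, e, map_add, AlternatingMap.map_update_add]
        rfl
      map_update_smul' := fun y k t a => by
        rename_i inst
        obtain rfl : inst = instDecidableEqFin p := Subsingleton.elim _ _
        have e : ∀ c, (fun l => S.p.f (Function.update y k c l)) =
          Function.update (fun l => S.p.f (y l)) k (S.p.f c) := fun c =>
            Function.comp_update _ _ _ _
        ext x
        rw [e, e, map_smul, AlternatingMap.map_update_smul]
        rfl }
  let m : MultilinearMap ℂ (fun _ : Fin p ⊕ Fin q => E.V) X :=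
    MultilinearMap.uncurrySum (N := fun _ : Fin p ⊕ Fin q => E.V) m₁
  have hm : ∀ v, m v = F (fun k => S.p.f (v (.inl k))) fun k => S.r.f (v (.inr k)) :=
    fun v => rfl
  let A : Finset (Equiv.Perm (Fin p ⊕ Fin q)) :=
    Finset.univ.filter fun σ => Set.MapsTo σ (Set.range Sum.inl) (Set.range Sum.inl)
  have hA : (A.card : ℂ) ≠ 0 := by
    have : (1 : Equiv.Perm (Fin p ⊕ Fin q)) ∈ A :=
      Finset.mem_filter.2 ⟨Finset.mem_univ _, fun _ h => h⟩
    exact_mod_cast (Finset.card_pos.2 ⟨_, this⟩).ne'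
  have key : ∀ y x, MultilinearMap.alternatization m
      (Sum.elim (fun k => S.s.f (y k)) fun k => S.i.f (x k)) = (A.card : ℂ) • F y x := by
    intro y x
    rw [MultilinearMap.alternatization_apply, ← Finset.sum_filter_add_sum_filter_not Finset.univ
      fun σ : Equiv.Perm (Fin p ⊕ Fin q) => Set.MapsTo σ (Set.range Sum.inl) (Set.range Sum.inl)]
    rw [Finset.sum_eq_zero (s := Finset.univ.filter fun σ : Equiv.Perm (Fin p ⊕ Fin q) =>
      ¬Set.MapsTo σ (Set.range Sum.inl) (Set.range Sum.inl)), add_zero]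
    · have h1 : ∀ σ ∈ A, Equiv.Perm.sign σ • m.domDomCongr σ
          (Sum.elim (fun k => S.s.f (y k)) fun k => S.i.f (x k)) = F y x := by
        intro σ hσ
        obtain ⟨⟨σ₁, σ₂⟩, rfl⟩ :=
          Equiv.Perm.mem_sumCongrHom_range_of_perm_mapsTo_inl (Finset.mem_filter.1 hσ).2
        have e1 : (fun k => S.p.f (Sum.elim (fun k => S.s.f (y k)) (fun k => S.i.f (x k))
            (Equiv.sumCongr σ₁ σ₂ (.inl k)))) = y ∘ σ₁ := funext fun k => by simp [S.p_s]
        have e2 : (fun k => S.r.f (Sum.elim (fun k => S.s.f (y k)) (fun k => S.i.f (x k))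
            (Equiv.sumCongr σ₁ σ₂ (.inr k)))) = x ∘ σ₂ := funext fun k => by simp [S.r_i]
        rw [MultilinearMap.domDomCongr_apply, hm]
        change Equiv.Perm.sign (Equiv.Perm.sumCongr σ₁ σ₂) • F (fun k => S.p.f (Sum.elim
          (fun k => S.s.f (y k)) (fun k => S.i.f (x k)) (Equiv.sumCongr σ₁ σ₂ (.inl k))))
          (fun k => S.r.f (Sum.elim (fun k => S.s.f (y k)) (fun k => S.i.f (x k))
            (Equiv.sumCongr σ₁ σ₂ (.inr k)))) = _
        rw [e1, e2, F.map_perm, AlternatingMap.smul_apply, AlternatingMap.map_perm,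
          Equiv.Perm.sign_sumCongr, smul_smul, smul_smul]
        rw [mul_assoc, Int.units_mul_self, one_smul]
      rw [Finset.sum_congr rfl h1, Finset.sum_const, Nat.cast_smul_eq_nsmul]
    · intro σ hσ
      have h2 := (Finset.mem_filter.1 hσ).2
      -- A mixing permutation feeds a vector of `U` into an argument of `F` belonging to `D`, where
      -- its projection is zero.
      obtain ⟨k, l, hkl⟩ : ∃ k l, σ (.inl k) = .inr l := by
        by_contra! h
        refine h2 ?_
        rintro _ ⟨k, rfl⟩
        cases h3 : σ (.inl k) with
        | inl l => exact ⟨l, rfl⟩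
        | inr l => exact absurd h3 (h k l)
      rw [MultilinearMap.domDomCongr_apply, hm, F.map_coord_zero k]
      · exact smul_zero _
      · rw [hkl, Sum.elim_inr, S.p_i]
  refine ⟨(A.card : ℂ)⁻¹ • (MultilinearMap.alternatization m).domDomCongr finSumFinEquiv, ?_⟩
  ext y x
  rw [map_smul, AlternatingMap.smul_apply, AlternatingMap.smul_apply, theta_apply,
    AlternatingMap.domDomCongr_apply]
  have e : (fun k => Fin.append (fun k => S.s.f (y k)) (fun k => S.i.f (x k)) (finSumFinEquiv k)) =
      Sum.elim (fun k => S.s.f (y k)) fun k => S.i.f (x k) := by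
    funext k
    cases k <;> simp
  change _ • MultilinearMap.alternatization m (fun k => Fin.append (fun k => S.s.f (y k))
    (fun k => S.i.f (x k)) (finSumFinEquiv k)) = _
  rw [e, key, inv_smul_smul₀ hA]

end Theta

section Diff

variable {X : Type} [AddCommGroup X] [Module ℂ X] {p q : ℕ} (a : U.V →ₗ[ℂ] Module.End ℂ U.V)
  (c : U.V →ₗ[ℂ] Module.End ℂ X)

/-- The extension by zero of a bracket on `U`. -/
def ext₀ : E.V →ₗ[ℂ] Module.End ℂ E.V :=
  LinearMap.mk₂ ℂ (fun x y => S.i.f (a (S.r.f x) (S.r.f y))) (fun _ _ _ => by simp)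
    (fun _ _ _ => by simp) (fun _ _ _ => by simp) (fun _ _ _ => by simp)

theorem ext₀_apply (x y : E.V) : S.ext₀ a x y = S.i.f (a (S.r.f x) (S.r.f y)) := rfl

/-- Vectors of `D` neither act nor bracket, so only the terms singling out a vector of `U` survive.
In these the index is shifted by `p`, which accounts for the sign. -/
theorem theta_twDiff (f : E.V [⋀^Fin (p + q)]→ₗ[ℂ] X) :
    S.theta X p (q + 1) (twDiff (S.ext₀ a) (c ∘ₗ S.r.f) (p + q) f) =
      (-1 : ℂ) ^ p • altComp (twDiff a c q) (S.theta X p q f) := by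
  ext y x
  rw [theta_apply, AlternatingMap.smul_apply, AlternatingMap.smul_apply, altComp_apply]
  refine (twDiff_apply (S.ext₀ a) (c ∘ₗ S.r.f) (p + q) f _).trans ?_
  rw [twDiff_apply, Finset.smul_sum]
  refine (Fin.sum_univ_add (a := p) (b := q + 1) _).trans ?_
  have h0 : ∀ k : Fin p, S.r.f (Fin.append (fun k => S.s.f (y k)) (fun k => S.i.f (x k))
      (Fin.castAdd (q + 1) k)) = 0 := fun k => by rw [Fin.append_left, S.r_s]
  have h1 : ∀ k : Fin (q + 1), S.r.f (Fin.append (fun k => S.s.f (y k)) (fun k => S.i.f (x k))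
      (Fin.natAdd p k)) = x k := fun k => by rw [Fin.append_right, S.r_i]
  rw [Finset.sum_eq_zero, zero_add]
  · refine Finset.sum_congr rfl fun k _ => ?_
    rw [removeNth_append]
    have e0 : (Fin.removeNth k fun l => S.i.f (x l)) = fun l => S.i.f (Fin.removeNth k x l) := rfl
    rw [e0, LinearMap.comp_apply, h1, ← theta_apply]
    have e2 : ∑ l : Fin (p + q), f (Function.update (Fin.append (fun k => S.s.f (y k))
        (fun l => S.i.f (Fin.removeNth k x l))) l (S.ext₀ a (Fin.append (fun k => S.s.f (y k))
        (fun k => S.i.f (x k)) (Fin.natAdd p k)) (Fin.append (fun k => S.s.f (y k))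
        (fun l => S.i.f (Fin.removeNth k x l)) l))) = ∑ l, S.theta X p q f y
          (Function.update (Fin.removeNth k x) l (a (x k) (Fin.removeNth k x l))) := by
      rw [Fin.sum_univ_add, Finset.sum_eq_zero, zero_add]
      · refine Finset.sum_congr rfl fun l _ => ?_
        rw [theta_apply, ext₀_apply, h1, Fin.append_right, S.r_i, ← append_update_right]
        congr 2
        exact (Function.comp_update S.i.f (Fin.removeNth k x) l _).symm
      · intro l _
        refine f.map_coord_zero (Fin.castAdd q l) ?_
        rw [Function.update_self, ext₀_apply, Fin.append_left, S.r_s, map_zero, map_zero]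
    rw [e2, Fin.val_natAdd, pow_add, mul_smul, ← Int.cast_smul_eq_zsmul ℂ ((-1) ^ p)]
    push_cast
    rfl
  · intro k _
    have e1 : ∀ w, S.ext₀ a (Fin.append (fun k => S.s.f (y k)) (fun k => S.i.f (x k))
        (Fin.castAdd (q + 1) k)) w = 0 := fun w => by rw [ext₀_apply, h0, map_zero]; exact map_zero _
    rw [LinearMap.comp_apply, h0, map_zero, LinearMap.zero_apply, Finset.sum_eq_zero]
    · simp
    · intro l _
      exact f.map_coord_zero l (by rw [Function.update_self, e1])

/-- Bracket and action depend only on the components in `U`, and the bracket takes its values there;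
scaling in positive weights does not affect them. Consequently this differential preserves weights.
-/
theorem altPre_scale_twDiff {n : ℕ} (k : ℕ) (f : E.V [⋀^Fin n]→ₗ[ℂ] X) :
    altPre (S.grading.scale k) (twDiff (S.ext₀ a) (c ∘ₗ S.r.f) n f) =
      twDiff (S.ext₀ a) (c ∘ₗ S.r.f) n (altPre (S.grading.scale k) f) := by
  have hs : ∀ v, S.grading.scale k v = S.i.f (S.r.f v) + (k : ℂ) • S.s.f (S.p.f v) := fun v => by
    rw [LinGrading.scale, LinearMap.sum_apply]
    change ∑ a ∈ Finset.range 2, _ = _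
    rw [Finset.sum_range_succ, Finset.sum_range_one, LinearMap.smul_apply, LinearMap.smul_apply,
      pow_zero, pow_one, one_smul, grading_zero, grading_one]
  have hr : ∀ v, S.r.f (S.grading.scale k v) = S.r.f v := fun v => by
    rw [hs, map_add, map_smul, S.r_i, S.r_s, smul_zero, add_zero]
  have hi : ∀ u, S.grading.scale k (S.i.f u) = S.i.f u := fun u => by
    rw [hs, S.r_i, S.p_i, map_zero, smul_zero, add_zero]
  ext v
  rw [altPre_apply, twDiff_apply, twDiff_apply]
  refine Finset.sum_congr rfl fun l _ => ?_
  rw [LinearMap.comp_apply, LinearMap.comp_apply, hr, altPre_apply]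
  congr 3
  refine Finset.sum_congr rfl fun t _ => ?_
  rw [altPre_apply]
  congr 1
  have e : S.ext₀ a (S.grading.scale k (v l)) (Fin.removeNth l (fun i => S.grading.scale k (v i)) t) =
      S.grading.scale k (S.ext₀ a (v l) (Fin.removeNth l v t)) := by
    rw [ext₀_apply, ext₀_apply, hi, hr]
    congr 2
    exact hr _
  rw [e]
  exact (Function.comp_update (S.grading.scale k) (Fin.removeNth l v) t _).symm

variable [FiniteDimensional ℂ E.V]

theorem altWt_twDiff {n : ℕ} (w : ℕ) (f : E.V [⋀^Fin n]→ₗ[ℂ] X) :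
    S.grading.altWt w (twDiff (S.ext₀ a) (c ∘ₗ S.r.f) n f) =
      twDiff (S.ext₀ a) (c ∘ₗ S.r.f) n (S.grading.altWt w f) := by
  simp only [LinGrading.altWt_apply, map_sum, map_smul, altPre_scale_twDiff]

end Diff

end Splitting

end GKMod

/-! ## Decompositions of modules of alternating forms -/

namespace GKMod

variable {P : HCPair}

/-- A morphism whose values lie in a submodule factors through it. -/
theorem Hom.exists_lift {X Y W : GKMod P} (i : Hom Y W) (g : Hom X W)
    (hi : Function.Injective i.f) (h : ∀ x, ∃ y, i.f y = g.f x) :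
    ∃ l : Hom X Y, ∀ x, i.f (l.f x) = g.f x := by
  obtain ⟨r, hr⟩ := LinearMap.exists_leftInverse_of_injective i.f (LinearMap.ker_eq_bot.2 hi)
  have hr' : ∀ y, r (i.f y) = y := fun y => LinearMap.congr_fun hr y
  have key : ∀ x, i.f (r (g.f x)) = g.f x := fun x => by
    obtain ⟨y, hy⟩ := h x
    rw [← hy, hr']
  refine ⟨⟨r ∘ₗ g.f, fun a x => hi ?_, fun m x => hi ?_⟩, key⟩
  · rw [i.map_ρ]
    exact (key _).trans ((g.map_ρ a x).trans (congrArg _ (key x).symm))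
  · rw [i.map_σ]
    exact (key _).trans ((g.map_σ m x).trans (congrArg _ (key x).symm))

/-- The class of a module with a decomposition given by orthogonal idempotents. -/
theorem mem_and_cls_of_idem {𝓛 : AbSubcat P} (M : GKMod P) (e : ℕ → Hom M M) (N : ℕ)
    (idem : ∀ a v, (e a).f ((e a).f v) = (e a).f v)
    (orth : ∀ a b v, a ≠ b → (e a).f ((e b).f v) = 0)
    (sum : ∀ v, ∑ a ∈ Finset.range N, (e a).f v = v) (he : ∀ a, 𝓛.mem (im (e a))) :
    ∃ h : 𝓛.mem M, K0.cls 𝓛 M h = ∑ a ∈ Finset.range N, K0.cls 𝓛 (im (e a)) (he a) := by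
  -- Membership of `M` is to be proved, so `M` is built up: `Y` is the direct sum of the first `k`
  -- images, embedded as the vectors annihilated by all the later idempotents.
  have key : ∀ k, ∃ (Y : GKMod P) (φ : Hom Y M) (hY : 𝓛.mem Y), Function.Injective φ.f ∧
      (∀ y a, k ≤ a → (e a).f (φ.f y) = 0) ∧
      (∀ v, (∀ a, k ≤ a → (e a).f v = 0) → ∃ y, φ.f y = v) ∧
      K0.cls 𝓛 Y hY = ∑ a ∈ Finset.range k, K0.cls 𝓛 (im (e a)) (he a) := by
    intro k
    induction k with
    | zero =>
      have hs : Subsingleton (im (Hom.zero M M)).V :=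
        ⟨fun ⟨_, a, ha⟩ ⟨_, b, hb⟩ => Subtype.ext (ha.symm.trans hb)⟩
      have hm : 𝓛.mem (im (Hom.zero M M)) := 𝓛.zero _ hs
      refine ⟨_, imIncl (Hom.zero M M), hm, fun a b _ => hs.elim a b, fun y a _ => ?_,
        fun v hv => ⟨0, ?_⟩, ?_⟩
      · rw [hs.elim y 0, map_zero, map_zero]
      · rw [map_zero, ← sum v, Finset.sum_eq_zero fun a _ => hv a (Nat.zero_le a)]
      · rw [Finset.sum_range_zero, K0.cls_zero]
    | succ k ih =>
      obtain ⟨Y, φ, hY, h1, h2, h3, h4⟩ := ih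
      let φ' : Hom (Y.prod (im (e k))) M := Cpx.Grading.coprodHom φ (imIncl (e k))
      have hφ' : ∀ v, φ'.f v = φ.f v.1 + v.2.1 := fun v => rfl
      have hw : ∀ (w : (im (e k)).V), (e k).f w.1 = w.1 := by
        rintro ⟨_, v, rfl⟩
        exact idem k v
      have hw' : ∀ (w : (im (e k)).V) a, k + 1 ≤ a → (e a).f w.1 = 0 := by
        rintro ⟨_, v, rfl⟩ a ha
        exact orth a k v (by omega)
      refine ⟨_, φ', prod_mem hY (he k), (injective_iff_map_eq_zero φ'.f).2 fun v hv => ?_,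
        fun v a ha => ?_, fun v hv => ?_, ?_⟩
      · have e1 : φ.f v.1 + v.2.1 = 0 := hv
        have e2 : v.2.1 = 0 := by
          have := congrArg (e k).f e1
          rwa [map_add, h2 _ _ le_rfl, zero_add, map_zero, hw] at this
        rw [e2, add_zero] at e1
        exact Prod.ext (h1 (e1.trans (map_zero _).symm)) (Subtype.ext e2)
      · rw [hφ', map_add, h2 _ _ (by omega), hw' _ _ ha, add_zero]
      · obtain ⟨y, hy⟩ := h3 (v - (e k).f v) fun a ha => by
          rw [map_sub]
          rcases eq_or_lt_of_le ha with rfl | h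
          · rw [idem, sub_self]
          · rw [hv a h, orth a k v (by omega), sub_zero]
        refine ⟨(y, (toIm (e k)).f v), (hφ' _).trans ?_⟩
        change φ.f y + (e k).f v = v
        rw [hy, sub_add_cancel]
      · rw [cls_prod hY (he k), h4, Finset.sum_range_succ]
  obtain ⟨Y, φ, hY, h1, h2, h3, h4⟩ := key N
  have hb : Function.Bijective φ.f := ⟨h1, fun v => h3 v fun a ha => by
    rw [← sum v, map_sum]
    refine Finset.sum_eq_zero fun b hb => orth a b v ?_
    have := Finset.mem_range.1 hb
    omega⟩
  exact ⟨mem_of_iso hY φ hb, (K0.cls_iso 𝓛 hY _ φ hb).symm.trans h4⟩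

/-- The components of a module decomposed by orthogonal idempotents `e₀, e₁, …` of which only
`e₀, …, e_n` are different from zero, indexed by the pairs `(p, q)` with `p + q = n`. -/
theorem mem_and_cls_antidiagonal {𝓛 : AbSubcat P} (M : GKMod P) (e : ℕ → Hom M M) (N n : ℕ)
    (idem : ∀ a v, (e a).f ((e a).f v) = (e a).f v)
    (orth : ∀ a b v, a ≠ b → (e a).f ((e b).f v) = 0)
    (sum : ∀ v, ∑ a ∈ Finset.range N, (e a).f v = v) (hn : ∀ a, n < a → ∀ v, (e a).f v = 0)
    (Y : ℕ → ℕ → GKMod P) (hY : ∀ p q, 𝓛.mem (Y p q))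
    (h : ∀ p q, p + q = n → ∃ f : Hom (im (e p)) (Y p q), Function.Bijective f.f) :
    ∃ h : 𝓛.mem M, K0.cls 𝓛 M h =
      ∑ a ∈ Finset.HasAntidiagonal.antidiagonal n, K0.cls 𝓛 (Y a.1 a.2) (hY a.1 a.2) := by
  have hs : ∀ a, n < a → Subsingleton (im (e a)).V := fun a ha => by
    refine ⟨?_⟩
    rintro ⟨_, v, rfl⟩ ⟨_, w, rfl⟩
    exact Subtype.ext ((hn a ha v).trans (hn a ha w).symm)
  have he : ∀ a, 𝓛.mem (im (e a)) := fun a => by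
    rcases lt_or_ge n a with ha | ha
    · exact 𝓛.zero _ (hs a ha)
    · obtain ⟨f, hf⟩ := h a (n - a) (by omega)
      exact mem_of_iso' (hY _ _) f hf
  -- The given range may be longer or shorter than `n + 1`. Idempotents beyond either bound vanish,
  -- so the sum does not change.
  have sum' : ∀ v, ∑ a ∈ Finset.range (n + 1), (e a).f v = v := fun v => by
    conv_rhs => rw [← sum v]
    have hN : ∀ a, N ≤ a → (e a).f v = 0 := fun a ha => by
      conv_lhs => rw [← sum v]
      rw [map_sum]
      refine Finset.sum_eq_zero fun b hb => orth a b v ?_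
      have := Finset.mem_range.1 hb
      omega
    rcases le_total N (n + 1) with hN' | hN'
    · refine (Finset.sum_subset (Finset.range_subset_range.2 hN') fun a _ ha => hN a ?_).symm
      simpa using ha
    · refine Finset.sum_subset (Finset.range_subset_range.2 hN') fun a _ ha => hn a ?_ v
      have : ¬a < n + 1 := fun h => ha (Finset.mem_range.2 h)
      omega
  obtain ⟨h1, h2⟩ := mem_and_cls_of_idem M e (n + 1) idem orth sum' he
  refine ⟨h1, h2.trans ?_⟩
  rw [Finset.Nat.sum_antidiagonal_eq_sum_range_succ_mk]
  refine Finset.sum_congr rfl fun a ha => ?_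
  obtain ⟨f, hf⟩ := h a (n - a) (by have := Finset.mem_range.1 ha; omega)
  exact K0.cls_iso 𝓛 _ _ f hf

/-- The component of a given weight of the module of alternating forms on a graded module. -/
def altWtHom {E : GKMod P} [FiniteDimensional ℂ E.V] (γ : LinGrading E.V)
    (hρ : ∀ a x v, γ.π a (E.ρ x v) = E.ρ x (γ.π a v))
    (hσ : ∀ a m v, γ.π a (E.σ m v) = E.σ m (γ.π a v)) (X : GKMod P) (w n : ℕ) :
    Hom (alt E X n) (alt E X n) where
  f := γ.altWt w
  map_ρ x f :=
    have key (f : E.V [⋀^Fin n]→ₗ[ℂ] X.V) : γ.altWt w (altPost (X.ρ x) f - altDer (E.ρ x) f) =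
        altPost (X.ρ x) (γ.altWt w f) - altDer (E.ρ x) (γ.altWt w f) := by
      rw [map_sub, γ.altWt_altPost, γ.altWt_altDer w (E.ρ x) fun a v => (hρ a x v).symm]
    key f
  map_σ m f :=
    have key (f : E.V [⋀^Fin n]→ₗ[ℂ] X.V) : γ.altWt w (altPost (X.σ m)
        (f.compLinearMap (E.σ m⁻¹))) =
        altPost (X.σ m) ((γ.altWt w f).compLinearMap (E.σ m⁻¹)) := by
      rw [γ.altWt_altPost, γ.altWt_compLinearMap w (E.σ m⁻¹) fun a v => (hσ a m⁻¹ v).symm]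
    key f

/-- The map `X ⊗ ⋀^q E* → Hom(⋀^q E, X)` of vector spaces. -/
def tensorForms (E X : Type) [AddCommGroup E] [Module ℂ E] [AddCommGroup X] [Module ℂ X] (q : ℕ) :
    X ⊗[ℂ] (E [⋀^Fin q]→ₗ[ℂ] ℂ) →ₗ[ℂ] (E [⋀^Fin q]→ₗ[ℂ] X) :=
  TensorProduct.lift (LinearMap.mk₂ ℂ (fun x ζ => altComp (LinearMap.toSpanSingleton ℂ X x) ζ)
    (fun x y ζ => by ext v; simp [altComp_apply]) (fun c x ζ => by
      ext v; simp [altComp_apply, smul_smul, mul_comm])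
    (fun x ζ η => map_add _ _ _) (fun c x ζ => map_smul _ _ _))

theorem tensorForms_tmul {E X : Type} [AddCommGroup E] [Module ℂ E] [AddCommGroup X] [Module ℂ X]
    {q : ℕ} (x : X) (ζ : E [⋀^Fin q]→ₗ[ℂ] ℂ) (v : Fin q → E) :
    tensorForms E X q (x ⊗ₜ ζ) v = ζ v • x := rfl

/-- The isomorphism `X ⊗ ⋀^q E* → Hom(⋀^q E, X)`. -/
def tensorExtDual (E X : GKMod P) [FiniteDimensional ℂ E.V] (q : ℕ) :
    Hom (X.tensor (E.extDual q)) (alt E X q) where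
  f := tensorForms E.V X.V q
  map_ρ x t := by
    have key : ∀ (y : X.V) (ζ : E.V [⋀^Fin q]→ₗ[ℂ] ℂ), tensorForms E.V X.V q (X.ρ x y ⊗ₜ ζ +
        y ⊗ₜ (altPost (0 : Module.End ℂ ℂ) ζ - altDer (E.ρ x) ζ)) =
        altPost (X.ρ x) (tensorForms E.V X.V q (y ⊗ₜ ζ)) -
          altDer (E.ρ x) (tensorForms E.V X.V q (y ⊗ₜ ζ)) := fun y ζ => by
      ext v
      rw [map_add, AlternatingMap.add_apply, AlternatingMap.sub_apply, altDer_apply, altPost_apply]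
      simp only [tensorForms_tmul]
      rw [map_smul, ← Finset.sum_smul, AlternatingMap.sub_apply, altPost_apply, altDer_apply,
        LinearMap.zero_apply, zero_sub, neg_smul, sub_eq_add_neg]
    exact LinearMap.congr_fun (show tensorForms E.V X.V q ∘ₗ ((X.ρ x).rTensor _ +
      LinearMap.lTensor X.V (altPost (0 : Module.End ℂ ℂ) - altDerL (E.ρ x))) =
      (altPost (X.ρ x) - altDerL (E.ρ x)) ∘ₗ tensorForms E.V X.V q from
        TensorProduct.ext' key) t
  map_σ m t := by
    have key : ∀ (y : X.V) (ζ : E.V [⋀^Fin q]→ₗ[ℂ] ℂ), tensorForms E.V X.V q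
        (X.σ m y ⊗ₜ altPost 1 (ζ.compLinearMap (E.σ m⁻¹))) =
        altPost (X.σ m) ((tensorForms E.V X.V q (y ⊗ₜ ζ)).compLinearMap (E.σ m⁻¹)) :=
      fun y ζ => by
        ext v
        rw [altPost_apply, AlternatingMap.compLinearMap_apply]
        simp only [tensorForms_tmul]
        rw [map_smul]
        rfl
    exact LinearMap.congr_fun (show tensorForms E.V X.V q ∘ₗ
      TensorProduct.map (X.σ m) (altσ E (triv P) m) =
      altσ E X m ∘ₗ tensorForms E.V X.V q from TensorProduct.ext' key) t

/-- No finiteness of `X` is available. Injectivity follows by writing a tensor in a basis of `X`.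
Surjectivity holds because a form on a finite-dimensional space takes its values in a
finite-dimensional subspace. -/
theorem tensorExtDual_bijective (E X : GKMod P) [FiniteDimensional ℂ E.V] (q : ℕ) :
    Function.Bijective (tensorExtDual E X q).f := by
  let F := tensorForms E.V X.V q
  have hF : ∀ (x : X.V) (ζ : E.V [⋀^Fin q]→ₗ[ℂ] ℂ) (v : Fin q → E.V),
    F (x ⊗ₜ ζ) v = ζ v • x := fun x ζ v => rfl
  suffices h : Function.Bijective F from h
  refine ⟨(injective_iff_map_eq_zero F).2 fun t ht => ?_, fun f => ?_⟩
  · let b := Module.Basis.ofVectorSpace ℂ X.V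
    obtain ⟨c, rfl⟩ := TensorProduct.eq_repr_basis_left b t
    have h : ∀ v i, c i v = 0 := fun v i => by
      have h1 := DFunLike.congr_fun ht v
      rw [Finsupp.sum, map_sum, alternatingMap_sum_apply] at h1
      simp only [hF] at h1
      by_cases hi : i ∈ c.support
      · exact linearIndependent_iff'.1 b.linearIndependent _ (fun i => c i v) h1 i hi
      · rw [Finsupp.notMem_support_iff.1 hi]; rfl
    refine Finset.sum_eq_zero fun i _ => ?_
    have : c i = 0 := AlternatingMap.ext fun v => h v i
    change b i ⊗ₜ c i = 0
    rw [this, TensorProduct.tmul_zero]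
  · obtain ⟨T, hT, h1⟩ := exists_altVal E X f
    obtain ⟨n, w, μ, h2⟩ := exists_expansion T
    refine ⟨∑ i, w i ⊗ₜ altComp (μ i) f, AlternatingMap.ext fun v => ?_⟩
    have h3 : f v ∈ T := by simpa using h1 1 v
    refine Eq.trans ?_ (h2 _ h3).symm
    rw [map_sum, alternatingMap_sum_apply]
    rfl

/-- Through the isomorphism of `X ⊗ ⋀^q E*` with `Hom(⋀^q E, X)`, closure under tensoring becomes
closure under forming modules of alternating forms, and `cls_alt` expresses multiplication by `[⋀^q
E*]` by such modules. -/
theorem alt_mem {𝓛 : AbSubcat P} {E : GKMod P} [FiniteDimensional ℂ E.V]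
    (h : 𝓛.ClosedUnderExt E) {X : GKMod P} (hX : 𝓛.mem X) (q : ℕ) : 𝓛.mem (alt E X q) :=
  mem_of_iso (h.tensor q X hX) _ (tensorExtDual_bijective E X q)

theorem cls_alt {𝓛 : AbSubcat P} {E : GKMod P} [FiniteDimensional ℂ E.V]
    (h : 𝓛.ClosedUnderExt E) {X : GKMod P} (hX : 𝓛.mem X) (q : ℕ) :
    K0.cls 𝓛 (alt E X q) (alt_mem h hX q) =
      K0.mulRight 𝓛 (E.extDual q) (h.tensor q) (K0.cls 𝓛 X hX) := by
  rw [K0.mulRight, K0.lift_cls]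
  exact (K0.cls_iso 𝓛 _ _ _ (tensorExtDual_bijective E X q)).symm

theorem alt_subsingleton {E : GKMod P} [FiniteDimensional ℂ E.V] (X : GKMod P) {q : ℕ}
    (h : Module.finrank ℂ E.V < q) : Subsingleton (alt E X q).V :=
  ⟨fun a b => (alt_eq_zero_of_finrank_lt h a).trans (alt_eq_zero_of_finrank_lt h b).symm⟩

namespace Splitting

variable {U E D : GKMod P} [FiniteDimensional ℂ U.V] [FiniteDimensional ℂ E.V]
  [FiniteDimensional ℂ D.V] (S : Splitting U E D) (X : GKMod P)

/-- The component of weight `p`, i.e. of degree `p` on `D`, of the forms on `E`. -/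
def wtHom (p n : ℕ) : Hom (alt E X n) (alt E X n) :=
  altWtHom S.grading S.grading_ρ S.grading_σ X p n

/-- The evaluation of forms on `p` vectors of `D` and `q` vectors of `U`, as a morphism. -/
def thetaHom (p q : ℕ) : Hom (alt E X (p + q)) (alt D (alt U X q) p) where
  f := S.theta X.V p q
  map_ρ h f := by
    refine AlternatingMap.ext fun y => AlternatingMap.ext fun x => ?_
    let f' : E.V [⋀^Fin (p + q)]→ₗ[ℂ] X.V := f
    change X.ρ h (f' _) - altDer (E.ρ h) f' (Fin.append (fun k => S.s.f (y k))
      (fun k => S.i.f (x k))) = X.ρ h (S.theta X.V p q f' y x) -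
        altDer (U.ρ h) (S.theta X.V p q f' y) x - (altDer (D.ρ h) (S.theta X.V p q f') y) x
    rw [altDer_apply, altDer_apply, altDer_apply, alternatingMap_sum_apply, Fin.sum_univ_add,
      sub_sub, add_comm (∑ k : Fin q, _)]
    congr 2
    · refine Finset.sum_congr rfl fun k _ => ?_
      rw [Fin.append_left, ← S.s.map_ρ, ← append_update_left, theta_apply]
      congr 2
      exact (Function.comp_update S.s.f y k _).symm
    · refine Finset.sum_congr rfl fun k _ => ?_
      rw [Fin.append_right, ← S.i.map_ρ, ← append_update_right, theta_apply]
      congr 2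
      exact (Function.comp_update S.i.f x k _).symm
  map_σ m f := by
    refine AlternatingMap.ext fun y => AlternatingMap.ext fun x => ?_
    let f' : E.V [⋀^Fin (p + q)]→ₗ[ℂ] X.V := f
    change X.σ m (f' fun k => E.σ m⁻¹ (Fin.append (fun k => S.s.f (y k))
      (fun k => S.i.f (x k)) k)) = X.σ m (S.theta X.V p q f' (fun k => D.σ m⁻¹ (y k))
        fun k => U.σ m⁻¹ (x k))
    rw [map_append, theta_apply]
    simp only [S.s.map_σ, S.i.map_σ]

variable {𝓛 : AbSubcat P}

include S in
/-- The class of `Hom(⋀^n E, X)`. -/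
theorem mem_and_cls_alt (hU : 𝓛.ClosedUnderExt U) (hD : 𝓛.ClosedUnderExt D) (hX : 𝓛.mem X)
    (n : ℕ) : ∃ h : 𝓛.mem (alt E X n), K0.cls 𝓛 (alt E X n) h =
      ∑ a ∈ Finset.HasAntidiagonal.antidiagonal n, K0.mulRight 𝓛 (D.extDual a.1) (hD.tensor a.1)
        (K0.mulRight 𝓛 (U.extDual a.2) (hU.tensor a.2) (K0.cls 𝓛 X hX)) := by
  obtain ⟨h1, h2⟩ := mem_and_cls_antidiagonal (𝓛 := 𝓛) (alt E X n) (fun p => S.wtHom X p n)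
    (S.grading.bound + 1) n (fun a v => S.grading.altWt_self a v)
    (fun a b v hab => S.grading.altWt_ne hab v) (fun v => S.grading.sum_altWt v)
    (fun a ha v => S.altWt_eq_zero ha v) (fun p q => alt D (alt U X q) p)
    (fun p q => alt_mem hD (alt_mem hU hX q) p) (by
      rintro p q rfl
      -- Projection to weight `p` and evaluation by `theta` are surjections from the same module
      -- with the same kernel.
      refine Hom.exists_iso (toIm (S.wtHom X p (p + q))) (S.thetaHom X p q)
        (LinearMap.surjective_rangeRestrict _) S.theta_surjective fun v => ?_
      have h : (toIm (S.wtHom X p (p + q))).f v = 0 ↔ S.grading.altWt p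
        (show E.V [⋀^Fin (p + q)]→ₗ[ℂ] X.V from v) = 0 := Subtype.ext_iff
      rw [h]
      constructor
      · intro h0
        have := S.theta_altWt (show E.V [⋀^Fin (p + q)]→ₗ[ℂ] X.V from v)
        rw [h0, map_zero] at this
        exact this.symm
      · intro h0
        refine S.eq_zero_of_theta _ (S.grading.altWt_self p _) ?_
        rw [theta_altWt]
        exact h0)
  refine ⟨h1, h2.trans (Finset.sum_congr rfl fun a _ => ?_)⟩
  rw [← cls_alt hU hX, ← cls_alt hD]

end Splitting

end GKMod

/-! ## The cohomology of a split complex -/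

/-- Primitives of coboundaries can be chosen linearly. This allows choosing them simultaneously for
all values of a form. -/
theorem exists_quasi_inverse {V W : Type} [AddCommGroup V] [Module ℂ V] [AddCommGroup W]
    [Module ℂ W] (f : V →ₗ[ℂ] W) : ∃ s : W →ₗ[ℂ] V, ∀ v, f (s (f v)) = f v := by
  obtain ⟨s, hs⟩ := LinearMap.exists_rightInverse_of_surjective f.rangeRestrict
    (LinearMap.range_eq_top.2 (LinearMap.surjective_rangeRestrict f))
  obtain ⟨s', hs'⟩ := LinearMap.exists_extend s
  refine ⟨s', fun v => ?_⟩
  have h1 : s' (f v) = s (f.rangeRestrict v) := LinearMap.congr_fun hs' (f.rangeRestrict v)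
  rw [h1]
  exact congrArg Subtype.val (LinearMap.congr_fun hs (f.rangeRestrict v))

namespace GKMod.Splitting

variable {P : HCPair} {U E D : GKMod P} [FiniteDimensional ℂ U.V] [FiniteDimensional ℂ E.V]
  [FiniteDimensional ℂ D.V] (S : Splitting U E D) {X : GKMod P}
  {a : U.V →ₗ[ℂ] Module.End ℂ U.V} {c : U.V →ₗ[ℂ] Module.End ℂ X.V}
  {dE : ∀ n, Hom (alt E X n) (alt E X (n + 1))} {dU : ∀ n, Hom (alt U X n) (alt U X (n + 1))}
  (hE2 : ∀ n v, (dE (n + 1)).f ((dE n).f v) = 0) (hU2 : ∀ n v, (dU (n + 1)).f ((dU n).f v) = 0)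
  (hE : ∀ n (f : E.V [⋀^Fin n]→ₗ[ℂ] X.V), (dE n).f f = twDiff (S.ext₀ a) (c ∘ₗ S.r.f) n f)
  (hU : ∀ n (f : U.V [⋀^Fin n]→ₗ[ℂ] X.V), (dU n).f f = twDiff a c n f)

/-- The component of degree `p` on `D` of the complex of forms on `E`. -/
def wtCpx (p : ℕ) : Cpx.Hom ⟨alt E X, dE, hE2⟩ ⟨alt E X, dE, hE2⟩ where
  f := S.wtHom X p
  comm n v := ((hE n _).trans (S.altWt_twDiff a c p _).symm).trans
    (congrArg (S.grading.altWt p) (hE n v).symm)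

-- By `theta_twDiff` the differential acts, up to sign, on the values of forms on `D`. A form is a
-- coboundary precisely when all its values are, because the primitives can be chosen linearly.
include hE hU in
theorem altWt_mem_B_iff (p q : ℕ) (z : E.V [⋀^Fin (p + q)]→ₗ[ℂ] X.V) :
    S.grading.altWt p z ∈ (⟨alt E X, dE, hE2⟩ : Cpx P).B (p + q) ↔
      ∀ y, S.theta X.V p q z y ∈ (⟨alt U X, dU, hU2⟩ : Cpx P).B q := by
  cases q with
  | zero =>
    -- For `q = 0` only zero is a coboundary on the side of `U`. On the side of `E`, a primitive has
    -- degree below `p`, hence no component of weight `p`.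
    have h1 : S.grading.altWt p z ∈ (⟨alt E X, dE, hE2⟩ : Cpx P).B p → S.grading.altWt p z = 0 := by
      intro h
      cases p with
      | zero => exact (Submodule.mem_bot ℂ).1 h
      | succ p =>
        obtain ⟨w, hw⟩ := h
        have h2 : ∀ w : E.V [⋀^Fin p]→ₗ[ℂ] X.V,
            S.grading.altWt (p + 1) (twDiff (S.ext₀ a) (c ∘ₗ S.r.f) p w) = 0 := fun w => by
          rw [S.altWt_twDiff, S.altWt_eq_zero (Nat.lt_succ_self p), map_zero]
        exact (S.grading.altWt_self (p + 1) z).symm.trans ((congrArg (S.grading.altWt (p + 1))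
          ((hE p w).symm.trans hw).symm).trans (h2 w))
    constructor
    · intro h y
      rw [← S.theta_altWt, h1 h, map_zero]
      exact zero_mem _
    · intro h
      have h2 : S.grading.altWt p z = 0 := S.eq_zero_of_theta (q := 0) _ (S.grading.altWt_self p _)
        (by
          rw [theta_altWt]
          exact AlternatingMap.ext fun y => (Submodule.mem_bot ℂ).1 (h y))
      rw [h2]
      exact zero_mem _
  | succ q =>
    constructor
    · rintro ⟨w, hw⟩ y
      have h2 : ∀ w : E.V [⋀^Fin (p + q)]→ₗ[ℂ] X.V,
          twDiff (S.ext₀ a) (c ∘ₗ S.r.f) (p + q) w = S.grading.altWt p z →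
          twDiff a c q ((-1 : ℂ) ^ p • S.theta X.V p q w y) = S.theta X.V p (q + 1) z y :=
        fun w h => by
          rw [← S.theta_altWt (q := q + 1) z, ← h, S.theta_twDiff a c w, map_smul,
            AlternatingMap.smul_apply, altComp_apply]
      exact ⟨_, (hU q _).trans (h2 w ((hE (p + q) w).symm.trans hw))⟩
    · intro h
      obtain ⟨s, hs⟩ := exists_quasi_inverse (twDiff a c q)
      obtain ⟨f, hf⟩ := S.theta_surjective (altComp s (S.theta X.V p (q + 1) z))
      have hsz : altComp (twDiff a c q) (altComp s (S.theta X.V p (q + 1) z)) =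
          S.theta X.V p (q + 1) z := by
        refine AlternatingMap.ext fun y => ?_
        obtain ⟨w, hw⟩ := h y
        have key : ∀ w : U.V [⋀^Fin q]→ₗ[ℂ] X.V, twDiff a c q w = S.theta X.V p (q + 1) z y →
            twDiff a c q (s (S.theta X.V p (q + 1) z y)) = S.theta X.V p (q + 1) z y :=
          fun w h => by rw [← h, hs]
        exact key w ((hU q w).symm.trans hw)
      -- The sign cancels the one in `theta_twDiff`, and the projection to weight `p` allows testing
      -- the equation by `theta`.
      let w := (-1 : ℂ) ^ p • S.grading.altWt p f
      have hw : twDiff (S.ext₀ a) (c ∘ₗ S.r.f) (p + q) w = S.grading.altWt p z := by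
        rw [← sub_eq_zero]
        refine S.eq_zero_of_theta (q := q + 1) _ ?_ ?_
        · rw [map_sub]
          congr 1
          · refine (S.altWt_twDiff a c p w).trans ?_
            rw [map_smul, S.grading.altWt_self]
          · exact S.grading.altWt_self p z
        · rw [map_sub, theta_altWt]
          refine sub_eq_zero.2 ((S.theta_twDiff a c w).trans ?_)
          rw [map_smul, theta_altWt, hf, map_smul, hsz, smul_smul, ← pow_add, ← two_mul, pow_mul]
          simp
      exact ⟨w, (hE (p + q) w).trans hw⟩

-- Forming alternating forms on `D` is exact in the coefficients, so it commutes with cohomology.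
-- Both sides are exhibited as quotients of the cocycles of degree `p + q` by the same submodule.
include hE hU in
theorem exists_iso_im_onH (p q : ℕ) : ∃ f : Hom (im ((S.wtCpx hE2 hE p).onH (p + q)))
    (alt D ((⟨alt U X, dU, hU2⟩ : Cpx P).H q) p), Function.Bijective f.f := by
  let G : Cpx P := ⟨alt E X, dE, hE2⟩
  let A : Cpx P := ⟨alt U X, dU, hU2⟩
  have hd : ∀ z : E.V [⋀^Fin (p + q)]→ₗ[ℂ] X.V, S.theta X.V p (q + 1)
      (show E.V [⋀^Fin (p + (q + 1))]→ₗ[ℂ] X.V from (dE (p + q)).f z) =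
      (-1 : ℂ) ^ p • altComp (twDiff a c q) (S.theta X.V p q z) := fun z =>
    (congrArg (S.theta X.V p (q + 1)) (hE (p + q) z)).trans (S.theta_twDiff a c z)
  have hz : ∀ (z : (G.Z (p + q)).V) y, (dU q).f (S.theta X.V p q z.1 y) = 0 := fun z y => by
    have h1 := hd z.1
    have h2 : (show E.V [⋀^Fin (p + (q + 1))]→ₗ[ℂ] X.V from (dE (p + q)).f z.1) = 0 := z.2
    rw [h2, map_zero] at h1
    have h3 := DFunLike.congr_fun h1 y
    exact (hU q _).trans ((smul_eq_zero.1 h3.symm).resolve_left (pow_ne_zero _ (by norm_num)))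
  -- The values of `theta` on a cocycle are cocycles. The retraction `r` turns it into a form with
  -- values in the module of cocycles.
  obtain ⟨r, hr⟩ := LinearMap.exists_leftInverse_of_injective
    (LinearMap.ker (dU q).f).subtype (LinearMap.ker_eq_bot.2 Subtype.val_injective)
  have hr' : ∀ v ∈ LinearMap.ker (dU q).f, (r v).1 = v := fun v hv =>
    congrArg Subtype.val (LinearMap.congr_fun hr ⟨v, hv⟩)
  obtain ⟨l, hl⟩ := Hom.exists_lift (altMap D (A.zIncl q) p)
    ((S.thetaHom X p q).comp (G.zIncl (p + q)))
    (fun u v huv => AlternatingMap.ext fun y => Subtype.ext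
      (congrArg (fun F : D.V [⋀^Fin p]→ₗ[ℂ] (A.C q).V => F y) huv))
    fun z => ⟨altComp r (S.theta X.V p q z.1), AlternatingMap.ext fun y => hr' _ (hz z y)⟩
  have hl' : ∀ (z : (G.Z (p + q)).V) y,
      ((show D.V [⋀^Fin p]→ₗ[ℂ] (A.Z q).V from l.f z) y).1 = S.theta X.V p q z.1 y :=
    fun z y => congrArg (fun F : D.V [⋀^Fin p]→ₗ[ℂ] (A.C q).V => F y) (hl z)
  refine Hom.exists_iso ((toIm ((S.wtCpx hE2 hE p).onH (p + q))).comp (G.hclsHom (p + q)))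
    ((altMap D (A.hclsHom q) p).comp l) ?_ ?_ fun z => ?_
  · exact (LinearMap.surjective_rangeRestrict _).comp (G.hcls_surjective (p + q))
  · intro F
    obtain ⟨s, hs⟩ := LinearMap.exists_rightInverse_of_surjective (A.hcls q)
      (LinearMap.range_eq_top.2 (A.hcls_surjective q))
    have hs' : ∀ v, A.hcls q (s v) = v := fun v => LinearMap.congr_fun hs v
    obtain ⟨f, hf⟩ := S.theta_surjective (p := p) (q := q)
      (altComp ((LinearMap.ker (dU q).f).subtype ∘ₗ s) F)
    have hf' : ∀ y, S.theta X.V p q f y = (s ((show D.V [⋀^Fin p]→ₗ[ℂ] (A.H q).V from F) y)).1 :=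
      fun y => DFunLike.congr_fun hf y
    have h0 : twDiff (S.ext₀ a) (c ∘ₗ S.r.f) (p + q) (S.grading.altWt p f) = 0 := by
      refine S.eq_zero_of_theta (q := q + 1) _ ?_ ?_
      · exact (S.altWt_twDiff a c p _).trans
          (congrArg (twDiff (S.ext₀ a) (c ∘ₗ S.r.f) (p + q)) (S.grading.altWt_self p f))
      · refine (S.theta_twDiff a c _).trans ?_
        rw [theta_altWt]
        refine smul_eq_zero.2 (.inr (AlternatingMap.ext fun y => ?_))
        rw [altComp_apply, hf']
        exact (hU q _).symm.trans (s _).2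
    refine ⟨⟨S.grading.altWt p f, (hE _ _).trans h0⟩, AlternatingMap.ext fun y => ?_⟩
    refine Eq.trans (congrArg (A.hcls q) (Subtype.ext ?_)) (hs' _)
    refine (hl' _ y).trans (Eq.trans ?_ (hf' y))
    rw [theta_altWt]
  · have h1 : ((toIm ((S.wtCpx hE2 hE p).onH (p + q))).comp (G.hclsHom (p + q))).f z = 0 ↔
        S.grading.altWt p (show E.V [⋀^Fin (p + q)]→ₗ[ℂ] X.V from z.1) ∈ G.B (p + q) :=
      Subtype.ext_iff.trans (G.hcls_eq_zero (p + q) _)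
    rw [h1, S.altWt_mem_B_iff hE2 hU2 hE hU]
    constructor
    · intro h
      refine AlternatingMap.ext fun y => (A.hcls_eq_zero q _).2 ?_
      have h2 := h y
      rw [← hl' z y] at h2
      exact h2
    · intro h y
      have h2 := (A.hcls_eq_zero q _).1
        (congrArg (fun F : D.V [⋀^Fin p]→ₗ[ℂ] (A.H q).V => F y) h)
      rw [← hl' z y]
      exact h2

variable {𝓛 : AbSubcat P}

include hE hU in
/-- The class of the cohomology of the complex of forms on `E`. -/
theorem mem_and_cls_H (hD : 𝓛.ClosedUnderExt D)
    (hA : ∀ q, 𝓛.mem ((⟨alt U X, dU, hU2⟩ : Cpx P).H q)) (n : ℕ) :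
    ∃ h : 𝓛.mem ((⟨alt E X, dE, hE2⟩ : Cpx P).H n), K0.cls 𝓛 _ h =
      ∑ a ∈ Finset.HasAntidiagonal.antidiagonal n, K0.mulRight 𝓛 (D.extDual a.1) (hD.tensor a.1)
        (K0.cls 𝓛 ((⟨alt U X, dU, hU2⟩ : Cpx P).H a.2) (hA a.2)) := by
  let G : Cpx P := ⟨alt E X, dE, hE2⟩
  obtain ⟨h1, h2⟩ := mem_and_cls_antidiagonal (𝓛 := 𝓛) (G.H n)
    (fun p => (S.wtCpx hE2 hE p).onH n) (S.grading.bound + 1) n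
    (fun a v => Cpx.Hom.onH_onH (S.wtCpx hE2 hE a) (S.wtCpx hE2 hE a) (S.wtCpx hE2 hE a)
      (Cpx.Hom.id G) (fun q v => S.grading.altWt_self a v) n v |>.trans (Cpx.Hom.id_onH G n _))
    (fun a b v hab => Cpx.Hom.onH_comp_zero (S.wtCpx hE2 hE b) (S.wtCpx hE2 hE a)
      (fun q v => S.grading.altWt_ne hab v) n v)
    (fun v => by
      obtain ⟨v, rfl⟩ := G.hcls_surjective n v
      have e : ∀ a, ((S.wtCpx hE2 hE a).onH n).f (G.hcls n v) =
        G.hcls n ((S.wtCpx hE2 hE a).onZ n v) := fun a => rfl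
      simp only [e]
      rw [← map_sum (G.hcls n)]
      refine congrArg (G.hcls n) (Subtype.ext ?_)
      rw [AddSubmonoidClass.coe_finsetSum]
      exact S.grading.sum_altWt v.1)
    (fun a ha v => by
      obtain ⟨v, rfl⟩ := G.hcls_surjective n v
      refine (congrArg (G.hcls n) (Subtype.ext ?_)).trans (map_zero (G.hcls n))
      exact S.altWt_eq_zero ha v.1)
    (fun p q => alt D ((⟨alt U X, dU, hU2⟩ : Cpx P).H q) p) (fun p q => alt_mem hD (hA q) p) (by
      rintro p q rfl
      exact S.exists_iso_im_onH hE2 hU2 hE hU p q)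
  refine ⟨h1, h2.trans (Finset.sum_congr rfl fun a _ => ?_)⟩
  rw [← cls_alt hD]

end GKMod.Splitting

/-! ## Differentials on forms on a graded space -/

namespace LinGrading

variable {E X : Type} [AddCommGroup E] [Module ℂ E] [AddCommGroup X] [Module ℂ X]
  [FiniteDimensional ℂ E] (γ : LinGrading E) {n : ℕ}

theorem apply_eq_zero {w : ℕ} {f : E [⋀^Fin n]→ₗ[ℂ] X} (hf : γ.altWt w f = f) {b : Fin n → ℕ}
    {v : Fin n → E} (h : γ.Homog b v) (hw : ∑ i, b i ≠ w) : f v = 0 := by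
  rw [← hf]
  exact γ.altWt_apply_eq_zero w f h hw

omit [FiniteDimensional ℂ E] in
theorem Homog.removeNth {γ : LinGrading E} {b : Fin (n + 1) → ℕ} {v : Fin (n + 1) → E}
    (h : γ.Homog b v) (i : Fin (n + 1)) :
    γ.Homog (Fin.removeNth i b) (Fin.removeNth i v) := fun k => h (i.succAbove k)

/-- The component of the bracket `a` on the part of weight `0`. -/
def bracket₀ (a : E →ₗ[ℂ] Module.End ℂ E) : E →ₗ[ℂ] Module.End ℂ E :=
  LinearMap.mk₂ ℂ (fun x y => a (γ.π 0 x) (γ.π 0 y)) (fun _ _ _ => by simp)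
    (fun _ _ _ => by simp) (fun _ _ _ => by simp) (fun _ _ _ => by simp)

variable {a : E →ₗ[ℂ] Module.End ℂ E} {c : E →ₗ[ℂ] Module.End ℂ X}
  (h₁ : ∀ i j k x y, 1 ≤ i + j → i + j ≤ k → γ.π i x = x → γ.π j y = y → γ.π k (a x y) = 0)
  (h₀ : ∀ x y, γ.π 0 x = x → γ.π 0 y = y → γ.π 0 (a x y) = a x y)

include h₁ h₀

/-- If one of the two bracketed vectors has positive weight, the bracket lowers the total weight
below `w`, where `f` vanishes, and the reduced bracket is zero. If both have weight 0, the two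
brackets agree and keep the total weight. -/
theorem apply_update_bracket {w : ℕ} {f : E [⋀^Fin n]→ₗ[ℂ] X} (hf : γ.altWt w f = f)
    {b : Fin (n + 1) → ℕ} {v : Fin (n + 1) → E} (h : γ.Homog b v) (i : Fin (n + 1)) (k : Fin n) :
    (∑ l, b l ≤ w → f (Function.update (Fin.removeNth i v) k (a (v i) (Fin.removeNth i v k))) =
      f (Function.update (Fin.removeNth i v) k (γ.bracket₀ a (v i) (Fin.removeNth i v k)))) ∧
    (∑ l, b l ≠ w →
      f (Function.update (Fin.removeNth i v) k (γ.bracket₀ a (v i) (Fin.removeNth i v k))) = 0) := by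
  have hs : ∑ l, b l = b i + ∑ l, Fin.removeNth i b l := Fin.sum_univ_succAbove b i
  have e : γ.bracket₀ a (v i) (Fin.removeNth i v k) =
    a (γ.π 0 (v i)) (γ.π 0 (Fin.removeNth i v k)) := rfl
  have hr := h.removeNth i
  rcases Nat.eq_zero_or_pos (b i + Fin.removeNth i b k) with h2 | h2
  · have hi : γ.π 0 (v i) = v i := by
      have := (h i).2
      rwa [show b i = 0 by omega] at this
    have hk : γ.π 0 (Fin.removeNth i v k) = Fin.removeNth i v k := by
      have := (hr k).2
      rwa [show Fin.removeNth i b k = 0 by omega] at this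
    rw [e, hi, hk]
    refine ⟨fun _ => rfl, fun hw => γ.apply_eq_zero hf (b := Fin.removeNth i b) (fun l => ?_) ?_⟩
    · rcases eq_or_ne l k with rfl | hl
      · rw [Function.update_self, show Fin.removeNth i b l = 0 by omega]
        exact ⟨Nat.zero_le _, h₀ _ _ hi hk⟩
      · rw [Function.update_of_ne hl]
        exact hr l
    · omega
  · have h3 : γ.bracket₀ a (v i) (Fin.removeNth i v k) = 0 := by
      rw [e]
      rcases Nat.eq_zero_or_pos (b i) with hi | hi
      · rw [← (hr k).2, γ.orth 0 _ (by omega), map_zero]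
      · rw [← (h i).2, γ.orth 0 _ (by omega), map_zero, LinearMap.zero_apply]
    have h4 : f (Function.update (Fin.removeNth i v) k 0) = 0 :=
      f.map_coord_zero k (Function.update_self k 0 _)
    rw [h3, h4]
    refine ⟨fun hw => γ.apply_update_eq_zero f hr k _ (b i + Fin.removeNth i b k - 1)
      (fun d hd => h₁ _ _ d _ _ h2 (by omega) (h i).2 (hr k).2) w (by omega) hf, fun _ => rfl⟩

-- Removing a vector of positive weight from a family of total weight at most `w` leaves a family on
-- which `f` vanishes, so only vectors of weight 0 act.
omit h₁ h₀ in
theorem action_apply_removeNth {w : ℕ} {f : E [⋀^Fin n]→ₗ[ℂ] X} (hf : γ.altWt w f = f)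
    {b : Fin (n + 1) → ℕ} {v : Fin (n + 1) → E} (h : γ.Homog b v) (i : Fin (n + 1)) :
    (∑ l, b l ≤ w → c (v i) (f (Fin.removeNth i v)) =
      (c ∘ₗ γ.π 0) (v i) (f (Fin.removeNth i v))) ∧
    (∑ l, b l ≠ w → (c ∘ₗ γ.π 0) (v i) (f (Fin.removeNth i v)) = 0) := by
  have hs : ∑ l, b l = b i + ∑ l, Fin.removeNth i b l := Fin.sum_univ_succAbove b i
  have hr := h.removeNth i
  rw [LinearMap.comp_apply]
  rcases Nat.eq_zero_or_pos (b i) with hi | hi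
  · have hi' : γ.π 0 (v i) = v i := by
      have := (h i).2
      rwa [hi] at this
    rw [hi']
    refine ⟨fun _ => rfl, fun hw => ?_⟩
    rw [γ.apply_eq_zero hf hr (by omega), map_zero]
  · refine ⟨fun hw => ?_, fun _ => ?_⟩
    · rw [γ.apply_eq_zero hf hr (by omega), map_zero, map_zero]
    · rw [← (h i).2, γ.orth 0 _ (by omega), map_zero, LinearMap.zero_apply]

/-- On forms of weight `w`, the components of weight at most `w` of the differential are those of
the differential formed from the part of weight `0`, which preserves the weight. -/
theorem twDiff_homog {w : ℕ} {f : E [⋀^Fin n]→ₗ[ℂ] X} (hf : γ.altWt w f = f)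
    {b : Fin (n + 1) → ℕ} {v : Fin (n + 1) → E} (h : γ.Homog b v) :
    (∑ l, b l ≤ w → twDiff a c n f v = twDiff (γ.bracket₀ a) (c ∘ₗ γ.π 0) n f v) ∧
    (∑ l, b l ≠ w → twDiff (γ.bracket₀ a) (c ∘ₗ γ.π 0) n f v = 0) := by
  rw [twDiff_apply, twDiff_apply]
  refine ⟨fun hw => Finset.sum_congr rfl fun i _ => ?_, fun hw => Finset.sum_eq_zero fun i _ => ?_⟩
  · rw [(γ.action_apply_removeNth hf h i).1 hw, Finset.sum_congr rfl fun k _ =>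
      (γ.apply_update_bracket h₁ h₀ hf h i k).1 hw]
  · rw [(γ.action_apply_removeNth hf h i).2 hw, Finset.sum_eq_zero fun k _ =>
      (γ.apply_update_bracket h₁ h₀ hf h i k).2 hw, smul_zero, sub_zero, smul_zero]

/-- On families of total weight below `w` the differential agrees with the reduced one, and that one
preserves the weight. -/
theorem altWt_twDiff_of_lt {w w' : ℕ} (hw : w' < w) (f : E [⋀^Fin n]→ₗ[ℂ] X) :
    γ.altWt w' (twDiff a c n (γ.altWt w f)) = 0 :=
  γ.alt_ext fun b v h => by
    obtain ⟨h1, h2⟩ := γ.twDiff_homog (c := c) h₁ h₀ (γ.altWt_self w f) h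
    rw [γ.altWt_homog _ _ h, AlternatingMap.zero_apply]
    split_ifs with hb
    · rw [h1 (by omega), h2 (by omega)]
    · rfl

theorem altWt_twDiff_self (w : ℕ) (f : E [⋀^Fin n]→ₗ[ℂ] X) :
    γ.altWt w (twDiff a c n (γ.altWt w f)) =
      twDiff (γ.bracket₀ a) (c ∘ₗ γ.π 0) n (γ.altWt w f) :=
  γ.alt_ext fun b v h => by
    obtain ⟨h1, h2⟩ := γ.twDiff_homog (c := c) h₁ h₀ (γ.altWt_self w f) h
    rw [γ.altWt_homog _ _ h]
    split_ifs with hb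
    · exact h1 hb.le
    · exact (h2 hb).symm

/-- This identifies the differential of the associated graded complex with the one formed from the
part of weight 0. -/
theorem sum_altWt_twDiff (f : E [⋀^Fin n]→ₗ[ℂ] X) :
    ∑ w ∈ Finset.range (γ.bound + 1), γ.altWt w (twDiff a c n (γ.altWt w f)) =
      twDiff (γ.bracket₀ a) (c ∘ₗ γ.π 0) n f := by
  rw [Finset.sum_congr rfl fun w _ => γ.altWt_twDiff_self h₁ h₀ w f, ← map_sum, γ.sum_altWt]

end LinGrading

/-! ## Euler characteristics of split complexes -/

/-- The rectangle is summed along its diagonals; their points outside the rectangle contribute zero.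
-/
theorem sum_range_antidiagonal {A : Type 1} [AddCommGroup A] (F : ℕ → ℕ → A) (d u : ℕ)
    (hd : ∀ p q, d < p → F p q = 0) (hu : ∀ p q, u < q → F p q = 0) :
    ∑ n ∈ Finset.range (u + d + 1), ∑ a ∈ Finset.HasAntidiagonal.antidiagonal n, F a.1 a.2 =
      ∑ p ∈ Finset.range (d + 1), ∑ q ∈ Finset.range (u + 1), F p q := by
  rw [← Finset.sum_product', ← Finset.sum_fiberwise_of_maps_to
    (s := Finset.range (d + 1) ×ˢ Finset.range (u + 1)) (t := Finset.range (u + d + 1))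
    (g := fun a => a.1 + a.2) (fun a ha => by
      rw [Finset.mem_product, Finset.mem_range, Finset.mem_range] at ha
      rw [Finset.mem_range]
      omega)]
  refine Finset.sum_congr rfl fun n _ => (Finset.sum_subset (fun a ha => ?_) fun a ha ha' => ?_).symm
  · rw [Finset.mem_filter] at ha
    exact Finset.HasAntidiagonal.mem_antidiagonal.2 ha.2
  · rw [Finset.HasAntidiagonal.mem_antidiagonal] at ha
    rw [Finset.mem_filter, Finset.mem_product, Finset.mem_range, Finset.mem_range, not_and] at ha'
    rcases lt_or_ge d a.1 with h | h
    · exact hd _ _ h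
    · exact hu _ _ (by
        by_contra h'
        exact ha' ⟨by omega, by omega⟩ ha)

namespace K0

variable {P : HCPair} {𝓛 : AbSubcat P}

theorem mulRight_eq_zero (F : GKMod P) [Subsingleton F.V]
    (h : ∀ X, 𝓛.mem X → 𝓛.mem (X.tensor F)) (x : K0 𝓛) : mulRight 𝓛 F h x = 0 := by
  have : mulRight 𝓛 F h = 0 := hom_ext fun X hX => by
    have : Subsingleton (X.tensor F).V := subsingleton_of_forall_eq 0 fun t => by
      have key : ∀ t : X.V ⊗[ℂ] F.V, t = 0 := fun t => by
        induction t using TensorProduct.induction_on with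
        | zero => rfl
        | add a b ha hb => rw [ha, hb, add_zero]
        | tmul a b => rw [Subsingleton.elim b 0, TensorProduct.tmul_zero]
      exact key t
    rw [mulRight, lift_cls, cls_zero]
    rfl
  rw [this]
  rfl

theorem mulRight_extDual_eq_zero {E : GKMod P} [FiniteDimensional ℂ E.V]
    (h : 𝓛.ClosedUnderExt E) {q : ℕ} (hq : Module.finrank ℂ E.V < q) (x : K0 𝓛) :
    mulRight 𝓛 (E.extDual q) (h.tensor q) x = 0 := by
  have := GKMod.alt_subsingleton (E := E) (GKMod.triv P) hq
  exact mulRight_eq_zero (E.extDual q) _ x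

theorem mulExt_apply {E : GKMod P} [FiniteDimensional ℂ E.V] (h : 𝓛.ClosedUnderExt E) (x : K0 𝓛) :
    mulExt 𝓛 E h x = ∑ q ∈ Finset.range (Module.finrank ℂ E.V + 1),
      (-1 : ℤ) ^ q • mulRight 𝓛 (E.extDual q) (h.tensor q) x := by
  simp [mulExt, AddMonoidHom.finsetSum_apply]

theorem mulRight_comm (E F : GKMod P) (hE : ∀ X, 𝓛.mem X → 𝓛.mem (X.tensor E))
    (hF : ∀ X, 𝓛.mem X → 𝓛.mem (X.tensor F)) (x : K0 𝓛) :
    mulRight 𝓛 E hE (mulRight 𝓛 F hF x) = mulRight 𝓛 F hF (mulRight 𝓛 E hE x) := by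
  refine DFunLike.congr_fun (f := (mulRight 𝓛 E hE).comp (mulRight 𝓛 F hF))
    (g := (mulRight 𝓛 F hF).comp (mulRight 𝓛 E hE)) (hom_ext fun X hX => ?_) x
  simp only [AddMonoidHom.comp_apply, mulRight, lift_cls]
  exact cls_iso 𝓛 _ _ (GKMod.rightComm X F E) (TensorProduct.rightComm ℂ X.V _ _).bijective

theorem mulTop_apply {E : GKMod P} [FiniteDimensional ℂ E.V] (h : 𝓛.ClosedUnderExt E) (x : K0 𝓛) :
    mulTop 𝓛 E h x = (-1 : ℤ) ^ Module.finrank ℂ E.V •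
      mulRight 𝓛 (E.extDual (Module.finrank ℂ E.V)) (h.tensor _) x := rfl

theorem mulTop_comm {E F : GKMod P} [FiniteDimensional ℂ E.V] [FiniteDimensional ℂ F.V]
    (hE : 𝓛.ClosedUnderExt E) (hF : 𝓛.ClosedUnderExt F) (x : K0 𝓛) :
    mulTop 𝓛 E hE (mulTop 𝓛 F hF x) = mulTop 𝓛 F hF (mulTop 𝓛 E hE x) := by
  simp only [mulTop_apply, map_zsmul, smul_smul]
  rw [mulRight_comm, mul_comm]

/-- The sign `(-1) ^ n` factors over `p + q = n`, so the double sum is a product of two alternating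
sums. -/
theorem sum_antidiagonal_mulRight {D : GKMod P} [FiniteDimensional ℂ D.V]
    (h : 𝓛.ClosedUnderExt D) (u : ℕ) (x : ℕ → K0 𝓛) (hx : ∀ q, u < q → x q = 0) :
    ∑ n ∈ Finset.range (u + Module.finrank ℂ D.V + 1), (-1 : ℤ) ^ n •
      ∑ a ∈ Finset.HasAntidiagonal.antidiagonal n,
        mulRight 𝓛 (D.extDual a.1) (h.tensor a.1) (x a.2) =
      mulExt 𝓛 D h (∑ q ∈ Finset.range (u + 1), (-1 : ℤ) ^ q • x q) := by
  rw [mulExt_apply]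
  have := sum_range_antidiagonal (fun p q => (-1 : ℤ) ^ p • (-1 : ℤ) ^ q •
    mulRight 𝓛 (D.extDual p) (h.tensor p) (x q)) (Module.finrank ℂ D.V) u
    (fun p q hp => by rw [mulRight_extDual_eq_zero h hp, smul_zero, smul_zero])
    (fun p q hq => by rw [hx q hq, map_zero, smul_zero, smul_zero])
  refine Eq.trans (Finset.sum_congr rfl fun n _ => ?_) (this.trans
    (Finset.sum_congr rfl fun p _ => ?_))
  · rw [Finset.smul_sum]
    refine Finset.sum_congr rfl fun a ha => ?_
    rw [smul_smul, ← pow_add, Finset.HasAntidiagonal.mem_antidiagonal.1 ha]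
  · rw [map_sum, Finset.smul_sum]
    simp only [map_zsmul]

end K0

namespace GKMod.Splitting

variable {P : HCPair} {U E D : GKMod P} [FiniteDimensional ℂ U.V] [FiniteDimensional ℂ E.V]
  [FiniteDimensional ℂ D.V] {𝓛 : AbSubcat P} {X : GKMod P}

omit [FiniteDimensional ℂ E.V] in
theorem finrank_eq (S : Splitting U E D) : Module.finrank ℂ E.V = Module.finrank ℂ U.V + Module.finrank ℂ D.V := by
  let e : E.V ≃ₗ[ℂ] U.V × D.V := LinearEquiv.ofBijective (S.r.f.prod S.p.f) ⟨fun a b hab => by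
    rw [← S.sum a, ← S.sum b, show S.r.f a = S.r.f b from congrArg Prod.fst hab,
      show S.p.f a = S.p.f b from congrArg Prod.snd hab], fun x => ⟨S.i.f x.1 + S.s.f x.2, by
        simp [S.r_i, S.p_s, S.p_i, S.r_s]⟩⟩
  rw [e.finrank_eq, Module.finrank_prod]

/-- The Euler characteristic of the forms on `E`. -/
theorem sum_cls_alt (S : Splitting U E D) (hU : 𝓛.ClosedUnderExt U) (hD : 𝓛.ClosedUnderExt D) (hX : 𝓛.mem X)
    (h : ∀ n, 𝓛.mem (alt E X n)) :
    ∑ n ∈ Finset.range (Module.finrank ℂ E.V + 1), (-1 : ℤ) ^ n • K0.cls 𝓛 (alt E X n) (h n) =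
      K0.mulExt 𝓛 D hD (K0.mulExt 𝓛 U hU (K0.cls 𝓛 X hX)) := by
  rw [S.finrank_eq, K0.mulExt_apply hU]
  rw [← K0.sum_antidiagonal_mulRight hD (Module.finrank ℂ U.V) _
    fun q hq => K0.mulRight_extDual_eq_zero hU hq _]
  refine Finset.sum_congr rfl fun n _ => ?_
  obtain ⟨_, h2⟩ := S.mem_and_cls_alt X hU hD hX n
  rw [h2]

/-- The top forms on `E`. -/
theorem cls_alt_top (S : Splitting U E D) (hU : 𝓛.ClosedUnderExt U) (hD : 𝓛.ClosedUnderExt D) (hX : 𝓛.mem X)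
    (h : 𝓛.mem (alt E X (Module.finrank ℂ E.V))) :
    (-1 : ℤ) ^ Module.finrank ℂ E.V • K0.cls 𝓛 (alt E X (Module.finrank ℂ E.V)) h =
      K0.mulTop 𝓛 U hU (K0.mulTop 𝓛 D hD (K0.cls 𝓛 X hX)) := by
  obtain ⟨_, h2⟩ := S.mem_and_cls_alt X hU hD hX (Module.finrank ℂ E.V)
  -- In degree `dim U + dim D` every other pair has a component exceeding the dimension of `D` or of
  -- `U`.
  rw [h2, Finset.sum_eq_single (Module.finrank ℂ D.V, Module.finrank ℂ U.V)]
  · rw [S.finrank_eq, K0.mulTop_apply, K0.mulTop_apply, map_zsmul, smul_smul, pow_add, K0.mulRight_comm]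
  · rintro ⟨p, q⟩ ha hne
    rw [Finset.HasAntidiagonal.mem_antidiagonal, S.finrank_eq] at ha
    rcases lt_trichotomy p (Module.finrank ℂ D.V) with hp | rfl | hp
    · dsimp only at ha ⊢
      rw [K0.mulRight_extDual_eq_zero hU (by omega), map_zero]
    · have : q = Module.finrank ℂ U.V := by dsimp only at ha; omega
      exact absurd (by rw [this]) hne
    · rw [K0.mulRight_extDual_eq_zero hD hp]
  · intro ha
    exact absurd (Finset.HasAntidiagonal.mem_antidiagonal.2 (by rw [S.finrank_eq, add_comm])) ha

variable {a : U.V →ₗ[ℂ] Module.End ℂ U.V} {c : U.V →ₗ[ℂ] Module.End ℂ X.V}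
  {dE : ∀ n, Hom (alt E X n) (alt E X (n + 1))} {dU : ∀ n, Hom (alt U X n) (alt U X (n + 1))}
  (hE2 : ∀ n v, (dE (n + 1)).f ((dE n).f v) = 0) (hU2 : ∀ n v, (dU (n + 1)).f ((dU n).f v) = 0)

/-- The Euler characteristic of the cohomology of the complex of forms on `E`. -/
theorem sum_cls_H (S : Splitting U E D)
    (hE : ∀ n (f : E.V [⋀^Fin n]→ₗ[ℂ] X.V), (dE n).f f = twDiff (S.ext₀ a) (c ∘ₗ S.r.f) n f)
    (hU : ∀ n (f : U.V [⋀^Fin n]→ₗ[ℂ] X.V), (dU n).f f = twDiff a c n f)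
    (hD : 𝓛.ClosedUnderExt D) (hA : ∀ q, 𝓛.mem ((⟨alt U X, dU, hU2⟩ : Cpx P).H q))
    (h : ∀ q, 𝓛.mem ((⟨alt E X, dE, hE2⟩ : Cpx P).H q)) :
    ∑ n ∈ Finset.range (Module.finrank ℂ E.V + 1),
      (-1 : ℤ) ^ n • K0.cls 𝓛 ((⟨alt E X, dE, hE2⟩ : Cpx P).H n) (h n) =
      K0.mulExt 𝓛 D hD (∑ q ∈ Finset.range (Module.finrank ℂ U.V + 1),
        (-1 : ℤ) ^ q • K0.cls 𝓛 ((⟨alt U X, dU, hU2⟩ : Cpx P).H q) (hA q)) := by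
  rw [S.finrank_eq]
  rw [← K0.sum_antidiagonal_mulRight hD (Module.finrank ℂ U.V)
    (fun q => K0.cls 𝓛 ((⟨alt U X, dU, hU2⟩ : Cpx P).H q) (hA q)) fun q hq => by
      have := alt_subsingleton X hq
      have : Subsingleton ((⟨alt U X, dU, hU2⟩ : Cpx P).H q).V :=
        (Cpx.hcls_surjective ⟨alt U X, dU, hU2⟩ q).subsingleton
      exact K0.cls_zero 𝓛 _ _]
  refine Finset.sum_congr rfl fun n _ => ?_
  obtain ⟨_, h2⟩ := S.mem_and_cls_H hE2 hU2 hE hU hD hA n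
  rw [h2]

end GKMod.Splitting

/-! ## Restriction of forms, tensor products and cohomology -/

section Restriction

variable {P P' : HCPair} (φ : HCPair.Hom P' P)

namespace GKMod

/-- Restriction commutes with the formation of modules of alternating forms. -/
def altRes (E X : GKMod P) [FiniteDimensional ℂ E.V] [FiniteDimensional ℂ (E.res φ).V] (n : ℕ) :
    Hom ((alt E X n).res φ) (alt (E.res φ) (X.res φ) n) where
  f := (LinearMap.id : (E.V [⋀^Fin n]→ₗ[ℂ] X.V) →ₗ[ℂ] (E.V [⋀^Fin n]→ₗ[ℂ] X.V))
  map_ρ _ _ := rfl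
  map_σ m f := AlternatingMap.ext fun v => by
    have key (f : E.V [⋀^Fin n]→ₗ[ℂ] X.V) : X.σ (φ.ψ m) (f fun k => E.σ (φ.ψ m)⁻¹ (v k)) =
        X.σ (φ.ψ m) (f fun k => E.σ (φ.ψ m⁻¹) (v k)) := by rw [map_inv φ.ψ]
    exact key f

/-- The inverse of `altRes`. -/
def altResSymm (E X : GKMod P) [FiniteDimensional ℂ E.V] [FiniteDimensional ℂ (E.res φ).V]
    (n : ℕ) : Hom (alt (E.res φ) (X.res φ) n) ((alt E X n).res φ) where
  f := (LinearMap.id : (E.V [⋀^Fin n]→ₗ[ℂ] X.V) →ₗ[ℂ] (E.V [⋀^Fin n]→ₗ[ℂ] X.V))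
  map_ρ _ _ := rfl
  map_σ m f := ((altRes φ E X n).map_σ m f).symm

theorem altRes_bijective (E X : GKMod P) [FiniteDimensional ℂ E.V]
    [FiniteDimensional ℂ (E.res φ).V] (n : ℕ) : Function.Bijective (altRes φ E X n).f :=
  Function.bijective_id

end GKMod

namespace Cpx

/-- Restriction of complexes. -/
def res (A : Cpx P) : Cpx P' where
  C n := (A.C n).res φ
  d n := (A.d n).res φ
  d_d := A.d_d

/-- Both modules are the same quotient of the same cocycles; only the case distinction in the
definition of coboundaries keeps this from being definitional. -/
theorem exists_res_iso (A : Cpx P) (q : ℕ) :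
    ∃ f : GKMod.Hom ((A.H q).res φ) ((A.res φ).H q), Function.Bijective f.f := by
  have hB : ∀ v : (A.C q).V, v ∈ A.B q ↔ (show ((A.res φ).C q).V from v) ∈ (A.res φ).B q :=
    fun v => by cases q <;> rfl
  let p : GKMod.Hom ((A.res φ).Z q) ((A.H q).res φ) := ⟨A.hcls q, fun _ _ => rfl, fun _ _ => rfl⟩
  refine GKMod.Hom.exists_iso p ((A.res φ).hclsHom q) (A.hcls_surjective q)
    ((A.res φ).hcls_surjective q) fun v => ?_
  exact (A.hcls_eq_zero q v).trans ((hB _).trans ((A.res φ).hcls_eq_zero q v).symm)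

theorem Hom.onH_bijective {A B : Cpx P} (f : Hom A B) (g : Hom B A)
    (h : ∀ q v, (g.f q).f ((f.f q).f v) = v) (h' : ∀ q v, (f.f q).f ((g.f q).f v) = v) (q : ℕ) :
    Function.Bijective (f.onH q).f :=
  ⟨fun a b hab => by
    rw [← onH_leftInverse f g h q a, ← onH_leftInverse f g h q b, hab],
    fun b => ⟨_, onH_leftInverse g f h' q b⟩⟩

end Cpx

end Restriction

namespace ParabolicInclusion

variable {R' R : ReductivePair} {ι : R'.Inclusion R} {𝔭' : GermaneParabolic R'}
  {𝔭 : GermaneParabolic R} (j : ParabolicInclusion ι 𝔭' 𝔭)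

/-- The inclusion `𝔲' → 𝔲` as a morphism. -/
def uHom : GKMod.Hom 𝔭'.uMod (𝔭.uMod.res j.hom) where
  f := j.uMap
  map_ρ x v := Subtype.ext (LieHom.map_lie ι.φC (x : R'.g) (show 𝔭'.u from v).1)
  map_σ m v := Subtype.ext (ι.hom.φ_Ad (m : 𝔭'.LK) (show 𝔭'.u from v).1)

/-- The endomorphism `1 - i r` annihilates `𝔲'` and therefore factors through `𝔲 / 𝔲'`, which
provides the section. -/
theorem exists_splitting (r : GKMod.Hom (𝔭.uMod.res j.hom) 𝔭'.uMod)
    (hr : ∀ v, r.f (j.uMap v) = v) :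
    ∃ S : GKMod.Splitting 𝔭'.uMod (𝔭.uMod.res j.hom) j.relMod, S.i = j.uHom ∧ S.r = r := by
  let p : GKMod.Hom (𝔭.uMod.res j.hom) j.relMod := GKMod.quotProj _ _ _ _
  let g : GKMod.Hom (𝔭.uMod.res j.hom) (𝔭.uMod.res j.hom) :=
    { f := LinearMap.id - j.uMap ∘ₗ r.f
      map_ρ := fun x v => by
        rw [LinearMap.sub_apply, LinearMap.sub_apply, LinearMap.comp_apply, LinearMap.comp_apply,
          r.map_ρ, map_sub]
        exact congrArg _ (j.uHom.map_ρ x _)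
      map_σ := fun m v => by
        rw [LinearMap.sub_apply, LinearMap.sub_apply, LinearMap.comp_apply, LinearMap.comp_apply,
          r.map_σ, map_sub]
        exact congrArg _ (j.uHom.map_σ m _) }
  have hg : ∀ v, g.f v = v - j.uMap (r.f v) := fun v => rfl
  have hp : Function.Surjective p.f := Submodule.mkQ_surjective _
  have hp0 : ∀ v, p.f (j.uMap v) = 0 := fun v => (Submodule.Quotient.mk_eq_zero _).2 ⟨v, rfl⟩
  obtain ⟨s, hs⟩ := p.exists_factor g hp fun v hv => by
    obtain ⟨u, rfl⟩ := (Submodule.Quotient.mk_eq_zero _).1 hv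
    rw [hg, hr, sub_self]
  refine ⟨⟨j.uHom, r, p, s, hr, fun d => ?_, fun v => ?_⟩, rfl, rfl⟩
  · obtain ⟨v, rfl⟩ := hp d
    rw [hs, hg, map_sub, hp0, sub_zero]
  · rw [hs, hg]
    exact add_sub_cancel _ _

/-- The restriction of the complex computing the cohomology of `𝔲`. -/
def resComplex (V : GKMod R.pair) : Cpx 𝔭'.leviPair where
  C := GKMod.alt (𝔭.uMod.res j.hom) ((V.res 𝔭.leviIncl).res j.hom)
  d n := ((GKMod.altRes j.hom 𝔭.uMod (V.res 𝔭.leviIncl) (n + 1)).comp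
    (((𝔭.complex V).d n).res j.hom)).comp (GKMod.altResSymm j.hom 𝔭.uMod (V.res 𝔭.leviIncl) n)
  d_d := (𝔭.complex V).d_d

theorem exists_coho_iso (V : GKMod R.pair) (q : ℕ) :
    ∃ f : GKMod.Hom ((𝔭.coho V q).res j.hom) ((j.resComplex V).H q), Function.Bijective f.f := by
  obtain ⟨f, hf⟩ := (𝔭.complex V).exists_res_iso j.hom q
  let g : Cpx.Hom ((𝔭.complex V).res j.hom) (j.resComplex V) :=
    ⟨fun n => GKMod.altRes j.hom 𝔭.uMod (V.res 𝔭.leviIncl) n, fun _ _ => rfl⟩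
  let g' : Cpx.Hom (j.resComplex V) ((𝔭.complex V).res j.hom) :=
    ⟨fun n => GKMod.altResSymm j.hom 𝔭.uMod (V.res 𝔭.leviIncl) n, fun _ _ => rfl⟩
  refine ⟨(g.onH q).comp f, ?_⟩
  exact (Cpx.Hom.onH_bijective g g' (fun _ _ => rfl) (fun _ _ => rfl) q).comp hf

/-- The bracket of `𝔲`. -/
def bracket (𝔭 : GermaneParabolic R) : 𝔭.u →ₗ[ℂ] Module.End ℂ 𝔭.u := LieAlgebra.ad ℂ 𝔭.u

/-- This replaces the Hochschild-Serre spectral sequence, as `𝔲'` need not be an ideal. The weights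
make the complex of `𝔲` filtered. Its graded complex consists of forms on `𝔲 / 𝔲'` with values in
the complex of `𝔲'`, and so has cohomology `Hom(⋀^p(𝔲/𝔲'), H^q(𝔲'; V))`, which lies in the category.
Then `Cpx.Grading.euler_eq` compares the two. -/
theorem euler_coho {𝓛 : AbSubcat 𝔭'.leviPair} (hD : 𝓛.ClosedUnderExt j.relMod) (V : GKMod R.pair)
    (hV : ∀ q, 𝓛.mem ((𝔭.coho V q).res j.hom)) (hV' : ∀ q, 𝓛.mem (𝔭'.coho (V.res ι.hom) q)) :
    ∑ q ∈ Finset.range (Module.finrank ℂ 𝔭.uMod.V + 1),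
      (-1 : ℤ) ^ q • K0.cls 𝓛 ((𝔭.coho V q).res j.hom) (hV q) =
    K0.mulExt 𝓛 j.relMod hD (∑ q ∈ Finset.range (Module.finrank ℂ 𝔭'.uMod.V + 1),
      (-1 : ℤ) ^ q • K0.cls 𝓛 (𝔭'.coho (V.res ι.hom) q) (hV' q)) := by
  obtain ⟨γ, r, hρ, hσ, hγ, hr, hbr⟩ := j.exists_grading
  obtain ⟨S, hSi, hSr⟩ := j.exists_splitting r hr
  let E := 𝔭.uMod.res j.hom
  let X := (V.res 𝔭.leviIncl).res j.hom
  let a : E.V →ₗ[ℂ] Module.End ℂ E.V := bracket 𝔭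
  let a' : 𝔭'.uMod.V →ₗ[ℂ] Module.End ℂ 𝔭'.uMod.V := bracket 𝔭'
  let c : E.V →ₗ[ℂ] Module.End ℂ X.V := V.ρ ∘ₗ 𝔭.u.toSubmodule.subtype
  let c' : 𝔭'.uMod.V →ₗ[ℂ] Module.End ℂ X.V :=
    (V.res ι.hom).ρ ∘ₗ 𝔭'.u.toSubmodule.subtype
  have h₁ : ∀ i k l x y, 1 ≤ i + k → i + k ≤ l → γ.π i x = x → γ.π k y = y →
      γ.π l (a x y) = 0 := hbr
  have haa : ∀ x y, a (j.uMap x) (j.uMap y) = j.uMap (a' x y) := fun x y =>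
    Subtype.ext (LieHom.map_lie ι.φC (show 𝔭'.u from x).1 (show 𝔭'.u from y).1).symm
  have h₀ : ∀ x y, γ.π 0 x = x → γ.π 0 y = y → γ.π 0 (a x y) = a x y := fun x y hx hy => by
    rw [← hx, ← hy, hγ x, hγ y, haa, hγ, hr]
  -- The projection to weight 0 is the retraction onto `𝔲'` followed by the inclusion, so the
  -- reduced bracket and action come from `𝔲'`.
  have hb : γ.bracket₀ a = S.ext₀ a' := LinearMap.ext fun x => LinearMap.ext fun y => by
    change a (γ.π 0 x) (γ.π 0 y) = S.i.f (a' (S.r.f x) (S.r.f y))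
    rw [hγ, hγ, haa, hSi, hSr]
    rfl
  have hc : c ∘ₗ γ.π 0 = c' ∘ₗ S.r.f := LinearMap.ext fun x => by
    rw [LinearMap.comp_apply, hγ, hSr]
    rfl
  let A := j.resComplex V
  have hd : ∀ n (f : E.V [⋀^Fin n]→ₗ[ℂ] X.V), (A.d n).f f = twDiff a c n f := fun n f => rfl
  let g : A.Grading :=
    { N := γ.bound + 1
      wt := fun w n => GKMod.altWtHom γ hρ hσ X w n
      wt_self := fun w n v => γ.altWt_self w v
      wt_ne := fun w w' n v h => γ.altWt_ne h v
      sum_wt := fun n v => γ.sum_altWt v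
      wt_d := fun w w' n v h => γ.altWt_twDiff_of_lt (c := c) h₁ h₀ h v }
  have hg : ∀ n (f : E.V [⋀^Fin n]→ₗ[ℂ] X.V), (g.d₀ n).f f =
      twDiff (S.ext₀ a') (c' ∘ₗ S.r.f) n f := fun n f => by
    refine (g.d₀_apply n f).trans ((γ.sum_altWt_twDiff (c := c) h₁ h₀ f).trans ?_)
    rw [hb, hc]
  have hU2 := (𝔭'.complex (V.res ι.hom)).d_d
  have hU : ∀ n (f : 𝔭'.uMod.V [⋀^Fin n]→ₗ[ℂ] X.V),
    ((𝔭'.complex (V.res ι.hom)).d n).f f = twDiff a' c' n f := fun n f => rfl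
  -- Only cohomology is claimed to lie in the category here; the cochains with values in `V` may
  -- not.
  have hG : ∀ q, 𝓛.mem (g.gr.H q) := fun q =>
    (S.mem_and_cls_H (X := X) g.gr.d_d hU2 hg hU hD hV' q).1
  have hA : ∀ q, 𝓛.mem (A.H q) := fun q => by
    obtain ⟨f, hf⟩ := j.exists_coho_iso V q
    exact GKMod.mem_of_iso (hV q) f hf
  have e1 : ∀ q, K0.cls 𝓛 ((𝔭.coho V q).res j.hom) (hV q) = K0.cls 𝓛 (A.H q) (hA q) := fun q => by
    obtain ⟨f, hf⟩ := j.exists_coho_iso V q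
    exact K0.cls_iso 𝓛 _ _ f hf
  simp only [e1]
  refine (g.euler_eq hA hG _ fun m hm => GKMod.alt_subsingleton (E := E) X hm).trans ?_
  exact S.sum_cls_H (X := X) g.gr.d_d hU2 hg hU hD hV' hG

end ParabolicInclusion

/-! ## Averaging over compact groups -/

section Averaging

open MeasureTheory

variable {G : Type} [Group G] [TopologicalSpace G]

/-- Locally finite and continuous representations. -/
structure IsLocFinite {V : Type} [AddCommGroup V] [Module ℂ V] (σ : G →* Module.End ℂ V) :
    Prop where
  finite : ∀ v, ∃ S : Submodule ℂ V, FiniteDimensional ℂ S ∧ ∀ m, σ m v ∈ S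
  continuous : ∀ (v : V) (l : Module.Dual ℂ V), Continuous fun m => l (σ m v)

theorem GKMod.isLocFinite {P : HCPair} (X : GKMod P) : IsLocFinite X.σ :=
  ⟨X.locallyFinite, X.σ_continuous⟩

omit [Group G] [TopologicalSpace G] in
/-- Vector-valued integrals of functions with values in finite-dimensional spaces. -/
theorem exists_integral [MeasurableSpace G] (μ : Measure G) {V : Type} [AddCommGroup V]
    [Module ℂ V] (F : G → V) (S : Submodule ℂ V) [FiniteDimensional ℂ S] (hS : ∀ m, F m ∈ S)
    (hF : ∀ l : Module.Dual ℂ V, Integrable (fun m => l (F m)) μ) :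
    ∃ v, ∀ l : Module.Dual ℂ V, l v = ∫ m, l (F m) ∂μ := by
  obtain ⟨n, w, ν, h⟩ := GKMod.exists_expansion S
  refine ⟨∑ i, (∫ m, ν i (F m) ∂μ) • w i, fun l => ?_⟩
  have e : ∀ m, l (F m) = ∑ i, ν i (F m) * l (w i) := fun m => by
    conv_lhs => rw [h _ (hS m)]
    simp
  simp only [e]
  rw [integral_finsetSum _ fun i _ => (hF (ν i)).mul_const _, map_sum]
  refine Finset.sum_congr rfl fun i _ => ?_
  rw [map_smul, smul_eq_mul, integral_mul_const]

variable [IsTopologicalGroup G] [CompactSpace G]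

/-- The average of a linear map between representations of a compact group. -/
theorem exists_average {V W : Type} [AddCommGroup V] [Module ℂ V] [AddCommGroup W] [Module ℂ W]
    {σ : G →* Module.End ℂ V} {τ : G →* Module.End ℂ W} (hσ : IsLocFinite σ) (hτ : IsLocFinite τ)
    (f₀ : W →ₗ[ℂ] V) : ∃ f : W →ₗ[ℂ] V, (∀ m w, f (τ m w) = σ m (f w)) ∧
      (∀ w (l : Module.Dual ℂ V) (c : ℂ), (∀ m, l (σ m (f₀ (τ m⁻¹ w))) = c) → l (f w) = c) := by
  borelize G
  let μ : Measure G := Measure.haarMeasure ⊤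
  have hμ : μ Set.univ = 1 := Measure.haarMeasure_self (K₀ := ⊤)
  have : IsProbabilityMeasure μ := ⟨hμ⟩
  -- The map `f₀` is arbitrary; continuity follows by expanding the orbit of `w` in a
  -- finite-dimensional space.
  have hc : ∀ w (l : Module.Dual ℂ V), Continuous fun m => l (σ m (f₀ (τ m⁻¹ w))) := fun w l => by
    obtain ⟨S, h1, h2⟩ := hτ.finite w
    obtain ⟨n, v, ν, h⟩ := GKMod.exists_expansion S
    have e : ∀ m, l (σ m (f₀ (τ m⁻¹ w))) = ∑ i, ν i (τ m⁻¹ w) * l (σ m (f₀ (v i))) := fun m => by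
      conv_lhs => rw [h _ (h2 m⁻¹)]
      simp
    simp only [e]
    exact continuous_finsetSum _ fun i _ =>
      ((hτ.continuous w (ν i)).comp continuous_inv).mul (hσ.continuous _ l)
  have hi : ∀ w (l : Module.Dual ℂ V), Integrable (fun m => l (σ m (f₀ (τ m⁻¹ w)))) μ :=
    fun w l => (hc w l).integrable_of_hasCompactSupport (HasCompactSupport.of_compactSpace _)
  -- The vector-valued integral is characterized by functionals, and exists since the integrand
  -- stays in a finite-dimensional subspace.
  have hex : ∀ w, ∃ v, ∀ l : Module.Dual ℂ V, l v = ∫ m, l (σ m (f₀ (τ m⁻¹ w))) ∂μ := fun w => by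
    obtain ⟨S, h1, h2⟩ := hτ.finite w
    obtain ⟨n, v, ν, h⟩ := GKMod.exists_expansion S
    choose T hT1 hT2 using fun i => hσ.finite (f₀ (v i))
    refine exists_integral μ _ (⨆ i, T i) (fun m => ?_) (hi w)
    rw [h _ (h2 m⁻¹), map_sum, map_sum]
    refine Submodule.sum_mem _ fun i _ => ?_
    rw [map_smul, map_smul]
    exact Submodule.smul_mem _ _ (le_iSup T i (hT2 i m))
  choose f hf using hex
  have hext : ∀ v v' : V, (∀ l : Module.Dual ℂ V, l v = l v') → v = v' := fun v v' h =>
    (Module.forall_dual_apply_eq_zero_iff ℂ (v - v')).1 (fun l => by rw [map_sub, h, sub_self])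
      |> sub_eq_zero.1
  refine ⟨⟨⟨f, fun a b => hext _ _ fun l => ?_⟩, fun c a => hext _ _ fun l => ?_⟩,
    fun g w => hext _ _ fun l => ?_, fun w l c h => ?_⟩
  · rw [map_add, hf, hf, hf, ← integral_add (hi a l) (hi b l)]
    simp only [map_add]
  · rw [RingHom.id_apply, map_smul, hf, hf, smul_eq_mul, ← integral_const_mul]
    simp only [map_smul, smul_eq_mul]
  · change l (f _) = l (σ g (f w))
    -- Equivariance of the average is left invariance of Haar measure.
    rw [hf, ← integral_mul_left_eq_self _ g]
    refine Eq.trans ?_ (hf w (l ∘ₗ σ g)).symm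
    refine integral_congr_ae (.of_forall fun m => ?_)
    change l (σ (g * m) (f₀ (τ (g * m)⁻¹ (τ g w)))) = l (σ g (σ m (f₀ (τ m⁻¹ w))))
    rw [← Module.End.mul_apply (τ _), ← map_mul, map_mul σ, Module.End.mul_apply, mul_inv_rev,
      inv_mul_cancel_right]
  · change l (f w) = c
    rw [hf]
    simp only [h]
    simp

end Averaging

/-- The property of averages with respect to functionals extends to all linear maps, since
functionals separate points. -/
theorem eq_of_average {I V V' : Type} [AddCommGroup V] [Module ℂ V] [AddCommGroup V'] [Module ℂ V']
    {v : I → V} {w : V}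
    (h : ∀ (l : Module.Dual ℂ V) (c : ℂ), (∀ m, l (v m) = c) → l w = c) (q : V →ₗ[ℂ] V') (v' : V')
    (hq : ∀ m, q (v m) = v') : q w = v' := by
  rw [← sub_eq_zero, ← Module.forall_dual_apply_eq_zero_iff ℂ]
  intro l
  rw [map_sub, sub_eq_zero]
  exact h (l ∘ₗ q) _ fun m => congrArg l (hq m)

theorem mem_of_average {I V : Type} [AddCommGroup V] [Module ℂ V] {v : I → V} {w : V}
    (h : ∀ (l : Module.Dual ℂ V) (c : ℂ), (∀ m, l (v m) = c) → l w = c) (Z : Submodule ℂ V)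
    (hZ : ∀ m, v m ∈ Z) : w ∈ Z :=
  (Submodule.Quotient.mk_eq_zero Z).1
    (eq_of_average h Z.mkQ 0 fun m => (Submodule.Quotient.mk_eq_zero Z).2 (hZ m))


/-! ## Restriction of duals of admissible modules -/

namespace GKMod

variable {P P' : HCPair} (φ : HCPair.Hom P' P)

/-- Finite-dimensional subspaces are contained in stable ones. -/
theorem exists_stable (X : GKMod P) (T : Submodule ℂ X.V) [FiniteDimensional ℂ T] :
    ∃ S : Submodule ℂ X.V, FiniteDimensional ℂ S ∧ T ≤ S ∧ ∀ m, ∀ v ∈ S, X.σ m v ∈ S := by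
  obtain ⟨S, h1, h2⟩ := X.exists_orbit fun i => (Module.finBasis ℂ T i : X.V)
  have h3 : ∀ m, ∀ t ∈ T, X.σ m t ∈ S := fun m t ht => by
    have h := (Module.finBasis ℂ T).sum_repr ⟨t, ht⟩
    have h' := congrArg T.subtype h
    rw [map_sum] at h'
    have e : t = _ := h'.symm
    rw [e, map_sum]
    refine Submodule.sum_mem _ fun i _ => ?_
    rw [map_smul, map_smul]
    exact Submodule.smul_mem _ _ (h2 i m)
  -- The vectors whose whole orbit lies in `S` form a stable subspace; taking `m = 1` shows that it
  -- is contained in `S`.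
  have hle : ⨅ m, S.comap (X.σ m) ≤ S := fun v hv => by
    simpa using (Submodule.mem_iInf _).1 hv 1
  refine ⟨⨅ m, S.comap (X.σ m), Submodule.finiteDimensional_of_le hle, fun t ht =>
    (Submodule.mem_iInf _).2 fun m => h3 m t ht, fun m v hv => (Submodule.mem_iInf _).2 fun m' => ?_⟩
  have := (Submodule.mem_iInf _).1 hv (m' * m)
  rwa [Submodule.mem_comap, map_mul, Module.End.mul_apply] at this

/-- The projection onto a stable finite-dimensional subspace. -/
theorem exists_stable_projection [CompactSpace P.M] (X : GKMod P) (S : Submodule ℂ X.V)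
    (hS : ∀ m, ∀ v ∈ S, X.σ m v ∈ S) : ∃ f : X.V →ₗ[ℂ] X.V,
      (∀ m v, f (X.σ m v) = X.σ m (f v)) ∧ (∀ v, f v ∈ S) ∧ ∀ v ∈ S, f v = v := by
  obtain ⟨p, hp⟩ := LinearMap.exists_extend (LinearMap.id : S →ₗ[ℂ] S)
  have hp' : ∀ v (hv : v ∈ S), p v = ⟨v, hv⟩ := fun v hv => LinearMap.congr_fun hp ⟨v, hv⟩
  obtain ⟨f, h1, h2⟩ := exists_average X.isLocFinite X.isLocFinite (S.subtype ∘ₗ p)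
  refine ⟨f, h1, fun v => mem_of_average (h2 v) S fun m => hS m _ (p _).2, fun v hv =>
    eq_of_average (h2 v) LinearMap.id v fun m => ?_⟩
  rw [LinearMap.id_apply, LinearMap.comp_apply, hp' _ (hS _ v hv), Submodule.subtype_apply,
    ← Module.End.mul_apply, ← map_mul, mul_inv_cancel, map_one, Module.End.one_apply]

variable [CompactSpace P.M] [CompactSpace P'.M]

/-- A functional on a module with admissible restriction that is finite for the smaller group is
finite for the bigger group. -/
theorem exists_finite_of_res (X : GKMod P) (hX : (X.res φ).IsAdmissible) (l : Module.Dual ℂ X.V)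
    (S : Submodule ℂ (Module.Dual ℂ X.V)) [FiniteDimensional ℂ S]
    (hl : ∀ m, l ∘ₗ X.σ (φ.ψ m) ∈ S) : ∃ S' : Submodule ℂ (Module.Dual ℂ X.V),
      FiniteDimensional ℂ S' ∧ ∀ m, l ∘ₗ X.σ m ∈ S' := by
  let σ : P'.M →* Module.End ℂ X.V := (X.res φ).σ
  have hσ : IsLocFinite σ := (X.res φ).isLocFinite
  -- the largest subspace in the kernel of `l` that is stable under the smaller group
  let K : Submodule ℂ X.V := ⨅ m, LinearMap.ker (l ∘ₗ σ m)
  have hK : ∀ v, v ∈ K ↔ ∀ m, l (σ m v) = 0 := fun v => Submodule.mem_iInf _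
  have hKσ : ∀ m, K ≤ K.comap (σ m) := fun m v hv => (hK _).2 fun m' => by
    rw [← Module.End.mul_apply, ← map_mul]
    exact (hK v).1 hv _
  let e : X.V →ₗ[ℂ] Module.Dual ℂ S := S.subtype.flip
  -- The common kernel of the functionals in `S` has finite codimension and lies in `K`, so `X / K`
  -- is finite-dimensional.
  have hle : LinearMap.ker e ≤ K := fun v hv => (hK v).2 fun m =>
    LinearMap.congr_fun (LinearMap.mem_ker.1 hv) ⟨_, hl m⟩
  have h1 : FiniteDimensional ℂ (X.V ⧸ LinearMap.ker e) :=
    LinearEquiv.finiteDimensional e.quotKerEquivRange.symm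
  have h2 : FiniteDimensional ℂ (X.V ⧸ K) :=
    Module.Finite.of_surjective (Submodule.factor hle) (Submodule.factor_surjective hle)
  let τ : P'.M →* Module.End ℂ (X.V ⧸ K) :=
    { toFun := fun m => K.mapQ K (σ m) (hKσ m)
      map_one' := by ext v; simp
      map_mul' := fun x y => by ext v; simp }
  have hτ' : ∀ m v, τ m (K.mkQ v) = K.mkQ (σ m v) := fun m v => rfl
  have hτ : IsLocFinite τ := ⟨fun v => ⟨⊤, inferInstance, fun _ => trivial⟩, fun v l => by
    obtain ⟨v, rfl⟩ := K.mkQ_surjective v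
    exact hσ.continuous v (l ∘ₗ K.mkQ)⟩
  -- the finite-dimensional span of the images of the intertwiners
  have h3 : FiniteDimensional ℂ ((X.res φ).intertwiners τ) := hX _ τ
  let ev : (X.res φ).intertwiners τ ⊗[ℂ] (X.V ⧸ K) →ₗ[ℂ] X.V :=
    TensorProduct.lift ((X.res φ).intertwiners τ).subtype
  -- By admissibility only finitely many dimensions are reached by equivariant maps from `X / K` to
  -- `X`. The subspace `T` contains them all and is stable under the bigger group.
  obtain ⟨T, hT1, hT2, hT3⟩ := X.exists_stable (LinearMap.range ev)
  obtain ⟨p, hp1, hp2, hp3⟩ := X.exists_stable_projection T hT3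
  let Z := LinearMap.ker p
  -- The kernel `Z` is a stable complement of `T`. Averaging a linear lift of the image of `Z` in `X
  -- / K` yields an equivariant map with values in `Z`. Its values also lie in `T`, so it is zero;
  -- but it still lifts the image of `Z`, which is therefore zero.
  have hZ : Z ≤ K := by
    have hZσ : ∀ m, ∀ v ∈ Z, σ m v ∈ Z := fun m v hv => LinearMap.mem_ker.2 <|
      (hp1 (φ.ψ m) v).trans (by rw [LinearMap.mem_ker.1 hv, map_zero])
    obtain ⟨s, hs⟩ := LinearMap.exists_rightInverse_of_surjective (K.mkQ.submoduleMap Z)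
      (LinearMap.range_eq_top.2 (K.mkQ.submoduleMap_surjective Z))
    obtain ⟨g, hg⟩ := LinearMap.exists_extend s
    have hg' : ∀ w ∈ Z.map K.mkQ, K.mkQ (g w) = w := fun w hw => by
      have e1 : g w = s ⟨w, hw⟩ := LinearMap.congr_fun hg ⟨w, hw⟩
      rw [e1]
      exact congrArg Subtype.val (LinearMap.congr_fun hs ⟨w, hw⟩)
    obtain ⟨f, hf1, hf2⟩ := exists_average hσ hτ (Z.subtype ∘ₗ g)
    have hfT : ∀ w, f w ∈ T := fun w => hT2 ⟨(⟨f, hf1⟩ : (X.res φ).intertwiners τ) ⊗ₜ w, rfl⟩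
    have hfZ : ∀ w, f w ∈ Z := fun w => mem_of_average (hf2 w) Z fun m => hZσ m _ (g _).2
    have hf0 : ∀ w, f w = 0 := fun w => by
      rw [← hp3 _ (hfT w)]
      exact LinearMap.mem_ker.1 (hfZ w)
    intro z hz
    have hw : K.mkQ (f (K.mkQ z)) = K.mkQ z := eq_of_average (hf2 _) K.mkQ _ fun m => by
      rw [LinearMap.comp_apply, Submodule.subtype_apply, hτ' m⁻¹ z, ← hτ',
        hg' _ (Submodule.mem_map_of_mem (hZσ _ z hz)), hτ', ← Module.End.mul_apply, ← map_mul,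
        mul_inv_cancel, map_one, Module.End.one_apply]
    rw [hf0, map_zero] at hw
    exact (Submodule.Quotient.mk_eq_zero K).1 hw.symm
  have hlp : ∀ v, l v = l (p v) := fun v => by
    rw [← sub_eq_zero, ← map_sub]
    have h4 : v - p v ∈ Z := by
      rw [LinearMap.mem_ker, map_sub, hp3 _ (hp2 v), sub_self]
    have h5 := (hK _).1 (hZ h4) 1
    rwa [map_one, Module.End.one_apply] at h5
  -- As `l = l p` and `p` commutes with the bigger group, all translates of `l` factor through `p`
  -- and the finite-dimensional space `T`.
  refine ⟨LinearMap.range (LinearMap.lcomp ℂ ℂ (p.codRestrict T hp2)), inferInstance,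
    fun m => ⟨l ∘ₗ X.σ m ∘ₗ T.subtype, LinearMap.ext fun v => ?_⟩⟩
  exact (congrArg l (hp1 m v)).symm.trans (hlp _).symm

/-- Functionals finite for the bigger group are finite for the smaller one; admissibility gives the
converse, so the same pairing exhibits the dual of the restriction. -/
theorem IsDual.res {X Y : GKMod P} (h : X.IsDual Y) (hX : (X.res φ).IsAdmissible) :
    (X.res φ).IsDual (Y.res φ) := by
  obtain ⟨b, b1, b2, b3, b4⟩ := h
  refine ⟨b, b1, fun x y v => b2 _ _ _, fun m y v => ?_, fun l => ⟨fun hy => ?_, ?_⟩⟩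
  · refine (b3 (φ.ψ m) y v).trans ?_
    rw [← map_inv φ.ψ]
    rfl
  · obtain ⟨S, h1, h2⟩ := (b4 l).1 hy
    exact ⟨S, h1, fun m => h2 (φ.ψ m)⟩
  · rintro ⟨S, h1, h2⟩
    exact (b4 l).2 (@exists_finite_of_res _ _ φ _ _ X hX l S h1 h2)

end GKMod

namespace K0

variable {P P' : HCPair} (φ : HCPair.Hom P' P) {𝓛 : AbSubcat P} {𝓛' : AbSubcat P'}
  (h : ∀ X, 𝓛.mem X → 𝓛'.mem (X.res φ))

theorem res_cls (X : GKMod P) (hX : 𝓛.mem X) :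
    res φ 𝓛 𝓛' h (cls 𝓛 X hX) = cls 𝓛' (X.res φ) (h X hX) := lift_cls _ _ _ _ _

theorem Mul.res {x y z : K0 𝓛} (H : Mul 𝓛 x y z) :
    Mul 𝓛' (K0.res φ 𝓛 𝓛' h x) (K0.res φ 𝓛 𝓛' h y) (K0.res φ 𝓛 𝓛' h z) := by
  induction H with
  | cls X Y hX hY hXY =>
    rw [res_cls, res_cls, res_cls]
    exact Mul.cls (X.res φ) (Y.res φ) _ _ (h _ hXY)
  | zero_left y => simpa using Mul.zero_left _
  | zero_right y => simpa using Mul.zero_right _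
  | neg_left _ ih => simpa using ih.neg_left
  | neg_right _ ih => simpa using ih.neg_right
  | add_left _ _ ih ih' => simpa using ih.add_left ih'
  | add_right _ _ ih ih' => simpa using ih.add_right ih'

theorem Dual.res [CompactSpace P.M] [CompactSpace P'.M] {x y : K0 𝓛}
    (H : Dual 𝓛 (fun X => (X.res φ).IsAdmissible) x y) :
    Dual 𝓛' GKMod.IsAdmissible (K0.res φ 𝓛 𝓛' h x) (K0.res φ 𝓛 𝓛' h y) := by
  induction H with
  | cls X Y hX hY hD hXY =>
    rw [res_cls, res_cls]
    exact Dual.cls (X.res φ) (Y.res φ) _ _ hD (hXY.res φ hD)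
  | zero => simpa using Dual.zero
  | neg _ ih => simpa using ih.neg
  | add _ _ ih ih' => simpa using ih.add ih'

end K0

/-! ## Compactness -/

/-- Stability is expressed by the vanishing of matrix coefficients, which are continuous in the
group element. -/
theorem isClosed_setOf_stable (R : ReductivePair) (S : Submodule ℂ R.g) :
    IsClosed {k : R.K | ∀ x ∈ S, R.AdC k x ∈ S} := by
  have e : {k : R.K | ∀ x ∈ S, R.AdC k x ∈ S} =
      ⋂ x ∈ S, ⋂ l : Module.Dual ℂ (R.g ⧸ S), {k | (l ∘ₗ S.mkQ) (R.AdC k x) = 0} := by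
    ext k
    simp only [Set.mem_ofPred_eq, Set.mem_iInter]
    refine forall₂_congr fun x _ => ?_
    rw [← Submodule.Quotient.mk_eq_zero S, ← Module.forall_dual_apply_eq_zero_iff ℂ]
    rfl
  rw [e]
  exact isClosed_biInter fun x _ => isClosed_iInter fun l =>
    isClosed_eq (R.pair.Ad_continuous x (l ∘ₗ S.mkQ)) continuous_const

theorem ReductivePair.map_AdC_eq_iff (R : ReductivePair) (S : Submodule ℂ R.g) (k : R.K) :
    S.map (R.AdC k) = S ↔ (∀ x ∈ S, R.AdC k x ∈ S) ∧ ∀ x ∈ S, R.AdC k⁻¹ x ∈ S := by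
  have h1 : ∀ k x, R.AdC k⁻¹ (R.AdC k x) = x := fun k x => by
    rw [← Module.End.mul_apply, ← map_mul, inv_mul_cancel, map_one, Module.End.one_apply]
  have h2 : ∀ k x, R.AdC k (R.AdC k⁻¹ x) = x := fun k x => by
    rw [← Module.End.mul_apply, ← map_mul, mul_inv_cancel, map_one, Module.End.one_apply]
  constructor
  · intro h
    refine ⟨fun x hx => h ▸ Submodule.mem_map_of_mem hx, fun x hx => ?_⟩
    rw [← h] at hx
    obtain ⟨y, hy, rfl⟩ := hx
    rw [h1]
    exact hy
  · rintro ⟨h3, h4⟩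
    refine le_antisymm (Submodule.map_le_iff_le_comap.2 h3) fun x hx => ⟨_, h4 x hx, h2 k x⟩

/-- Stabilizing `𝔮` and `θ(𝔮)` are closed conditions on the compact group `K`. Compactness of `L ∩
K` is what permits averaging. -/
instance (R : ReductivePair) (𝔭 : GermaneParabolic R) : CompactSpace 𝔭.LK := by
  refine isCompact_iff_compactSpace.1 (IsClosed.isCompact ?_)
  have e : (𝔭.LK : Set R.K) =
      ({k | ∀ x ∈ 𝔭.q.toSubmodule, R.AdC k x ∈ 𝔭.q.toSubmodule} ∩
        Inv.inv ⁻¹' {k | ∀ x ∈ 𝔭.q.toSubmodule, R.AdC k x ∈ 𝔭.q.toSubmodule}) ∩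
      ({k | ∀ x ∈ 𝔭.q.toSubmodule.map R.θC, R.AdC k x ∈ 𝔭.q.toSubmodule.map R.θC} ∩
        Inv.inv ⁻¹' {k | ∀ x ∈ 𝔭.q.toSubmodule.map R.θC, R.AdC k x ∈ 𝔭.q.toSubmodule.map R.θC}) := by
    ext k
    exact and_congr (R.map_AdC_eq_iff _ k) (R.map_AdC_eq_iff _ k)
  rw [e]
  exact (((isClosed_setOf_stable R _).inter ((isClosed_setOf_stable R _).preimage continuous_inv))).inter
    ((isClosed_setOf_stable R _).inter ((isClosed_setOf_stable R _).preimage continuous_inv))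

/-! ## Homomorphisms from localizations -/

namespace Loc

variable {A B : Type 1} [AddCommGroup A] [AddCommGroup B] (w : A →+ A)

theorem frac_add (a b : A) (n : ℕ) : frac w (a + b) n = frac w a n + frac w b n := by
  refine LocalizedModule.mk_eq.2 ⟨1, ?_⟩ |>.trans (LocalizedModule.mk_add_mk (S :=
    Submonoid.powers (Polynomial.X : ℤ[X]))).symm
  simp only [map_add, smul_add, smul_smul, one_mul]

theorem X_pow_smul_of (n : ℕ) (a : A) : (Polynomial.X ^ n : ℤ[X]) •
    Module.AEval'.of w.toIntLinearMap a = Module.AEval'.of w.toIntLinearMap (w^[n] a) := by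
  induction n with
  | zero => simp
  | succ n ih =>
    rw [pow_succ', mul_smul, ih, Module.AEval'.X_smul_of, Function.iterate_succ_apply']
    rfl

theorem frac_iterate (a : A) (n k : ℕ) : frac w (w^[k] a) (n + k) = frac w a n := by
  refine LocalizedModule.mk_eq.2 ⟨1, ?_⟩
  rw [one_smul, one_smul, ← X_pow_smul_of]
  change (Polynomial.X ^ n : ℤ[X]) • (Polynomial.X ^ k : ℤ[X]) •
    Module.AEval'.of w.toIntLinearMap a =
      (Polynomial.X ^ (n + k) : ℤ[X]) • Module.AEval'.of w.toIntLinearMap a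
  rw [pow_add, mul_smul]

theorem frac_succ (a : A) (n : ℕ) : frac w (w a) (n + 1) = frac w a n := frac_iterate w a n 1

theorem frac_eq_frac {a b : A} {m n : ℕ} (h : frac w a m = frac w b n) :
    ∃ k, w^[k + n] a = w^[k + m] b := by
  obtain ⟨⟨_, k, rfl⟩, hk⟩ := LocalizedModule.mk_eq.1 h
  refine ⟨k, (Module.AEval'.of w.toIntLinearMap).injective ?_⟩
  rw [← X_pow_smul_of, ← X_pow_smul_of, pow_add, pow_add, mul_smul, mul_smul]
  exact hk

theorem exists_frac (x : Loc w) : ∃ a n, x = frac w a n := by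
  induction x using LocalizedModule.induction_on with
  | h m s =>
    obtain ⟨_, n, rfl⟩ := s
    exact ⟨(Module.AEval'.of w.toIntLinearMap).symm m, n, by
      rw [frac, LinearEquiv.apply_symm_apply]⟩

/-- Additive maps on fractions compatible with the extension of fractions are defined on the
localization. -/
theorem exists_lift (φ : A → ℕ → B) (hadd : ∀ a b n, φ (a + b) n = φ a n + φ b n)
    (hw : ∀ a n, φ (w a) (n + 1) = φ a n) :
    ∃ r : Loc w →+ B, ∀ a n, r (frac w a n) = φ a n := by
  have hk : ∀ k a n, φ (w^[k] a) (n + k) = φ a n := fun k => by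
    induction k with
    | zero => exact fun _ _ => rfl
    | succ k ih =>
      intro a n
      rw [Function.iterate_succ_apply', ← add_assoc, hw, ih]
  -- The map is defined through an arbitrary choice of fractions; `key` shows that the choice does
  -- not matter.
  choose α ν h using exists_frac w
  have key : ∀ a n, φ (α (frac w a n)) (ν (frac w a n)) = φ a n := fun a n => by
    obtain ⟨k, hk'⟩ := frac_eq_frac w (h (frac w a n))
    rw [← hk (k + n), ← hk', ← hk (k + ν (frac w a n)) a n]
    congr 1
    omega
  refine ⟨AddMonoidHom.mk' (fun x => φ (α x) (ν x)) fun x y => ?_, key⟩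
  obtain ⟨a, m, rfl⟩ := exists_frac w x
  obtain ⟨b, n, rfl⟩ := exists_frac w y
  have e : frac w a m + frac w b n = frac w (w^[n] a + w^[m] b) (m + n) := by
    rw [frac_add, frac_iterate, add_comm m n, frac_iterate]
  rw [e, key, key, key, hadd, hk, add_comm m n, hk]

variable (v : A →+ A) (h : ∀ a, v (w a) = w (v a))

/-- Cancellation in the inner denominator; `frac_frac_right` is cancellation in the outer one, after
moving `v` out of the inner fraction. -/
theorem frac_frac_left (a : A) (m n : ℕ) :
    frac (map w v h) (frac w (w a) (m + 1)) n = frac (map w v h) (frac w a m) n := by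
  rw [frac_succ]

theorem frac_frac_right (a : A) (m n : ℕ) :
    frac (map w v h) (frac w (v a) m) (n + 1) = frac (map w v h) (frac w a m) n := by
  rw [← map_frac w v h, frac_succ]

end Loc

/-! ## Restriction and the Weyl denominators -/

namespace K0

variable {P : HCPair} (𝓛 : AbSubcat P) {E : GKMod P} [FiniteDimensional ℂ E.V]
  (h : 𝓛.ClosedUnderExt E)

theorem mulExt_cls (X : GKMod P) (hX : 𝓛.mem X) : mulExt 𝓛 E h (cls 𝓛 X hX) =
    ∑ q ∈ Finset.range (Module.finrank ℂ E.V + 1),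
      (-1 : ℤ) ^ q • cls 𝓛 (GKMod.alt E X q) (GKMod.alt_mem h hX q) := by
  rw [mulExt_apply]
  simp only [GKMod.cls_alt h hX]

theorem triv_mem (h : 𝓛.ClosedUnderExt E) : 𝓛.mem (GKMod.triv P) := by
  let f : GKMod.Hom (GKMod.triv P) (E.extDual 0) :=
    { f := (AlternatingMap.constLinearEquivOfIsEmpty :
        ℂ ≃ₗ[ℂ] (E.V [⋀^Fin 0]→ₗ[ℂ] ℂ)).toLinearMap
      map_ρ := fun x v => AlternatingMap.ext fun y => by
        have key (c : ℂ) : (0 : ℂ) = 0 - ∑ _k : Fin 0, c := by simp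
        exact key v
      map_σ := fun m v => rfl }
  exact GKMod.mem_of_iso' (h.mem 0) f (LinearEquiv.bijective _)

/-- Applying the multiplication operator to the class of the trivial module recovers the element, so
identities of operators yield identities of elements. -/
theorem extCls_eq : extCls 𝓛 E h = mulExt 𝓛 E h (cls 𝓛 (GKMod.triv P) (triv_mem 𝓛 h)) := by
  rw [mulExt_cls]
  rfl

end K0

namespace ParabolicInclusion

variable {R' R : ReductivePair} {ι : R'.Inclusion R} {𝔭' : GermaneParabolic R'}
  {𝔭 : GermaneParabolic R} (j : ParabolicInclusion ι 𝔭' 𝔭) {𝓛 : AbSubcat 𝔭.leviPair}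
  {𝓛' : AbSubcat 𝔭'.leviPair} (hres : ∀ X, 𝓛.mem X → 𝓛'.mem (X.res j.hom))
  (hE : 𝓛.ClosedUnderExt 𝔭.uMod) (hU : 𝓛'.ClosedUnderExt 𝔭'.uMod)
  (hD : 𝓛'.ClosedUnderExt j.relMod)

theorem nonempty_splitting :
    Nonempty (GKMod.Splitting 𝔭'.uMod (𝔭.uMod.res j.hom) j.relMod) := by
  obtain ⟨_, r, _, _, _, hr, _⟩ := j.exists_grading
  obtain ⟨S, _⟩ := j.exists_splitting r hr
  exact ⟨S⟩

include hres hE in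
theorem alt_res_mem {X : GKMod 𝔭.leviPair} (hX : 𝓛.mem X) (q : ℕ) :
    𝓛'.mem (GKMod.alt (𝔭.uMod.res j.hom) (X.res j.hom) q) :=
  GKMod.mem_of_iso (hres _ (GKMod.alt_mem hE hX q)) (GKMod.altRes j.hom 𝔭.uMod X q)
    (GKMod.altRes_bijective j.hom 𝔭.uMod X q)

theorem res_cls_alt {X : GKMod 𝔭.leviPair} (hX : 𝓛.mem X) (q : ℕ) :
    K0.res j.hom 𝓛 𝓛' hres (K0.cls 𝓛 (GKMod.alt 𝔭.uMod X q) (GKMod.alt_mem hE hX q)) =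
      K0.cls 𝓛' (GKMod.alt (𝔭.uMod.res j.hom) (X.res j.hom) q) (j.alt_res_mem hres hE hX q) := by
  rw [K0.res_cls]
  exact K0.cls_iso 𝓛' _ _ (GKMod.altRes j.hom 𝔭.uMod X q)
    (GKMod.altRes_bijective j.hom 𝔭.uMod X q)

/-- Restriction and multiplication by the Weyl denominators. -/
theorem res_mulExt (x : K0 𝓛) : K0.res j.hom 𝓛 𝓛' hres (K0.mulExt 𝓛 𝔭.uMod hE x) =
    K0.mulExt 𝓛' j.relMod hD (K0.mulExt 𝓛' 𝔭'.uMod hU (K0.res j.hom 𝓛 𝓛' hres x)) := by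
  obtain ⟨S⟩ := j.nonempty_splitting
  refine DFunLike.congr_fun (f := (K0.res j.hom 𝓛 𝓛' hres).comp (K0.mulExt 𝓛 𝔭.uMod hE))
    (g := (K0.mulExt 𝓛' j.relMod hD).comp
      ((K0.mulExt 𝓛' 𝔭'.uMod hU).comp (K0.res j.hom 𝓛 𝓛' hres))) (K0.hom_ext fun X hX => ?_) x
  rw [AddMonoidHom.comp_apply, AddMonoidHom.comp_apply, AddMonoidHom.comp_apply, K0.mulExt_cls,
    map_sum, K0.res_cls, ← S.sum_cls_alt hU hD (hres X hX) (j.alt_res_mem hres hE hX)]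
  refine Finset.sum_congr rfl fun q _ => ?_
  rw [map_zsmul, j.res_cls_alt hres hE hX]

/-- Restriction and multiplication by the top exterior powers. -/
theorem res_mulTop (x : K0 𝓛) : K0.res j.hom 𝓛 𝓛' hres (K0.mulTop 𝓛 𝔭.uMod hE x) =
    K0.mulTop 𝓛' 𝔭'.uMod hU (K0.mulTop 𝓛' j.relMod hD (K0.res j.hom 𝓛 𝓛' hres x)) := by
  obtain ⟨S⟩ := j.nonempty_splitting
  refine DFunLike.congr_fun (f := (K0.res j.hom 𝓛 𝓛' hres).comp (K0.mulTop 𝓛 𝔭.uMod hE))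
    (g := (K0.mulTop 𝓛' 𝔭'.uMod hU).comp
      ((K0.mulTop 𝓛' j.relMod hD).comp (K0.res j.hom 𝓛 𝓛' hres))) (K0.hom_ext fun X hX => ?_) x
  rw [AddMonoidHom.comp_apply, AddMonoidHom.comp_apply, AddMonoidHom.comp_apply, K0.mulTop_apply,
    ← GKMod.cls_alt hE hX, map_zsmul, j.res_cls_alt hres hE hX, K0.res_cls]
  exact S.cls_alt_top hU hD (hres X hX) _

end ParabolicInclusion

theorem Admissible.H_cls {R : ReductivePair} {𝔭 : GermaneParabolic R} {𝒢 : AbSubcat R.pair}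
    {𝓛 : AbSubcat 𝔭.leviPair} (h : Admissible 𝔭 𝒢 𝓛) (V : GKMod R.pair) (hV : 𝒢.mem V) :
    h.H (K0.cls 𝒢 V hV) = ∑ q ∈ Finset.range (Module.finrank ℂ 𝔭.uMod.V + 1),
      (-1 : ℤ) ^ q • K0.cls 𝓛 (𝔭.coho V q) (h.coho_mem V hV q) :=
  K0.lift_cls 𝒢 _ _ V hV

/-! ### Restriction of algebraic characters. -/

namespace Compatible

variable {R' R : ReductivePair} {ι : R'.Inclusion R} {𝔭' : GermaneParabolic R'}
  {𝔭 : GermaneParabolic R} {j : ParabolicInclusion ι 𝔭' 𝔭} {Q' : Quadruple 𝔭'} {Q : Quadruple 𝔭}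
  (h : Compatible j Q' Q)

/-- The identity of operators is evaluated at the trivial module, which restricts to the trivial
module. -/
theorem res_extCls :
    K0.res j.hom Q.𝓛 Q'.𝓛 h.resL (K0.extCls Q.𝓛 𝔭.uMod Q.adm.ext) =
      Q'.adm.W (K0.extCls Q'.𝓛 j.relMod h.ext) := by
  rw [K0.extCls_eq, K0.extCls_eq, j.res_mulExt h.resL Q.adm.ext Q'.adm.ext h.ext, K0.mulExt_comm,
    K0.res_cls]
  rfl

theorem onL_W (x : Q.KL) : h.onL (Q.W x) = Q'.W (h.relW (h.onL x)) :=
  Subtype.ext ((j.res_mulExt h.resL Q.adm.ext Q'.adm.ext h.ext _).trans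
    (K0.mulExt_comm Q'.𝓛 _ _ _ _ _))

/-- It suffices to compare both sides on classes of modules, where this is the Euler characteristic
identity `ParabolicInclusion.euler_coho`. -/
theorem onL_H (x : Q.KG) : h.onL (Q.H x) = h.relW (Q'.H (h.onG x)) := by
  have key : (K0.res j.hom Q.𝓛 Q'.𝓛 h.resL).comp Q.adm.H =
      (K0.mulExt Q'.𝓛 j.relMod h.ext).comp (Q'.adm.H.comp (K0.res ι.hom Q.𝒢 Q'.𝒢 h.resG)) := by
    refine K0.hom_ext fun V hV => ?_
    rw [AddMonoidHom.comp_apply, AddMonoidHom.comp_apply, AddMonoidHom.comp_apply, K0.res_cls,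
      Q.adm.H_cls, Q'.adm.H_cls, map_sum]
    refine Eq.trans (Finset.sum_congr rfl fun q _ => ?_) (j.euler_coho h.ext V
      (fun q => h.resL _ (Q.adm.coho_mem V hV q)) fun q => Q'.adm.coho_mem _ (h.resG V hV) q)
    rw [map_zsmul, K0.res_cls]
  exact Subtype.ext (DFunLike.congr_fun key (x : K0 Q.𝒢))

/-- Extending a fraction by `W_𝔮` amounts, after restriction, to extending by both `W_𝔮'` and
`W_{𝔮/𝔮'}`, each of which cancels in its own denominator. -/
theorem exists_lift : ∃ r : Q.C →+ h.C, ∀ (a : Q.KL) (n : ℕ),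
    r (Q.frac a n) = h.frac (Q'.frac (h.onL a) n) n := by
  refine Loc.exists_lift Q.W (fun a n => h.frac (Q'.frac (h.onL a) n) n) (fun a b n => ?_)
    fun a n => ?_
  · rw [map_add]
    simp only [frac, Quadruple.frac, Loc.frac_add]
  · rw [h.onL_W]
    exact (Loc.frac_frac_left Q'.W h.relW _ _ _ _).trans (Loc.frac_frac_right Q'.W h.relW _ _ _ _)

/-- The element `t` restricts to the product of the commuting elements formed from `𝔲'` and `𝔲 /
𝔲'`, so its powers can be separated. -/
theorem res_mulTop_iterate (n : ℕ) (b : K0 Q.𝓛) :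
    K0.res j.hom Q.𝓛 Q'.𝓛 h.resL ((K0.mulTop Q.𝓛 𝔭.uMod Q.adm.ext)^[n] b) =
      (K0.mulTop Q'.𝓛 𝔭'.uMod Q'.adm.ext)^[n]
        ((K0.mulTop Q'.𝓛 j.relMod h.ext)^[n] (K0.res j.hom Q.𝓛 Q'.𝓛 h.resL b)) := by
  have hc : Function.Commute (K0.mulTop Q'.𝓛 𝔭'.uMod Q'.adm.ext) (K0.mulTop Q'.𝓛 j.relMod h.ext) :=
    K0.mulTop_comm _ _
  rw [← Function.comp_apply (f := (K0.mulTop Q'.𝓛 𝔭'.uMod Q'.adm.ext)^[n]), ← hc.comp_iterate]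
  have hs : Function.Semiconj (K0.res j.hom Q.𝓛 Q'.𝓛 h.resL) (K0.mulTop Q.𝓛 𝔭.uMod Q.adm.ext)
      (K0.mulTop Q'.𝓛 𝔭'.uMod Q'.adm.ext ∘ K0.mulTop Q'.𝓛 j.relMod h.ext) :=
    j.res_mulTop h.resL Q.adm.ext Q'.adm.ext h.ext
  exact (hs.iterate_right n).eq b

end Compatible

end AlgChar

end

theorem proposition1p7 {R' R : AlgChar.ReductivePair} (ι : R'.Inclusion R)
    {𝔭' : AlgChar.GermaneParabolic R'} {𝔭 : AlgChar.GermaneParabolic R}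
    (j : AlgChar.ParabolicInclusion ι 𝔭' 𝔭) (Q' : AlgChar.Quadruple 𝔭')
    (Q : AlgChar.Quadruple 𝔭) (h : AlgChar.Compatible j Q' Q) :
    -- the restriction of `W_𝔮` is `W_𝔮' W_{𝔮/𝔮'}`
    AlgChar.K0.res j.hom Q.𝓛 Q'.𝓛 h.resL (AlgChar.K0.extCls Q.𝓛 𝔭.uMod Q.adm.ext) =
      Q'.adm.W (AlgChar.K0.extCls Q'.𝓛 j.relMod h.ext) ∧
    -- restriction is well defined and additive on the localized groups
    ∃ r : Q.C →+ h.C,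
      (∀ (a : Q.KL) (n : ℕ), r (Q.frac a n) = h.frac (Q'.frac (h.onL a) n) n) ∧
      -- it is multiplicative
      (∀ x y z, Q.Mul x y z → h.Mul (r x) (r y) (r z)) ∧
      -- it respects duals
      (∀ x z, Q.Dual (fun X => (X.res j.hom).IsAdmissible) x z →
        h.Dual AlgChar.GKMod.IsAdmissible (r x) (r z)) ∧
      -- it is compatible with the algebraic characters
      ∀ x : Q.KG, r (Q.c x) = h.frac (Q'.c (h.onG x)) 0 := by
  refine ⟨h.res_extCls, ?_⟩
  obtain ⟨r, hr⟩ := h.exists_lift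
  refine ⟨r, hr, ?_, ?_, fun x => ?_⟩
  · rintro _ _ _ ⟨a, b, c, m, n, habc, rfl, rfl, rfl⟩
    exact ⟨_, _, _, m, n, ⟨h.onL a, h.onL b, h.onL c, m, n,
      AlgChar.K0.Mul.res j.hom h.resL habc, rfl, rfl, rfl⟩, hr a m, hr b n, hr c (m + n)⟩
  · rintro _ _ ⟨a, c, b, n, hab, hc, rfl, rfl⟩
    -- Both exponents of the dual equal `n`, as the two denominators enter with the same power.
    exact ⟨h.onL a, h.onL c, AlgChar.K0.res j.hom Q.𝓛 Q'.𝓛 h.resL b, n, n,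
      AlgChar.K0.Dual.res j.hom h.resL hab,
      (congrArg (AlgChar.K0.res j.hom Q.𝓛 Q'.𝓛 h.resL) hc).trans (h.res_mulTop_iterate n b),
      hr a n, hr c n⟩
  · refine (hr _ 1).trans ?_
    rw [h.onL_H]
    -- The factor `W_{𝔮/𝔮'}` in the restriction of `H(X)` cancels the outer denominator and leaves
    -- exponent 0.
    exact AlgChar.Loc.frac_frac_right Q'.W h.relW _ _ _ _
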